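/- Let $k\ge 0$ and $m\ge 1$ be integers, $q$ an indeterminate, and call a map of $\mathbb Q(q)$-vector spaces anti-linear if it is additive and semilinear for the field automorphism $q\mapsto q^{-1}$ of $\mathbb Q(q)$. **The quantum group.** Let $\mathbb I=\{-\frac{k-1}2,-\frac{k-1}2+1,\dots,\frac{k-1}2\}$, $I=\{-\frac k2,-\frac k2+1,\dots,\frac k2\}$ and $\mathbb I^\imath=\{i\in\mathbb I: i>0\}$. Let $\alpha_i$ $(i\in\mathbb I)$ be the simple roots of type $A_k$, with $(\alpha_i,\alpha_i)=2$, $(\alpha_i,\alpha_j)=-1$ if $|i-j|=1$ and $(\alpha_i,\alpha_j)=0$ if $|i-j|>1$. Let $U=U_q(\mathfrak{sl}_{k+1})$ be the $\mathbb Q(q)$-algebra with generators $E_i,F_i,K_i^{\pm1}$ $(i\in\mathbb I)$ and relations $K_iK_i^{-1}=K_i^{-1}K_i=1$, $K_iK_j=K_jK_i$, $K_iE_jK_i^{-1}=q^{(\alpha_i,\alpha_j)}E_j$, $K_iF_jK_i^{-1}=q^{-(\alpha_i,\alpha_j)}F_j$, $E_iF_j-F_jE_i=\delta_{ij}\frac{K_i-K_i^{-1}}{q-q^{-1}}$,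 $E_i^2E_j+E_jE_i^2=(q+q^{-1})E_iE_jE_i$ and $F_i^2F_j+F_jF_i^2=(q+q^{-1})F_iF_jF_i$ if $|i-j|=1$, $E_iE_j=E_jE_i$ and $F_iF_j=F_jF_i$ if $|i-j|>1$. Its coproduct is $\Delta(E_i)=1\otimes E_i+E_i\otimes K_i^{-1}$, $\Delta(F_i)=F_i\otimes1+K_i\otimes F_i$, $\Delta(K_i)=K_i\otimes K_i$, and its bar involution $\psi$ is the anti-linear ring automorphism with $E_i\mapsto E_i$, $F_i\mapsto F_i$, $K_i\mapsto K_i^{-1}$. For $\mu\in\mathbb N\Pi=\bigoplus_i\mathbb N\alpha_i$ let $U^+_\mu$ (resp. $U^-_{-\mu}$) be the span of the monomials in the $E_i$ (resp. $F_i$) of weight $\mu$ (resp. $-\mu$). **The coideal subalgebra.** Let $U^\imath$ be the $\mathbb Q(q)$-algebra with generators $e_i,f_i,k_i^{\pm1}$ $(i\in\mathbb I^\imath)$ and, if $k$ is odd, one more generator $t$, subject to: $k_ik_i^{-1}=k_i^{-1}k_i=1$, $k_ik_j=k_jk_i$, $k_ie_jk_i^{-1}=q^{(\alpha_i-\alpha_{-i},\alpha_j)}e_j$,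 $k_if_jk_i^{-1}=q^{-(\alpha_i-\alpha_{-i},\alpha_j)}f_j$; $e_if_j-f_je_i=\delta_{ij}\frac{k_i-k_i^{-1}}{q-q^{-1}}$ for $(i,j)\ne(\frac12,\frac12)$; the $q$-Serre relations $e_i^2e_j+e_je_i^2=(q+q^{-1})e_ie_je_i$, $f_i^2f_j+f_jf_i^2=(q+q^{-1})f_if_jf_i$ if $|i-j|=1$, and $e_ie_j=e_je_i$, $f_if_j=f_jf_i$ if $|i-j|>1$; if $k\ge 2$ is even, $$f_{\frac12}^2e_{\frac12}+e_{\frac12}f_{\frac12}^2=(q+q^{-1})\bigl(f_{\frac12}e_{\frac12}f_{\frac12}-q^2f_{\frac12}k_{\frac12}^{-1}-q^{-2}f_{\frac12}k_{\frac12}\bigr),$$ $$e_{\frac12}^2f_{\frac12}+f_{\frac12}e_{\frac12}^2=(q+q^{-1})\bigl(e_{\frac12}f_{\frac12}e_{\frac12}-q^{-2}k_{\frac12}e_{\frac12}-q^{2}k_{\frac12}^{-1}e_{\frac12}\bigr);$$ if $k$ is odd, $k_itk_i^{-1}=t$, $e_it=te_i$ and $f_it=tf_i$ for $i>1$, and,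 for $x\in\{e_1,f_1\}$ (when $1\in\mathbb I^\imath$), $x^2t+tx^2=(q+q^{-1})xtx$ and $t^2x+xt^2=(q+q^{-1})txt+x$. The bar involution $\psi_\imath$ of $U^\imath$ is the anti-linear ring automorphism with $e_i\mapsto e_i$, $f_i\mapsto f_i$, $k_i\mapsto k_i^{-1}$, $t\mapsto t$. The embedding $\imath:U^\imath\to U$ is the algebra homomorphism $k_i\mapsto K_iK_{-i}^{-1}$, $e_i\mapsto E_i+F_{-i}K_i^{-1}$, $f_i\mapsto K_{-i}^{-1}F_i+E_{-i}$, $t\mapsto E_0+qF_0K_0^{-1}$; through it, $U$-modules are $U^\imath$-modules. **The bar involution on the tensor space.** Let $\mathbb V$ be the natural $U$-module, with basis $v_a$ $(a\in I)$ and $E_iv_a=\delta_{a,i+\frac12}v_{a-1}$, $F_iv_a=\delta_{a,i-\frac12}v_{a+1}$, $K_iv_a=q^{\delta_{a,i-1/2}-\delta_{a,i+1/2}}v_a$, and with the anti-linear involution $\psi(v_a)=v_a$. Let $U$ act on $\mathbb V^{\otimes m}$ by the iterated coproduct, and let $\psi$ be the anti-linear involution on $\mathbb V^{\otimes m}$ obtained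 by iterating $\psi=\Theta\circ(\psi\otimes\psi)$ on $\mathbb V^{\otimes m}=\mathbb V^{\otimes(m-1)}\otimes\mathbb V$. Here $\Theta=\sum_\nu\Theta_\nu$, $\Theta_\nu\in U^+_\nu\otimes U^-_{-\nu}$, $\Theta_0=1\otimes1$, is Lusztig's quasi-$R$-matrix for $\Delta$, characterised by $\Delta(u)\Theta=\Theta\,(\psi\otimes\psi)(\Delta(\psi(u)))$ for all $u\in U$ in a completion of $U\otimes U$. Let $\Upsilon=\sum_{\mu\in\mathbb N\Pi}\Upsilon_\mu$, $\Upsilon_\mu\in U^-_{-\mu}$, $\Upsilon_0=1$, be the intertwiner of the quantum symmetric pair $(U,U^\imath)$, characterised by $\imath(\psi_\imath(u))\Upsilon=\Upsilon\,\psi(\imath(u))$ for all $u\in U^\imath$ in the completion of $U$. Put $\psi_\imath=\Upsilon\circ\psi:\mathbb V^{\otimes m}\to\mathbb V^{\otimes m}$. **The Hecke algebras.** For $f=(f(1),\dots,f(m))\in I^m$ let $M_f=v_{f(1)}\otimes\cdots\otimes v_{f(m)}$, let $f\cdot s_0=(-f(1),f(2),\dots,f(m))$, and for $1\le i\le m-1$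 let $f\cdot s_i$ be $f$ with $f(i)$ and $f(i+1)$ exchanged. Let $\mathcal H^1_{B_m}$ be the $\mathbb Q(q)$-algebra with generators $s_0,H_1,\dots,H_{m-1}$ and relations $s_0^2=1$, $(H_i-q^{-1})(H_i+q)=0$, $H_iH_{i+1}H_i=H_{i+1}H_iH_{i+1}$, $H_iH_j=H_jH_i$ for $|i-j|>1$, $s_0H_1s_0H_1=H_1s_0H_1s_0$, $s_0H_i=H_is_0$ for $i>1$. It acts on $\mathbb V^{\otimes m}$ from the right by $M_f\cdot s_0=M_{f\cdot s_0}$ and $$M_f\cdot H_i=\begin{cases}q^{-1}M_f,&f(i)=f(i+1),\\ M_{f\cdot s_i},&f(i)<f(i+1),\\ M_{f\cdot s_i}+(q^{-1}-q)M_f,&f(i)>f(i+1).\end{cases}$$ For $m\ge2$ let $\mathcal H_{D_m}$ be the $\mathbb Q(q)$-algebra with generators $H_0,H_1,\dots,H_{m-1}$ and relations $(H_i-q^{-1})(H_i+q)=0$ for $i\ge0$; $H_iH_{i+1}H_i=H_{i+1}H_iH_{i+1}$ and $H_iH_j=H_jH_i$ $(|i-j|>1)$ for positive indices; $H_0H_2H_0=H_2H_0H_2$,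 and $H_0H_i=H_iH_0$ for $i\ne2$. For $m=1$ let $\mathcal H_{D_1}=\mathbb Q(q)$. The bar involution $h\mapsto\overline h$ of $\mathcal H_{D_m}$ is the anti-linear ring automorphism with $\overline{H_i}=H_i^{-1}$. The algebra $\mathcal H_{D_m}$ acts on $\mathbb V^{\otimes m}$ from the right through the embedding $\rho:\mathcal H_{D_m}\to\mathcal H^1_{B_m}$, $H_0\mapsto s_0H_1s_0$, $H_i\mapsto H_i$ $(i\ge1)$. Call $f\in I^m$ $D$-anti-dominant if $|f(1)|\le f(2)\le f(3)\le\cdots\le f(m)$. **Theorem.** The map $\psi_\imath$ is an anti-linear involution of $\mathbb V^{\otimes m}$ such that, for all $u\in U^\imath$, $v\in\mathbb V^{\otimes m}$ and $h\in\mathcal H_{D_m}$, $$\psi_\imath(u\,v\,h)=\psi_\imath(u)\,\psi_\imath(v)\,\overline h,\qquad\text{and}\qquad \psi_\imath(M_f)=M_f\ \text{ for all $D$-anti-dominant } f\in I^m .$$ Moreover, $\psi_\imath$ is the only anti-linear involution of $\mathbb V^{\otimes m}$ with these properties. -/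

import Mathlib

set_option linter.unusedSimpArgs false
set_option linter.unusedVariables false
set_option linter.unnecessarySeqFocus false

open scoped TensorProduct

noncomputable section

namespace QSymPair

/-- The ground field `ℚ(q)`. -/
abbrev Qq : Type := RatFunc ℚ

/-- The indeterminate `q`. -/
def q : Qq := RatFunc.X

theorem q_ne_zero : q ≠ 0 := RatFunc.X_ne_zero

theorem q_sub_inv_ne_zero : q - q⁻¹ ≠ 0 := by
  intro h
  have h2 : q * q = 1 := by
    have : q = q⁻¹ := sub_eq_zero.mp h
    nth_rewrite 2 [this]
    exact mul_inv_cancel₀ q_ne_zero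
  have h3 : (algebraMap (Polynomial ℚ) (RatFunc ℚ)) (Polynomial.X * Polynomial.X)
      = algebraMap (Polynomial ℚ) (RatFunc ℚ) 1 := by
    rw [map_mul, map_one, RatFunc.algebraMap_X]
    exact h2
  have h4 := RatFunc.algebraMap_injective ℚ h3
  have h5 := congrArg (Polynomial.eval 2) h4
  norm_num at h5

theorem zpow_two_neg : q⁻¹ * q⁻¹ = q ^ (-2 : ℤ) := by
  rw [zpow_neg, ← mul_inv, ← pow_two]; norm_cast

theorem aeval_q_inv_injective :
    Function.Injective (Polynomial.aeval (R := ℚ) (q⁻¹ : Qq)) := by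
  rw [← transcendental_iff_injective]
  intro h
  refine RatFunc.transcendental_X (K := ℚ) ?_
  have h2 := h.inv
  rw [inv_inv] at h2
  convert h2
  · exact Subsingleton.elim _ _
  · rfl

/-- The field automorphism of `ℚ(q)` with `q ↦ q⁻¹`. -/
def bar : Qq →+* Qq :=
  IsFractionRing.lift (A := Polynomial ℚ) (K := Qq)
    (g := (Polynomial.aeval (R := ℚ) (q⁻¹ : Qq)).toRingHom) aeval_q_inv_injective

@[simp] theorem bar_q : bar q = q⁻¹ := by
  have : q = algebraMap (Polynomial ℚ) Qq Polynomial.X := RatFunc.algebraMap_X.symm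
  conv_lhs => rw [this]
  rw [bar, IsFractionRing.lift_algebraMap]
  simp

/-- `A` with scalars acting through `bar`. A `ℚ(q)`-algebra homomorphism `B → Twist A` is the same
as an anti-linear ring homomorphism `B → A`. -/
def Twist (A : Type) : Type := A

instance (A : Type) [Ring A] : Ring (Twist A) := inferInstanceAs (Ring A)

instance (A : Type) [Ring A] [Algebra Qq A] : Algebra Qq (Twist A) :=
  RingHom.toAlgebra' (S := Twist A) ((algebraMap Qq A).comp bar)
    (fun c x => Algebra.commutes (A := A) (bar c) x)

/-- The identity map `A → Twist A`. -/
abbrev Twist.of {A : Type} (x : A) : Twist A := x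

theorem twist_smul (A : Type) [Ring A] [Algebra Qq A] (c : Qq) (x : Twist A) :
    c • x = (show Twist A from bar c • (show A from x)) := (Algebra.smul_def (bar c) (show A from x)).symm

/-- The anti-linear map underlying an algebra homomorphism into `Twist A`. -/
def antilinear {A : Type} [Ring A] [Algebra Qq A] (φ : A →ₐ[Qq] Twist A) : A →ₛₗ[bar] A where
  toFun x := φ x
  map_add' x y := map_add φ x y
  map_smul' c x := (map_smul φ c x).trans (twist_smul A c (φ x))

/-- The bilinear pairing `(α_i, α_j)` of simple roots of type `A_k`. -/
def cartan {k : ℕ} (i j : Fin k) : ℤ :=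
  if i = j then 2 else if (i : ℕ) + 1 = j ∨ (j : ℕ) + 1 = i then -1 else 0

/-- `|i - j| = 1`. -/
def Adjacent {k : ℕ} (i j : Fin k) : Prop := (i : ℕ) + 1 = j ∨ (j : ℕ) + 1 = i

/-- `|i - j| > 1`. -/
def Far {k : ℕ} (i j : Fin k) : Prop := (i : ℕ) + 1 < j ∨ (j : ℕ) + 1 < i

section Skew

variable {R A : Type} [Field R] [Ring A] [Algebra R A]

theorem skew_right {κ κ' x : A} {c : R} (h2 : κ' * κ = 1) (h : κ * x * κ' = c • x) :
    κ * x = c • (x * κ) := by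
  have : κ * x * κ' * κ = c • x * κ := by rw [h]
  rwa [mul_assoc, h2, mul_one, smul_mul_assoc] at this

theorem skew_inv {κ κ' x : A} {c : R} (hc : c ≠ 0) (h1 : κ * κ' = 1) (h2 : κ' * κ = 1)
    (h : κ * x = c • (x * κ)) : κ' * x = c⁻¹ • (x * κ') := by
  have h3 : κ' * (κ * x) * κ' = c • (κ' * x * κ * κ') := by
    rw [h]; simp only [mul_smul_comm, smul_mul_assoc, mul_assoc]
  rw [← mul_assoc κ' κ, h2, one_mul, mul_assoc _ κ κ', h1, mul_one] at h3
  rw [h3, smul_smul, inv_mul_cancel₀ hc, one_smul]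

theorem conj_of_skew {κ κ' x : A} {c : R} (h1 : κ * κ' = 1) (h : κ * x = c • (x * κ)) :
    κ * x * κ' = c • x := by
  rw [h, smul_mul_assoc, mul_assoc, h1, mul_one]

theorem conj_inv {κ κ' x : A} {c : R} (hc : c ≠ 0) (h1 : κ * κ' = 1) (h2 : κ' * κ = 1)
    (h : κ * x * κ' = c • x) : κ' * x * κ = c⁻¹ • x :=
  conj_of_skew h2 (skew_inv hc h1 h2 (skew_right h2 h))

theorem inv_comm {κ κ' μ μ' : A} (h1 : κ * κ' = 1) (h2 : κ' * κ = 1) (m1 : μ * μ' = 1)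
    (m2 : μ' * μ = 1) (h : κ * μ = μ * κ) : κ' * μ' = μ' * κ' := by
  calc κ' * μ' = μ' * (μ * κ') * μ' := by rw [← mul_assoc, m2, one_mul]
    _ = μ' * (κ' * (κ * μ) * κ') * μ' := by rw [← mul_assoc κ', h2, one_mul]
    _ = μ' * (κ' * (μ * κ) * κ') * μ' := by rw [h]
    _ = μ' * κ' * μ * (κ * κ') * μ' := by simp only [mul_assoc]
    _ = μ' * κ' := by rw [h1, mul_one, mul_assoc, m1, mul_one]

theorem serre_add {t : R} (ht : t ≠ 0) {x x' y y' : A}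
    (hx : x ^ 2 * x' + x' * x ^ 2 = (t + t⁻¹) • (x * x' * x))
    (hy : y ^ 2 * y' + y' * y ^ 2 = (t + t⁻¹) • (y * y' * y))
    (h1 : y * x = (t⁻¹ * t⁻¹) • (x * y)) (h2 : y * x' = t • (x' * y)) (h3 : y' * x = t • (x * y')) :
    (x + y) ^ 2 * (x' + y') + (x' + y') * (x + y) ^ 2
      = (t + t⁻¹) • ((x + y) * (x' + y') * (x + y)) := by
  have h1' (w : A) : y * (x * w) = (t⁻¹ * t⁻¹) • (x * (y * w)) := by
    rw [← mul_assoc, h1, smul_mul_assoc, mul_assoc]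
  have h2' (w : A) : y * (x' * w) = t • (x' * (y * w)) := by
    rw [← mul_assoc, h2, smul_mul_assoc, mul_assoc]
  have h3' (w : A) : y' * (x * w) = t • (x * (y' * w)) := by
    rw [← mul_assoc, h3, smul_mul_assoc, mul_assoc]
  have hx' : x * (x * x') = (t + t⁻¹) • (x * (x' * x)) - x' * (x * x) := by
    simp only [pow_two, mul_assoc] at hx; rw [← hx]; abel
  have hy' : y * (y * y') = (t + t⁻¹) • (y * (y' * y)) - y' * (y * y) := by
    simp only [pow_two, mul_assoc] at hy; rw [← hy]; abel
  simp only [pow_two, add_mul, mul_add, mul_assoc, smul_mul_assoc, mul_smul_comm, h1, h2, h3,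
    h1', h2', h3', hx', hy', smul_smul]
  match_scalars <;> field_simp <;> ring

theorem commute_add {x x' y y' : A} (hx : x * x' = x' * x) (hy : y * y' = y' * y)
    (h2 : y * x' = x' * y) (h3 : y' * x = x * y') :
    (x + y) * (x' + y') = (x' + y') * (x + y) := by
  simp only [add_mul, mul_add, hx, hy, h2, h3]; abel

theorem skew_mul {κ μ x : A} {c d : R} (h1 : κ * x = c • (x * κ)) (h2 : μ * x = d • (x * μ)) :
    (κ * μ) * x = (c * d) • (x * (κ * μ)) := by
  rw [mul_assoc, h2, mul_smul_comm, ← mul_assoc, h1, smul_mul_assoc, smul_smul, mul_assoc, mul_comm]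

end Skew

theorem cartan_symm {k : ℕ} (i j : Fin k) : cartan i j = cartan j i := by
  unfold cartan; simp only [eq_comm (a := i), or_comm]
theorem cartan_self {k : ℕ} (i : Fin k) : cartan i i = 2 := by simp [cartan]
theorem cartan_adjacent {k : ℕ} {i j : Fin k} (h : Adjacent i j) : cartan i j = -1 := by
  unfold Adjacent at h
  rw [cartan, if_neg (by intro h2; subst h2; omega), if_pos h]
theorem cartan_far {k : ℕ} {i j : Fin k} (h : Far i j) : cartan i j = 0 := by
  unfold Far at h
  rw [cartan, if_neg (by intro h2; subst h2; omega), if_neg (by omega)]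
theorem Adjacent.symm {k : ℕ} {i j : Fin k} (h : Adjacent i j) : Adjacent j i := Or.symm h
theorem Far.symm {k : ℕ} {i j : Fin k} (h : Far i j) : Far j i := Or.symm h

/-- Generators of `U_q(sl_{k+1})`. -/
inductive UGen (k : ℕ) : Type
  | E (i : Fin k)
  | F (i : Fin k)
  | K (i : Fin k)
  | Kinv (i : Fin k)

namespace UGen

/-- The generators in the free algebra. -/
abbrev e {k : ℕ} (i : Fin k) : FreeAlgebra Qq (UGen k) := FreeAlgebra.ι Qq (E i)
abbrev f {k : ℕ} (i : Fin k) : FreeAlgebra Qq (UGen k) := FreeAlgebra.ι Qq (F i)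
abbrev κ {k : ℕ} (i : Fin k) : FreeAlgebra Qq (UGen k) := FreeAlgebra.ι Qq (K i)
abbrev κ' {k : ℕ} (i : Fin k) : FreeAlgebra Qq (UGen k) := FreeAlgebra.ι Qq (Kinv i)

end UGen

open UGen in
/-- The defining relations of `U_q(sl_{k+1})`. -/
inductive URel (k : ℕ) : FreeAlgebra Qq (UGen k) → FreeAlgebra Qq (UGen k) → Prop
  | K_Kinv (i : Fin k) : URel k (κ i * κ' i) 1
  | Kinv_K (i : Fin k) : URel k (κ' i * κ i) 1
  | K_K (i j : Fin k) : URel k (κ i * κ j) (κ j * κ i)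
  | K_E (i j : Fin k) : URel k (κ i * e j * κ' i) (q ^ cartan i j • e j)
  | K_F (i j : Fin k) : URel k (κ i * f j * κ' i) (q ^ (-cartan i j) • f j)
  | E_F (i : Fin k) : URel k (e i * f i - f i * e i) ((q - q⁻¹)⁻¹ • (κ i - κ' i))
  | E_F_ne (i j : Fin k) (h : i ≠ j) : URel k (e i * f j - f j * e i) 0
  | E_serre (i j : Fin k) (h : Adjacent i j) :
      URel k (e i ^ 2 * e j + e j * e i ^ 2) ((q + q⁻¹) • (e i * e j * e i))
  | E_far (i j : Fin k) (h : Far i j) : URel k (e i * e j) (e j * e i)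
  | F_serre (i j : Fin k) (h : Adjacent i j) :
      URel k (f i ^ 2 * f j + f j * f i ^ 2) ((q + q⁻¹) • (f i * f j * f i))
  | F_far (i j : Fin k) (h : Far i j) : URel k (f i * f j) (f j * f i)

/-- The quantum group `U = U_q(sl_{k+1})`. The index `i : Fin k` stands for the element
`i - (k-1)/2` of `𝕀_k`; thus `-i` is `Fin.rev i`. -/
def U (k : ℕ) : Type := RingQuot (URel k)

instance (k : ℕ) : Ring (U k) := inferInstanceAs (Ring (RingQuot (URel k)))
instance (k : ℕ) : Algebra Qq (U k) := inferInstanceAs (Algebra Qq (RingQuot (URel k)))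

namespace U

variable {k : ℕ}

/-- The class of a generator. -/
def gen (x : UGen k) : U k := RingQuot.mkAlgHom Qq (URel k) (FreeAlgebra.ι Qq x)

/-- The universal property of `U`. -/
def lift {A : Type} [Ring A] [Algebra Qq A] (g : UGen k → A)
    (h : ∀ x y, URel k x y → FreeAlgebra.lift Qq g x = FreeAlgebra.lift Qq g y) : U k →ₐ[Qq] A :=
  RingQuot.liftAlgHom Qq ⟨FreeAlgebra.lift Qq g, fun x y => h x y⟩

@[simp] theorem lift_gen {A : Type} [Ring A] [Algebra Qq A] (g : UGen k → A)
    (h : ∀ x y, URel k x y → FreeAlgebra.lift Qq g x = FreeAlgebra.lift Qq g y) (x : UGen k) :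
    lift g h (gen x) = g x := by
  unfold lift gen
  erw [RingQuot.liftAlgHom_mkAlgHom_apply]
  exact FreeAlgebra.lift_ι_apply g x

abbrev E (i : Fin k) : U k := gen (UGen.E i)
abbrev F (i : Fin k) : U k := gen (UGen.F i)
abbrev K (i : Fin k) : U k := gen (UGen.K i)
abbrev Kinv (i : Fin k) : U k := gen (UGen.Kinv i)

theorem rel {x y : FreeAlgebra Qq (UGen k)} (h : URel k x y) :
    RingQuot.mkAlgHom Qq (URel k) x = RingQuot.mkAlgHom Qq (URel k) y :=
  RingQuot.mkAlgHom_rel Qq h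

theorem K_Kinv (i : Fin k) : K i * Kinv i = 1 := by
  have := rel (URel.K_Kinv i); rw [map_mul, map_one] at this; exact this
theorem Kinv_K (i : Fin k) : Kinv i * K i = 1 := by
  have := rel (URel.Kinv_K i); rw [map_mul, map_one] at this; exact this
theorem K_K (i j : Fin k) : K i * K j = K j * K i := by
  have := rel (URel.K_K i j); rw [map_mul, map_mul] at this; exact this
theorem K_E_Kinv (i j : Fin k) : K i * E j * Kinv i = q ^ cartan i j • E j := by
  have := rel (URel.K_E i j); rw [map_mul, map_mul, map_smul] at this; exact this
theorem K_F_Kinv (i j : Fin k) : K i * F j * Kinv i = q ^ (-cartan i j) • F j := by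
  have := rel (URel.K_F i j); rw [map_mul, map_mul, map_smul] at this; exact this
theorem E_F (i : Fin k) : E i * F i - F i * E i = (q - q⁻¹)⁻¹ • (K i - Kinv i) := by
  have := rel (URel.E_F i)
  rw [map_sub, map_mul, map_mul, map_smul, map_sub] at this; exact this
theorem E_F_ne (i j : Fin k) (h : i ≠ j) : E i * F j - F j * E i = 0 := by
  have := rel (URel.E_F_ne i j h); rw [map_sub, map_mul, map_mul, map_zero] at this; exact this
theorem E_serre (i j : Fin k) (h : Adjacent i j) :
    E i ^ 2 * E j + E j * E i ^ 2 = (q + q⁻¹) • (E i * E j * E i) := by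
  have := rel (URel.E_serre i j h)
  simp only [map_add, map_mul, map_pow, map_smul] at this; exact this
theorem E_far (i j : Fin k) (h : Far i j) : E i * E j = E j * E i := by
  have := rel (URel.E_far i j h); rw [map_mul, map_mul] at this; exact this
theorem F_serre (i j : Fin k) (h : Adjacent i j) :
    F i ^ 2 * F j + F j * F i ^ 2 = (q + q⁻¹) • (F i * F j * F i) := by
  have := rel (URel.F_serre i j h)
  simp only [map_add, map_mul, map_pow, map_smul] at this; exact this
theorem F_far (i j : Fin k) (h : Far i j) : F i * F j = F j * F i := by
  have := rel (URel.F_far i j h); rw [map_mul, map_mul] at this; exact this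

theorem K_E (i j : Fin k) : K i * E j = q ^ cartan i j • (E j * K i) :=
  skew_right (Kinv_K i) (K_E_Kinv i j)
theorem K_F (i j : Fin k) : K i * F j = q ^ (-cartan i j) • (F j * K i) :=
  skew_right (Kinv_K i) (K_F_Kinv i j)
theorem Kinv_E (i j : Fin k) : Kinv i * E j = q ^ (-cartan i j) • (E j * Kinv i) := by
  rw [zpow_neg]
  exact skew_inv (zpow_ne_zero _ q_ne_zero) (K_Kinv i) (Kinv_K i) (K_E i j)
theorem Kinv_F (i j : Fin k) : Kinv i * F j = q ^ cartan i j • (F j * Kinv i) := by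
  have := skew_inv (zpow_ne_zero _ q_ne_zero) (K_Kinv i) (Kinv_K i) (K_F i j)
  rwa [zpow_neg, inv_inv] at this
theorem Kinv_K' (i j : Fin k) : Kinv i * K j = K j * Kinv i := by
  have h : K i * K j = (1 : Qq) • (K j * K i) := by rw [one_smul]; exact K_K i j
  simpa using skew_inv one_ne_zero (K_Kinv i) (Kinv_K i) h
theorem Kinv_Kinv (i j : Fin k) : Kinv i * Kinv j = Kinv j * Kinv i := by
  have h : K i * Kinv j = (1 : Qq) • (Kinv j * K i) := by rw [one_smul]; exact (Kinv_K' j i).symm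
  simpa using skew_inv one_ne_zero (K_Kinv i) (Kinv_K i) h

/-- The bar involution of `U` as a homomorphism into the twisted algebra. -/
def barHom : U k →ₐ[Qq] Twist (U k) :=
  lift (A := Twist (U k)) (fun x => match x with
    | .E i => E i
    | .F i => F i
    | .K i => Kinv i
    | .Kinv i => K i) (by
    intro x y h
    have hs : bar (q + q⁻¹) = q + q⁻¹ := by simp [add_comm]
    cases h with
    | K_Kinv i => simp only [map_mul, map_one, FreeAlgebra.lift_ι_apply]; exact Kinv_K i
    | Kinv_K i => simp only [map_mul, map_one, FreeAlgebra.lift_ι_apply]; exact K_Kinv i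
    | K_K i j => simp only [map_mul, FreeAlgebra.lift_ι_apply]; exact Kinv_Kinv i j
    | K_E i j =>
      rw [map_smul, twist_smul, map_zpow₀, bar_q, inv_zpow']
      simp only [map_mul, FreeAlgebra.lift_ι_apply]
      exact conj_of_skew (Kinv_K i) (Kinv_E i j)
    | K_F i j =>
      rw [map_smul, twist_smul, map_zpow₀, bar_q, inv_zpow', neg_neg]
      simp only [map_mul, FreeAlgebra.lift_ι_apply]
      exact conj_of_skew (Kinv_K i) (Kinv_F i j)
    | E_F i =>
      have hb : bar (q - q⁻¹)⁻¹ = (q⁻¹ - q)⁻¹ := by simp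
      rw [map_smul, twist_smul, hb]
      simp only [map_mul, map_sub, FreeAlgebra.lift_ι_apply]
      refine (E_F i).trans ?_
      have h2 : (q - q⁻¹)⁻¹ • (K i - Kinv i) = (q⁻¹ - q)⁻¹ • (Kinv i - K i) := by
        rw [← neg_sub q q⁻¹, inv_neg, neg_smul, ← smul_neg, neg_sub]
      exact h2
    | E_F_ne i j h =>
      simp only [map_mul, map_sub, map_zero, FreeAlgebra.lift_ι_apply]; exact E_F_ne i j h
    | E_serre i j h =>
      simp only [map_mul, map_add, map_pow, map_smul, FreeAlgebra.lift_ι_apply, twist_smul, hs]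
      exact E_serre i j h
    | E_far i j h => simp only [map_mul, FreeAlgebra.lift_ι_apply]; exact E_far i j h
    | F_serre i j h =>
      simp only [map_mul, map_add, map_pow, map_smul, FreeAlgebra.lift_ι_apply, twist_smul, hs]
      exact F_serre i j h
    | F_far i j h => simp only [map_mul, FreeAlgebra.lift_ι_apply]; exact F_far i j h)

/-- The bar involution `ψ` of `U`: anti-linear and multiplicative, with `E_i ↦ E_i`, `F_i ↦ F_i`,
`K_i ↦ K_i⁻¹`. -/
def barU : U k →ₛₗ[bar] U k := antilinear barHom

open Algebra.TensorProduct in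
/-- The coproduct. -/
def coprod : U k →ₐ[Qq] U k ⊗[Qq] U k :=
  lift (fun x => match x with
    | .E i => 1 ⊗ₜ E i + E i ⊗ₜ Kinv i
    | .F i => F i ⊗ₜ 1 + K i ⊗ₜ F i
    | .K i => K i ⊗ₜ K i
    | .Kinv i => Kinv i ⊗ₜ Kinv i) (by
    intro x y h
    cases h with
    | K_Kinv i =>
      simp only [map_mul, map_one, FreeAlgebra.lift_ι_apply, tmul_mul_tmul,
        K_Kinv, Algebra.TensorProduct.one_def]
    | Kinv_K i =>
      simp only [map_mul, map_one, FreeAlgebra.lift_ι_apply, tmul_mul_tmul,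
        Kinv_K, Algebra.TensorProduct.one_def]
    | K_K i j =>
      simp only [map_mul, FreeAlgebra.lift_ι_apply, tmul_mul_tmul, K_K i j]
    | K_E i j =>
      simp only [map_mul, map_smul, FreeAlgebra.lift_ι_apply, mul_add, add_mul, tmul_mul_tmul]
      rw [K_E_Kinv, mul_one, K_Kinv, ← Kinv_K' j i, mul_assoc, K_Kinv, mul_one, smul_add,
        TensorProduct.tmul_smul, TensorProduct.smul_tmul', TensorProduct.smul_tmul']
    | K_F i j =>
      simp only [map_mul, map_smul, FreeAlgebra.lift_ι_apply, mul_add, add_mul, tmul_mul_tmul]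
      rw [K_F_Kinv, mul_one, K_Kinv, K_K i j, mul_assoc, K_Kinv, mul_one, smul_add,
        TensorProduct.tmul_smul, TensorProduct.smul_tmul', TensorProduct.smul_tmul']
    | E_F i =>
      simp only [map_mul, map_sub, map_smul, FreeAlgebra.lift_ι_apply, mul_add, add_mul,
        tmul_mul_tmul, mul_one, one_mul]
      rw [K_E i i, Kinv_F i i, TensorProduct.tmul_smul, TensorProduct.smul_tmul',
        show ∀ a b c d b' c' : U k ⊗[Qq] U k,
          a + b + (c + d) - (a + b' + (c' + d)) = (c - b') + (b - c') by intros; abel,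
        ← TensorProduct.sub_tmul, ← TensorProduct.tmul_sub, E_F, ← TensorProduct.smul_tmul',
        TensorProduct.tmul_smul, ← smul_add, TensorProduct.sub_tmul, TensorProduct.tmul_sub]
      congr 1; abel
    | E_F_ne i j h =>
      simp only [map_mul, map_sub, map_zero, FreeAlgebra.lift_ι_apply, mul_add, add_mul,
        tmul_mul_tmul, mul_one, one_mul]
      rw [K_E j i, Kinv_F i j, cartan_symm, TensorProduct.tmul_smul, TensorProduct.smul_tmul',
        show ∀ a b c d b' c' : U k ⊗[Qq] U k,
          a + b + (c + d) - (a + b' + (c' + d)) = (c - b') + (b - c') by intros; abel,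
        ← TensorProduct.sub_tmul, ← TensorProduct.tmul_sub, E_F_ne _ _ h]
      simp
    | E_serre i j h =>
      simp only [map_mul, map_add, map_pow, map_smul, FreeAlgebra.lift_ι_apply]
      have hc := cartan_adjacent h
      have hc' := cartan_adjacent h.symm
      refine serre_add q_ne_zero ?_ ?_ ?_ ?_ ?_ <;>
        simp only [pow_two, tmul_mul_tmul, mul_one, one_mul]
      · rw [← TensorProduct.tmul_add, ← pow_two, E_serre i j h, TensorProduct.tmul_smul]
      · have h1 : Kinv i * Kinv i * Kinv j = Kinv i * Kinv j * Kinv i := by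
          rw [mul_assoc, mul_assoc, Kinv_Kinv i j]
        have h2 : Kinv j * (Kinv i * Kinv i) = Kinv i * Kinv j * Kinv i := by
          rw [← mul_assoc, Kinv_Kinv i j]
        rw [h1, h2, ← TensorProduct.add_tmul, ← pow_two, E_serre i j h, TensorProduct.smul_tmul']
      · rw [Kinv_E, cartan_self, TensorProduct.tmul_smul, ← zpow_two_neg]
      · rw [Kinv_E, hc, TensorProduct.tmul_smul, neg_neg, zpow_one]
      · rw [Kinv_E, hc', TensorProduct.tmul_smul, neg_neg, zpow_one]
    | E_far i j h =>
      simp only [map_mul, FreeAlgebra.lift_ι_apply]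
      have hc := cartan_far h
      have hc' := cartan_far h.symm
      refine commute_add ?_ ?_ ?_ ?_ <;> simp only [tmul_mul_tmul, mul_one, one_mul]
      · rw [E_far i j h]
      · rw [E_far i j h, Kinv_Kinv i j]
      · rw [Kinv_E, hc, neg_zero, zpow_zero, one_smul]
      · rw [Kinv_E, hc', neg_zero, zpow_zero, one_smul]
    | F_serre i j h =>
      simp only [map_mul, map_add, map_pow, map_smul, FreeAlgebra.lift_ι_apply]
      have hc := cartan_adjacent h
      have hc' := cartan_adjacent h.symm
      refine serre_add q_ne_zero ?_ ?_ ?_ ?_ ?_ <;>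
        simp only [pow_two, tmul_mul_tmul, mul_one, one_mul]
      · rw [← TensorProduct.add_tmul, ← pow_two, F_serre i j h, TensorProduct.smul_tmul']
      · have h1 : K i * K i * K j = K i * K j * K i := by
          rw [mul_assoc, mul_assoc, K_K i j]
        have h2 : K j * (K i * K i) = K i * K j * K i := by
          rw [← mul_assoc, K_K i j]
        rw [h1, h2, ← TensorProduct.tmul_add, ← pow_two, F_serre i j h, TensorProduct.tmul_smul]
      · rw [K_F, cartan_self, ← TensorProduct.smul_tmul', ← zpow_two_neg]
      · rw [K_F, hc, ← TensorProduct.smul_tmul', neg_neg, zpow_one]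
      · rw [K_F, hc', ← TensorProduct.smul_tmul', neg_neg, zpow_one]
    | F_far i j h =>
      simp only [map_mul, FreeAlgebra.lift_ι_apply]
      have hc := cartan_far h
      have hc' := cartan_far h.symm
      refine commute_add ?_ ?_ ?_ ?_ <;> simp only [tmul_mul_tmul, mul_one, one_mul]
      · rw [F_far i j h]
      · rw [F_far i j h, K_K i j]
      · rw [K_F, hc, neg_zero, zpow_zero, one_smul]
      · rw [K_F, hc', neg_zero, zpow_zero, one_smul])

/-- The counit. -/
def counit : U k →ₐ[Qq] Qq :=
  lift (fun x => match x with
    | .E _ => 0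
    | .F _ => 0
    | .K _ => 1
    | .Kinv _ => 1) (by
    intro x y h
    cases h <;> simp)

end U


/-- `𝕍` has basis `v_a`, `a ∈ I_k = {-k/2, …, k/2}`; the index `a : Fin (k+1)` stands for
`a - k/2`. For `i : Fin k`, the indices `i - 1/2` and `i + 1/2` are `i.castSucc` and `i.succ`, and
`-a` is `Fin.rev a`. -/
abbrev V (k : ℕ) : Type := Fin (k + 1) → Qq

namespace V

variable {k : ℕ}

/-- The standard basis of `𝕍`. -/
abbrev basis (k : ℕ) : Module.Basis (Fin (k + 1)) Qq (V k) := Pi.basisFun Qq (Fin (k + 1))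

/-- The basis vector `v_a`. -/
abbrev v (a : Fin (k + 1)) : V k := basis k a

/-- The linear operator with prescribed values on the `v_a`. -/
abbrev op (g : Fin (k + 1) → V k) : Module.End Qq (V k) := (basis k).constr Qq g

/-- The action of the generators of `U` on `𝕍`. -/
def genAct : UGen k → Module.End Qq (V k)
  | .E i => op fun a => if a = i.succ then v i.castSucc else 0
  | .F i => op fun a => if a = i.castSucc then v i.succ else 0
  | .K i => op fun a => (if a = i.castSucc then q else if a = i.succ then q⁻¹ else 1) • v a
  | .Kinv i => op fun a => (if a = i.castSucc then q⁻¹ else if a = i.succ then q else 1) • v a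

theorem E_v (i : Fin k) (a : Fin (k + 1)) :
    genAct (.E i) (v a) = if a = i.succ then v i.castSucc else 0 := Module.Basis.constr_basis ..
theorem F_v (i : Fin k) (a : Fin (k + 1)) :
    genAct (.F i) (v a) = if a = i.castSucc then v i.succ else 0 := Module.Basis.constr_basis ..
theorem K_v (i : Fin k) (a : Fin (k + 1)) : genAct (.K i) (v a) =
    (if a = i.castSucc then q else if a = i.succ then q⁻¹ else 1) • v a :=
  Module.Basis.constr_basis ..
theorem Kinv_v (i : Fin k) (a : Fin (k + 1)) : genAct (.Kinv i) (v a) =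
    (if a = i.castSucc then q⁻¹ else if a = i.succ then q else 1) • v a :=
  Module.Basis.constr_basis ..

theorem EE (i j : Fin k) (h : (i : ℕ) + 1 ≠ j) :
    (genAct (.E i) * genAct (.E j) : Module.End Qq (V k)) = 0 := by
  refine (basis k).ext fun a => ?_
  rw [Module.End.mul_apply, E_v]
  split_ifs with h1
  · rw [E_v, if_neg (by simp [Fin.ext_iff]; omega)]; rfl
  · simp

theorem FF (i j : Fin k) (h : (j : ℕ) + 1 ≠ i) :
    (genAct (.F i) * genAct (.F j) : Module.End Qq (V k)) = 0 := by
  refine (basis k).ext fun a => ?_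
  rw [Module.End.mul_apply, F_v]
  split_ifs with h1
  · rw [F_v, if_neg (by simp [Fin.ext_iff]; omega)]; rfl
  · simp

/-- The natural representation of `U`. -/
def rep : U k →ₐ[Qq] Module.End Qq (V k) :=
  U.lift genAct (by
    intro x y h
    have hq := q_ne_zero
    cases h with
    | K_Kinv i =>
      simp only [map_mul, map_one, FreeAlgebra.lift_ι_apply]
      refine (basis k).ext fun a => ?_
      rw [Module.End.mul_apply, Kinv_v, map_smul, K_v, smul_smul]
      split_ifs <;> simp [hq]
    | Kinv_K i =>
      simp only [map_mul, map_one, FreeAlgebra.lift_ι_apply]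
      refine (basis k).ext fun a => ?_
      rw [Module.End.mul_apply, K_v, map_smul, Kinv_v, smul_smul]
      split_ifs <;> simp [hq]
    | K_K i j =>
      simp only [map_mul, FreeAlgebra.lift_ι_apply]
      refine (basis k).ext fun a => ?_
      simp only [Module.End.mul_apply, K_v, map_smul, smul_smul, mul_comm]
    | K_E i j =>
      simp only [map_mul, map_smul, FreeAlgebra.lift_ι_apply]
      refine (basis k).ext fun a => ?_
      rw [Module.End.mul_apply, Module.End.mul_apply, Kinv_v, map_smul, map_smul,
        LinearMap.smul_apply, E_v]
      by_cases h : a = j.succ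
      · subst h
        rw [if_pos rfl, K_v, smul_smul]
        congr 1
        simp only [Fin.ext_iff, Fin.val_succ, Fin.val_castSucc, cartan]
        split_ifs <;> first | omega | (simp [hq]; done) | (norm_cast; field_simp)
      · simp [h]
    | K_F i j =>
      simp only [map_mul, map_smul, FreeAlgebra.lift_ι_apply]
      refine (basis k).ext fun a => ?_
      rw [Module.End.mul_apply, Module.End.mul_apply, Kinv_v, map_smul, map_smul,
        LinearMap.smul_apply, F_v]
      by_cases h : a = j.castSucc
      · subst h
        rw [if_pos rfl, K_v, smul_smul]
        congr 1
        simp only [Fin.ext_iff, Fin.val_succ, Fin.val_castSucc, cartan]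
        split_ifs <;> first | omega | (simp [hq]; done) | (simp only [zpow_neg]; norm_cast; field_simp)
      · simp [h]
    | E_F i =>
      simp only [map_mul, map_smul, map_sub, FreeAlgebra.lift_ι_apply]
      refine (basis k).ext fun a => ?_
      have hq2 := q_sub_inv_ne_zero
      have hne : i.succ ≠ i.castSucc := by simp [Fin.ext_iff]
      simp only [LinearMap.sub_apply, LinearMap.smul_apply, Module.End.mul_apply, E_v, F_v, K_v,
        Kinv_v]
      by_cases h1 : a = i.castSucc
      · subst h1
        simp only [if_pos, hne.symm, if_false, map_zero, E_v, sub_zero]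
        rw [← sub_smul, smul_smul, inv_mul_cancel₀ hq2, one_smul]
      · by_cases h2 : a = i.succ
        · subst h2
          simp only [if_pos, hne, if_false, map_zero, F_v, zero_sub]
          rw [← sub_smul, smul_smul, ← neg_sub q q⁻¹, mul_neg, inv_mul_cancel₀ hq2, neg_smul, one_smul]
        · simp [h1, h2]
    | E_F_ne i j h =>
      simp only [map_mul, map_zero, map_sub, FreeAlgebra.lift_ι_apply]
      refine (basis k).ext fun a => ?_
      have h1 : j.succ ≠ i.succ := fun e => h (Fin.succ_injective _ e).symm
      have h2 : i.castSucc ≠ j.castSucc := fun e => h (Fin.castSucc_injective _ e)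
      simp only [LinearMap.sub_apply, Module.End.mul_apply, E_v, F_v]
      split_ifs <;> simp only [map_zero, E_v, F_v, if_neg h1, if_neg h2, sub_zero, LinearMap.zero_apply]
    | E_serre i j h =>
      simp only [map_mul, map_smul, map_add, map_pow, FreeAlgebra.lift_ι_apply]
      rw [pow_two, EE i i (by omega), zero_mul, mul_zero, add_zero]
      by_cases h1 : (i : ℕ) + 1 = j
      · rw [mul_assoc, EE j i (by omega), mul_zero, smul_zero]
      · rw [EE i j h1, zero_mul, smul_zero]
    | E_far i j h =>
      simp only [map_mul, FreeAlgebra.lift_ι_apply]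
      unfold Far at h
      rw [EE i j (by omega), EE j i (by omega)]
    | F_serre i j h =>
      simp only [map_mul, map_smul, map_add, map_pow, FreeAlgebra.lift_ι_apply]
      rw [pow_two, FF i i (by omega), zero_mul, mul_zero, add_zero]
      by_cases h1 : (i : ℕ) + 1 = j
      · rw [FF i j (by omega), zero_mul, smul_zero]
      · rw [mul_assoc, FF j i (by omega), mul_zero, smul_zero]
    | F_far i j h =>
      simp only [map_mul, FreeAlgebra.lift_ι_apply]
      unfold Far at h
      rw [FF i j (by omega), FF j i (by omega)])

/-- The anti-linear involution `ψ` of `𝕍` fixing every `v_a`. -/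
def psi : V k →ₛₗ[bar] V k where
  toFun x a := bar (x a)
  map_add' x y := by ext a; simp
  map_smul' c x := by ext a; simp

end V

/-- The tensor power `𝕍^{⊗ m}`. -/
abbrev T (k m : ℕ) : Type := ⨂[Qq]^m (V k)

/-- `𝕍^{⊗ 0} ≃ ℚ(q)`. -/
def tensorZero (k : ℕ) : T k 0 ≃ₗ[Qq] Qq :=
  PiTensorProduct.isEmptyEquiv (R := Qq) (s := fun _ : Fin 0 => V k) (Fin 0)

/-- `𝕍^{⊗ m} ⊗ 𝕍 ≃ 𝕍^{⊗ (m+1)}`. -/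
def tensorSnoc (k m : ℕ) : T k m ⊗[Qq] V k ≃ₗ[Qq] T k (m + 1) :=
  (TensorProduct.congr (LinearEquiv.refl Qq (T k m))
    (PiTensorProduct.subsingletonEquiv (R := Qq) (s := fun _ : Fin 1 => V k) 0).symm).trans
    (TensorPower.mulEquiv (R := Qq) (M := V k) (n := m) (m := 1))

/-- The basis `M_f = v_{f(1)} ⊗ ⋯ ⊗ v_{f(m)}` of `𝕍^{⊗ m}`. -/
def M (k m : ℕ) : Module.Basis (Fin m → Fin (k + 1)) Qq (T k m) :=
  Basis.piTensorProduct fun _ => V.basis k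

/-- The action of `U ⊗ U` on `M ⊗ N`, given actions of `U` on `M` and on `N`. -/
def pairRep {k : ℕ} {M N : Type} [AddCommGroup M] [Module Qq M] [AddCommGroup N] [Module Qq N]
    (ρ : U k →ₐ[Qq] Module.End Qq M) (σ : U k →ₐ[Qq] Module.End Qq N) :
    U k ⊗[Qq] U k →ₐ[Qq] Module.End Qq (M ⊗[Qq] N) :=
  (Module.endTensorEndAlgHom (R := Qq) (S := Qq) (A := Qq) (M := M) (N := N)).comp
    (Algebra.TensorProduct.map ρ σ)

/-- The action of `U` on `𝕍^{⊗ m}` by the iterated coproduct (`U` acts on `𝕍^{⊗ 0} = ℚ(q)` by the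
counit). -/
def rep (k : ℕ) : (m : ℕ) → U k →ₐ[Qq] Module.End Qq (T k m)
  | 0 => (Algebra.ofId Qq (Module.End Qq (T k 0))).comp U.counit
  | m + 1 => ((tensorSnoc k m).conjAlgEquiv Qq).toAlgHom.comp
      ((pairRep (rep k m) V.rep).comp U.coprod)

section Completions

open U

/-- `U⁺`, as a subspace. -/
def Upos (k : ℕ) : Submodule Qq (U k) :=
  Subalgebra.toSubmodule (Algebra.adjoin Qq (Set.range (E (k := k))))

/-- `U⁻`, as a subspace. -/
def Uneg (k : ℕ) : Submodule Qq (U k) :=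
  Subalgebra.toSubmodule (Algebra.adjoin Qq (Set.range (F (k := k))))

/-- `U⁰`, as a subspace. -/
def Uzero (k : ℕ) : Submodule Qq (U k) :=
  Subalgebra.toSubmodule (Algebra.adjoin Qq (Set.range (K (k := k)) ∪ Set.range (Kinv (k := k))))

/-- `ℕΠ`: the function `μ` stands for `∑ μ_i α_i`. -/
abbrev RootCone (k : ℕ) : Type := Fin k → ℕ

/-- The height of an element of `ℕΠ`. -/
def ht {k : ℕ} (μ : RootCone k) : ℕ := ∑ i, μ i

/-- `U⁺_μ`: the span of the monomials in the `E_i` in which `E_i` occurs `μ_i` times. -/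
def UposW {k : ℕ} (μ : RootCone k) : Submodule Qq (U k) :=
  Submodule.span Qq {x | ∃ l : List (Fin k), (∀ i, l.count i = μ i) ∧ x = (l.map E).prod}

/-- `U⁻_{-μ}`: the span of the monomials in the `F_i` in which `F_i` occurs `μ_i` times. -/
def UnegW {k : ℕ} (μ : RootCone k) : Submodule Qq (U k) :=
  Submodule.span Qq {x | ∃ l : List (Fin k), (∀ i, l.count i = μ i) ∧ x = (l.map F).prod}

/-- `U⁺ U⁰ (∑_{ht μ ≥ N} U⁻_{-μ})`. -/
def filNeg (k N : ℕ) : Submodule Qq (U k) :=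
  Upos k * Uzero k * ⨆ (μ : RootCone k) (_ : N ≤ ht μ), UnegW μ

/-- `U⁻ U⁰ (∑_{ht μ ≥ N} U⁺_μ)`. -/
def filPos (k N : ℕ) : Submodule Qq (U k) :=
  Uneg k * Uzero k * ⨆ (μ : RootCone k) (_ : N ≤ ht μ), UposW μ

/-- `A ⊗ B`, as a subspace of `U ⊗ U`. -/
def tensorSub {k : ℕ} (A B : Submodule Qq (U k)) : Submodule Qq (U k ⊗[Qq] U k) :=
  Submodule.map₂ (TensorProduct.mk Qq (U k) (U k)) A B

/-- The descending filtration that defines the completion of `U ⊗ U`. -/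
def filTensor (k N : ℕ) : Submodule Qq (U k ⊗[Qq] U k) :=
  tensorSub (filPos k N) ⊤ ⊔ tensorSub ⊤ (filNeg k N)

/-- The sum `∑ x_μ` is zero in the completion with respect to the filtration `J`. -/
def SumsToZero {k : ℕ} {X : Type} [AddCommGroup X] [Module Qq X] (J : ℕ → Submodule Qq X)
    (x : RootCone k → X) : Prop :=
  ∀ N : ℕ, ∃ S₀ : Finset (RootCone k), ∀ S : Finset (RootCone k), S₀ ⊆ S → ∑ μ ∈ S, x μ ∈ J N

/-- `(ψ ⊗ ψ) ∘ Δ ∘ ψ`. -/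
def barCoprod {k : ℕ} (u : U k) : U k ⊗[Qq] U k :=
  TensorProduct.map barU barU (coprod (barU u))

/-- Lusztig's quasi-`R`-matrix, for the coproduct above: the family of components
`Θ_ν ∈ U⁺_ν ⊗ U⁻_{-ν}` with `Θ_0 = 1 ⊗ 1` and `Δ(u) Θ = Θ (ψ ⊗ ψ)(Δ(ψ u))` for all `u`, in the
completion of `U ⊗ U`. -/
structure IsQuasiR {k : ℕ} (Θ : RootCone k → U k ⊗[Qq] U k) : Prop where
  mem : ∀ ν, Θ ν ∈ tensorSub (UposW ν) (UnegW ν)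
  zero : Θ 0 = 1
  intertwines : ∀ u : U k, SumsToZero (filTensor k) fun ν => coprod u * Θ ν - Θ ν * barCoprod u

/-- The quasi-`R`-matrix `Θ`. -/
def quasiR (k : ℕ) : RootCone k → U k ⊗[Qq] U k := Classical.epsilon IsQuasiR

end Completions

/-- The anti-linear involution `ψ` of `𝕍^{⊗ m}`: on a tensor product of involutive modules it is
`Θ ∘ (ψ ⊗ ψ)`. Only finitely many components of `Θ` act by a non-zero operator. -/
def psiT (k : ℕ) : (m : ℕ) → T k m →ₛₗ[bar] T k m
  | 0 => (tensorZero k).symm.toLinearMap.comp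
      (bar.toSemilinearMap.comp (tensorZero k).toLinearMap)
  | m + 1 => (tensorSnoc k m).toLinearMap.comp
      ((∑ᶠ ν, pairRep (rep k m) V.rep (quasiR k ν)).comp
        ((TensorProduct.map (psiT k m) V.psi).comp (tensorSnoc k m).symm.toLinearMap))


/-- `𝕀^ı`, the positive elements of `𝕀_k`. For `i : Fin k` the integer `i - Fin.rev i` is twice the
element of `𝕀_k` that `i` stands for. -/
abbrev Pos (k : ℕ) : Type := {i : Fin k // i.rev < i}

/-- `i = 1/2` (this occurs for even `k` only). -/
def IsHalf {k : ℕ} (i : Fin k) : Prop := (i : ℕ) = i.rev + 1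

/-- `i = 1` (this occurs for odd `k` only). -/
def IsOne {k : ℕ} (i : Fin k) : Prop := (i : ℕ) = i.rev + 2

/-- `i > 1`. -/
def GtOne {k : ℕ} (i : Fin k) : Prop := (i.rev : ℕ) + 2 < i

/-- Generators of `U^ı`; the generator `t` is present when `0 ∈ 𝕀_k`, that is, for odd `k`. -/
inductive IGen (k : ℕ) : Type
  | e (i : Pos k)
  | f (i : Pos k)
  | κ (i : Pos k)
  | κinv (i : Pos k)
  | t (z : Fin k) (hz : z.rev = z)

namespace IGen

/-- The generators in the free algebra. -/
abbrev e' {k : ℕ} (i : Pos k) : FreeAlgebra Qq (IGen k) := FreeAlgebra.ι Qq (e i)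
abbrev f' {k : ℕ} (i : Pos k) : FreeAlgebra Qq (IGen k) := FreeAlgebra.ι Qq (f i)
abbrev k' {k : ℕ} (i : Pos k) : FreeAlgebra Qq (IGen k) := FreeAlgebra.ι Qq (κ i)
abbrev k'' {k : ℕ} (i : Pos k) : FreeAlgebra Qq (IGen k) := FreeAlgebra.ι Qq (κinv i)
abbrev t' {k : ℕ} (z : Fin k) (hz : z.rev = z) : FreeAlgebra Qq (IGen k) :=
  FreeAlgebra.ι Qq (t z hz)

end IGen

/-- `(α_i - α_{-i}, α_j)`. -/
def icartan {k : ℕ} (i j : Pos k) : ℤ := cartan i.1 j.1 - cartan i.1.rev j.1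

open IGen in
/-- The defining relations of `U^ı = U^ı_q(sl_{k+1})`. -/
inductive IRel (k : ℕ) : FreeAlgebra Qq (IGen k) → FreeAlgebra Qq (IGen k) → Prop
  | k_kinv (i : Pos k) : IRel k (k' i * k'' i) 1
  | kinv_k (i : Pos k) : IRel k (k'' i * k' i) 1
  | k_k (i j : Pos k) : IRel k (k' i * k' j) (k' j * k' i)
  | k_e (i j : Pos k) : IRel k (k' i * e' j * k'' i) (q ^ icartan i j • e' j)
  | k_f (i j : Pos k) : IRel k (k' i * f' j * k'' i) (q ^ (-icartan i j) • f' j)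
  | e_f (i : Pos k) (h : ¬ IsHalf i.1) :
      IRel k (e' i * f' i - f' i * e' i) ((q - q⁻¹)⁻¹ • (k' i - k'' i))
  | e_f_ne (i j : Pos k) (h : i ≠ j) : IRel k (e' i * f' j - f' j * e' i) 0
  | e_serre (i j : Pos k) (h : Adjacent i.1 j.1) :
      IRel k (e' i ^ 2 * e' j + e' j * e' i ^ 2) ((q + q⁻¹) • (e' i * e' j * e' i))
  | f_serre (i j : Pos k) (h : Adjacent i.1 j.1) :
      IRel k (f' i ^ 2 * f' j + f' j * f' i ^ 2) ((q + q⁻¹) • (f' i * f' j * f' i))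
  | e_far (i j : Pos k) (h : Far i.1 j.1) : IRel k (e' i * e' j) (e' j * e' i)
  | f_far (i j : Pos k) (h : Far i.1 j.1) : IRel k (f' i * f' j) (f' j * f' i)
  | f_half (i : Pos k) (h : IsHalf i.1) : IRel k (f' i ^ 2 * e' i + e' i * f' i ^ 2)
      ((q + q⁻¹) • (f' i * e' i * f' i - q ^ 2 • (f' i * k'' i) - (q⁻¹) ^ 2 • (f' i * k' i)))
  | e_half (i : Pos k) (h : IsHalf i.1) : IRel k (e' i ^ 2 * f' i + f' i * e' i ^ 2)
      ((q + q⁻¹) • (e' i * f' i * e' i - (q⁻¹) ^ 2 • (k' i * e' i) - q ^ 2 • (k'' i * e' i)))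
  | k_t (i : Pos k) (z : Fin k) (hz : z.rev = z) : IRel k (k' i * t' z hz * k'' i) (t' z hz)
  | e_t (i : Pos k) (h : GtOne i.1) (z : Fin k) (hz : z.rev = z) :
      IRel k (e' i * t' z hz) (t' z hz * e' i)
  | e_e_t (i : Pos k) (h : IsOne i.1) (z : Fin k) (hz : z.rev = z) :
      IRel k (e' i ^ 2 * t' z hz + t' z hz * e' i ^ 2) ((q + q⁻¹) • (e' i * t' z hz * e' i))
  | t_t_e (i : Pos k) (h : IsOne i.1) (z : Fin k) (hz : z.rev = z) :
      IRel k (t' z hz ^ 2 * e' i + e' i * t' z hz ^ 2)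
        ((q + q⁻¹) • (t' z hz * e' i * t' z hz) + e' i)
  | f_t (i : Pos k) (h : GtOne i.1) (z : Fin k) (hz : z.rev = z) :
      IRel k (f' i * t' z hz) (t' z hz * f' i)
  | f_f_t (i : Pos k) (h : IsOne i.1) (z : Fin k) (hz : z.rev = z) :
      IRel k (f' i ^ 2 * t' z hz + t' z hz * f' i ^ 2) ((q + q⁻¹) • (f' i * t' z hz * f' i))
  | t_t_f (i : Pos k) (h : IsOne i.1) (z : Fin k) (hz : z.rev = z) :
      IRel k (t' z hz ^ 2 * f' i + f' i * t' z hz ^ 2)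
        ((q + q⁻¹) • (t' z hz * f' i * t' z hz) + f' i)

/-- The algebra `U^ı = U^ı_q(sl_{k+1})`. -/
def UI (k : ℕ) : Type := RingQuot (IRel k)

instance (k : ℕ) : Ring (UI k) := inferInstanceAs (Ring (RingQuot (IRel k)))
instance (k : ℕ) : Algebra Qq (UI k) := inferInstanceAs (Algebra Qq (RingQuot (IRel k)))

namespace UI

variable {k : ℕ}

/-- The class of a generator. -/
def gen (x : IGen k) : UI k := RingQuot.mkAlgHom Qq (IRel k) (FreeAlgebra.ι Qq x)

/-- The universal property of `U^ı`. -/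
def lift {A : Type} [Ring A] [Algebra Qq A] (g : IGen k → A)
    (h : ∀ x y, IRel k x y → FreeAlgebra.lift Qq g x = FreeAlgebra.lift Qq g y) : UI k →ₐ[Qq] A :=
  RingQuot.liftAlgHom Qq ⟨FreeAlgebra.lift Qq g, fun x y => h x y⟩

/-- The bar involution on generators. -/
def barGen : IGen k → Twist (UI k)
  | .e i => Twist.of (gen (.e i))
  | .f i => Twist.of (gen (.f i))
  | .κ i => Twist.of (gen (.κinv i))
  | .κinv i => Twist.of (gen (.κ i))
  | .t z hz => Twist.of (gen (.t z hz))

theorem rel {x y : FreeAlgebra Qq (IGen k)} (h : IRel k x y) :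
    FreeAlgebra.lift Qq gen x = FreeAlgebra.lift Qq gen y := by
  have e : FreeAlgebra.lift Qq (gen (k := k)) = RingQuot.mkAlgHom Qq (IRel k) := by
    ext x; exact FreeAlgebra.lift_ι_apply gen x
  rw [e]
  exact RingQuot.mkAlgHom_rel Qq h

theorem k_kinv (i : Pos k) : gen (.κ i) * gen (.κinv i) = 1 := by
  simpa using rel (IRel.k_kinv i)
theorem kinv_k (i : Pos k) : gen (.κinv i) * gen (.κ i) = 1 := by
  simpa using rel (IRel.kinv_k i)

/-- The bar involution of `U^ı` as a homomorphism into the twisted algebra. -/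
def barHom : UI k →ₐ[Qq] Twist (UI k) :=
  lift (A := Twist (UI k)) barGen (by
    intro x y h
    have hs : bar (q + q⁻¹) = q + q⁻¹ := by simp [add_comm]
    have hr := rel h
    cases h with
    | k_kinv i =>
      simp only [map_mul, map_one, FreeAlgebra.lift_ι_apply, barGen] at hr ⊢
      exact kinv_k i
    | kinv_k i =>
      simp only [map_mul, map_one, FreeAlgebra.lift_ι_apply, barGen] at hr ⊢
      exact k_kinv i
    | k_k i j =>
      simp only [map_mul, FreeAlgebra.lift_ι_apply, barGen] at hr ⊢
      exact inv_comm (k_kinv i) (kinv_k i) (k_kinv j) (kinv_k j) hr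
    | k_e i j =>
      simp only [map_mul, map_smul, FreeAlgebra.lift_ι_apply] at hr
      rw [map_smul, twist_smul, map_zpow₀, bar_q, inv_zpow]
      simp only [map_mul, FreeAlgebra.lift_ι_apply, barGen]
      exact conj_inv (zpow_ne_zero _ q_ne_zero) (k_kinv i) (kinv_k i) hr
    | k_f i j =>
      simp only [map_mul, map_smul, FreeAlgebra.lift_ι_apply] at hr
      rw [map_smul, twist_smul, map_zpow₀, bar_q, inv_zpow]
      simp only [map_mul, FreeAlgebra.lift_ι_apply, barGen]
      exact conj_inv (zpow_ne_zero _ q_ne_zero) (k_kinv i) (kinv_k i) hr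
    | e_f i h =>
      simp only [map_mul, map_smul, map_sub, FreeAlgebra.lift_ι_apply] at hr
      have hb : bar (q - q⁻¹)⁻¹ = (q⁻¹ - q)⁻¹ := by simp
      rw [map_smul, twist_smul, hb]
      simp only [map_mul, map_sub, FreeAlgebra.lift_ι_apply, barGen]
      have h2 : (q - q⁻¹)⁻¹ • (gen (.κ i) - gen (.κinv i))
          = (q⁻¹ - q)⁻¹ • (gen (.κinv i) - gen (.κ i)) := by
        rw [← neg_sub q q⁻¹, inv_neg, neg_smul, ← smul_neg, neg_sub]
      exact hr.trans h2
    | f_half i h =>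
      simp only [map_mul, map_sub, map_add, map_pow, map_smul, FreeAlgebra.lift_ι_apply] at hr
      rw [map_smul, twist_smul, hs, map_sub, map_sub, map_smul, map_smul, twist_smul, twist_smul,
        map_pow, map_pow, map_inv₀, bar_q, inv_inv]
      simp only [map_mul, map_add, map_pow, FreeAlgebra.lift_ι_apply, barGen]
      rw [sub_right_comm] at hr
      exact hr
    | e_half i h =>
      simp only [map_mul, map_sub, map_add, map_pow, map_smul, FreeAlgebra.lift_ι_apply] at hr
      rw [map_smul, twist_smul, hs, map_sub, map_sub, map_smul, map_smul, twist_smul, twist_smul,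
        map_pow, map_pow, map_inv₀, bar_q, inv_inv]
      simp only [map_mul, map_add, map_pow, FreeAlgebra.lift_ι_apply, barGen]
      rw [sub_right_comm] at hr
      exact hr
    | k_t i z hz =>
      simp only [map_mul, FreeAlgebra.lift_ι_apply, barGen] at hr ⊢
      have h2 : gen (.κ i) * gen (.t z hz) * gen (.κinv i) = (1 : Qq) • gen (.t z hz) := by
        rw [one_smul]; exact hr
      have h3 := conj_inv one_ne_zero (k_kinv i) (kinv_k i) h2
      rw [inv_one, one_smul] at h3
      exact h3
    | t_t_e i h z hz =>
      simp only [map_mul, map_add, map_pow, map_smul, FreeAlgebra.lift_ι_apply] at hr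
      rw [map_add _ (_ • _), map_smul, twist_smul, hs]
      simp only [map_mul, map_add, map_pow, FreeAlgebra.lift_ι_apply, barGen]
      exact hr
    | t_t_f i h z hz =>
      simp only [map_mul, map_add, map_pow, map_smul, FreeAlgebra.lift_ι_apply] at hr
      rw [map_add _ (_ • _), map_smul, twist_smul, hs]
      simp only [map_mul, map_add, map_pow, FreeAlgebra.lift_ι_apply, barGen]
      exact hr
    | e_serre | f_serre | e_e_t | f_f_t =>
      simp only [map_mul, map_add, map_pow, map_smul, FreeAlgebra.lift_ι_apply] at hr
      rw [map_smul, twist_smul, hs]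
      simp only [map_mul, map_add, map_pow, FreeAlgebra.lift_ι_apply, barGen]
      exact hr
    | e_f_ne | e_far | f_far | e_t | f_t =>
      simp only [map_mul, map_sub, map_zero, FreeAlgebra.lift_ι_apply, barGen] at hr ⊢
      exact hr)

end UI

section Skew

variable {R A : Type} [Field R] [Ring A] [Algebra R A]

theorem serre_mul {t c d : R} {x x' g g' : A}
    (hx : x ^ 2 * x' + x' * x ^ 2 = t • (x * x' * x)) (hg : g' * g = g * g')
    (h1 : g * x = d • (x * g)) (h2 : g * x' = c • (x' * g)) (h3 : g' * x = c • (x * g')) :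
    (x * g) ^ 2 * (x' * g') + (x' * g') * (x * g) ^ 2 = t • ((x * g) * (x' * g') * (x * g)) := by
  have as : ∀ {x y z : A}, x * y = z → ∀ w, x * (y * w) = z * w := fun h w => by
    rw [← mul_assoc, h]
  have e1 : (x * g) ^ 2 * (x' * g') = (d * c * c) • ((x ^ 2 * x') * (g * (g * g'))) := by
    simp only [pow_two, mul_assoc, as h1, as h2, mul_smul_comm, smul_mul_assoc, smul_smul]
  have e2 : (x' * g') * (x * g) ^ 2 = (d * c * c) • ((x' * x ^ 2) * (g * (g * g'))) := by
    simp only [pow_two, mul_assoc, as h1, as h3, mul_smul_comm, smul_mul_assoc, smul_smul, hg,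
      as hg]
  have e3 : (x * g) * (x' * g') * (x * g) = (d * c * c) • ((x * x' * x) * (g * (g * g'))) := by
    simp only [mul_assoc, as h1, as h2, as h3, mul_smul_comm, smul_mul_assoc, smul_smul, hg]
    congr 1; ring
  rw [e1, e2, e3, ← smul_add, ← add_mul, hx, smul_mul_assoc, smul_comm]

theorem serre_smul {t c c' : R} {x x' : A}
    (hx : x ^ 2 * x' + x' * x ^ 2 = t • (x * x' * x)) :
    (c • x) ^ 2 * (c' • x') + (c' • x') * (c • x) ^ 2 = t • ((c • x) * (c' • x') * (c • x)) := by
  have : (c • x) ^ 2 * (c' • x') + (c' • x') * (c • x) ^ 2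
      = (c * c * c') • (x ^ 2 * x' + x' * x ^ 2) := by
    simp only [pow_two, mul_smul_comm, smul_mul_assoc, smul_smul, smul_add]
    congr 2; ring
  rw [this, hx]
  simp only [mul_smul_comm, smul_mul_assoc, smul_smul]
  congr 1; ring

/-- The relations used for a pair of adjacent nodes `i`, `j`. -/
theorem half_e {q : R} (hq : q ≠ 0) (hq2 : q - q⁻¹ ≠ 0)
    {Ei Ej Fi Fj Ki Kj Ki' Kj' : A}
    (hEi : Ei * Fi = Fi * Ei + (q - q⁻¹)⁻¹ • (Ki - Ki'))
    (hEj : Ej * Fj = Fj * Ej + (q - q⁻¹)⁻¹ • (Kj - Kj'))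
    (hij : Ei * Fj = Fj * Ei) (hji : Ej * Fi = Fi * Ej)
    (kk : Kj * Ki = Ki * Kj) (kk1 : Kj * Ki' = Ki' * Kj) (kk2 : Kj' * Ki = Ki * Kj')
    (kk3 : Kj' * Ki' = Ki' * Kj')
    (ii : Ki * Ki' = 1) (ii' : Ki' * Ki = 1) (jj : Kj * Kj' = 1) (jj' : Kj' * Kj = 1)
    (a1 : Ki * Ei = q ^ 2 • (Ei * Ki)) (a2 : Ki * Ej = q⁻¹ • (Ej * Ki))
    (a3 : Ki * Fi = (q⁻¹) ^ 2 • (Fi * Ki)) (a4 : Ki * Fj = q • (Fj * Ki))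
    (b1 : Kj * Ej = q ^ 2 • (Ej * Kj)) (b2 : Kj * Ei = q⁻¹ • (Ei * Kj))
    (b3 : Kj * Fj = (q⁻¹) ^ 2 • (Fj * Kj)) (b4 : Kj * Fi = q • (Fi * Kj))
    (a1' : Ki' * Ei = (q⁻¹) ^ 2 • (Ei * Ki')) (a2' : Ki' * Ej = q • (Ej * Ki'))
    (a3' : Ki' * Fi = q ^ 2 • (Fi * Ki')) (a4' : Ki' * Fj = q⁻¹ • (Fj * Ki'))
    (b1' : Kj' * Ej = (q⁻¹) ^ 2 • (Ej * Kj')) (b2' : Kj' * Ei = q • (Ei * Kj'))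
    (b3' : Kj' * Fj = q ^ 2 • (Fj * Kj')) (b4' : Kj' * Fi = q⁻¹ • (Fi * Kj'))
    (sE : Ei * (Ei * Ej) = (q + q⁻¹) • (Ei * (Ej * Ei)) - Ej * (Ei * Ei))
    (sF : Fj * (Fj * Fi) = (q + q⁻¹) • (Fj * (Fi * Fj)) - Fi * (Fj * Fj))
    (tE : Ej * (Ej * Ei) = (q + q⁻¹) • (Ej * (Ei * Ej)) - Ei * (Ej * Ej))
    (tF : Fi * (Fi * Fj) = (q + q⁻¹) • (Fi * (Fj * Fi)) - Fj * (Fi * Fi)) :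
    (Ei + Fj * Ki') ^ 2 * (Kj' * Fi + Ej) + (Kj' * Fi + Ej) * (Ei + Fj * Ki') ^ 2
      = (q + q⁻¹) • ((Ei + Fj * Ki') * (Kj' * Fi + Ej) * (Ei + Fj * Ki')
        - (q⁻¹) ^ 2 • (Ki * Kj' * (Ei + Fj * Ki')) - q ^ 2 • (Kj * Ki' * (Ei + Fj * Ki'))) ∧
    (Kj' * Fi + Ej) ^ 2 * (Ei + Fj * Ki') + (Ei + Fj * Ki') * (Kj' * Fi + Ej) ^ 2
      = (q + q⁻¹) • ((Kj' * Fi + Ej) * (Ei + Fj * Ki') * (Kj' * Fi + Ej)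
        - q ^ 2 • ((Kj' * Fi + Ej) * (Kj * Ki')) - (q⁻¹) ^ 2 • ((Kj' * Fi + Ej) * (Ki * Kj'))) := by
  have as : ∀ {x y z : A}, x * y = z → ∀ w, x * (y * w) = z * w := fun h w => by
    rw [← mul_assoc, h]
  have sE' : ∀ w, Ei * (Ei * (Ej * w)) = ((q + q⁻¹) • (Ei * (Ej * Ei)) - Ej * (Ei * Ei)) * w :=
    fun w => by rw [← sE]; simp only [mul_assoc]
  have sF' : ∀ w, Fj * (Fj * (Fi * w)) = ((q + q⁻¹) • (Fj * (Fi * Fj)) - Fi * (Fj * Fj)) * w :=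
    fun w => by rw [← sF]; simp only [mul_assoc]
  have tE' : ∀ w, Ej * (Ej * (Ei * w)) = ((q + q⁻¹) • (Ej * (Ei * Ej)) - Ei * (Ej * Ej)) * w :=
    fun w => by rw [← tE]; simp only [mul_assoc]
  have tF' : ∀ w, Fi * (Fi * (Fj * w)) = ((q + q⁻¹) • (Fi * (Fj * Fi)) - Fj * (Fi * Fi)) * w :=
    fun w => by rw [← tF]; simp only [mul_assoc]
  have hq3 : q ^ 2 - 1 ≠ 0 := by
    intro h; apply hq2; field_simp; rw [mul_zero]; exact h
  constructor <;>
  · simp only [pow_two, add_mul, mul_add, sub_mul, mul_sub, mul_assoc, smul_mul_assoc,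
      mul_smul_comm, smul_add, smul_sub, smul_smul, one_mul, mul_one,
      hEi, hEj, hij, hji, kk, kk1, kk2, kk3, ii, ii', jj, jj', a1, a2, a3, a4, b1, b2, b3, b4, a1',
      a2', a3', a4', b1', b2', b3', b4', sE, sF, sE', sF', tE, tF, tE', tF',
      as hEi, as hEj, as hij, as hji, as kk, as kk1, as kk2, as kk3, as ii, as ii', as jj, as jj',
      as a1, as a2, as a3, as a4, as b1, as b2, as b3, as b4, as a1',
      as a2', as a3', as a4', as b1', as b2', as b3', as b4']
    match_scalars <;> field_simp <;> ring

/-- The relations between the node `0` and an adjacent node. -/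
theorem serre_zero {q s : R} (hq : q ≠ 0) (hs : s * (q * q - 1) = 1) {x x' y y' κ : A}
    (hx : x ^ 2 * x' + x' * x ^ 2 = (q + q⁻¹) • (x * x' * x))
    (hy : y ^ 2 * y' + y' * y ^ 2 = (q + q⁻¹) • (y * y' * y))
    (h1 : y * x = (q⁻¹ * q⁻¹) • (x * y) - s • (1 - κ)) (h2 : y * x' = q • (x' * y))
    (h3 : y' * x = q • (x * y')) (h4 : κ * x' = (q * q) • (x' * κ))
    (h5 : κ * y' = (q⁻¹ * q⁻¹) • (y' * κ))
    (h6 : κ * x = (q⁻¹ * q⁻¹ * (q⁻¹ * q⁻¹)) • (x * κ)) (h7 : κ * y = (q * q * (q * q)) • (y * κ)) :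
    (x + y) ^ 2 * (x' + y') + (x' + y') * (x + y) ^ 2
      = (q + q⁻¹) • ((x + y) * (x' + y') * (x + y)) + (x' + y') := by
  have as : ∀ {x y z : A}, x * y = z → ∀ w, x * (y * w) = z * w := fun h w => by
    rw [← mul_assoc, h]
  have hx' : x * (x * x') = (q + q⁻¹) • (x * (x' * x)) - x' * (x * x) := by
    simp only [pow_two, mul_assoc] at hx; rw [← hx]; abel
  have hy' : y * (y * y') = (q + q⁻¹) • (y * (y' * y)) - y' * (y * y) := by
    simp only [pow_two, mul_assoc] at hy; rw [← hy]; abel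
  have hs' : s * q ^ 2 = 1 + s := by rw [pow_two]; linear_combination hs
  simp only [pow_two, add_mul, mul_add, sub_mul, mul_sub, mul_assoc, smul_mul_assoc,
    mul_smul_comm, smul_add, smul_sub, smul_smul, one_mul, mul_one, h1, h2, h3, h4, h5, h6, h7, hx',
    hy', as h1, as h2, as h3, as h4, as h5, as h6, as h7]
  match_scalars <;> field_simp <;> first | ring1 | linear_combination hs'

theorem ef_aux {c d : R} {E F' g g' F E' : A} (h1 : g' * E = E * g') (h2 : g * E' = E' * g)
    (h3 : E * E' = E' * E) (h4 : F' * F = F * F') (h5 : g * g' = g' * g) (h6 : g * F = d • (F * g))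
    (h7 : g' * F' = d • (F' * g')) (h8 : g' * F = c • (F * g')) :
    (E + F' * g) * (g' * F + E') - (g' * F + E') * (E + F' * g)
      = g' * (E * F - F * E) + (F' * E' - E' * F') * g := by
  have as : ∀ {x y z : A}, x * y = z → ∀ w, x * (y * w) = z * w := fun h w => by
    rw [← mul_assoc, h]
  have e : F' * g * (g' * F) = g' * F * (F' * g) := by
    have : g' * F * (F' * g) = g' * F' * F * g := by
      rw [mul_assoc g' F', h4]; simp only [mul_assoc]
    rw [this, h7]
    simp only [mul_assoc, as h4, smul_mul_assoc, mul_smul_comm, h8, as h8, h6, as h6, smul_smul,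
      h5]
    rw [mul_comm]
  have e2 : E * (g' * F) = g' * (E * F) := by rw [← mul_assoc, ← h1, mul_assoc]
  have e3 : F' * g * E' = F' * E' * g := by rw [mul_assoc, h2, mul_assoc]
  have e4 : (E + F' * g) * (g' * F + E')
      = g' * (E * F) + E' * E + F' * g * (g' * F) + F' * E' * g := by
    rw [add_mul, mul_add, mul_add, e2, h3, e3]; abel
  rw [e4, e]
  simp only [add_mul, mul_add, sub_mul, mul_sub, mul_assoc]
  abel

end Skew

theorem cartan_rev {k : ℕ} (i j : Fin k) : cartan i.rev j.rev = cartan i j := by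
  unfold cartan
  simp only [Fin.rev_inj, Fin.val_rev]
  have hi := i.2
  have hj := j.2
  congr 1
  split_ifs <;> first | rfl | omega

theorem cartan_rev' {k : ℕ} (i j : Fin k) : cartan i j.rev = cartan i.rev j := by
  rw [← cartan_rev i.rev j, Fin.rev_rev]

theorem Adjacent.rev {k : ℕ} {i j : Fin k} (h : Adjacent i j) : Adjacent i.rev j.rev := by
  have hi := i.2
  have hj := j.2
  unfold Adjacent at *; simp only [Fin.val_rev]; omega

theorem Far.rev {k : ℕ} {i j : Fin k} (h : Far i j) : Far i.rev j.rev := by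
  have hi := i.2
  have hj := j.2
  unfold Far at *; simp only [Fin.val_rev]; omega

theorem Pos.far_rev {k : ℕ} {i j : Pos k} (h : ¬ IsHalf i.1 ∨ i ≠ j) : Far i.1 j.1.rev := by
  obtain ⟨i, hi⟩ := i
  obtain ⟨j, hj⟩ := j
  have hi2 := i.2
  have hj2 := j.2
  have hi3 : (i.rev : ℕ) < i := hi
  have hj3 : (j.rev : ℕ) < j := hj
  simp only [IsHalf, Far, Fin.lt_def, Fin.val_rev, ne_eq, Subtype.mk.injEq, Fin.ext_iff] at *
  omega

theorem Pos.ne_rev {k : ℕ} (i j : Pos k) : i.1 ≠ j.1.rev := by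
  obtain ⟨i, hi⟩ := i
  obtain ⟨j, hj⟩ := j
  have hi2 := i.2
  have hj2 := j.2
  have hi3 : (i.rev : ℕ) < i := hi
  have hj3 : (j.rev : ℕ) < j := hj
  simp only [Fin.lt_def, Fin.val_rev, ne_eq, Fin.ext_iff] at *
  omega

theorem Adjacent.ne {k : ℕ} {i j : Pos k} (h : Adjacent i.1 j.1) : i ≠ j := by
  rintro rfl; unfold Adjacent at h; omega

theorem Far.ne {k : ℕ} {i j : Pos k} (h : Far i.1 j.1) : i ≠ j := by
  rintro rfl; unfold Far at h; omega

namespace UI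

open U

variable {k : ℕ}

/-- The embedding `ı` on generators. For odd `k` every `K_i` with `i > 0` commutes with `F_{-i}`, so
the order of the factors matters for even `k` only. -/
def embGen : IGen k → U k
  | .e i => E i.1 + F i.1.rev * Kinv i.1
  | .f i => Kinv i.1.rev * F i.1 + E i.1.rev
  | .κ i => K i.1 * Kinv i.1.rev
  | .κinv i => K i.1.rev * Kinv i.1
  | .t z _ => E z + q • (F z * Kinv z)

theorem kap_E (i : Pos k) (a : Fin k) : K i.1 * Kinv i.1.rev * E a
    = q ^ (cartan i.1 a - cartan i.1.rev a) • (E a * (K i.1 * Kinv i.1.rev)) := by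
  rw [skew_mul (K_E i.1 a) (Kinv_E i.1.rev a), ← zpow_add₀ q_ne_zero, sub_eq_add_neg]

theorem kap_F (i : Pos k) (a : Fin k) : K i.1 * Kinv i.1.rev * F a
    = q ^ (-(cartan i.1 a - cartan i.1.rev a)) • (F a * (K i.1 * Kinv i.1.rev)) := by
  rw [skew_mul (K_F i.1 a) (Kinv_F i.1.rev a), ← zpow_add₀ q_ne_zero]
  congr 2; ring

theorem kap_Kinv (i : Pos k) (a : Fin k) :
    K i.1 * Kinv i.1.rev * Kinv a = Kinv a * (K i.1 * Kinv i.1.rev) :=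
  (Commute.mul_left (Kinv_K' a i.1).symm (Kinv_Kinv i.1.rev a) : Commute _ _)

theorem kap_FK (i : Pos k) (a b : Fin k) : K i.1 * Kinv i.1.rev * (F a * Kinv b)
    = q ^ (-(cartan i.1 a - cartan i.1.rev a)) • (F a * Kinv b * (K i.1 * Kinv i.1.rev)) := by
  rw [← mul_assoc, kap_F, smul_mul_assoc, mul_assoc, kap_Kinv, ← mul_assoc]

theorem kap_KF (i : Pos k) (a b : Fin k) : K i.1 * Kinv i.1.rev * (Kinv b * F a)
    = q ^ (-(cartan i.1 a - cartan i.1.rev a)) • (Kinv b * F a * (K i.1 * Kinv i.1.rev)) := by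
  rw [← mul_assoc, kap_Kinv, mul_assoc, kap_F, mul_smul_comm, ← mul_assoc]

theorem kap_inv (i : Pos k) : K i.1 * Kinv i.1.rev * (K i.1.rev * Kinv i.1) = 1 := by
  rw [mul_assoc, ← mul_assoc (Kinv i.1.rev), Kinv_K, one_mul, K_Kinv]

theorem kap_inv' (i : Pos k) : K i.1.rev * Kinv i.1 * (K i.1 * Kinv i.1.rev) = 1 := by
  rw [mul_assoc, ← mul_assoc (Kinv i.1), Kinv_K, one_mul, K_Kinv]

theorem EE {i j : Fin k} (h : Far i j) : Commute (E i) (E j) := E_far i j h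
theorem FF {i j : Fin k} (h : Far i j) : Commute (F i) (F j) := F_far i j h
theorem EF {i j : Fin k} (h : i ≠ j) : Commute (E i) (F j) := sub_eq_zero.mp (E_F_ne i j h)
theorem KE {i j : Fin k} (h : Far i j) : Commute (Kinv i) (E j) := by
  have := Kinv_E i j; rw [cartan_far h, neg_zero, zpow_zero, one_smul] at this; exact this
theorem KF {i j : Fin k} (h : Far i j) : Commute (Kinv i) (F j) := by
  have := Kinv_F i j; rw [cartan_far h, zpow_zero, one_smul] at this; exact this
theorem KK (i j : Fin k) : Commute (Kinv i) (Kinv j) := Kinv_Kinv i j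

theorem rel_ef {i j : Pos k} (h : ¬ IsHalf i.1 ∨ i ≠ j) :
    embGen (.e i) * embGen (.f j) - embGen (.f j) * embGen (.e i)
      = Kinv j.1.rev * (E i.1 * F j.1 - F j.1 * E i.1)
        + (F i.1.rev * E j.1.rev - E j.1.rev * F i.1.rev) * Kinv i.1 := by
  have hf := Pos.far_rev h
  have h7 := Kinv_F j.1.rev i.1.rev
  rw [cartan_rev, cartan_symm] at h7
  have hf2 : Far i.1.rev j.1 := by have := hf.rev; rwa [Fin.rev_rev] at this
  exact ef_aux (KE hf.symm).eq (KE hf).eq (EE hf).eq (FF hf2).eq (Kinv_Kinv _ _) (Kinv_F _ _) h7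
    (Kinv_F _ _)

theorem rel_e_serre (i j : Pos k) (h : Adjacent i.1 j.1) :
    embGen (.e i) ^ 2 * embGen (.e j) + embGen (.e j) * embGen (.e i) ^ 2
      = (q + q⁻¹) • (embGen (.e i) * embGen (.e j) * embGen (.e i)) := by
  have hc := cartan_adjacent h
  have hc' := cartan_adjacent h.symm
  have hf := Pos.far_rev (Or.inr h.ne)
  have hf' := Pos.far_rev (Or.inr h.symm.ne)
  refine serre_add q_ne_zero (E_serre _ _ h) (serre_mul (c := 1) (F_serre _ _ h.rev)
    (Kinv_Kinv _ _) (Kinv_F _ _) ?_ ?_) ?_ ?_ ?_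
  · rw [one_smul]; exact KF hf
  · rw [one_smul]; exact KF hf'
  · rw [mul_assoc, Kinv_E, cartan_self, mul_smul_comm, ← mul_assoc, ← (EF (Pos.ne_rev i i)).eq,
      zpow_two_neg, mul_assoc]
  · rw [mul_assoc, Kinv_E, hc, mul_smul_comm, ← mul_assoc, ← (EF (Pos.ne_rev j i)).eq, neg_neg,
      zpow_one, mul_assoc]
  · rw [mul_assoc, Kinv_E, hc', mul_smul_comm, ← mul_assoc, ← (EF (Pos.ne_rev i j)).eq, neg_neg,
      zpow_one, mul_assoc]

theorem rel_f_serre (i j : Pos k) (h : Adjacent i.1 j.1) :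
    embGen (.f i) ^ 2 * embGen (.f j) + embGen (.f j) * embGen (.f i) ^ 2
      = (q + q⁻¹) • (embGen (.f i) * embGen (.f j) * embGen (.f i)) := by
  have hc := cartan_adjacent h.rev
  have hc' := cartan_adjacent h.rev.symm
  have hf := (Pos.far_rev (Or.inr h.ne)).symm
  have hf' := (Pos.far_rev (Or.inr h.symm.ne)).symm
  simp only [embGen]
  rw [add_comm (Kinv i.1.rev * F i.1), add_comm (Kinv j.1.rev * F j.1)]
  refine serre_add q_ne_zero (E_serre _ _ h.rev) ?_ ?_ ?_ ?_
  · rw [Kinv_F, Kinv_F j.1.rev]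
    refine serre_smul (serre_mul (c := 1) (F_serre _ _ h) (Kinv_Kinv _ _) (Kinv_F _ _) ?_ ?_)
    · rw [one_smul]; exact KF hf'
    · rw [one_smul]; exact KF hf
  · rw [mul_assoc, ← (EF (Pos.ne_rev i i).symm).eq, ← mul_assoc, Kinv_E, cartan_self,
      smul_mul_assoc, zpow_two_neg, mul_assoc]
  · rw [mul_assoc, ← (EF (Pos.ne_rev i j).symm).eq, ← mul_assoc, Kinv_E, hc,
      smul_mul_assoc, neg_neg, zpow_one, mul_assoc]
  · rw [mul_assoc, ← (EF (Pos.ne_rev j i).symm).eq, ← mul_assoc, Kinv_E, hc',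
      smul_mul_assoc, neg_neg, zpow_one, mul_assoc]

theorem rel_e_far (i j : Pos k) (h : Far i.1 j.1) :
    embGen (.e i) * embGen (.e j) = embGen (.e j) * embGen (.e i) := by
  have hf := Pos.far_rev (Or.inr h.ne)
  have hf' := Pos.far_rev (Or.inr h.symm.ne)
  have c1 : Commute (E i.1) (embGen (.e j)) :=
    (EE h).add_right ((EF (Pos.ne_rev i j)).mul_right (KE h.symm).symm)
  have c2 : Commute (F i.1.rev) (embGen (.e j)) :=
    (EF (Pos.ne_rev j i)).symm.add_right ((FF h.rev).mul_right (KF hf').symm)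
  have c3 : Commute (Kinv i.1) (embGen (.e j)) := (KE h).add_right ((KF hf).mul_right (KK _ _))
  exact (c1.add_left (c2.mul_left c3) : Commute _ _)

theorem rel_f_far (i j : Pos k) (h : Far i.1 j.1) :
    embGen (.f i) * embGen (.f j) = embGen (.f j) * embGen (.f i) := by
  have hf := (Pos.far_rev (Or.inr h.ne)).symm
  have hf' := (Pos.far_rev (Or.inr h.symm.ne)).symm
  have c1 : Commute (E i.1.rev) (embGen (.f j)) :=
    ((KE h.rev.symm).symm.mul_right (EF (Pos.ne_rev j i).symm)).add_right (EE h.rev)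
  have c2 : Commute (F i.1) (embGen (.f j)) :=
    ((KF hf).symm.mul_right (FF h)).add_right (EF (Pos.ne_rev i j).symm).symm
  have c3 : Commute (Kinv i.1.rev) (embGen (.f j)) :=
    ((KK _ _).mul_right (KF hf')).add_right (KE h.rev)
  exact ((c3.mul_left c2).add_left c1 : Commute _ _)

theorem rel_half (i : Pos k) (h : IsHalf i.1) :
    (embGen (.e i) ^ 2 * embGen (.f i) + embGen (.f i) * embGen (.e i) ^ 2
      = (q + q⁻¹) • (embGen (.e i) * embGen (.f i) * embGen (.e i)
        - (q⁻¹) ^ 2 • (embGen (.κ i) * embGen (.e i)) - q ^ 2 • (embGen (.κinv i) * embGen (.e i)))) ∧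
    (embGen (.f i) ^ 2 * embGen (.e i) + embGen (.e i) * embGen (.f i) ^ 2
      = (q + q⁻¹) • (embGen (.f i) * embGen (.e i) * embGen (.f i)
        - q ^ 2 • (embGen (.f i) * embGen (.κinv i))
        - (q⁻¹) ^ 2 • (embGen (.f i) * embGen (.κ i)))) := by
  have ha : Adjacent i.1 i.1.rev := Or.inr h.symm
  have hc := cartan_adjacent ha
  have hc' := cartan_adjacent ha.symm
  have hne := Pos.ne_rev i i
  have z1 : q ^ (2 : ℤ) = q ^ 2 := by norm_cast
  have z2 : q ^ (-2 : ℤ) = q⁻¹ ^ 2 := by rw [zpow_neg, inv_pow]; norm_cast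
  have z3 : q ^ (-1 : ℤ) = q⁻¹ := zpow_neg_one q
  have sE : ∀ {a b : Fin k}, Adjacent a b →
      E a * (E a * E b) = (q + q⁻¹) • (E a * (E b * E a)) - E b * (E a * E a) := fun {a b} h => by
    have := E_serre a b h
    simp only [pow_two, mul_assoc] at this; rw [← this]; abel
  have sF : ∀ {a b : Fin k}, Adjacent a b →
      F a * (F a * F b) = (q + q⁻¹) • (F a * (F b * F a)) - F b * (F a * F a) := fun {a b} h => by
    have := F_serre a b h
    simp only [pow_two, mul_assoc] at this; rw [← this]; abel
  have ef : ∀ a : Fin k, E a * F a = F a * E a + (q - q⁻¹)⁻¹ • (K a - Kinv a) := fun a => by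
    rw [← E_F]; abel
  refine half_e q_ne_zero q_sub_inv_ne_zero (ef _) (ef _) (EF hne).eq (EF hne.symm).eq (K_K _ _)
    (Kinv_K' _ _).symm (Kinv_K' _ _) (Kinv_Kinv _ _) (K_Kinv _) (Kinv_K _) (K_Kinv _) (Kinv_K _)
    ?_ ?_ ?_ ?_ ?_ ?_ ?_ ?_ ?_ ?_ ?_ ?_ ?_ ?_ ?_ ?_ (sE ha) (sF ha.symm) (sE ha.symm) (sF ha)
  all_goals
    first | rw [K_E] | rw [K_F] | rw [Kinv_E] | rw [Kinv_F]
    simp only [cartan_self, hc, hc', neg_neg, zpow_one, z1, z2, z3]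

/-- The relations between `t` and `E_a + F_b K_a⁻¹`, where `b = -a` and `a = ± 1`. -/
theorem rel_t {z a b : Fin k} (ha : Adjacent z a) (hb : Adjacent z b) (hab : Far a b) :
    ((E a + F b * Kinv a) ^ 2 * (E z + q • (F z * Kinv z))
      + (E z + q • (F z * Kinv z)) * (E a + F b * Kinv a) ^ 2
      = (q + q⁻¹) • ((E a + F b * Kinv a) * (E z + q • (F z * Kinv z)) * (E a + F b * Kinv a))) ∧
    ((E z + q • (F z * Kinv z)) ^ 2 * (E a + F b * Kinv a)
      + (E a + F b * Kinv a) * (E z + q • (F z * Kinv z)) ^ 2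
      = (q + q⁻¹) • ((E z + q • (F z * Kinv z)) * (E a + F b * Kinv a) * (E z + q • (F z * Kinv z)))
        + (E a + F b * Kinv a)) := by
  have hza : z ≠ a := by rintro rfl; unfold Adjacent at ha; omega
  have hzb : z ≠ b := by rintro rfl; unfold Adjacent at hb; omega
  have hne : a ≠ b := by rintro rfl; unfold Far at hab; omega
  have ca := cartan_adjacent ha
  have ca' := cartan_adjacent ha.symm
  have cb := cartan_adjacent hb
  have z1 : q ^ (2 : ℤ) = q * q := by rw [← pow_two]; norm_cast
  have h2 : q • (F z * Kinv z) * E a = q • (E a * (q • (F z * Kinv z))) := by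
    rw [smul_mul_assoc, mul_assoc, Kinv_E, ca, mul_smul_comm, ← mul_assoc, ← (EF hza.symm).eq,
      neg_neg, zpow_one, mul_assoc, mul_smul_comm]
  have h3 : F b * Kinv a * E z = q • (E z * (F b * Kinv a)) := by
    rw [mul_assoc, Kinv_E, ca', mul_smul_comm, ← mul_assoc, ← (EF hzb).eq, neg_neg, zpow_one,
      mul_assoc]
  constructor
  · refine serre_add q_ne_zero (E_serre _ _ ha.symm) ?_ ?_ h3 h2
    · have h := serre_smul (c := 1) (c' := q) (serre_mul (c := q⁻¹) (F_serre b z hb.symm)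
        (Kinv_Kinv z a) (Kinv_F a b) (by rw [Kinv_F, ca', zpow_neg_one])
        (by rw [Kinv_F, cb, zpow_neg_one]))
      simpa only [one_smul] using h
    · rw [mul_assoc, Kinv_E, cartan_self, mul_smul_comm, ← mul_assoc, ← (EF hne).eq, zpow_two_neg,
        mul_assoc]
  · refine serre_zero (s := q⁻¹ * (q - q⁻¹)⁻¹) (κ := Kinv z * Kinv z) q_ne_zero ?_
      (E_serre _ _ ha) ?_ ?_ h2 h3 ?_ ?_ ?_ ?_
    · have hq := q_ne_zero
      have h0 : q * q - 1 = q * (q - q⁻¹) := by rw [mul_sub, mul_inv_cancel₀ hq]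
      rw [h0, mul_mul_mul_comm, inv_mul_cancel₀ hq, inv_mul_cancel₀ q_sub_inv_ne_zero, one_mul]
    · have h := serre_smul (c := q) (c' := 1) (serre_mul (c := q⁻¹) (F_serre z b hb)
        (Kinv_Kinv a z) (Kinv_F z z) (by rw [Kinv_F, cb, zpow_neg_one])
        (by rw [Kinv_F, ca', zpow_neg_one]))
      simpa only [one_smul] using h
    · have ef : F z * E z = E z * F z - (q - q⁻¹)⁻¹ • (K z - Kinv z) := by rw [← E_F]; abel
      rw [smul_mul_assoc, mul_assoc, Kinv_E, cartan_self, mul_smul_comm, ← mul_assoc, ef, sub_mul,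
        smul_mul_assoc, sub_mul, K_Kinv, ← zpow_two_neg, smul_sub, smul_sub, smul_smul, smul_smul,
        smul_smul, mul_smul_comm, smul_smul, mul_assoc (E z)]
      have q1 : q * (q⁻¹ * q⁻¹) = q⁻¹ := by rw [← mul_assoc, mul_inv_cancel₀ q_ne_zero, one_mul]
      rw [mul_comm _ q, q1]
    · rw [skew_mul (Kinv_E z a) (Kinv_E z a), ca, neg_neg, zpow_one]
    · have e : Kinv z * (F b * Kinv a) = q⁻¹ • (F b * Kinv a * Kinv z) := by
        rw [← mul_assoc, Kinv_F, cb, zpow_neg_one, smul_mul_assoc, mul_assoc, Kinv_Kinv z a,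
          mul_assoc]
      exact skew_mul e e
    · rw [skew_mul (Kinv_E z z) (Kinv_E z z), cartan_self, zpow_two_neg]
    · have e : Kinv z * (q • (F z * Kinv z)) = (q * q) • (q • (F z * Kinv z) * Kinv z) := by
        rw [mul_smul_comm, ← mul_assoc, Kinv_F, cartan_self, z1, smul_mul_assoc, smul_mul_assoc,
          smul_comm]
      exact skew_mul e e

theorem rel_t_far {z a b : Fin k} (ha : Far z a) (hb : Far z b) :
    (E a + F b * Kinv a) * (E z + q • (F z * Kinv z))
      = (E z + q • (F z * Kinv z)) * (E a + F b * Kinv a) := by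
  have hza : z ≠ a := by rintro rfl; unfold Far at ha; omega
  have hzb : z ≠ b := by rintro rfl; unfold Far at hb; omega
  have c1 : Commute (E a) (E z + q • (F z * Kinv z)) :=
    (EE ha.symm).add_right (((EF hza.symm).mul_right (KE ha).symm).smul_right q)
  have c2 : Commute (F b) (E z + q • (F z * Kinv z)) :=
    (EF hzb).symm.add_right (((FF hb.symm).mul_right (KF hb).symm).smul_right q)
  have c3 : Commute (Kinv a) (E z + q • (F z * Kinv z)) :=
    (KE ha.symm).add_right (((KF ha.symm).mul_right (KK _ _)).smul_right q)
  exact (c1.add_left (c2.mul_left c3) : Commute _ _)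

theorem f_eq (i : Pos k) (h : ¬ IsHalf i.1) :
    embGen (.f i) = E i.1.rev + F i.1 * Kinv i.1.rev := by
  have hf := (Pos.far_rev (j := i) (Or.inl h)).symm
  change Kinv i.1.rev * F i.1 + E i.1.rev = _
  rw [(KF hf).eq, add_comm]

theorem one_facts {i : Pos k} (h : IsOne i.1) {z : Fin k} (hz : z.rev = z) :
    Adjacent z i.1 ∧ Adjacent z i.1.rev ∧ Far i.1 i.1.rev ∧ ¬ IsHalf i.1 := by
  have hi := i.1.2
  have hz2 := z.2
  unfold IsOne at h
  unfold Adjacent Far IsHalf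
  rw [Fin.ext_iff] at hz
  simp only [Fin.val_rev] at *
  omega

theorem gt_facts {i : Pos k} (h : GtOne i.1) {z : Fin k} (hz : z.rev = z) :
    Far z i.1 ∧ Far z i.1.rev ∧ ¬ IsHalf i.1 := by
  have hi := i.1.2
  have hz2 := z.2
  unfold GtOne at h
  unfold Far IsHalf
  rw [Fin.ext_iff] at hz
  simp only [Fin.val_rev] at *
  omega

/-- The embedding `ı : U^ı → U`. -/
def emb : UI k →ₐ[Qq] U k :=
  lift embGen (by
    intro x y h
    cases h with
    | k_kinv i =>
      simp only [map_mul, map_one, FreeAlgebra.lift_ι_apply]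
      exact kap_inv i
    | kinv_k i =>
      simp only [map_mul, map_one, FreeAlgebra.lift_ι_apply]
      exact kap_inv' i
    | k_k i j =>
      simp only [map_mul, FreeAlgebra.lift_ι_apply]
      have c1 : Commute (K i.1) (embGen (.κ j)) :=
        Commute.mul_right (K_K _ _) (Kinv_K' _ _).symm
      have c2 : Commute (Kinv i.1.rev) (embGen (.κ j)) :=
        Commute.mul_right (Kinv_K' _ _) (Kinv_Kinv _ _)
      exact (c1.mul_left c2 : Commute _ _)
    | k_e i j =>
      simp only [map_mul, map_smul, FreeAlgebra.lift_ι_apply]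
      refine conj_of_skew (kap_inv i) ?_
      have e : -(cartan i.1 j.1.rev - cartan i.1.rev j.1.rev) = icartan i j := by
        rw [cartan_rev, cartan_rev', icartan]; ring
      simp only [embGen]
      rw [mul_add, add_mul, kap_E, kap_FK, e, smul_add]
      rfl
    | k_f i j =>
      simp only [map_mul, map_smul, FreeAlgebra.lift_ι_apply]
      refine conj_of_skew (kap_inv i) ?_
      have e : cartan i.1 j.1.rev - cartan i.1.rev j.1.rev = -icartan i j := by
        rw [cartan_rev, cartan_rev', icartan]; ring
      simp only [embGen]
      rw [mul_add, add_mul, kap_E, kap_KF, e, smul_add]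
      rfl
    | e_f i h =>
      simp only [map_mul, map_sub, map_smul, FreeAlgebra.lift_ι_apply]
      rw [rel_ef (Or.inl h), E_F, ← neg_sub (E i.1.rev * F i.1.rev), E_F, mul_smul_comm, neg_mul,
        smul_mul_assoc, ← smul_neg, ← smul_add]
      simp only [embGen]
      rw [mul_sub, sub_mul, Kinv_K', Kinv_Kinv i.1.rev]
      congr 1; abel
    | e_f_ne i j h =>
      simp only [map_mul, map_sub, map_zero, FreeAlgebra.lift_ι_apply]
      have h1 : i.1 ≠ j.1 := fun e => h (Subtype.ext e)
      have h2 : j.1.rev ≠ i.1.rev := fun e => h1 (Fin.rev_inj.mp e).symm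
      rw [rel_ef (Or.inr h), E_F_ne _ _ h1, (EF h2).eq, sub_self, mul_zero, zero_mul, add_zero]
    | e_serre i j h =>
      simp only [map_mul, map_add, map_pow, map_smul, FreeAlgebra.lift_ι_apply]
      exact rel_e_serre i j h
    | f_serre i j h =>
      simp only [map_mul, map_add, map_pow, map_smul, FreeAlgebra.lift_ι_apply]
      exact rel_f_serre i j h
    | e_far i j h =>
      simp only [map_mul, FreeAlgebra.lift_ι_apply]
      exact rel_e_far i j h
    | f_far i j h =>
      simp only [map_mul, FreeAlgebra.lift_ι_apply]
      exact rel_f_far i j h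
    | f_half i h =>
      simp only [map_mul, map_add, map_sub, map_pow, map_smul, FreeAlgebra.lift_ι_apply]
      exact (rel_half i h).2
    | e_half i h =>
      simp only [map_mul, map_add, map_sub, map_pow, map_smul, FreeAlgebra.lift_ι_apply]
      exact (rel_half i h).1
    | k_t i z hz =>
      simp only [map_mul, FreeAlgebra.lift_ι_apply]
      have e : cartan i.1.rev z = cartan i.1 z := by rw [← cartan_rev', hz]
      have h : embGen (.κ i) * embGen (.t z hz) = (1 : Qq) • (embGen (.t z hz) * embGen (.κ i)) := by
        simp only [embGen]
        rw [mul_add, add_mul, kap_E, mul_smul_comm, kap_FK, e, sub_self, neg_zero, zpow_zero,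
          one_smul, one_smul, one_smul, smul_mul_assoc]
      exact (conj_of_skew (kap_inv i) h).trans (one_smul _ _)
    | e_t i h z hz =>
      simp only [map_mul, FreeAlgebra.lift_ι_apply]
      obtain ⟨h1, h2, -⟩ := gt_facts h hz
      exact rel_t_far h1 h2
    | e_e_t i h z hz =>
      simp only [map_mul, map_add, map_pow, map_smul, FreeAlgebra.lift_ι_apply]
      obtain ⟨h1, h2, h3, -⟩ := one_facts h hz
      exact (rel_t h1 h2 h3).1
    | t_t_e i h z hz =>
      simp only [map_mul, map_add, map_pow, map_smul, FreeAlgebra.lift_ι_apply]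
      obtain ⟨h1, h2, h3, -⟩ := one_facts h hz
      exact (rel_t h1 h2 h3).2
    | f_t i h z hz =>
      simp only [map_mul, FreeAlgebra.lift_ι_apply]
      obtain ⟨h1, h2, h3⟩ := gt_facts h hz
      rw [f_eq i h3]
      exact rel_t_far h2 h1
    | f_f_t i h z hz =>
      simp only [map_mul, map_add, map_pow, map_smul, FreeAlgebra.lift_ι_apply]
      obtain ⟨h1, h2, h3, h4⟩ := one_facts h hz
      rw [f_eq i h4]
      exact (rel_t h2 h1 h3.symm).1
    | t_t_f i h z hz =>
      simp only [map_mul, map_add, map_pow, map_smul, FreeAlgebra.lift_ι_apply]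
      obtain ⟨h1, h2, h3, h4⟩ := one_facts h hz
      rw [f_eq i h4]
      exact (rel_t h2 h1 h3.symm).2)

/-- The bar involution `ψ_ı` of `U^ı`: anti-linear and multiplicative, with `e_i ↦ e_i`,
`f_i ↦ f_i`, `t ↦ t`, `k_i ↦ k_i⁻¹`. -/
def barUI : UI k →ₛₗ[bar] UI k := antilinear barHom

end UI

/-- `Υ = ∑ Υ_μ` is the intertwiner of the pair `(U, U^ı)`: `Υ_μ ∈ U⁻_{-μ}`, `Υ_0 = 1` and
`ψ_ı(u) Υ = Υ ψ(u)` for all `u ∈ U^ı`, in the completion of `U`. -/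
structure IsIntertwiner {k : ℕ} (Y : RootCone k → U k) : Prop where
  mem : ∀ μ, Y μ ∈ UnegW μ
  zero : Y 0 = 1
  intertwines : ∀ u : UI k,
    SumsToZero (filNeg k) fun μ => UI.emb (UI.barUI u) * Y μ - Y μ * U.barU (UI.emb u)

/-- The intertwiner `Υ`. -/
def upsilon (k : ℕ) : RootCone k → U k := Classical.epsilon IsIntertwiner

/-- The bar involution `ψ_ı = Υ ∘ ψ` of `𝕍^{⊗ m}`. Only finitely many `Υ_μ` act by a non-zero
operator. -/
def psiIota (k m : ℕ) : T k m →ₛₗ[bar] T k m :=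
  (∑ᶠ μ, rep k m (upsilon k μ)).comp (psiT k m)

section Hecke

variable {R A : Type} [Field R] [Ring A] [Algebra R A]

theorem hecke_sq {q : R} (hq : q ≠ 0) {a : A} (h : (a - q⁻¹ • 1) * (a + q • 1) = 0) :
    a * (a + (q - q⁻¹) • 1) = 1 ∧ (a + (q - q⁻¹) • 1) * a = 1 := by
  have e : (a - q⁻¹ • 1) * (a + q • 1) = a * a + (q - q⁻¹) • a - 1 := by
    simp only [sub_mul, mul_add, smul_mul_assoc, mul_smul_comm, one_mul, mul_one, smul_sub, smul_smul,
      inv_mul_cancel₀ hq, mul_inv_cancel₀ hq, one_smul, sub_smul]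
    abel
  rw [e, sub_eq_zero] at h
  constructor
  · rw [mul_add, mul_smul_comm, mul_one, h]
  · rw [add_mul, smul_mul_assoc, one_mul, h]

theorem hecke_sq_bar {q : R} {a : A} (h : (a - q⁻¹ • 1) * (a + q • 1) = 0) :
    (a + (q - q⁻¹) • 1 - q • 1) * (a + (q - q⁻¹) • 1 + q⁻¹ • 1) = 0 := by
  rw [← h]
  congr 1 <;> rw [sub_smul] <;> abel

theorem hecke_sq_conj {q : R} {s a : A} (hs : s * s = 1) (h : (a - q⁻¹ • 1) * (a + q • 1) = 0) :
    (s * a * s - q⁻¹ • 1) * (s * a * s + q • 1) = 0 := by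
  have e1 : s * a * s - q⁻¹ • 1 = s * (a - q⁻¹ • 1) * s := by
    rw [mul_sub, sub_mul, mul_smul_comm, smul_mul_assoc, mul_one, hs]
  have e2 : s * a * s + q • 1 = s * (a + q • 1) * s := by
    rw [mul_add, add_mul, mul_smul_comm, smul_mul_assoc, mul_one, hs]
  have e3 : ∀ x y : A, s * x * s * (s * y * s) = s * (x * y) * s := fun x y => by
    rw [mul_assoc (s * x), ← mul_assoc s (s * y), ← mul_assoc s s, hs, one_mul, mul_assoc s x,
      mul_assoc s (x * y), mul_assoc x y]
  rw [e1, e2, e3, h, mul_zero, zero_mul]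

theorem hecke_swap {q : R} {a : A} (h : (a - q⁻¹ • 1) * (a + q • 1) = 0) :
    (a + q • 1) * (a - q⁻¹ • 1) = 0 := by
  rw [← h]
  simp only [add_mul, mul_sub, sub_mul, mul_add, smul_mul_assoc, mul_smul_comm, one_mul, mul_one,
    smul_sub, smul_add]
  rw [smul_comm q]; abel

theorem refl_swap {s : A} (h : s * s = 1) : (s + 1) * (s - 1) = 0 := by
  rw [add_mul, mul_sub, h, mul_one, one_mul]; abel

theorem sq_of_refl {s : A} (h : (s - 1) * (s + 1) = 0) : s * s = 1 := by
  have e : (s - 1) * (s + 1) = s * s - 1 := by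
    simp only [sub_mul, mul_add, mul_one, one_mul]; abel
  rwa [e, sub_eq_zero] at h

theorem braid_inv {a b a' b' : A} (ha : a * a' = 1) (ha' : a' * a = 1) (hb : b * b' = 1)
    (hb' : b' * b = 1) (h : a * b * a = b * a * b) : a' * b' * a' = b' * a' * b' := by
  have h1 : a' * b' * a' * (a * b * a) = 1 := by
    rw [mul_assoc, mul_assoc a b a, ← mul_assoc a' a, ha', one_mul, mul_assoc, ← mul_assoc b' b, hb',
      one_mul, ha']
  have h2 : b * a * b * (b' * a' * b') = 1 := by
    rw [mul_assoc, mul_assoc b' a' b', ← mul_assoc b b', hb, one_mul, mul_assoc, ← mul_assoc a a',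
      ha, one_mul, hb]
  rw [h] at h1
  exact left_inv_eq_right_inv h1 h2

end Hecke

/-- Generators of the Hecke algebra of type `B_{n+1}`; `H i` stands for `H_{i+1}`. -/
inductive BGen (n : ℕ) : Type
  | s0
  | H (i : Fin n)

/-- Generators of the Hecke algebra of type `D_{n+1}`; `H i` stands for `H_{i+1}`. For `n = 0` there
is no generator. -/
inductive DGen (n : ℕ) : Type
  | H0 (h : 0 < n)
  | H (i : Fin n)

/-- The generators in the free algebra. -/
abbrev BGen.s {n : ℕ} : FreeAlgebra Qq (BGen n) := FreeAlgebra.ι Qq .s0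
abbrev BGen.h {n : ℕ} (i : Fin n) : FreeAlgebra Qq (BGen n) := FreeAlgebra.ι Qq (.H i)
abbrev DGen.h0 {n : ℕ} (hn : 0 < n) : FreeAlgebra Qq (DGen n) := FreeAlgebra.ι Qq (.H0 hn)
abbrev DGen.h {n : ℕ} (i : Fin n) : FreeAlgebra Qq (DGen n) := FreeAlgebra.ι Qq (.H i)

open BGen in
/-- The defining relations of the Hecke algebra of type `B_{n+1}` with parameter `p = 1`. -/
inductive BRel (n : ℕ) : FreeAlgebra Qq (BGen n) → FreeAlgebra Qq (BGen n) → Prop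
  | sq0 : BRel n ((s - 1) * (s + 1)) 0
  | sq (i : Fin n) : BRel n ((h i - q⁻¹ • 1) * (h i + q • 1)) 0
  | braid (i j : Fin n) (hij : (i : ℕ) + 1 = j) : BRel n (h i * h j * h i) (h j * h i * h j)
  | far (i j : Fin n) (hij : Far i j) : BRel n (h i * h j) (h j * h i)
  | braid0 (i : Fin n) (hi : (i : ℕ) = 0) : BRel n (s * h i * s * h i) (h i * s * h i * s)
  | far0 (i : Fin n) (hi : 0 < (i : ℕ)) : BRel n (s * h i) (h i * s)

open DGen in
/-- The defining relations of the Hecke algebra of type `D_{n+1}`. -/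
inductive DRel (n : ℕ) : FreeAlgebra Qq (DGen n) → FreeAlgebra Qq (DGen n) → Prop
  | sq0 (hn : 0 < n) : DRel n ((h0 hn - q⁻¹ • 1) * (h0 hn + q • 1)) 0
  | sq (i : Fin n) : DRel n ((h i - q⁻¹ • 1) * (h i + q • 1)) 0
  | braid (i j : Fin n) (hij : (i : ℕ) + 1 = j) : DRel n (h i * h j * h i) (h j * h i * h j)
  | far (i j : Fin n) (hij : Far i j) : DRel n (h i * h j) (h j * h i)
  | braid0 (hn : 0 < n) (i : Fin n) (hi : (i : ℕ) = 1) :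
      DRel n (h0 hn * h i * h0 hn) (h i * h0 hn * h i)
  | far0 (hn : 0 < n) (i : Fin n) (hi : (i : ℕ) ≠ 1) : DRel n (h0 hn * h i) (h i * h0 hn)

/-- The Hecke algebra `H^1_{B_m}`, `m = n + 1`. -/
def HB (n : ℕ) : Type := RingQuot (BRel n)

instance (n : ℕ) : Ring (HB n) := inferInstanceAs (Ring (RingQuot (BRel n)))
instance (n : ℕ) : Algebra Qq (HB n) := inferInstanceAs (Algebra Qq (RingQuot (BRel n)))

/-- The Hecke algebra `H_{D_m}`, `m = n + 1`. -/
def HD (n : ℕ) : Type := RingQuot (DRel n)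

instance (n : ℕ) : Ring (HD n) := inferInstanceAs (Ring (RingQuot (DRel n)))
instance (n : ℕ) : Algebra Qq (HD n) := inferInstanceAs (Algebra Qq (RingQuot (DRel n)))

namespace HB

variable {n : ℕ}

/-- The class of a generator. -/
def gen (x : BGen n) : HB n := RingQuot.mkAlgHom Qq (BRel n) (FreeAlgebra.ι Qq x)

/-- The universal property of `H^1_{B_m}`. -/
def lift {A : Type} [Ring A] [Algebra Qq A] (g : BGen n → A)
    (h : ∀ x y, BRel n x y → FreeAlgebra.lift Qq g x = FreeAlgebra.lift Qq g y) : HB n →ₐ[Qq] A :=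
  RingQuot.liftAlgHom Qq ⟨FreeAlgebra.lift Qq g, fun x y => h x y⟩

theorem rel {x y : FreeAlgebra Qq (BGen n)} (h : BRel n x y) :
    FreeAlgebra.lift Qq gen x = FreeAlgebra.lift Qq gen y := by
  have e : FreeAlgebra.lift Qq (gen (n := n)) = RingQuot.mkAlgHom Qq (BRel n) := by
    ext x; exact FreeAlgebra.lift_ι_apply gen x
  rw [e]
  exact RingQuot.mkAlgHom_rel Qq h

theorem sq0 : (gen .s0 : HB n) * gen .s0 = 1 := sq_of_refl (by simpa using rel (BRel.sq0 (n := n)))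
theorem sq (i : Fin n) : ((gen (.H i) : HB n) - q⁻¹ • 1) * (gen (.H i) + q • 1) = 0 := by
  simpa only [map_mul, map_sub, map_add, map_smul, map_one, map_zero, FreeAlgebra.lift_ι_apply]
    using rel (BRel.sq i)
theorem braid (i j : Fin n) (hij : (i : ℕ) + 1 = j) :
    (gen (.H i) : HB n) * gen (.H j) * gen (.H i) = gen (.H j) * gen (.H i) * gen (.H j) := by
  simpa using rel (BRel.braid i j hij)
theorem far (i j : Fin n) (hij : Far i j) :
    (gen (.H i) : HB n) * gen (.H j) = gen (.H j) * gen (.H i) := by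
  simpa using rel (BRel.far i j hij)
theorem braid0 (i : Fin n) (hi : (i : ℕ) = 0) : (gen .s0 : HB n) * gen (.H i) * gen .s0 * gen (.H i)
    = gen (.H i) * gen .s0 * gen (.H i) * gen .s0 := by
  simpa using rel (BRel.braid0 i hi)
theorem far0 (i : Fin n) (hi : 0 < (i : ℕ)) :
    (gen .s0 : HB n) * gen (.H i) = gen (.H i) * gen .s0 := by
  simpa using rel (BRel.far0 i hi)

end HB

namespace HD

variable {n : ℕ}

/-- The class of a generator. -/
def gen (x : DGen n) : HD n := RingQuot.mkAlgHom Qq (DRel n) (FreeAlgebra.ι Qq x)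

/-- The universal property of `H_{D_m}`. -/
def lift {A : Type} [Ring A] [Algebra Qq A] (g : DGen n → A)
    (h : ∀ x y, DRel n x y → FreeAlgebra.lift Qq g x = FreeAlgebra.lift Qq g y) : HD n →ₐ[Qq] A :=
  RingQuot.liftAlgHom Qq ⟨FreeAlgebra.lift Qq g, fun x y => h x y⟩

theorem rel {x y : FreeAlgebra Qq (DGen n)} (h : DRel n x y) :
    FreeAlgebra.lift Qq gen x = FreeAlgebra.lift Qq gen y := by
  have e : FreeAlgebra.lift Qq (gen (n := n)) = RingQuot.mkAlgHom Qq (DRel n) := by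
    ext x; exact FreeAlgebra.lift_ι_apply gen x
  rw [e]
  exact RingQuot.mkAlgHom_rel Qq h

theorem sq (x : DGen n) : ((gen x : HD n) - q⁻¹ • 1) * (gen x + q • 1) = 0 := by
  cases x with
  | H0 hn =>
    simpa only [map_mul, map_sub, map_add, map_smul, map_one, map_zero, FreeAlgebra.lift_ι_apply]
      using rel (DRel.sq0 hn)
  | H i =>
    simpa only [map_mul, map_sub, map_add, map_smul, map_one, map_zero, FreeAlgebra.lift_ι_apply]
      using rel (DRel.sq i)

/-- The inverse `H_i⁻¹ = H_i + (q - q⁻¹)` of a generator. -/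
def inv (x : DGen n) : HD n := gen x + (q - q⁻¹) • 1

theorem gen_inv (x : DGen n) : gen x * inv x = 1 := (hecke_sq q_ne_zero (sq x)).1
theorem inv_gen (x : DGen n) : inv x * gen x = 1 := (hecke_sq q_ne_zero (sq x)).2

theorem sq_bar (x : DGen n) : (inv x - q • 1) * (inv x + q⁻¹ • 1) = 0 := hecke_sq_bar (sq x)

/-- The bar involution of `H_{D_m}` as a homomorphism into the twisted algebra. -/
def barHom : HD n →ₐ[Qq] Twist (HD n) :=
  lift (A := Twist (HD n)) (fun x => Twist.of (inv x)) (by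
    intro x y h
    have hr := rel h
    cases h with
    | sq0 hn =>
      simp only [map_mul, map_sub, map_add, map_zero, FreeAlgebra.lift_ι_apply]
      rw [map_smul, map_smul, twist_smul, twist_smul, map_inv₀, bar_q, inv_inv, map_one]
      exact sq_bar (.H0 hn)
    | sq i =>
      simp only [map_mul, map_sub, map_add, map_zero, FreeAlgebra.lift_ι_apply]
      rw [map_smul, map_smul, twist_smul, twist_smul, map_inv₀, bar_q, inv_inv, map_one]
      exact sq_bar (.H i)
    | braid i j hij =>
      simp only [map_mul, FreeAlgebra.lift_ι_apply] at hr ⊢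
      exact braid_inv (gen_inv _) (inv_gen _) (gen_inv _) (inv_gen _) hr
    | far i j hij =>
      simp only [map_mul, FreeAlgebra.lift_ι_apply] at hr ⊢
      exact inv_comm (gen_inv _) (inv_gen _) (gen_inv _) (inv_gen _) hr
    | braid0 hn i hi =>
      simp only [map_mul, FreeAlgebra.lift_ι_apply] at hr ⊢
      exact braid_inv (gen_inv _) (inv_gen _) (gen_inv _) (inv_gen _) hr
    | far0 hn i hi =>
      simp only [map_mul, FreeAlgebra.lift_ι_apply] at hr ⊢
      exact inv_comm (gen_inv _) (inv_gen _) (gen_inv _) (inv_gen _) hr)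

/-- The bar involution `h ↦ h̄` of `H_{D_m}`: anti-linear and multiplicative, with
`H_i ↦ H_i⁻¹`. -/
def barHD : HD n →ₛₗ[bar] HD n := antilinear barHom

/-- The images of the generators in `H^1_{B_m}`. -/
def rhoGen : DGen n → HB n
  | .H0 hn => HB.gen .s0 * HB.gen (.H ⟨0, hn⟩) * HB.gen .s0
  | .H i => HB.gen (.H i)

/-- The homomorphism `ρ : H_{D_m} → H^1_{B_m}` with `H_0 ↦ s_0 H_1 s_0` and `H_i ↦ H_i`. -/
def rho : HD n →ₐ[Qq] HB n :=
  lift rhoGen (by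
    intro x y h
    cases h with
    | sq0 hn =>
      simp only [map_mul, map_sub, map_add, map_zero, map_smul, map_one, FreeAlgebra.lift_ι_apply]
      exact hecke_sq_conj HB.sq0 (HB.sq _)
    | sq i =>
      simp only [map_mul, map_sub, map_add, map_zero, map_smul, map_one, FreeAlgebra.lift_ι_apply]
      exact HB.sq i
    | braid i j hij =>
      simp only [map_mul, FreeAlgebra.lift_ι_apply]
      exact HB.braid i j hij
    | far i j hij =>
      simp only [map_mul, FreeAlgebra.lift_ι_apply]
      exact HB.far i j hij
    | braid0 hn i hi =>
      simp only [map_mul, FreeAlgebra.lift_ι_apply, rhoGen]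
      have h1 := HB.far0 i (by omega)
      have h2 := HB.braid ⟨0, hn⟩ i (by simp [hi])
      have h3 := HB.sq0 (n := n)
      generalize (HB.gen .s0 : HB n) = s at *
      generalize (HB.gen (.H i) : HB n) = b at *
      generalize (HB.gen (.H ⟨0, hn⟩) : HB n) = a at *
      have h4 : s * b * s = b := by rw [h1, mul_assoc, h3, mul_one]
      calc s * a * s * b * (s * a * s) = s * a * (s * b * s) * a * s := by simp only [mul_assoc]
        _ = s * (a * b * a) * s := by rw [h4]; simp only [mul_assoc]
        _ = (s * b) * a * (b * s) := by rw [h2]; simp only [mul_assoc]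
        _ = b * (s * a * s) * b := by
          rw [show b * (s * a * s) * b = (b * s) * a * (s * b) by simp only [mul_assoc], h1]
    | far0 hn i hi =>
      simp only [map_mul, FreeAlgebra.lift_ι_apply, rhoGen]
      by_cases hi0 : (i : ℕ) = 0
      · have e : (⟨0, hn⟩ : Fin n) = i := Fin.ext hi0.symm
        rw [e]
        simpa only [mul_assoc] using HB.braid0 i hi0
      · have h1 := HB.far0 i (by omega)
        have h2 := HB.far ⟨0, hn⟩ i (Or.inl (by simp; omega))
        generalize (HB.gen .s0 : HB n) = s at *
        generalize (HB.gen (.H i) : HB n) = b at *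
        generalize (HB.gen (.H ⟨0, hn⟩) : HB n) = a at *
        have c1 : Commute s b := h1
        have c2 : Commute a b := h2
        exact ((c1.mul_left c2).mul_left c1).eq)

end HD

section LocalHecke

variable {R X I : Type} [Field R] [AddCommGroup X] [Module R X] [LinearOrder I]

/-- `q⁻¹ u`, `v` or `v + (q⁻¹ - q) u`, according to whether `x = y`, `x < y` or `x > y`. -/
def heckeCase (q : R) (x y : I) (u v : X) : X :=
  if x = y then q⁻¹ • u else if x < y then v else v + (q⁻¹ - q) • u

theorem heckeCase_eq (q : R) (x : I) (u v : X) : heckeCase q x x u v = q⁻¹ • u := if_pos rfl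
theorem heckeCase_lt (q : R) {x y : I} (h : x < y) (u v : X) : heckeCase q x y u v = v := by
  rw [heckeCase, if_neg h.ne, if_pos h]
theorem heckeCase_gt (q : R) {x y : I} (h : y < x) (u v : X) :
    heckeCase q x y u v = v + (q⁻¹ - q) • u := by
  rw [heckeCase, if_neg h.ne', if_neg h.not_gt]

variable {P Q S : X →ₗ[R] X} {q : R}

theorem local_sq (hq : q ≠ 0) (B : I → I → X)
    (hP : ∀ x y, P (B x y) = heckeCase q x y (B x y) (B y x)) (x y : I) :
    P (P (B x y)) + q • P (B x y) - (q⁻¹ • P (B x y) + q⁻¹ • q • B x y) = 0 := by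
  rcases lt_trichotomy x y with h | rfl | h
  · simp only [hP, heckeCase_lt q h, heckeCase_gt q h]
    match_scalars <;> field_simp <;> ring
  · simp only [hP, heckeCase_eq, map_smul]
    match_scalars <;> field_simp <;> ring
  · simp only [hP, heckeCase_lt q h, heckeCase_gt q h, map_add, map_smul]
    match_scalars <;> field_simp <;> ring

theorem local_braid (hq : q ≠ 0) (B : I → I → I → X)
    (hP : ∀ x y z, P (B x y z) = heckeCase q x y (B x y z) (B y x z))
    (hQ : ∀ x y z, Q (B x y z) = heckeCase q y z (B x y z) (B x z y)) (x y z : I) :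
    P (Q (P (B x y z))) = Q (P (Q (B x y z))) := by
  rcases lt_trichotomy x y with h | h | h <;> rcases lt_trichotomy x z with h' | h' | h' <;>
  rcases lt_trichotomy y z with h'' | h'' | h'' <;>
  first
  | (exfalso; order)
  | (subst_vars
     simp only [hP, hQ, heckeCase_eq, map_smul, map_add, heckeCase_lt q, heckeCase_gt q, *]
     try (match_scalars <;> field_simp <;> ring))

theorem local_braid0 (hq : q ≠ 0) (ν : I → I) (hν : ∀ x, ν (ν x) = x)
    (hlt : ∀ x y, x < y → ν y < ν x) (B : I → I → X)
    (hP : ∀ x y, P (B x y) = heckeCase q x y (B x y) (B y x))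
    (hS : ∀ x y, S (B x y) = B (ν x) y) (x y : I) :
    P (S (P (S (B x y)))) = S (P (S (P (B x y)))) := by
  have k1 : ∀ a b, ν a < b → ν b < a := fun a b h => by have := hlt _ _ h; rwa [hν] at this
  have k2 : ∀ a b, a < ν b → b < ν a := fun a b h => by have := hlt _ _ h; rwa [hν] at this
  rcases lt_trichotomy x y with h | h | h <;> rcases lt_trichotomy (ν x) y with h' | h' | h'
  all_goals
    first
    | have g := hlt _ _ h
    | subst h
    first
    | have g' := k1 _ _ h'
    | have g' := k2 _ _ h'
    | (have g' : ν y = x := by rw [← h', hν])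
    | skip
    simp only [hP, hS, hν, heckeCase_eq, map_smul, map_add, heckeCase_lt q, heckeCase_gt q, *]
    try (match_scalars <;> field_simp)

theorem local_far (hq : q ≠ 0) (B : I → I → I → I → X)
    (hP : ∀ x y z w, P (B x y z w) = heckeCase q x y (B x y z w) (B y x z w))
    (hQ : ∀ x y z w, Q (B x y z w) = heckeCase q z w (B x y z w) (B x y w z)) (x y z w : I) :
    P (Q (B x y z w)) = Q (P (B x y z w)) := by
  rcases lt_trichotomy x y with h | rfl | h <;> rcases lt_trichotomy z w with h' | rfl | h' <;>
  · simp only [hP, hQ, heckeCase_eq, map_smul, map_add, heckeCase_lt q, heckeCase_gt q, *]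
    try (match_scalars <;> field_simp)

theorem local_far0 (hq : q ≠ 0) (ν : I → I) (B : I → I → I → X)
    (hP : ∀ x y z, P (B x y z) = heckeCase q y z (B x y z) (B x z y))
    (hS : ∀ x y z, S (B x y z) = B (ν x) y z) (x y z : I) :
    P (S (B x y z)) = S (P (B x y z)) := by
  rcases lt_trichotomy y z with h | rfl | h <;>
  simp only [hP, hS, heckeCase_eq, map_smul, map_add, heckeCase_lt q, heckeCase_gt q, *]

end LocalHecke

section Action

variable {k n : ℕ}

/-- `f · s_0 = (-f(1), f(2), …, f(m))`. -/
def actS0 (f : Fin (n + 1) → Fin (k + 1)) : Fin (n + 1) → Fin (k + 1) :=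
  Function.update f 0 (f 0).rev

/-- `f · s_{i+1} = (…, f(i+2), f(i+1), …)`; the positions `i + 1`, `i + 2` of the standard numbering
are `i.castSucc` and `i.succ`. -/
def actS (i : Fin n) (f : Fin (n + 1) → Fin (k + 1)) : Fin (n + 1) → Fin (k + 1) :=
  fun j => f (Equiv.swap i.castSucc i.succ j)

/-- The operator `M_f ↦ M_f · s_0 = M_{f · s_0}`. -/
def opS0 (k n : ℕ) : Module.End Qq (T k (n + 1)) :=
  (M k (n + 1)).constr Qq fun f => M k (n + 1) (actS0 f)

/-- The operator `M_f ↦ M_f · H_{i+1}`. -/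
def opH (k : ℕ) {n : ℕ} (i : Fin n) : Module.End Qq (T k (n + 1)) :=
  (M k (n + 1)).constr Qq fun f =>
    if f i.castSucc = f i.succ then q⁻¹ • M k (n + 1) f
    else if f i.castSucc < f i.succ then M k (n + 1) (actS i f)
    else M k (n + 1) (actS i f) + (q⁻¹ - q) • M k (n + 1) f

theorem opS0_M (f : Fin (n + 1) → Fin (k + 1)) :
    opS0 k n (M k (n + 1) f) = M k (n + 1) (actS0 f) := Module.Basis.constr_basis ..

theorem opH_M (i : Fin n) (f : Fin (n + 1) → Fin (k + 1)) : opH k i (M k (n + 1) f)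
    = heckeCase q (f i.castSucc) (f i.succ) (M k (n + 1) f) (M k (n + 1) (actS i f)) :=
  Module.Basis.constr_basis ..

theorem actS0_actS0 (f : Fin (n + 1) → Fin (k + 1)) : actS0 (actS0 f) = f := by
  simp [actS0]

/-- `f` with the values at some positions replaced. -/
def put (a b c d : Fin (n + 1)) (f : Fin (n + 1) → Fin (k + 1)) (x y z w : Fin (k + 1)) :
    Fin (n + 1) → Fin (k + 1) :=
  fun j => if j = a then x else if j = b then y else if j = c then z else if j = d then w else f j

theorem put_self (a b c d : Fin (n + 1)) (f : Fin (n + 1) → Fin (k + 1)) :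
    put a b c d f (f a) (f b) (f c) (f d) = f := by
  funext j; unfold put; split_ifs <;> simp_all

theorem opS0_sq : opS0 k n * opS0 k n = 1 := by
  refine (M k (n + 1)).ext fun f => ?_
  rw [Module.End.mul_apply, opS0_M, opS0_M, actS0_actS0]; rfl

theorem opH_sq (i : Fin n) : (opH k i - q⁻¹ • 1) * (opH k i + q • 1) = 0 := by
  refine (M k (n + 1)).ext fun f => ?_
  have h := local_sq (P := opH k i) q_ne_zero
    (fun x y => M k (n + 1) (put i.castSucc i.succ i.succ i.succ f x y y y)) (fun x y => by
      rw [opH_M]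
      have h1 : i.succ ≠ i.castSucc := by simp [Fin.ext_iff]
      congr 2
      · simp [put]
      · simp [put, h1]
      · funext j
        simp only [actS, put, Equiv.swap_apply_def]
        split_ifs <;> simp_all) (f i.castSucc) (f i.succ)
  simp only [put_self] at h
  rw [LinearMap.zero_apply, ← h]
  simp only [Module.End.mul_apply, LinearMap.sub_apply, LinearMap.add_apply, LinearMap.smul_apply,
    Module.End.one_apply, map_add, map_smul, smul_add]
  rw [smul_sub, smul_comm q q⁻¹]; abel

theorem opH_braid (i j : Fin n) (hij : (i : ℕ) + 1 = j) :
    opH k i * opH k j * opH k i = opH k j * opH k i * opH k j := by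
  refine (M k (n + 1)).ext fun f => ?_
  have e : j.castSucc = i.succ := by simp [Fin.ext_iff, hij]
  have h1 : i.succ ≠ i.castSucc := by simp [Fin.ext_iff]
  have h2 : j.succ ≠ i.castSucc := by simp [Fin.ext_iff]; omega
  have h3 : j.succ ≠ i.succ := by simp [Fin.ext_iff]; omega
  have h := local_braid (P := opH k i) (Q := opH k j) q_ne_zero
    (fun x y z => M k (n + 1) (put i.castSucc i.succ j.succ j.succ f x y z z)) (fun x y z => by
      rw [opH_M]
      congr 2
      · simp [put]
      · simp [put, h1]
      · funext l
        simp only [actS, put, Equiv.swap_apply_def]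
        split_ifs <;> simp_all) (fun x y z => by
      rw [opH_M, e]
      congr 2
      · simp [put, h1]
      · simp [put, h2, h3]
      · funext l
        simp only [actS, put, Equiv.swap_apply_def]
        split_ifs <;> simp_all) (f i.castSucc) (f i.succ) (f j.succ)
  simp only [put_self] at h
  exact h

theorem opH_far (i j : Fin n) (hij : Far i j) : opH k i * opH k j = opH k j * opH k i := by
  refine (M k (n + 1)).ext fun f => ?_
  unfold Far at hij
  have h1 : i.succ ≠ i.castSucc := by simp [Fin.ext_iff]
  have h2 : j.castSucc ≠ i.castSucc := by simp [Fin.ext_iff]; omega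
  have h3 : j.castSucc ≠ i.succ := by simp [Fin.ext_iff]; omega
  have h4 : j.succ ≠ i.castSucc := by simp [Fin.ext_iff]; omega
  have h5 : j.succ ≠ i.succ := by simp [Fin.ext_iff]; omega
  have h6 : j.succ ≠ j.castSucc := by simp [Fin.ext_iff]
  have h := local_far (P := opH k i) (Q := opH k j) q_ne_zero
    (fun x y z w => M k (n + 1) (put i.castSucc i.succ j.castSucc j.succ f x y z w))
    (fun x y z w => by
      rw [opH_M]
      congr 2
      · simp [put]
      · simp [put, h1]
      · funext l
        simp only [actS, put, Equiv.swap_apply_def]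
        split_ifs <;> simp_all) (fun x y z w => by
      rw [opH_M]
      congr 2
      · simp [put, h2, h3]
      · simp [put, h4, h5, h6]
      · funext l
        simp only [actS, put, Equiv.swap_apply_def]
        split_ifs <;> simp_all) (f i.castSucc) (f i.succ) (f j.castSucc) (f j.succ)
  simp only [put_self] at h
  exact h

theorem op_braid0 (i : Fin n) (hi : (i : ℕ) = 0) :
    opS0 k n * opH k i * opS0 k n * opH k i = opH k i * opS0 k n * opH k i * opS0 k n := by
  refine (M k (n + 1)).ext fun f => ?_
  have e : i.castSucc = 0 := by simp [Fin.ext_iff, hi]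
  have h1 : i.succ ≠ 0 := Fin.succ_ne_zero i
  have h := local_braid0 (P := opH k i) (S := opS0 k n) q_ne_zero Fin.rev Fin.rev_rev
    (fun x y h => Fin.rev_lt_rev.mpr h)
    (fun x y => M k (n + 1) (put 0 i.succ i.succ i.succ f x y y y)) (fun x y => by
      have g1 : put 0 i.succ i.succ i.succ f x y y y 0 = x := by simp [put]
      have g2 : put 0 i.succ i.succ i.succ f x y y y i.succ = y := by simp [put, h1]
      have g3 : actS i (put 0 i.succ i.succ i.succ f x y y y) = put 0 i.succ i.succ i.succ f y x x x := by
        funext l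
        simp only [actS, put, Equiv.swap_apply_def]
        split_ifs <;> simp_all
      rw [opH_M, e, g1, g2, g3]) (fun x y => by
      rw [opS0_M]
      congr 1
      funext l
      by_cases hl : l = 0
      · subst hl; simp [actS0, put]
      · simp [actS0, put, hl]) (f 0) (f i.succ)
  simp only [put_self] at h
  exact h.symm

theorem op_far0 (i : Fin n) (hi : 0 < (i : ℕ)) : opS0 k n * opH k i = opH k i * opS0 k n := by
  refine (M k (n + 1)).ext fun f => ?_
  have h0 : i.castSucc ≠ 0 := by simp [Fin.ext_iff]; omega
  have h1 : i.succ ≠ 0 := Fin.succ_ne_zero i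
  have h2 : i.succ ≠ i.castSucc := by simp [Fin.ext_iff]
  have h := local_far0 (P := opH k i) (S := opS0 k n) q_ne_zero Fin.rev
    (fun x y z => M k (n + 1) (put 0 i.castSucc i.succ i.succ f x y z z)) (fun x y z => by
      rw [opH_M]
      congr 2
      · simp [put, h0]
      · simp [put, h1, h2]
      · funext l
        simp only [actS, put, Equiv.swap_apply_def]
        split_ifs <;> simp_all [(Fin.succ_ne_zero i).symm]) (fun x y z => by
      rw [opS0_M]
      congr 1
      funext l
      by_cases hl : l = 0
      · subst hl; simp [actS0, put]
      · simp [actS0, put, hl]) (f 0) (f i.castSucc) (f i.succ)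
  simp only [put_self] at h
  exact h.symm

/-- The operators by which the generators of `H^1_{B_m}` act. -/
def opGen (k : ℕ) {n : ℕ} : BGen n → (Module.End Qq (T k (n + 1)))ᵐᵒᵖ
  | .s0 => MulOpposite.op (opS0 k n)
  | .H i => MulOpposite.op (opH k i)

end Action

/-- The right action of `H^1_{B_m}` on `𝕍^{⊗ m}`, `m = n + 1`, as a homomorphism into the opposite of
the endomorphism algebra. -/
def actB (k n : ℕ) : HB n →ₐ[Qq] (Module.End Qq (T k (n + 1)))ᵐᵒᵖ :=
  HB.lift (opGen k) (by
    intro x y h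
    cases h with
    | sq0 =>
      simp only [map_mul, map_sub, map_add, map_zero, map_one, FreeAlgebra.lift_ι_apply, opGen]
      apply MulOpposite.unop_injective
      change (opS0 k n + 1) * (opS0 k n - 1) = 0
      exact refl_swap (A := Module.End Qq (T k (n + 1))) opS0_sq
    | sq i =>
      simp only [map_mul, map_sub, map_add, map_zero, map_smul, map_one, FreeAlgebra.lift_ι_apply,
        opGen]
      apply MulOpposite.unop_injective
      have e := opH_sq (k := k) i
      change (opH k i + q • 1) * (opH k i - q⁻¹ • 1) = 0
      exact hecke_swap (A := Module.End Qq (T k (n + 1))) e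
    | braid i j hij =>
      simp only [map_mul, FreeAlgebra.lift_ι_apply, opGen]
      apply MulOpposite.unop_injective
      simp only [MulOpposite.unop_mul, MulOpposite.unop_op, ← mul_assoc]
      exact opH_braid i j hij
    | far i j hij =>
      simp only [map_mul, FreeAlgebra.lift_ι_apply, opGen]
      apply MulOpposite.unop_injective
      simp only [MulOpposite.unop_mul, MulOpposite.unop_op, ← mul_assoc]
      exact (opH_far i j hij).symm
    | braid0 i hi =>
      simp only [map_mul, FreeAlgebra.lift_ι_apply, opGen]
      apply MulOpposite.unop_injective
      simp only [MulOpposite.unop_mul, MulOpposite.unop_op, ← mul_assoc]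
      exact (op_braid0 i hi).symm
    | far0 i hi =>
      simp only [map_mul, FreeAlgebra.lift_ι_apply, opGen]
      apply MulOpposite.unop_injective
      simp only [MulOpposite.unop_mul, MulOpposite.unop_op, ← mul_assoc]
      exact (op_far0 i hi).symm)

/-- `u v`, for `u ∈ U^ı` and `v ∈ 𝕍^{⊗ m}`. -/
def actI {k m : ℕ} (u : UI k) (v : T k m) : T k m := rep k m (UI.emb u) v

/-- `v h`, for `v ∈ 𝕍^{⊗ m}` and `h ∈ H_{D_m}`, which acts through `ρ`. -/
def actD {k n : ℕ} (v : T k (n + 1)) (h : HD n) : T k (n + 1) :=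
  (actB k n (HD.rho h)).unop v

/-- The integer `2 a`, for the half-integer `a` that the index stands for. -/
def twice {k : ℕ} (a : Fin (k + 1)) : ℤ := 2 * (a : ℤ) - k

/-- `|f(1)| ≤ f(2) ≤ ⋯ ≤ f(m)`. -/
def DAntidominant {k n : ℕ} (f : Fin (n + 1) → Fin (k + 1)) : Prop :=
  ∀ i : Fin n, (if (i : ℕ) = 0 then |twice (f i.castSucc)| else twice (f i.castSucc))
    ≤ twice (f i.succ)

/-- `φ` is an anti-linear involution of `𝕍^{⊗ m}`, `m = n + 1`, that is compatible with the bar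
involutions of `U^ı` and of `H_{D_m}` and fixes `M_f` for all `D`-anti-dominant `f`. -/
structure IsCompatibleBar {k n : ℕ} (φ : T k (n + 1) →ₛₗ[bar] T k (n + 1)) : Prop where
  involutive : ∀ v, φ (φ v) = v
  compatible : ∀ (u : UI k) (v : T k (n + 1)) (h : HD n),
    φ (actD (actI u v) h) = actD (actI (UI.barUI u) (φ v)) (HD.barHD h)
  fixes : ∀ f : Fin (n + 1) → Fin (k + 1), DAntidominant f → φ (M k (n + 1) f) = M k (n + 1) f

end QSymPair

end

/-! The components of Θ and Υ enter the definitions through a choice operator, so the first task is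
to show that such families exist. Only their defining properties are used afterwards, never their
uniqueness.

Existence. Let U_q(n⁻) be the algebra on letters θ_i with the quantum Serre relations, and let r_i
and l_i be the skew derivations that remove a letter from the right and from the left. The hard fact
is that an element killed by every r_i is a scalar (`scalar_of_r_eq_zero`). It makes Lusztig's form,
for which right multiplication by θ_i is adjoint to r_i and left multiplication is adjoint to l_i,
nondegenerate on each weight space. Up to a power of q - q⁻¹, Θ_ν is the canonical element of the
form in weight ν; its recursion is the adjunction combined with the commutator formula `E_neg'`. The
component Υ_μ represents, through the form, the restriction to weight μ of a linear functional L
with L(1) = 1, L(θ_i x) = c_{-i} L(l_{-i} x) and L(x θ_i) = c_i L(r_{-i} x). The left rule alone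
defines L on the free algebra; the right rule follows from it, and the two together show that L
vanishes on the Serre ideal (`functional_serre`).

Passage to modules. On a finite-dimensional module only finitely many components act by a nonzero
operator, by an eigenvalue count for conjugation with K_{2ρ} (`rep_E_word_eq_zero`). Identities in
the completions thus become identities of operators: ψ is compatible with the bar involution of U,
and ψ_ı with that of U^ı.

Rigidity. Filter 𝕍^{⊗m} ⊗ 𝕍 by the index of the last factor. Up to terms that raise this index, Θ
acts as the identity and an element of U⁻ acts on the first factor only. The elements E_j of U and
B_j = E_j + (scalar) F_{-j} K_j⁻¹ of U^ı act as 1 ⊗ E_j up to terms that do not lower it. An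
additive map that raises the last index and commutes with these lowering operators is zero
(`eq_zero_of_commutes`). Two anti-linear maps that commute with them and agree to leading order are
therefore equal (`eq_of_commutes`). This yields the explicit form of ψ on 𝕍 ⊗ 𝕍, the associativity
of the construction of ψ, the value of ψ_ı on 𝕍, and, by induction on m, the commutation of ψ_ı with
s_0. A version for single vectors gives ψ_ı(M_f) = M_f: the difference of the two sides has last
index above f(m) and is killed by every B_j that could detect it.

Hecke algebra. On 𝕍 ⊗ 𝕍 the rule ψ(x H) = ψ(x) H⁻¹ is read off the explicit formula. Associativity
and naturality of Θ carry it to every H_i with i ≥ 1, and Υ commutes with H_i because U does. Since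
H_0 acts as s_0 H_1 s_0, the rule for H_0 follows.

Conclusion. Every M_f is obtained from D-anti-dominant ones by H_{D_m} (`opD_induction`). A
compatible bar map is thus determined by its values on those, which proves uniqueness. For the same
reason ψ_ı² is the identity, since ψ_ı² is linear, commutes with H_{D_m} and fixes these vectors. -/

noncomputable section

namespace QSymPair

/-! ### The algebra U_q(n⁻), the free algebra, and their skew derivations -/

/-- The quantum Serre relations of type `A_k`; there are none of them if `s` is false. -/
inductive SerreRel (s : Prop) (k : ℕ) :
    FreeAlgebra Qq (Fin k) → FreeAlgebra Qq (Fin k) → Prop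
  | serre (hs : s) (i j : Fin k) (h : Adjacent i j) : SerreRel s k
      (FreeAlgebra.ι Qq i ^ 2 * FreeAlgebra.ι Qq j + FreeAlgebra.ι Qq j * FreeAlgebra.ι Qq i ^ 2)
      ((q + q⁻¹) • (FreeAlgebra.ι Qq i * FreeAlgebra.ι Qq j * FreeAlgebra.ι Qq i))
  | far (hs : s) (i j : Fin k) (h : Far i j) : SerreRel s k
      (FreeAlgebra.ι Qq i * FreeAlgebra.ι Qq j) (FreeAlgebra.ι Qq j * FreeAlgebra.ι Qq i)

/-- The algebra with `k` generators and, if `s` holds, the quantum Serre relations. -/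
def NilAlg (s : Prop) (k : ℕ) : Type := RingQuot (SerreRel s k)

instance (s : Prop) (k : ℕ) : Ring (NilAlg s k) := inferInstanceAs (Ring (RingQuot (SerreRel s k)))
instance (s : Prop) (k : ℕ) : Algebra Qq (NilAlg s k) :=
  inferInstanceAs (Algebra Qq (RingQuot (SerreRel s k)))

namespace NilAlg

variable {s : Prop} {k : ℕ}

/-- The quotient map. -/
def mk : FreeAlgebra Qq (Fin k) →ₐ[Qq] NilAlg s k := RingQuot.mkAlgHom Qq (SerreRel s k)

theorem mk_surjective : Function.Surjective (mk : FreeAlgebra Qq (Fin k) →ₐ[Qq] NilAlg s k) :=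
  RingQuot.mkAlgHom_surjective Qq (SerreRel s k)

/-- The generators. -/
def gen (i : Fin k) : NilAlg s k := mk (FreeAlgebra.ι Qq i)

theorem serre (hs : s) {i j : Fin k} (h : Adjacent i j) :
    (gen i : NilAlg s k) ^ 2 * gen j + gen j * gen i ^ 2 = (q + q⁻¹) • (gen i * gen j * gen i) := by
  have := RingQuot.mkAlgHom_rel Qq (SerreRel.serre hs i j h)
  simp only [map_add, map_mul, map_pow, map_smul] at this
  exact this

theorem far (hs : s) {i j : Fin k} (h : Far i j) :
    (gen i : NilAlg s k) * gen j = gen j * gen i := by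
  have := RingQuot.mkAlgHom_rel Qq (SerreRel.far hs i j h)
  rw [map_mul, map_mul] at this
  exact this

section Lift

variable {A : Type*} [Ring A] [Algebra Qq A]

/-- The universal property. -/
def lift (g : Fin k → A)
    (h1 : s → ∀ i j, Adjacent i j → g i ^ 2 * g j + g j * g i ^ 2 = (q + q⁻¹) • (g i * g j * g i))
    (h2 : s → ∀ i j, Far i j → g i * g j = g j * g i) : NilAlg s k →ₐ[Qq] A :=
  RingQuot.liftAlgHom Qq ⟨FreeAlgebra.lift Qq g, by
    intro x y h
    cases h with
    | serre hs i j h =>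
      simp only [map_add, map_mul, map_pow, map_smul, FreeAlgebra.lift_ι_apply]; exact h1 hs i j h
    | far hs i j h => simp only [map_mul, FreeAlgebra.lift_ι_apply]; exact h2 hs i j h⟩

@[simp] theorem lift_gen (g : Fin k → A) (h1 h2) (i : Fin k) :
    lift (s := s) g h1 h2 (gen i) = g i := by
  unfold lift gen mk
  erw [RingQuot.liftAlgHom_mkAlgHom_apply]
  exact FreeAlgebra.lift_ι_apply g i

theorem hom_ext {φ ψ : NilAlg s k →ₐ[Qq] A} (h : ∀ i, φ (gen i) = ψ (gen i)) : φ = ψ := by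
  refine RingQuot.ringQuot_ext' Qq φ ψ (FreeAlgebra.hom_ext ?_)
  funext i
  exact h i

end Lift

theorem induction_left {P : NilAlg s k → Prop} (h1 : P 1) (hm : ∀ i x, P x → P (gen i * x))
    (ha : ∀ x y, P x → P y → P (x + y)) (hs : ∀ (c : Qq) x, P x → P (c • x)) (x : NilAlg s k) :
    P x := by
  obtain ⟨a, rfl⟩ := mk_surjective x
  suffices h : ∀ y : NilAlg s k, P y → P (mk a * y) by
    have := h 1 h1; rwa [mul_one] at this
  induction a using FreeAlgebra.induction with
  | grade0 c =>
    intro y hy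
    rw [AlgHom.commutes, ← Algebra.smul_def]
    exact hs c y hy
  | grade1 i => intro y hy; exact hm i y hy
  | mul a b iha ihb => intro y hy; rw [map_mul, mul_assoc]; exact iha _ (ihb y hy)
  | add a b iha ihb => intro y hy; rw [map_add, add_mul]; exact ha _ _ (iha y hy) (ihb y hy)

theorem induction_right {P : NilAlg s k → Prop} (h1 : P 1) (hm : ∀ i x, P x → P (x * gen i))
    (ha : ∀ x y, P x → P y → P (x + y)) (hs : ∀ (c : Qq) x, P x → P (c • x)) (x : NilAlg s k) :
    P x := by
  obtain ⟨a, rfl⟩ := mk_surjective x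
  suffices h : ∀ y : NilAlg s k, P y → P (y * mk a) by
    have := h 1 h1; rwa [one_mul] at this
  induction a using FreeAlgebra.induction with
  | grade0 c =>
    intro y hy
    rw [AlgHom.commutes, ← Algebra.commutes, ← Algebra.smul_def]
    exact hs c y hy
  | grade1 i => intro y hy; exact hm i y hy
  | mul a b iha ihb => intro y hy; rw [map_mul, ← mul_assoc]; exact ihb _ (iha y hy)
  | add a b iha ihb => intro y hy; rw [map_add, mul_add]; exact ha _ _ (iha y hy) (ihb y hy)

theorem linear_ext {X : Type*} [AddCommGroup X] [Module Qq X] {φ ψ : NilAlg s k →ₗ[Qq] X}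
    (h1 : φ 1 = ψ 1) (hm : ∀ i x, φ x = ψ x → φ (gen i * x) = ψ (gen i * x)) : φ = ψ := by
  ext x
  induction x using induction_left with
  | h1 => exact h1
  | hm i x h => exact hm i x h
  | ha x y hx hy => rw [map_add, map_add, hx, hy]
  | hs c x hx => rw [map_smul, map_smul, hx]

/-- The augmentation. -/
def counit : NilAlg s k →ₐ[Qq] Qq := lift (fun _ => 0) (by intros; simp) (by intros; simp)

@[simp] theorem counit_gen (i : Fin k) : counit (gen i : NilAlg s k) = 0 := lift_gen ..

instance : Nontrivial (NilAlg s k) := counit.toRingHom.domain_nontrivial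

/-- The automorphism `θ_j ↦ q^{-(α_i, α_j)} θ_j`. -/
def kap (i : Fin k) : NilAlg s k →ₐ[Qq] NilAlg s k :=
  lift (fun j => q ^ (-cartan i j) • gen j) (fun hs a b h => serre_smul (serre hs h))
    (fun hs a b h => by
      rw [smul_mul_smul_comm, smul_mul_smul_comm, far hs h, mul_comm (q ^ _)])

@[simp] theorem kap_gen (i j : Fin k) :
    kap i (gen j : NilAlg s k) = q ^ (-cartan i j) • gen j := lift_gen ..

/-- A triangular matrix is its diagonal part plus a strictly triangular part. The Serre relation
holds for each part, trivially for the second, where all products vanish; the skew commutations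
`h1`–`h3` let `serre_add` combine them. The parameter `t` is q for `rHom` and q⁻¹ for `lHom`. -/
theorem mat_serre {B : Type} [Ring B] [Algebra Qq B] {t : Qq} (ht : t ≠ 0)
    (htt : t + t⁻¹ = q + q⁻¹) {x x' y y' δ δ' : B}
    (hx : x ^ 2 * x' + x' * x ^ 2 = (q + q⁻¹) • (x * x' * x))
    (hy : y ^ 2 * y' + y' * y ^ 2 = (q + q⁻¹) • (y * y' * y))
    (h1 : δ * y = (t⁻¹ * t⁻¹) • (x * δ)) (h2 : δ * y' = t • (x' * δ)) (h3 : δ' * y = t • (x * δ')) :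
    (!![x, δ; 0, y] : Matrix (Fin 2) (Fin 2) B) ^ 2 * !![x', δ'; 0, y']
      + !![x', δ'; 0, y'] * !![x, δ; 0, y] ^ 2
      = (q + q⁻¹) • (!![x, δ; 0, y] * !![x', δ'; 0, y'] * !![x, δ; 0, y]) := by
  have e : ∀ x δ y : B, (!![x, δ; 0, y] : Matrix (Fin 2) (Fin 2) B)
      = !![x, 0; 0, y] + !![0, δ; 0, 0] := fun x δ y => by simp
  rw [e, e x', ← htt]
  rw [← htt] at hx hy
  refine serre_add ht ?_ ?_ ?_ ?_ ?_
  · simp only [pow_two, Matrix.smul_mul, Matrix.mul_smul, Matrix.mul_fin_two, Matrix.smul_of] at *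
    simp [Matrix.mul_fin_two, hx, hy]
  · ext a b; fin_cases a <;> fin_cases b <;> simp [pow_two, Matrix.mul_fin_two]
  · ext a b; fin_cases a <;> fin_cases b <;> simp [Matrix.mul_fin_two, h1]
  · ext a b; fin_cases a <;> fin_cases b <;> simp [Matrix.mul_fin_two, h2]
  · ext a b; fin_cases a <;> fin_cases b <;> simp [Matrix.mul_fin_two, h3]

theorem mat_far {B : Type} [Ring B] [Algebra Qq B] {x x' y y' δ δ' : B}
    (hx : x * x' = x' * x) (hy : y * y' = y' * y) (h2 : δ * y' = x' * δ) (h3 : δ' * y = x * δ') :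
    (!![x, δ; 0, y] : Matrix (Fin 2) (Fin 2) B) * !![x', δ'; 0, y']
      = !![x', δ'; 0, y'] * !![x, δ; 0, y] := by
  simp [Matrix.mul_fin_two, hx, hy, h2, h3, add_comm]

theorem far_ne {i j : Fin k} (h : Far i j) : i ≠ j := by
  rintro rfl; unfold Far at h; omega

/-- `x ↦ [[x, r_i x], [0, κ_i x]]`. -/
def rHom (i : Fin k) : NilAlg s k →ₐ[Qq] Matrix (Fin 2) (Fin 2) (NilAlg s k) :=
  lift (fun j => !![gen j, if i = j then 1 else 0; 0, q ^ (-cartan i j) • gen j])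
    (fun hs a b h => by
      refine mat_serre (t := q) q_ne_zero rfl (serre hs h) (serre_smul (serre hs h)) ?_ ?_ ?_
      · split_ifs with h1
        · subst h1; rw [cartan_self, one_mul, mul_one, zpow_two_neg]
        · simp
      · split_ifs with h1
        · subst h1; rw [cartan_adjacent h, one_mul, mul_one, neg_neg, zpow_one]
        · simp
      · split_ifs with h1
        · subst h1; rw [cartan_adjacent h.symm, one_mul, mul_one, neg_neg, zpow_one]
        · simp)
    (fun hs a b h => by
      refine mat_far (far hs h) ?_ ?_ ?_
      · rw [smul_mul_smul_comm, smul_mul_smul_comm, far hs h, mul_comm (q ^ _)]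
      · split_ifs with h1
        · subst h1; simp [cartan_far h]
        · simp
      · split_ifs with h1
        · subst h1; simp [cartan_far h.symm]
        · simp)

theorem rHom_gen (i j : Fin k) : rHom i (gen j : NilAlg s k)
    = !![gen j, if i = j then 1 else 0; 0, q ^ (-cartan i j) • gen j] := lift_gen ..

/-- `x ↦ [[κ_i x, l_i x], [0, x]]`. -/
def lHom (i : Fin k) : NilAlg s k →ₐ[Qq] Matrix (Fin 2) (Fin 2) (NilAlg s k) :=
  lift (fun j => !![q ^ (-cartan i j) • gen j, if i = j then 1 else 0; 0, gen j])
    (fun hs a b h => by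
      have hq := q_ne_zero
      refine mat_serre (t := q⁻¹) (inv_ne_zero hq) (by rw [inv_inv, add_comm])
        (serre_smul (serre hs h)) (serre hs h) ?_ ?_ ?_
      · split_ifs with h1
        · subst h1
          rw [cartan_self, one_mul, mul_one, smul_smul, ← zpow_two_neg, inv_inv]
          field_simp; simp
        · simp
      · split_ifs with h1
        · subst h1; rw [cartan_adjacent h, one_mul, mul_one, neg_neg, zpow_one, smul_smul]
          field_simp; simp
        · simp
      · split_ifs with h1
        · subst h1; rw [cartan_adjacent h.symm, one_mul, mul_one, neg_neg, zpow_one, smul_smul]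
          field_simp; simp
        · simp)
    (fun hs a b h => by
      refine mat_far ?_ (far hs h) ?_ ?_
      · rw [smul_mul_smul_comm, smul_mul_smul_comm, far hs h, mul_comm (q ^ _)]
      · split_ifs with h1
        · subst h1; simp [cartan_far h]
        · simp
      · split_ifs with h1
        · subst h1; simp [cartan_far h.symm]
        · simp)

theorem lHom_gen (i j : Fin k) : lHom i (gen j : NilAlg s k)
    = !![q ^ (-cartan i j) • gen j, if i = j then 1 else 0; 0, gen j] := lift_gen ..

theorem rHom_entries (i : Fin k) (x : NilAlg s k) :
    rHom i x 0 0 = x ∧ rHom i x 1 0 = 0 ∧ rHom i x 1 1 = kap i x := by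
  induction x using induction_left with
  | h1 => simp
  | hm j x h =>
    rw [map_mul, map_mul]
    simp [Matrix.mul_apply, Fin.sum_univ_two, h, rHom_gen]
  | ha x y hx hy => simp [hx, hy]
  | hs c x hx => simp [hx]

theorem lHom_entries (i : Fin k) (x : NilAlg s k) :
    lHom i x 0 0 = kap i x ∧ lHom i x 1 0 = 0 ∧ lHom i x 1 1 = x := by
  induction x using induction_left with
  | h1 => simp
  | hm j x h =>
    rw [map_mul, map_mul]
    simp [Matrix.mul_apply, Fin.sum_univ_two, h, lHom_gen]
  | ha x y hx hy => simp [hx, hy]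
  | hs c x hx => simp [hx]

/-- The skew derivation that removes a letter `θ_i`, from the right. -/
def r (i : Fin k) : NilAlg s k →ₗ[Qq] NilAlg s k where
  toFun x := rHom i x 0 1
  map_add' x y := by simp
  map_smul' c x := by simp

/-- The skew derivation that removes a letter `θ_i`, from the left. -/
def l (i : Fin k) : NilAlg s k →ₗ[Qq] NilAlg s k where
  toFun x := lHom i x 0 1
  map_add' x y := by simp
  map_smul' c x := by simp

/-- The twisted Leibniz rule is the off-diagonal entry of a product of triangular matrices. Encoding
it in an algebra homomorphism makes it descend through the Serre relations. -/
theorem r_mul (i : Fin k) (x y : NilAlg s k) : r i (x * y) = x * r i y + r i x * kap i y := by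
  change rHom i (x * y) 0 1 = x * rHom i y 0 1 + rHom i x 0 1 * kap i y
  rw [map_mul, Matrix.mul_apply, Fin.sum_univ_two, (rHom_entries i x).1, (rHom_entries i y).2.2]

theorem l_mul (i : Fin k) (x y : NilAlg s k) : l i (x * y) = l i x * y + kap i x * l i y := by
  change lHom i (x * y) 0 1 = lHom i x 0 1 * y + kap i x * lHom i y 0 1
  rw [map_mul, Matrix.mul_apply, Fin.sum_univ_two, (lHom_entries i x).1, (lHom_entries i y).2.2,
    add_comm]

@[simp] theorem r_one (i : Fin k) : r i (1 : NilAlg s k) = 0 := by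
  change rHom i 1 0 1 = 0; simp
@[simp] theorem l_one (i : Fin k) : l i (1 : NilAlg s k) = 0 := by
  change lHom i 1 0 1 = 0; simp
@[simp] theorem r_gen (i j : Fin k) : r i (gen j : NilAlg s k) = if i = j then 1 else 0 := by
  change rHom i (gen j) 0 1 = _; simp [rHom]
@[simp] theorem l_gen (i j : Fin k) : l i (gen j : NilAlg s k) = if i = j then 1 else 0 := by
  change lHom i (gen j) 0 1 = _; simp [lHom]

theorem r_gen_mul (i j : Fin k) (x : NilAlg s k) :
    r i (gen j * x) = gen j * r i x + if i = j then kap i x else 0 := by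
  rw [r_mul, r_gen]; split_ifs <;> simp
theorem r_mul_gen (i j : Fin k) (x : NilAlg s k) :
    r i (x * gen j) = (if i = j then x else 0) + q ^ (-cartan i j) • (r i x * gen j) := by
  rw [r_mul, r_gen, kap_gen, mul_smul_comm]; split_ifs <;> simp
theorem l_gen_mul (i j : Fin k) (x : NilAlg s k) :
    l i (gen j * x) = (if i = j then x else 0) + q ^ (-cartan i j) • (gen j * l i x) := by
  rw [l_mul, l_gen, kap_gen, smul_mul_assoc]; split_ifs <;> simp
theorem l_mul_gen (i j : Fin k) (x : NilAlg s k) :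
    l i (x * gen j) = l i x * gen j + if i = j then kap i x else 0 := by
  rw [l_mul, l_gen]; split_ifs <;> simp

theorem l_kap (i j : Fin k) (x : NilAlg s k) : l i (kap j x) = q ^ (-cartan j i) • kap j (l i x) := by
  have : (l i).comp (kap j).toLinearMap
      = q ^ (-cartan j i) • ((kap j).toLinearMap.comp (l i : NilAlg s k →ₗ[Qq] _)) := by
    refine linear_ext (by simp) fun a x hx => ?_
    simp only [LinearMap.comp_apply, AlgHom.toLinearMap_apply, LinearMap.smul_apply] at hx ⊢
    rw [map_mul, kap_gen, smul_mul_assoc, map_smul, l_gen_mul, hx, l_gen_mul, map_add, map_smul,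
      map_mul, kap_gen]
    split_ifs with h
    · subst h
      simp only [smul_add, smul_mul_assoc, mul_smul_comm, smul_smul, mul_comm]
    · simp only [map_zero, zero_add, smul_mul_assoc, mul_smul_comm, smul_smul]; congr 1; ring
  exact LinearMap.congr_fun this x

/-- Removal of a letter at one end does not interact with removal at the other, except for the power
of q recorded by κ when both hit the same letter; symmetry of the Cartan matrix balances that power.
-/
theorem l_r (i j : Fin k) (x : NilAlg s k) : l i (r j x) = r j (l i x) := by
  have : (l i).comp (r j) = (r j).comp (l i : NilAlg s k →ₗ[Qq] _) := by
    refine linear_ext (by simp) fun a x hx => ?_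
    simp only [LinearMap.comp_apply] at hx ⊢
    rw [r_gen_mul, map_add, l_gen_mul, hx, l_gen_mul, map_add, map_smul, r_gen_mul]
    rw [smul_add, ← add_assoc]
    congr 1
    · congr 1
      split_ifs <;> simp
    · split_ifs with h1
      · subst h1; rw [l_kap, cartan_symm]
      · simp
  exact LinearMap.congr_fun this x

/-- Both sides read off the coefficient of the one-letter word θ_i. -/
theorem counit_l (i : Fin k) (x : NilAlg s k) : counit (l i x) = counit (r i x) := by
  have h0 : ∀ x : NilAlg s k, counit (kap i x) = counit x := fun x => by
    have : (counit.comp (kap i) : NilAlg s k →ₐ[Qq] Qq) = counit := hom_ext fun a => by simp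
    exact DFunLike.congr_fun this x
  have : counit.toLinearMap.comp (l i) = counit.toLinearMap.comp (r i : NilAlg s k →ₗ[Qq] _) := by
    refine linear_ext (by simp) fun a x hx => ?_
    simp only [LinearMap.comp_apply, AlgHom.toLinearMap_apply] at hx ⊢
    rw [r_gen_mul, l_gen_mul]
    split_ifs <;> simp [h0]
  exact LinearMap.congr_fun this x

end NilAlg

end QSymPair

end

/-! ### Root vectors of segments and their commutation relations -/

noncomputable section

namespace QSymPair

/-- The Cartan matrix, with natural numbers as indices. -/
def ca (i j : ℕ) : ℤ := if i = j then 2 else if i + 1 = j ∨ j + 1 = i then -1 else 0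

theorem cartan_eq_ca {k : ℕ} (i j : Fin k) : cartan i j = ca i j := by
  simp only [cartan, ca, Fin.ext_iff]

theorem q_add_inv_ne_zero : q + q⁻¹ ≠ 0 := by
  intro h
  have hq := q_ne_zero
  have h2 : q * q + 1 = 0 := by
    have := congrArg (q * ·) h
    simpa [mul_add, hq] using this
  have h3 : (algebraMap (Polynomial ℚ) (RatFunc ℚ)) (Polynomial.X * Polynomial.X + 1)
      = algebraMap (Polynomial ℚ) (RatFunc ℚ) 0 := by
    rw [map_add, map_mul, map_one, map_zero, RatFunc.algebraMap_X]
    exact h2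
  have h4 := RatFunc.algebraMap_injective ℚ h3
  have h5 := congrArg (Polynomial.eval 2) h4
  norm_num at h5

theorem one_sub_q_sq_ne_zero : 1 - q * q ≠ 0 := by
  intro h
  have hq := q_ne_zero
  apply q_sub_inv_ne_zero
  field_simp
  linear_combination -h

/-- After multiplication by a power of q the sum is a polynomial whose value at q = 1 is the number
of terms. These sums later appear as the scalars by which a skew derivation acts on root monomials.
-/
theorem sum_zpow_ne_zero (l : List ℤ) (hl : l ≠ []) : (l.map fun e => q ^ e).sum ≠ 0 := by
  intro h
  obtain ⟨N, hN⟩ : ∃ N : ℕ, ∀ e ∈ l, 0 ≤ e + N := by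
    clear h hl
    induction l with
    | nil => exact ⟨0, by simp⟩
    | cons a l ih =>
      obtain ⟨N, hN⟩ := ih
      refine ⟨N + a.natAbs, fun e he => ?_⟩
      rcases List.mem_cons.mp he with rfl | he
      · have := neg_abs_le e; push_cast; linarith [N.cast_nonneg (α := ℤ)]
      · have := hN e he; have := abs_nonneg a; push_cast; linarith
  have key : ∀ l : List ℤ, (∀ e ∈ l, 0 ≤ e + N) → ∃ P : Polynomial ℚ,
      P.eval 1 = l.length ∧ algebraMap (Polynomial ℚ) Qq P = (l.map fun e => q ^ e).sum * q ^ N := by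
    intro l
    induction l with
    | nil => intro _; exact ⟨0, by simp⟩
    | cons a l ih =>
      intro hN
      obtain ⟨P, h1, h2⟩ := ih fun e he => hN e (List.mem_cons_of_mem a he)
      refine ⟨Polynomial.X ^ (a + N).toNat + P, ?_, ?_⟩
      · simp [h1, add_comm]
      · have ha := hN a (List.mem_cons_self ..)
        rw [map_add, map_pow, RatFunc.algebraMap_X, h2, List.map_cons, List.sum_cons, add_mul]
        congr 1
        change q ^ (a + N).toNat = _
        rw [← zpow_natCast q (a + N).toNat, Int.toNat_of_nonneg ha, zpow_add₀ q_ne_zero,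
          zpow_natCast]
  obtain ⟨P, h1, h2⟩ := key l hN
  rw [h, zero_mul, ← map_zero (algebraMap (Polynomial ℚ) Qq)] at h2
  rw [RatFunc.algebraMap_injective ℚ h2, Polynomial.eval_zero] at h1
  exact hl (List.length_eq_zero_iff.mp (by exact_mod_cast h1.symm))

/-- `U_q(n⁻)`. -/
abbrev SA (k : ℕ) : Type := NilAlg True k

namespace SA

open NilAlg

variable {k : ℕ}

/-- The generator `θ_n`, or zero if there is none. -/
def th (n : ℕ) : SA k := if h : n < k then gen ⟨n, h⟩ else 0

theorem th_of_lt {n : ℕ} (h : n < k) : (th n : SA k) = gen ⟨n, h⟩ := dif_pos h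

theorem th_val (i : Fin k) : (th i : SA k) = gen i := th_of_lt i.2

theorem th_serre {n m : ℕ} (h : n + 1 = m ∨ m + 1 = n) :
    (th n : SA k) ^ 2 * th m + th m * th n ^ 2 = (q + q⁻¹) • (th n * th m * th n) := by
  unfold th
  split_ifs with h1 h2 h2
  · exact serre trivial (i := ⟨n, h1⟩) (j := ⟨m, h2⟩) h
  all_goals simp

theorem th_far {n m : ℕ} (h : n + 1 < m ∨ m + 1 < n) : Commute (th n : SA k) (th m) := by
  unfold th Commute SemiconjBy
  split_ifs with h1 h2 h2
  · exact far trivial (i := ⟨n, h1⟩) (j := ⟨m, h2⟩) h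
  all_goals simp

theorem r_th (i : Fin k) (n : ℕ) : r i (th n : SA k) = if (i : ℕ) = n then 1 else 0 := by
  unfold th
  split_ifs with h1 h2 h2
  · rw [r_gen, if_pos (Fin.ext h2)]
  · rw [r_gen, if_neg fun e => h2 (congrArg Fin.val e)]
  · exact absurd i.2 (by omega)
  · simp

theorem kap_th (i : Fin k) (n : ℕ) : kap i (th n : SA k) = q ^ (-ca i n) • th n := by
  unfold th
  split_ifs with h1
  · rw [kap_gen, cartan_eq_ca]
  · simp

/-- The root vector for the segment `j, j + 1, …, j + n`. -/
def X (j : ℕ) : ℕ → SA k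
  | 0 => th j
  | n + 1 => X j n * th (j + n + 1) - q • (th (j + n + 1) * X j n)

theorem X_zero (j : ℕ) : (X j 0 : SA k) = th j := rfl
theorem X_succ (j n : ℕ) :
    (X j (n + 1) : SA k) = X j n * th (j + n + 1) - q • (th (j + n + 1) * X j n) := rfl

theorem commute_bracket {A : Type} [Ring A] [Algebra Qq A] {c : Qq} {a x y : A} (h1 : Commute a x)
    (h2 : Commute a y) : Commute a (x * y - c • (y * x)) :=
  (h1.mul_right h2).sub_right ((h2.mul_right h1).smul_right c)

theorem X_far {a j n : ℕ} (h : a + 1 < j ∨ j + n + 1 < a) : Commute (th a : SA k) (X j n) := by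
  induction n with
  | zero => exact th_far (by omega)
  | succ n ih =>
    rw [X_succ]
    exact commute_bracket (ih (by omega)) (th_far (by omega))

/-- A root vector can be built from either end, because the first and the last letter of a segment
of length at least three commute. -/
theorem X_succ' (j n : ℕ) :
    (X j (n + 1) : SA k) = th j * X (j + 1) n - q • (X (j + 1) n * th j) := by
  induction n with
  | zero => rfl
  | succ n ih =>
    have hc : Commute (th j : SA k) (th (j + (n + 1) + 1)) := th_far (by omega)
    have e : X (j + 1) (n + 1) = X (j + 1) n * th (j + (n + 1) + 1)
        - q • (th (j + (n + 1) + 1) * X (j + 1) n : SA k) := by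
      rw [X_succ, show j + 1 + n + 1 = j + (n + 1) + 1 by ring]
    rw [X_succ, ih, e]
    generalize (th (j + (n + 1) + 1) : SA k) = t at *
    generalize (th j : SA k) = a at *
    generalize (X (j + 1) n : SA k) = x at *
    have h1 : t * (a * x) = a * (t * x) := by rw [← mul_assoc, ← hc.eq, mul_assoc]
    simp only [sub_mul, mul_sub, smul_mul_assoc, mul_smul_comm, mul_assoc, h1, hc.eq, smul_sub]
    abel

/-- The Serre relation is linear in its second argument and is preserved by multiplying that
argument by something that commutes with `t`, so it passes to both q-brackets. -/
theorem serre_bracket {A : Type} [Ring A] [Algebra Qq A] {c d : Qq} {t x y : A}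
    (h : t ^ 2 * x + x * t ^ 2 = d • (t * x * t)) (hc : Commute t y) :
    (t ^ 2 * (x * y - c • (y * x)) + (x * y - c • (y * x)) * t ^ 2
      = d • (t * (x * y - c • (y * x)) * t)) ∧
    (t ^ 2 * (y * x - c • (x * y)) + (y * x - c • (x * y)) * t ^ 2
      = d • (t * (y * x - c • (x * y)) * t)) := by
  have h2 : Commute (t ^ 2) y := hc.pow_left 2
  have e1 : t ^ 2 * (x * y) + x * y * t ^ 2 = d • (t * (x * y) * t) := by
    have : t ^ 2 * (x * y) + x * y * t ^ 2 = (t ^ 2 * x + x * t ^ 2) * y := by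
      rw [add_mul, mul_assoc x y, ← h2.eq]; simp only [mul_assoc]
    rw [this, h, smul_mul_assoc, mul_assoc _ t y, hc.eq]; simp only [mul_assoc]
  have e2 : t ^ 2 * (y * x) + y * x * t ^ 2 = d • (t * (y * x) * t) := by
    have : t ^ 2 * (y * x) + y * x * t ^ 2 = y * (t ^ 2 * x + x * t ^ 2) := by
      rw [mul_add, ← mul_assoc, h2.eq]; simp only [mul_assoc]
    rw [this, h, mul_smul_comm, ← mul_assoc t y, hc.eq]; simp only [mul_assoc]
  constructor
  · rw [mul_sub, sub_mul, mul_smul_comm, smul_mul_assoc, sub_add_sub_comm, ← smul_add, e1, e2,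
      mul_sub, sub_mul, mul_smul_comm, smul_mul_assoc, smul_sub, smul_comm c d]
  · rw [mul_sub, sub_mul, mul_smul_comm, smul_mul_assoc, sub_add_sub_comm, ← smul_add, e1, e2,
      mul_sub, sub_mul, mul_smul_comm, smul_mul_assoc, smul_sub, smul_comm c d]

theorem serre_X_left (j n : ℕ) : (th j : SA k) ^ 2 * X (j + 1) n + X (j + 1) n * th j ^ 2
    = (q + q⁻¹) • (th j * X (j + 1) n * th j) := by
  induction n with
  | zero => exact th_serre (by omega)
  | succ n ih =>
    rw [X_succ]
    exact (serre_bracket ih (th_far (by omega))).1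

theorem serre_X_right (j n : ℕ) :
    (th (j + n + 1) : SA k) ^ 2 * X j n + X j n * th (j + n + 1) ^ 2
    = (q + q⁻¹) • (th (j + n + 1) * X j n * th (j + n + 1)) := by
  induction n generalizing j with
  | zero => exact th_serre (by omega)
  | succ n ih =>
    rw [X_succ']
    have := ih (j + 1)
    rw [show j + 1 + n + 1 = j + (n + 1) + 1 by ring] at this
    exact (serre_bracket this (th_far (by omega))).2

/-- The Serre polynomial in `t` factors into two q-commutators with parameters p and p⁻¹; once one
of them has been applied, what is left says that the result q-commutes with `t`. -/
theorem q_commute_left {R A : Type} [Field R] [Ring A] [Algebra R A] {p : R} (hp : p ≠ 0) {t x : A}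
    (h : t ^ 2 * x + x * t ^ 2 = (p + p⁻¹) • (t * x * t)) :
    (t * x - p • (x * t)) * t = p • (t * (t * x - p • (x * t))) ∧
    (x * t - p • (t * x)) * t = p⁻¹ • (t * (x * t - p • (t * x))) := by
  have h' : t * (t * x) = (p + p⁻¹) • (t * (x * t)) - x * (t * t) := by
    simp only [pow_two, mul_assoc] at h; rw [← h]; abel
  constructor <;>
  · simp only [sub_mul, mul_sub, smul_mul_assoc, mul_smul_comm, mul_assoc, h', smul_sub, smul_smul]
    match_scalars <;> field_simp <;> ring

theorem X_mul_th_self (j n : ℕ) :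
    (X j (n + 1) : SA k) * th j = q • (th j * X j (n + 1)) := by
  rw [X_succ']; exact (q_commute_left q_ne_zero (serre_X_left j n)).1

theorem X_mul_th_last (j n : ℕ) :
    (X j (n + 1) : SA k) * th (j + n + 1) = q⁻¹ • (th (j + n + 1) * X j (n + 1)) := by
  rw [X_succ]; exact (q_commute_left q_ne_zero (serre_X_right j n)).2

/-- The rank-three case of the fact that an interior letter commutes with the root vector of its
segment. -/
theorem commute_middle {R A : Type} [Field R] [Ring A] [Algebra R A] {q : R} (hq : q ≠ 0)
    (hq2 : q + q⁻¹ ≠ 0) {a b c : A}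
    (h1 : b ^ 2 * a + a * b ^ 2 = (q + q⁻¹) • (b * a * b))
    (h2 : b ^ 2 * c + c * b ^ 2 = (q + q⁻¹) • (b * c * b)) (h3 : a * c = c * a) :
    Commute b (a * (b * c - q • (c * b)) - q • ((b * c - q • (c * b)) * a)) := by
  have hq3 : q ^ 2 + 1 ≠ 0 := by
    intro h; apply hq2; field_simp; rw [mul_zero]; exact h
  -- The Serre relations are solved for the alternating words b a b and b c b, which needs q + q⁻¹ ≠
  -- 0. What remains is a comparison of coefficients.
  have e1 : b * (a * b) = (q + q⁻¹)⁻¹ • (b * (b * a) + a * (b * b)) := by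
    simp only [pow_two, mul_assoc] at h1; rw [h1, smul_smul, inv_mul_cancel₀ hq2, one_smul]
  have e2 : b * (c * b) = (q + q⁻¹)⁻¹ • (b * (b * c) + c * (b * b)) := by
    simp only [pow_two, mul_assoc] at h2; rw [h2, smul_smul, inv_mul_cancel₀ hq2, one_smul]
  have e1' : ∀ w, b * (a * (b * w)) = (q + q⁻¹)⁻¹ • ((b * (b * a) + a * (b * b)) * w) := fun w => by
    rw [← smul_mul_assoc, ← e1]; simp only [mul_assoc]
  have e2' : ∀ w, b * (c * (b * w)) = (q + q⁻¹)⁻¹ • ((b * (b * c) + c * (b * b)) * w) := fun w => by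
    rw [← smul_mul_assoc, ← e2]; simp only [mul_assoc]
  have e3 : ∀ w, c * (a * w) = a * (c * w) := fun w => by rw [← mul_assoc, ← h3, mul_assoc]
  unfold Commute SemiconjBy
  simp only [sub_mul, mul_sub, add_mul, smul_mul_assoc, mul_smul_comm, mul_assoc, e1, e2, e1', e2',
    ← h3, e3, smul_sub, smul_add, mul_add, smul_smul]
  match_scalars <;> field_simp <;> ring

theorem X_middle (d j m : ℕ) : Commute (th (j + d + 1) : SA k) (X j (d + m + 2)) := by
  induction d generalizing j with
  | zero =>
    rw [show 0 + m + 2 = (m + 1) + 1 by ring, X_succ', X_succ']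
    exact commute_middle q_ne_zero q_add_inv_ne_zero (th_serre (by omega)) (serre_X_left (j + 1) m) (X_far (by omega)).eq
  | succ d ih =>
    rw [show d + 1 + m + 2 = (d + m + 2) + 1 by ring, X_succ']
    have := ih (j + 1)
    rw [show j + 1 + d + 1 = j + (d + 1) + 1 by ring] at this
    exact commute_bracket (th_far (by omega)) this

/-- Both segments end at the same place. The first letter of the shorter one is interior to the
longer one and commutes with its root vector; removing it shortens the inner segment, down to the
case of the common last letter. -/
theorem X_q_commute (n j d : ℕ) : (X j (d + n + 1) : SA k) * X (j + d + 1) n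
    = q⁻¹ • (X (j + d + 1) n * X j (d + n + 1)) := by
  induction n generalizing d with
  | zero => exact X_mul_th_last j d
  | succ n ih =>
    have h1 := ih (d + 1)
    rw [show d + 1 + n + 1 = d + (n + 1) + 1 by ring, show j + (d + 1) + 1 = j + d + 1 + 1 by ring]
      at h1
    have h3 := X_middle (k := k) d j n
    rw [show d + n + 2 = d + (n + 1) + 1 by ring] at h3
    rw [X_succ' (j + d + 1) n]
    rw [mul_sub, sub_mul, mul_smul_comm, smul_mul_assoc, ← mul_assoc, ← h3.eq, mul_assoc, h1,
      ← mul_assoc, h1, smul_mul_assoc, mul_assoc _ (X j _), ← h3.eq, smul_sub, mul_smul_comm,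
      smul_comm q q⁻¹, mul_assoc, mul_assoc]

theorem kap_X (i : Fin k) (j n : ℕ) :
    kap i (X j n : SA k) = q ^ (-∑ a ∈ Finset.range (n + 1), ca i (j + a)) • X j n := by
  induction n with
  | zero => simp [X_zero, kap_th]
  | succ n ih =>
    rw [X_succ, map_sub, map_smul, map_mul, map_mul, ih, kap_th, smul_mul_smul_comm,
      smul_mul_smul_comm, Finset.sum_range_succ _ (n + 1), neg_add, zpow_add₀ q_ne_zero, smul_sub,
      smul_comm q, mul_comm (q ^ (-ca i _)), add_assoc]

theorem kap_X_next (i : Fin k) (j n : ℕ) (h : (i : ℕ) = j + n + 1) :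
    kap i (X j n : SA k) = q • X j n := by
  rw [kap_X, Finset.sum_range_succ, Finset.sum_eq_zero, zero_add]
  · rw [ca, if_neg (by omega), if_pos (by omega), neg_neg, zpow_one]
  · intro a ha
    have := Finset.mem_range.mp ha
    rw [ca, if_neg (by omega), if_neg (by omega)]

theorem r_mul_th (i : Fin k) (n : ℕ) (x : SA k) :
    r i (x * th n) = (if (i : ℕ) = n then x else 0) + q ^ (-ca i n) • (r i x * th n) := by
  rw [r_mul, r_th, kap_th, mul_smul_comm]; split_ifs <;> simp
theorem r_th_mul (i : Fin k) (n : ℕ) (x : SA k) :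
    r i (th n * x) = th n * r i x + if (i : ℕ) = n then kap i x else 0 := by
  rw [r_mul, r_th]; split_ifs <;> simp

theorem r_X_step (i : Fin k) (j n : ℕ) (hi : (i : ℕ) = j + n + 1) (h0 : r i (X j n : SA k) = 0) :
    r i (X j (n + 1) : SA k) = (1 - q * q) • X j n := by
  rw [X_succ, map_sub, map_smul, r_mul_th, r_th_mul, h0, if_pos hi, if_pos hi, zero_mul, mul_zero,
    smul_zero, add_zero, zero_add, kap_X_next i j n hi, sub_smul, one_smul, smul_smul]

/-- The two claims are proved together: for r_{j+n} the two terms of the bracket X_{j,n+1} cancel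
exactly because the new letter commutes with r_{j+n} X_{j,n}, and that commutation holds because
r_{j+n} X_{j,n} is a multiple of the root vector of a segment two steps away. -/
theorem r_X_aux (j n : ℕ) : (∀ i : Fin k, (i : ℕ) ≠ j + n → r i (X j n : SA k) = 0) ∧
    ∀ i : Fin k, (i : ℕ) = j + n → Commute (th (j + n + 1)) (r i (X j n : SA k)) := by
  induction n with
  | zero =>
    refine ⟨fun i h => ?_, fun i h => ?_⟩
    · rw [X_zero, r_th, if_neg (by omega)]
    · rw [X_zero, r_th, if_pos (by omega)]; exact Commute.one_right _
  | succ n ih =>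
    refine ⟨fun i h => ?_, fun i h => ?_⟩
    · rw [X_succ, map_sub, map_smul, r_mul_th, r_th_mul, if_neg (by omega), if_neg (by omega),
        zero_add, add_zero]
      by_cases hi : (i : ℕ) = j + n
      · have e : ca i (j + n + 1) = -1 := by rw [ca, if_neg (by omega), if_pos (by omega)]
        rw [e, neg_neg, zpow_one, ← smul_sub, (ih.2 i hi).eq, sub_self, smul_zero]
      · rw [ih.1 i hi]; simp
    · rw [r_X_step i j n h (ih.1 i (by omega))]
      exact (X_far (by omega)).smul_right _

theorem r_X_of_ne {i : Fin k} {j n : ℕ} (h : (i : ℕ) ≠ j + n) : r i (X j n : SA k) = 0 :=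
  (r_X_aux j n).1 i h

theorem r_X_zero {i : Fin k} {j : ℕ} (h : (i : ℕ) = j) : r i (X j 0 : SA k) = 1 := by
  rw [X_zero, r_th, if_pos h]

theorem r_X_succ {i : Fin k} {j n : ℕ} (h : (i : ℕ) = j + n + 1) :
    r i (X j (n + 1) : SA k) = (1 - q * q) • X j n :=
  r_X_step i j n h (r_X_of_ne (by omega))

end SA

end QSymPair

end

/-! ### A quantum torus representation that separates root monomials -/

noncomputable section

namespace QSymPair

namespace SA

open NilAlg

variable {k : ℕ}

/-- The space on which the torus representation of `U_q(n⁻)` acts. -/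
abbrev Tor : Type := (ℕ → ℤ) →₀ Qq

/-- The basis of `Tor`. -/
def Tor.e (c : ℕ → ℤ) : Tor := Finsupp.single c 1

/-- The shift `c ↦ c + δ_n - δ_m`. -/
def shift (n m : ℕ) (c : ℕ → ℤ) : ℕ → ℤ := c + Pi.single n 1 - Pi.single m 1

/-- The operator by which `θ_n` acts on `Tor`. -/
def torOp (n : ℕ) : Module.End Qq Tor :=
  Finsupp.linearCombination Qq fun c => q ^ (-c (n + 1)) • Tor.e (shift n (n + 1) c)

theorem torOp_e (n : ℕ) (c : ℕ → ℤ) :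
    torOp n (Tor.e c) = q ^ (-c (n + 1)) • Tor.e (shift n (n + 1) c) := by
  rw [torOp, Tor.e, Finsupp.linearCombination_single, one_smul]

theorem Tor.ext_e {f g : Module.End Qq Tor} (h : ∀ c, f (Tor.e c) = g (Tor.e c)) : f = g :=
  Finsupp.lhom_ext' fun c => LinearMap.ext_ring (h c)

theorem torOp_succ (n : ℕ) : torOp (n + 1) * torOp n = q • (torOp n * torOp (n + 1)) := by
  refine Tor.ext_e fun c => ?_
  simp only [Module.End.mul_apply, LinearMap.smul_apply, torOp_e, map_smul, smul_smul]
  rw [show shift (n + 1) (n + 1 + 1) (shift n (n + 1) c)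
    = shift n (n + 1) (shift (n + 1) (n + 1 + 1) c) by simp only [shift]; abel]
  congr 1
  have e : ∀ a b c d : ℤ, a + b = 1 + (c + d) → q ^ a * q ^ b = q * (q ^ c * q ^ d) := by
    intro a b c d h
    rw [← zpow_add₀ q_ne_zero, ← zpow_add₀ q_ne_zero, h, zpow_add₀ q_ne_zero 1, zpow_one]
  apply e
  have h1 : n + 1 + 1 ≠ n := by omega
  simp [shift, Pi.single_apply, h1]
  ring

theorem torOp_far {n m : ℕ} (h : n + 1 < m) : torOp n * torOp m = torOp m * torOp n := by
  refine Tor.ext_e fun c => ?_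
  simp only [Module.End.mul_apply, torOp_e, map_smul, smul_smul]
  rw [show shift n (n + 1) (shift m (m + 1) c) = shift m (m + 1) (shift n (n + 1) c) by
    simp only [shift]; abel]
  congr 1
  rw [← zpow_add₀ q_ne_zero, ← zpow_add₀ q_ne_zero]
  congr 1
  have h1 : n + 1 ≠ m := by omega
  have h2 : n + 1 ≠ m + 1 := by omega
  have h3 : m + 1 ≠ n := by omega
  have h4 : m + 1 ≠ n + 1 := by omega
  have h5 : n ≠ m := by omega
  simp [shift, Pi.single_apply, h1, h2, h3, h4, h5, h5.symm]
  ring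

/-- The condition on `c` says c = q or c = q⁻¹. In the torus representation neighbouring generators
q-commute, which is stronger than the Serre relations. -/
theorem serre_of_q_commute {A : Type*} [Ring A] [Algebra Qq A] {c : Qq} {x y : A}
    (h : x * y = c • (y * x)) (hc : c * c + 1 = (q + q⁻¹) * c) :
    x ^ 2 * y + y * x ^ 2 = (q + q⁻¹) • (x * y * x) := by
  rw [pow_two, mul_assoc, h, mul_smul_comm, ← mul_assoc, h, smul_mul_assoc,
    smul_smul, smul_smul, ← hc, add_smul, one_smul, mul_assoc]

theorem skew_bracket {A : Type*} [Ring A] [Algebra Qq A] {c d : Qq} {t s x : A}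
    (h1 : t * s = d • (s * t)) (h2 : Commute t x) :
    t * (x * s - c • (s * x)) = d • ((x * s - c • (s * x)) * t) := by
  rw [mul_sub, sub_mul, mul_smul_comm, smul_mul_assoc, ← mul_assoc, h2.eq, mul_assoc, h1,
    ← mul_assoc, h1, smul_mul_assoc, mul_assoc s t, h2.eq, smul_sub, mul_smul_comm, smul_comm c d,
    mul_assoc, mul_assoc]

/-- This is why the representation is easy to use: on q-commuting operators a q-bracket collapses to
a nonzero multiple of a product, so root vectors act by monomial operators. -/
theorem bracket_of_skew {A : Type*} [Ring A] [Algebra Qq A] {c : Qq} {t x : A}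
    (h : t * x = c • (x * t)) : x * t - c • (t * x) = (1 - c * c) • (x * t) := by
  rw [h, smul_smul, sub_smul, one_smul]

/-- The torus representation. -/
def tor : SA k →ₐ[Qq] Module.End Qq Tor :=
  lift (fun i => torOp i) (fun _ i j h => by
      have hq := q_ne_zero
      rcases h with h | h
      · rw [← h]
        refine serre_of_q_commute (c := q⁻¹) ?_ (by field_simp; ring)
        rw [torOp_succ, smul_smul, inv_mul_cancel₀ hq, one_smul]
      · rw [← h]
        exact serre_of_q_commute (torOp_succ _) (by field_simp))
    (fun _ i j h => by
      rcases h with h | h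
      · exact torOp_far h
      · exact (torOp_far h).symm)

theorem tor_th {n : ℕ} (h : n < k) : tor (k := k) (th n : SA k) = torOp n := by
  rw [th_of_lt h]; exact lift_gen ..

theorem tor_th_succ (n : ℕ) : tor (k := k) (th (n + 1) : SA k) * tor (k := k) (th n)
    = q • (tor (k := k) (th n : SA k) * tor (k := k) (th (n + 1))) := by
  by_cases h : n + 1 < k
  · rw [tor_th h, tor_th (by omega), torOp_succ]
  · rw [show (th (n + 1) : SA k) = 0 from dif_neg h]; simp

theorem tor_th_X (j n : ℕ) : tor (k := k) (th (j + n + 1) : SA k) * tor (k := k) (X j n)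
    = q • (tor (k := k) (X j n : SA k) * tor (k := k) (th (j + n + 1))) := by
  cases n with
  | zero => exact tor_th_succ j
  | succ n =>
    have h1 := tor_th_succ (k := k) (j + n + 1)
    have h2 : Commute (tor (k := k) (th (j + n + 1 + 1) : SA k)) (tor (k := k) (X j n)) :=
      (X_far (a := j + n + 1 + 1) (by omega)).map tor
    rw [show j + (n + 1) + 1 = j + n + 1 + 1 by ring, X_succ, map_sub, map_smul, map_mul, map_mul]
    exact skew_bracket (A := Module.End Qq Tor) h1 h2

theorem tor_X_succ (j n : ℕ) : tor (k := k) (X j (n + 1) : SA k)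
    = (1 - q * q) • (tor (k := k) (X j n) * tor (k := k) (th (j + n + 1))) := by
  rw [X_succ, map_sub, map_smul, map_mul, map_mul]
  exact bracket_of_skew (A := Module.End Qq Tor) (tor_th_X j n)

theorem tor_X_e {j n : ℕ} (h : j + n < k) (c : ℕ → ℤ) :
    ∃ a : Qq, a ≠ 0 ∧ tor (k := k) (X j n : SA k) (Tor.e c) = a • Tor.e (shift j (j + n + 1) c) := by
  induction n generalizing c with
  | zero =>
    refine ⟨q ^ (-c (j + 1)), zpow_ne_zero _ q_ne_zero, ?_⟩
    rw [X_zero, tor_th (by omega), torOp_e]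
  | succ n ih =>
    obtain ⟨a, ha, h1⟩ := ih (by omega) (shift (j + n + 1) (j + n + 1 + 1) c)
    refine ⟨(1 - q * q) * (q ^ (-c (j + n + 1 + 1)) * a), mul_ne_zero one_sub_q_sq_ne_zero
      (mul_ne_zero (zpow_ne_zero _ q_ne_zero) ha), ?_⟩
    rw [tor_X_succ, LinearMap.smul_apply, Module.End.mul_apply,
      tor_th (by omega), torOp_e, map_smul,
      h1, smul_smul, smul_smul, mul_assoc]
    congr 2
    simp only [shift, add_assoc]; abel

/-- The product of the root vectors of the segments `j, …, p`, for `j` in a list. -/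
def lmon (p : ℕ) (L : List ℕ) : SA k := (L.map fun j => X j (p - j)).prod

theorem lmon_cons (p j : ℕ) (L : List ℕ) : (lmon p (j :: L) : SA k) = X j (p - j) * lmon p L := by
  simp [lmon]
theorem lmon_append (p : ℕ) (L L' : List ℕ) : (lmon p (L ++ L') : SA k) = lmon p L * lmon p L' := by
  simp [lmon]
theorem lmon_concat (p j : ℕ) (L : List ℕ) :
    (lmon p (L ++ [j]) : SA k) = lmon p L * X j (p - j) := by
  rw [lmon_append]; simp [lmon]

theorem X_q_commute' {p a b : ℕ} (ha : a ≤ p) (hb : b ≤ p) : ∃ c : Qq, c ≠ 0 ∧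
    (X a (p - a) : SA k) * X b (p - b) = c • (X b (p - b) * X a (p - a)) := by
  have hq := q_ne_zero
  rcases lt_trichotomy a b with h | rfl | h
  · have := X_q_commute (k := k) (p - b) a (b - a - 1)
    rw [show b - a - 1 + (p - b) + 1 = p - a by omega, show a + (b - a - 1) + 1 = b by omega] at this
    exact ⟨q⁻¹, inv_ne_zero hq, this⟩
  · exact ⟨1, one_ne_zero, by simp⟩
  · have := X_q_commute (k := k) (p - a) b (a - b - 1)
    rw [show a - b - 1 + (p - a) + 1 = p - b by omega, show b + (a - b - 1) + 1 = a by omega] at this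
    refine ⟨q, hq, ?_⟩
    rw [this, smul_smul, mul_inv_cancel₀ hq, one_smul]

/-- Root vectors with a common end q-commute pairwise, so the order of the factors matters only up
to a nonzero scalar. This permits indexing monomials by multisets. -/
theorem lmon_perm {p : ℕ} {L L' : List ℕ} (h : L.Perm L') (hL : ∀ j ∈ L, j ≤ p) :
    ∃ c : Qq, c ≠ 0 ∧ (lmon p L : SA k) = c • lmon p L' := by
  induction h with
  | nil => exact ⟨1, one_ne_zero, by simp⟩
  | cons x _ ih =>
    obtain ⟨c, hc, h⟩ := ih fun j hj => hL j (List.mem_cons_of_mem _ hj)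
    exact ⟨c, hc, by rw [lmon_cons, h, lmon_cons, mul_smul_comm]⟩
  | swap x y l =>
    obtain ⟨c, hc, h⟩ := X_q_commute' (k := k) (hL y (by simp)) (hL x (by simp))
    exact ⟨c, hc, by rw [lmon_cons, lmon_cons, lmon_cons, lmon_cons, ← mul_assoc, h, smul_mul_assoc,
      mul_assoc]⟩
  | trans h1 _ ih1 ih2 =>
    obtain ⟨c, hc, e1⟩ := ih1 hL
    obtain ⟨d, hd, e2⟩ := ih2 fun j hj => hL j (h1.mem_iff.mpr hj)
    exact ⟨c * d, mul_ne_zero hc hd, by rw [e1, e2, smul_smul]⟩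

theorem tor_lmon_e {p : ℕ} (hp : p < k) (L : List ℕ) (hL : ∀ j ∈ L, j ≤ p) (c : ℕ → ℤ) :
    ∃ (a : Qq) (c' : ℕ → ℤ), a ≠ 0 ∧ tor (k := k) (lmon p L : SA k) (Tor.e c) = a • Tor.e c' ∧
      ∀ j ≤ p, c' j = c j + L.count j := by
  induction L with
  | nil => exact ⟨1, c, one_ne_zero, by simp [lmon], by simp⟩
  | cons x L ih =>
    obtain ⟨a, c', ha, h1, h2⟩ := ih fun j hj => hL j (List.mem_cons_of_mem _ hj)
    have hx := hL x (by simp)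
    obtain ⟨b, hb, h3⟩ := tor_X_e (k := k) (j := x) (n := p - x) (by omega) c'
    refine ⟨a * b, shift x (x + (p - x) + 1) c', mul_ne_zero ha hb, ?_, ?_⟩
    · rw [lmon_cons, map_mul, Module.End.mul_apply, h1, map_smul, h3, smul_smul]
    · intro j hj
      rw [List.count_cons]
      have : j ≠ x + (p - x) + 1 := by omega
      simp only [shift, Pi.add_apply, Pi.sub_apply, Pi.single_apply, h2 j hj, if_neg this]
      by_cases e : j = x
      · subst e; simp; ring
      · have e' : ¬ x = j := fun h => e h.symm
        simp [e, e']

/-- The ordered monomials in the root vectors of the segments that end in `p`. -/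
def mon (p : ℕ) (m : Multiset ℕ) : SA k := lmon p m.toList

theorem mon_zero (p : ℕ) : (mon p 0 : SA k) = 1 := by simp [mon, lmon]

theorem lmon_eq_mon {p : ℕ} {L : List ℕ} (hL : ∀ j ∈ L, j ≤ p) :
    ∃ c : Qq, c ≠ 0 ∧ (lmon p L : SA k) = c • mon p (L : Multiset ℕ) :=
  lmon_perm (Multiset.coe_eq_coe.mp (Multiset.coe_toList (L : Multiset ℕ)).symm) hL

/-- Applied to one basis vector, distinct monomials give nonzero multiples of distinct basis
vectors. -/
theorem tor_mon_independent {p : ℕ} (hp : p < k) {S : Finset (Multiset ℕ)}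
    (hS : ∀ m ∈ S, ∀ j ∈ m, j ≤ p) {c : Multiset ℕ → Qq}
    (h : ∑ m ∈ S, c m • tor (k := k) (mon p m : SA k) = 0) : ∀ m ∈ S, c m = 0 := by
  have key : ∀ m : S, ∃ (a : Qq) (c' : ℕ → ℤ), a ≠ 0 ∧
      tor (k := k) (mon p m.1 : SA k) (Tor.e 0) = a • Tor.e c' ∧ ∀ j ≤ p, c' j = m.1.count j := fun m => by
    obtain ⟨a, c', h1, h2, h3⟩ := tor_lmon_e hp m.1.toList
      (fun j hj => hS _ m.2 j (Multiset.mem_toList.mp hj)) 0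
    refine ⟨a, c', h1, h2, fun j hj => ?_⟩
    rw [h3 j hj]
    conv_rhs => rw [← Multiset.coe_toList m.1, Multiset.coe_count]
    simp
  choose a w ha h1 h2 using key
  intro m hm
  have h3 := congrArg (fun f => f (Tor.e 0) (w ⟨m, hm⟩)) h
  simp only [LinearMap.sum_apply, LinearMap.smul_apply, LinearMap.zero_apply,
    Finsupp.coe_zero, Pi.zero_apply, Finsupp.finsetSum_apply] at h3
  rw [Finset.sum_eq_single_of_mem m hm] at h3
  · rw [h1 ⟨m, hm⟩] at h3
    simpa [Tor.e, ha] using h3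
  · intro m' hm' hne
    rw [h1 ⟨m', hm'⟩]
    -- The coordinates j ≤ p of the resulting weight are the multiplicities of the multiset, so the
    -- weight determines the multiset.
    have : w ⟨m', hm'⟩ ≠ w ⟨m, hm⟩ := by
      intro e
      apply hne
      ext j
      by_cases hj : j ≤ p
      · have := h2 ⟨m, hm⟩ j hj
        rw [← e, h2 _ j hj] at this
        exact_mod_cast this
      · rw [Multiset.count_eq_zero_of_notMem fun hh => hj (hS _ hm' j hh),
          Multiset.count_eq_zero_of_notMem fun hh => hj (hS _ hm j hh)]
    simp [Tor.e, this]

theorem kap_lmon (i : Fin k) (p : ℕ) (L : List ℕ) :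
    ∃ e : ℤ, kap i (lmon p L : SA k) = q ^ e • lmon p L := by
  induction L with
  | nil => exact ⟨0, by simp [lmon]⟩
  | cons x L ih =>
    obtain ⟨e, h⟩ := ih
    exact ⟨-(∑ a ∈ Finset.range (p - x + 1), ca i (x + a)) + e, by
      rw [lmon_cons, map_mul, h, kap_X, smul_mul_smul_comm, ← zpow_add₀ q_ne_zero]⟩

theorem r_lmon_of_lt {p : ℕ} (i : Fin k) (hi : (i : ℕ) < p) (L : List ℕ) (hL : ∀ j ∈ L, j ≤ p) :
    r i (lmon p L : SA k) = 0 := by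
  induction L with
  | nil => simp [lmon]
  | cons x L ih =>
    have := hL x (by simp)
    rw [lmon_cons, r_mul, ih fun j hj => hL j (List.mem_cons_of_mem _ hj), r_X_of_ne (by omega)]
    simp

/-- Removing the last letter of a root vector and multiplying by it again on the right is the
identity in the torus: the factor 1 - q² produced by r_p is the one by which the bracket collapses
there. -/
theorem tor_r_X_mul {p : ℕ} (i : Fin k) (hi : (i : ℕ) = p) {x : ℕ} (hx : x ≤ p) :
    tor (k := k) (r i (X x (p - x) : SA k)) * tor (k := k) (th p) = tor (k := k) (X x (p - x)) := by
  rcases hx.eq_or_lt with rfl | h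
  · rw [Nat.sub_self, r_X_zero hi, map_one, one_mul, X_zero]
  · obtain ⟨d, hd⟩ : ∃ d, p - x = d + 1 := ⟨p - x - 1, by omega⟩
    rw [hd, r_X_succ (by omega), tor_X_succ, map_smul, smul_mul_assoc, show x + d + 1 = p by omega]

theorem X_mul_th_p {p x : ℕ} (hx : x ≤ p) : ∃ e : ℤ,
    (X x (p - x) : SA k) * th p = q ^ e • (th p * X x (p - x)) := by
  rcases hx.eq_or_lt with rfl | h
  · exact ⟨0, by rw [Nat.sub_self, X_zero]; simp⟩
  · obtain ⟨d, hd⟩ : ∃ d, p - x = d + 1 := ⟨p - x - 1, by omega⟩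
    refine ⟨-1, ?_⟩
    have := X_mul_th_last (k := k) x d
    rw [hd, show p = x + d + 1 by omega, this, zpow_neg_one]

/-- Each factor contributes one term to r_p of the monomial, and each term is a power of q times the
same monomial after multiplication by θ_p. The sum has as many terms as there are factors, so
`sum_zpow_ne_zero` applies unless the monomial is empty. -/
theorem tor_r_lmon {p : ℕ} (i : Fin k) (hi : (i : ℕ) = p) (L : List ℕ) (hL : ∀ j ∈ L, j ≤ p) :
    ∃ l : List ℤ, l.length = L.length ∧ tor (k := k) (r i (lmon p L : SA k)) * tor (k := k) (th p)
      = (l.map fun e => q ^ e).sum • tor (k := k) (lmon p L) := by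
  induction L using List.reverseRecOn with
  | nil => exact ⟨[], by simp [lmon]⟩
  | append_singleton L x ih =>
    obtain ⟨l, hl, h⟩ := ih fun j hj => hL j (by simp [hj])
    have hx := hL x (by simp)
    obtain ⟨e, he⟩ := X_mul_th_p (k := k) hx
    set f : ℤ := -∑ a ∈ Finset.range (p - x + 1), ca i (x + a) with hf
    -- Exponent 0 belongs to the term where the last factor loses its letter. The other terms pick
    -- up `f` from κ acting on that factor and `e` from moving θ_p past it.
    refine ⟨0 :: l.map (fun e' => f + e + e'), by simp [hl], ?_⟩
    rw [lmon_concat, r_mul, kap_X, ← hf, map_add, add_mul, map_mul, map_mul, map_smul, map_mul,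
      mul_assoc, tor_r_X_mul i hi hx, mul_smul_comm, smul_mul_assoc, mul_assoc, ← map_mul tor _ (th p),
      he, map_smul, mul_smul_comm, map_mul, ← mul_assoc, h, smul_mul_assoc, smul_smul, smul_smul]
    rw [List.map_cons, List.sum_cons, add_smul, zpow_zero, one_smul, List.map_map,
      ← zpow_add₀ q_ne_zero, ← List.sum_map_mul_left]
    simp only [Function.comp_def, zpow_add₀ q_ne_zero]

end SA

end QSymPair

end

/-! ### Elements killed by all skew derivations are scalars -/

noncomputable section

namespace QSymPair

namespace SA

open NilAlg

variable {k : ℕ}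

/-- The span of the words of length at most `d` in the letters `θ_n`, `n < p`. -/
def W (k p : ℕ) : ℕ → Submodule Qq (SA k)
  | 0 => Submodule.span Qq {1}
  | d + 1 => Submodule.span Qq ({x | x ∈ W k p d} ∪ {y | ∃ x ∈ W k p d, ∃ n < p, y = x * th n})

variable {p d : ℕ}

theorem W_le_succ : W k p d ≤ W k p (d + 1) := fun x hx => Submodule.subset_span (Or.inl hx)

theorem mul_th_mem_W {x : SA k} {n : ℕ} (hx : x ∈ W k p d) (hn : n < p) :
    x * th n ∈ W k p (d + 1) := Submodule.subset_span (Or.inr ⟨x, hx, n, hn, rfl⟩)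

theorem one_mem_W (d : ℕ) : (1 : SA k) ∈ W k p d := by
  induction d with
  | zero => exact Submodule.mem_span_singleton_self 1
  | succ d ih => exact W_le_succ ih

theorem W_mono {d' : ℕ} (h : d ≤ d') : W k p d ≤ W k p d' := by
  induction h with
  | refl => exact le_rfl
  | step _ ih => exact ih.trans W_le_succ

theorem mem_W_zero {x : SA k} : x ∈ W k p 0 ↔ ∃ c : Qq, c • 1 = x := Submodule.mem_span_singleton

theorem r_mem_W (i : Fin k) (x : SA k) (hx : x ∈ W k p (d + 1)) : r i x ∈ W k p d := by
  induction d generalizing x with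
  | zero =>
    refine Submodule.span_le (p := (W k p 0).comap (r i)) |>.mpr ?_ hx
    rintro x (hx | ⟨x, hx, n, hn, rfl⟩)
    · obtain ⟨c, rfl⟩ := (mem_W_zero (p := p)).mp hx
      simp
    · obtain ⟨c, rfl⟩ := (mem_W_zero (p := p)).mp hx
      change r i _ ∈ W k p 0
      rw [smul_mul_assoc, one_mul, map_smul, r_th]
      split_ifs
      · exact Submodule.smul_mem _ _ (one_mem_W 0)
      · simp
  | succ d ih =>
    refine Submodule.span_le (p := (W k p (d + 1)).comap (r i)) |>.mpr ?_ hx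
    rintro x (hx | ⟨x, hx, n, hn, rfl⟩)
    · exact W_le_succ (ih x hx)
    · change r i _ ∈ W k p (d + 1)
      rw [r_mul_th]
      refine add_mem ?_ (Submodule.smul_mem _ _ (mul_th_mem_W (ih x hx) hn))
      split_ifs
      · exact hx
      · exact zero_mem _

theorem exists_mem_W (x : SA k) : ∃ d, x ∈ W k k d := by
  induction x using induction_right with
  | h1 => exact ⟨0, one_mem_W 0⟩
  | hm i x h =>
    obtain ⟨d, h⟩ := h
    exact ⟨d + 1, by rw [← th_val]; exact mul_th_mem_W h i.2⟩
  | ha x y hx hy =>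
    obtain ⟨d, hx⟩ := hx
    obtain ⟨d', hy⟩ := hy
    exact ⟨max d d', add_mem (W_mono (le_max_left ..) hx) (W_mono (le_max_right ..) hy)⟩
  | hs c x hx =>
    obtain ⟨d, hx⟩ := hx
    exact ⟨d, Submodule.smul_mem _ _ hx⟩

/-- The span of the products of words in the letters `θ_n`, `n < p`, of length at most `d`, and
products of root vectors of segments that end in `p`. -/
def WX (k p d : ℕ) : Submodule Qq (SA k) :=
  Submodule.span Qq {y | ∃ x ∈ W k p d, ∃ L : List ℕ, (∀ j ∈ L, j ≤ p) ∧ y = x * lmon p L}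

theorem mul_lmon_mem_WX {x : SA k} (hx : x ∈ W k p d) {L : List ℕ} (hL : ∀ j ∈ L, j ≤ p) :
    x * lmon p L ∈ WX k p d := Submodule.subset_span ⟨x, hx, L, hL, rfl⟩

theorem WX_mono {d' : ℕ} (h : d ≤ d') : WX k p d ≤ WX k p d' := by
  refine Submodule.span_le.mpr ?_
  rintro y ⟨x, hx, L, hL, rfl⟩
  exact mul_lmon_mem_WX (W_mono h hx) hL

theorem WX_mul_X {y : SA k} (hy : y ∈ WX k p d) {j : ℕ} (hj : j ≤ p) :
    y * X j (p - j) ∈ WX k p d := by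
  refine Submodule.span_le (p :=
    (WX k p d).comap (LinearMap.mulRight Qq (X j (p - j)))) |>.mpr ?_ hy
  rintro y ⟨x, hx, L, hL, rfl⟩
  change x * lmon p L * X j (p - j) ∈ WX k p d
  rw [mul_assoc, ← lmon_concat]
  refine mul_lmon_mem_WX hx fun a ha => ?_
  rcases List.mem_append.mp ha with ha | ha
  · exact hL a ha
  · rw [List.mem_singleton.mp ha]; exact hj

/-- A smaller letter moves left past a root vector ending in p up to a power of q, except when it
extends the segment by one step; then the bracket creates the root vector of the longer segment,
still ending in p. -/
theorem X_mul_th {j n : ℕ} (hj : j ≤ p) (hn : n < p) : ∃ e : ℤ,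
    (X j (p - j) : SA k) * th n = q ^ e • (th n * X j (p - j)) ∨
    n < p ∧ (X j (p - j) : SA k) * th n = q ^ e • (th n * X j (p - j) - X n (p - n)) := by
  have hq := q_ne_zero
  by_cases h1 : n + 1 < j
  · exact ⟨0, Or.inl (by rw [zpow_zero, one_smul]; exact (X_far (Or.inl h1)).eq.symm)⟩
  by_cases h2 : n + 1 = j
  · refine ⟨-1, Or.inr ⟨hn, ?_⟩⟩
    have := X_succ' (k := k) n (p - j)
    rw [h2] at this
    rw [show p - n = p - j + 1 by omega, this, sub_sub_cancel, zpow_neg_one, smul_smul,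
      inv_mul_cancel₀ hq, one_smul]
  by_cases h3 : n = j
  · refine ⟨1, Or.inl ?_⟩
    have := X_mul_th_self (k := k) j (p - j - 1)
    rw [show p - j - 1 + 1 = p - j by omega] at this
    rw [h3, this, zpow_one]
  · refine ⟨0, Or.inl ?_⟩
    have := X_middle (k := k) (n - j - 1) j (p - n - 1)
    rw [show j + (n - j - 1) + 1 = n by omega, show n - j - 1 + (p - n - 1) + 2 = p - j by omega]
      at this
    rw [zpow_zero, one_smul, this.eq]

/-- In each step the letter either travels to the left, where it lengthens the word by one, or is
absorbed into a root vector. -/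
theorem lmon_mul_th {x : SA k} (hx : x ∈ W k p d) {n : ℕ} (hn : n < p) (L : List ℕ)
    (hL : ∀ j ∈ L, j ≤ p) : x * lmon p L * th n ∈ WX k p (d + 1) := by
  induction L using List.reverseRecOn with
  | nil =>
    have := mul_lmon_mem_WX (mul_th_mem_W hx hn) (L := []) (by simp)
    simpa [lmon] using this
  | append_singleton L j ih =>
    have ih := ih fun a ha => hL a (by simp [ha])
    have hj := hL j (by simp)
    have hL' : ∀ a ∈ L, a ≤ p := fun a ha => hL a (by simp [ha])
    rw [lmon_concat, ← mul_assoc, mul_assoc _ (X j _)]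
    obtain ⟨e, h | ⟨hn', h⟩⟩ := X_mul_th (k := k) hj hn
    · rw [h, mul_smul_comm, ← mul_assoc]
      exact Submodule.smul_mem _ _ (WX_mul_X ih hj)
    · rw [h, mul_smul_comm, mul_sub, ← mul_assoc]
      exact Submodule.smul_mem _ _ (sub_mem (WX_mul_X ih hj)
        (WX_mul_X (mul_lmon_mem_WX (W_le_succ hx) hL') hn.le))

/-- The spanning half of a PBW decomposition: words in the letters up to p split into words in
smaller letters times root monomials ending in p. The bound `d` on the word length is kept because
later inductions run over it. -/
theorem W_succ_le_WX : W k (p + 1) d ≤ WX k p d := by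
  have h1 : ∀ d, (1 : SA k) ∈ WX k p d := fun d => by
    have := mul_lmon_mem_WX (k := k) (p := p) (one_mem_W d) (L := []) (by simp)
    simpa [lmon] using this
  induction d with
  | zero => exact Submodule.span_le.mpr (by rintro x rfl; exact h1 0)
  | succ d ih =>
    refine Submodule.span_le.mpr ?_
    rintro y (hy | ⟨x, hx, n, hn, rfl⟩)
    · exact WX_mono (Nat.le_succ d) (ih hy)
    -- The letter p is itself the root vector of a one-letter segment; every smaller letter is moved
    -- to the left.
    · rcases (Nat.lt_succ_iff.mp hn).eq_or_lt with rfl | hn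
      · have := WX_mul_X (WX_mono (Nat.le_succ d) (ih hx)) (le_refl n)
        rwa [Nat.sub_self, X_zero] at this
      · refine Submodule.span_le (p := (WX k p (d + 1)).comap (LinearMap.mulRight Qq (th n))) |>.mpr
          ?_ (ih hx)
        rintro y ⟨x, hx, L, hL, rfl⟩
        exact lmon_mul_th hx hn L hL

theorem exists_sum_mon {y : SA k} (hy : y ∈ W k (p + 1) d) : ∃ c : Multiset ℕ →₀ SA k,
    (∀ m, c m ∈ W k p d) ∧ (∀ m ∈ c.support, ∀ j ∈ m, j ≤ p) ∧
    y = ∑ m ∈ c.support, c m * mon p m := by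
  classical
  have key : ∀ c : Multiset ℕ →₀ SA k, ∑ m ∈ c.support, c m * mon p m
      = c.sum fun m a => a * mon p m := fun c => rfl
  simp only [key]
  refine Submodule.span_induction (p := fun y _ => ∃ c : Multiset ℕ →₀ SA k,
    (∀ m, c m ∈ W k p d) ∧ (∀ m ∈ c.support, ∀ j ∈ m, j ≤ p) ∧
    y = c.sum fun m a => a * mon p m) ?_ ?_ ?_ ?_ (W_succ_le_WX hy)
  · rintro y ⟨x, hx, L, hL, rfl⟩
    obtain ⟨a, ha, h⟩ := lmon_eq_mon (k := k) hL
    refine ⟨Finsupp.single (L : Multiset ℕ) (a • x), fun m => ?_, fun m hm j hj => ?_, ?_⟩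
    · rw [Finsupp.single_apply]
      split_ifs
      · exact Submodule.smul_mem _ _ hx
      · exact zero_mem _
    · rw [Finset.mem_singleton.mp (Finsupp.support_single_subset hm)] at hj
      exact hL j hj
    · rw [Finsupp.sum_single_index (by simp), h, mul_smul_comm, smul_mul_assoc]
  · exact ⟨0, by simp, by simp, by simp⟩
  · rintro _ _ _ _ ⟨c, h1, h2, rfl⟩ ⟨c', h1', h2', rfl⟩
    refine ⟨c + c', fun m => add_mem (h1 m) (h1' m), fun m hm => ?_, ?_⟩
    · rcases Finset.mem_union.mp (Finsupp.support_add hm) with h | h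
      · exact h2 m h
      · exact h2' m h
    · rw [Finsupp.sum_add_index (by simp) (by simp [add_mul])]
  · rintro a _ _ ⟨c, h1, h2, rfl⟩
    refine ⟨a • c, fun m => Submodule.smul_mem _ _ (h1 m), fun m hm =>
      h2 m (Finsupp.support_smul hm), ?_⟩
    rw [Finsupp.sum_smul_index' (by simp), Finsupp.smul_sum]
    simp

/-- For i < p the derivation r_i kills every root vector ending in p, so it sees only the
coefficient; the monomial contributes a power of q through κ. -/
theorem r_mul_mon (i : Fin k) (hi : (i : ℕ) < p) {m : Multiset ℕ} (hm : ∀ j ∈ m, j ≤ p) :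
    ∃ e : ℤ, ∀ x : SA k, r i (x * mon p m) = q ^ e • (r i x * mon p m) := by
  obtain ⟨e, he⟩ := kap_lmon (k := k) i p m.toList
  refine ⟨e, fun x => ?_⟩
  rw [r_mul, mon, r_lmon_of_lt i hi _ fun j hj => hm j (Multiset.mem_toList.mp hj), he, mul_zero,
    zero_add, mul_smul_comm]

/-- The elements of the algebra generated by `θ_n`, `n < p`, that are killed by the skew derivations
`r_i` are scalars. -/
def NonDeg (k p : ℕ) : Prop :=
  ∀ d, ∀ y ∈ W k p d, (∀ i : Fin k, (i : ℕ) < p → r i y = 0) → ∃ c : Qq, y = c • 1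

/-- The independence half of the PBW decomposition. Applying r_i with i < p to a relation gives a
relation among the r_i(c_m), of smaller degree; by induction these vanish, so the c_m are scalars by
`NonDeg`, and the torus representation finishes. -/
theorem mon_free (hp : p < k) (h : NonDeg k p) {S : Finset (Multiset ℕ)}
    (hS : ∀ m ∈ S, ∀ j ∈ m, j ≤ p) (c : Multiset ℕ → SA k) (hc : ∀ m ∈ S, c m ∈ W k p d)
    (h0 : ∑ m ∈ S, c m * mon p m = 0) : ∀ m ∈ S, c m = 0 := by
  -- Relations with scalar coefficients are excluded by the torus representation alone.
  have scal : ∀ c : Multiset ℕ → SA k, (∀ m ∈ S, ∃ a : Qq, c m = a • 1) →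
      ∑ m ∈ S, c m * mon p m = 0 → ∀ m ∈ S, c m = 0 := by
    intro c hc h0 m hm
    choose! a ha using hc
    have h1 : ∑ m ∈ S, a m • tor (k := k) (mon p m) = 0 := by
      rw [← map_zero tor, ← h0, map_sum]
      refine Finset.sum_congr rfl fun m hm => ?_
      rw [ha m hm, smul_mul_assoc, one_mul, map_smul]
    rw [ha m hm, tor_mon_independent hp hS h1 m hm, zero_smul]
  induction d generalizing c with
  | zero =>
    refine scal c (fun m hm => ?_) h0
    obtain ⟨a, ha⟩ := (mem_W_zero (p := p)).mp (hc m hm)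
    exact ⟨a, ha.symm⟩
  | succ d ih =>
    refine scal c (fun m hm => h _ _ (hc m hm) fun i hi => ?_) h0
    choose! e he using fun (m : Multiset ℕ) (hm : m ∈ S) => r_mul_mon (k := k) i hi (hS m hm)
    have h1 := ih (fun m => q ^ e m • r i (c m))
      (fun m hm => Submodule.smul_mem _ _ (r_mem_W i _ (hc m hm))) (by
        rw [← map_zero (r i), ← h0, map_sum]
        refine Finset.sum_congr rfl fun m hm => ?_
        rw [he m hm, smul_mul_assoc]) m hm
    exact (smul_eq_zero.mp h1).resolve_left (zpow_ne_zero _ q_ne_zero)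

/-- The derivations r_i with i < p force all coefficients in the root-monomial expansion to be
scalars. The derivation r_p multiplies each nonempty monomial, as seen in the torus, by a nonzero
sum of powers of q, so only the empty monomial survives. -/
theorem nonDeg_succ (hp : p < k) (h : NonDeg k p) : NonDeg k (p + 1) := by
  intro d y hy hr
  obtain ⟨c, h1, h2, rfl⟩ := exists_sum_mon hy
  have h3 : ∀ m ∈ c.support, ∃ a : Qq, c m = a • 1 := by
    intro m hm
    refine h d _ (h1 m) fun i hi => ?_
    choose! e he using fun (m : Multiset ℕ) (hm : m ∈ c.support) => r_mul_mon (k :=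
      k) i hi (h2 m hm)
    have h4 := mon_free hp h h2 (fun m => q ^ e m • r i (c m))
      (fun m hm => Submodule.smul_mem _ _ (r_mem_W i _ (W_le_succ (h1 m)))) (by
        rw [← hr i (by omega), map_sum]
        refine Finset.sum_congr rfl fun m hm => ?_
        rw [he m hm, smul_mul_assoc]) m hm
    exact (smul_eq_zero.mp h4).resolve_left (zpow_ne_zero _ q_ne_zero)
  choose! a ha using h3
  choose! l hl1 hl2 using fun (m : Multiset ℕ) (hm : m ∈ c.support) =>
    tor_r_lmon (k := k) ⟨p, hp⟩ rfl m.toList fun j hj => h2 m hm j (Multiset.mem_toList.mp hj)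
  -- Obtained from r_p y = 0 by applying the torus representation and multiplying by θ_p on the
  -- right.
  have h5 : ∑ m ∈ c.support, (a m * ((l m).map fun e => q ^ e).sum) • tor (k := k) (mon p m) = 0 := by
    have h6 := congrArg (fun z => tor z * tor (k := k) (th p)) (hr ⟨p, hp⟩ (by simp))
    simp only [map_zero, zero_mul, map_sum, Finset.sum_mul] at h6
    rw [← h6]
    refine Finset.sum_congr rfl fun m hm => ?_
    rw [ha m hm, smul_mul_assoc, one_mul, map_smul, map_smul, smul_mul_assoc, mon, hl2 m hm,
      smul_smul]
  have h7 := tor_mon_independent hp h2 h5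
  by_cases h0 : (0 : Multiset ℕ) ∈ c.support
  · refine ⟨a 0, ?_⟩
    rw [Finset.sum_eq_single_of_mem 0 h0, mon_zero, mul_one, ha 0 h0]
    intro m hm hne
    have := (mul_eq_zero.mp (h7 m hm)).resolve_right (sum_zpow_ne_zero _ fun e => hne ?_)
    · rw [ha m hm, this]; simp
    · have h8 := hl1 m hm
      rw [e] at h8
      simpa using h8.symm
  · refine ⟨0, ?_⟩
    rw [zero_smul]
    refine Finset.sum_eq_zero fun m hm => ?_
    have hne : m ≠ 0 := fun e => h0 (e ▸ hm)
    have := (mul_eq_zero.mp (h7 m hm)).resolve_right (sum_zpow_ne_zero _ fun e => hne ?_)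
    · rw [ha m hm, this]; simp
    · have h8 := hl1 m hm
      rw [e] at h8
      simpa using h8.symm

theorem nonDeg (hp : p ≤ k) : NonDeg k p := by
  induction p with
  | zero =>
    intro d
    induction d with
    | zero =>
      intro y hy _
      obtain ⟨a, ha⟩ := (mem_W_zero (p := p)).mp hy
      exact ⟨a, ha.symm⟩
    | succ d ih =>
      intro y hy hr
      refine ih y (Submodule.span_le.mpr ?_ hy) hr
      rintro y (hy | ⟨x, hx, n, hn, rfl⟩)
      · exact hy
      · omega
  | succ p ih => exact nonDeg_succ hp (ih (by omega))

theorem scalar_of_r_eq_zero {y : SA k} (h : ∀ i, r i y = 0) : ∃ c : Qq, y = c • 1 := by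
  obtain ⟨d, hd⟩ := exists_mem_W y
  exact nonDeg le_rfl d y hd fun i _ => h i

end SA

end QSymPair

end

/-! ### Weight spaces -/

noncomputable section

namespace QSymPair

namespace NilAlg

variable {s : Prop} {k : ℕ}

/-- The product of the letters of a word. -/
def word (l : List (Fin k)) : NilAlg s k := (l.map gen).prod

@[simp] theorem word_nil : (word [] : NilAlg s k) = 1 := rfl
@[simp] theorem word_cons (i : Fin k) (l : List (Fin k)) :
    (word (i :: l) : NilAlg s k) = gen i * word l := by simp [word]
theorem word_concat (i : Fin k) (l : List (Fin k)) :
    (word (l ++ [i]) : NilAlg s k) = word l * gen i := by simp [word]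

/-- The number of occurrences of the letters in a word. -/
def content (l : List (Fin k)) : Fin k → ℕ := fun i => l.count i

@[simp] theorem content_nil : content ([] : List (Fin k)) = 0 := rfl
@[simp] theorem content_cons (i : Fin k) (l : List (Fin k)) :
    content (i :: l) = content l + Pi.single i 1 := by
  funext j
  by_cases h : j = i
  · subst h; simp [content]
  · have h' : ¬ i = j := fun e => h e.symm
    simp [content, List.count_cons, h, h', Pi.single_apply]
theorem content_concat (i : Fin k) (l : List (Fin k)) :
    content (l ++ [i]) = content l + Pi.single i 1 := by
  rw [← content_cons]; funext j; simp [content, List.count_append, List.count_cons, add_comm]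

/-- The weight spaces. -/
def wt (μ : Fin k → ℕ) : Submodule Qq (NilAlg s k) :=
  Submodule.span Qq {x | ∃ l : List (Fin k), content l = μ ∧ x = word l}

theorem word_mem_wt (l : List (Fin k)) : (word l : NilAlg s k) ∈ wt (content l) :=
  Submodule.subset_span ⟨l, rfl, rfl⟩

theorem wt_le {μ : Fin k → ℕ} {S : Submodule Qq (NilAlg s k)}
    (h : ∀ l, content l = μ → word l ∈ S) : wt μ ≤ S :=
  Submodule.span_le.mpr (by rintro _ ⟨l, hl, rfl⟩; exact h l hl)

theorem eq_top_of_word_mem {S : Submodule Qq (NilAlg s k)} (h : ∀ l, word l ∈ S) (x : NilAlg s k) :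
    x ∈ S := by
  suffices h' : x ∈ Submodule.span Qq (Set.range (word : List (Fin k) → NilAlg s k)) from
    Submodule.span_le.mpr (by rintro _ ⟨l, rfl⟩; exact h l) h'
  induction x using induction_left with
  | h1 => exact Submodule.subset_span ⟨[], rfl⟩
  | hm i x h =>
    refine Submodule.span_le (p := (Submodule.span Qq (Set.range word)).comap
      (LinearMap.mulLeft Qq (gen i))) |>.mpr ?_ h
    rintro _ ⟨l, rfl⟩
    exact Submodule.subset_span ⟨i :: l, word_cons i l⟩
  | ha x y hx hy => exact add_mem hx hy
  | hs c x hx => exact Submodule.smul_mem _ _ hx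

theorem one_mem_wt : (1 : NilAlg s k) ∈ wt 0 := word_mem_wt []

theorem gen_mul_mem_wt {μ : Fin k → ℕ} (i : Fin k) {x : NilAlg s k} (h : x ∈ wt μ) :
    gen i * x ∈ wt (μ + Pi.single i 1) := by
  refine wt_le (S := (wt (μ + Pi.single i 1)).comap (LinearMap.mulLeft Qq (gen i))) ?_ h
  rintro l rfl
  have := word_mem_wt (s := s) (i :: l)
  rwa [word_cons, content_cons] at this

theorem mul_gen_mem_wt {μ : Fin k → ℕ} (i : Fin k) {x : NilAlg s k} (h : x ∈ wt μ) :
    x * gen i ∈ wt (μ + Pi.single i 1) := by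
  refine wt_le (S := (wt (μ + Pi.single i 1)).comap (LinearMap.mulRight Qq (gen i))) ?_ h
  rintro l rfl
  have := word_mem_wt (s := s) (l ++ [i])
  rwa [word_concat, content_concat] at this

theorem kap_of_mem_wt {μ : Fin k → ℕ} (i : Fin k) {x : NilAlg s k} (h : x ∈ wt μ) :
    kap i x = q ^ (-∑ j, cartan i j * μ j) • x := by
  refine wt_le (S := LinearMap.eqLocus (kap i).toLinearMap
    (q ^ (-∑ j, cartan i j * μ j) • LinearMap.id)) ?_ h
  rintro l rfl
  change kap i (word l) = q ^ (-∑ j, cartan i j * (content l j : ℤ)) • word l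
  clear h
  induction l with
  | nil => simp
  | cons a l ih =>
    rw [word_cons, map_mul, ih, kap_gen, smul_mul_smul_comm, ← zpow_add₀ q_ne_zero, content_cons]
    congr 2
    simp only [Pi.add_apply, Nat.cast_add, mul_add, Finset.sum_add_distrib, neg_add]
    rw [add_comm]
    congr 2
    rw [Finset.sum_eq_single a (fun b _ hb => by simp [Pi.single_apply, hb]) (by simp)]
    simp

/-- Common argument for r_i and l_i: an operator that either passes a first letter up to a scalar or
removes it lowers the weight by α_i. -/
theorem letter_removal (i : Fin k) (D : NilAlg s k →ₗ[Qq] NilAlg s k) (h1 : D 1 = 0)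
    (hD : ∀ a l, ∃ c c' : Qq, D (gen a * word l)
      = c • (gen a * D (word l)) + if i = a then c' • word l else 0) (l : List (Fin k)) :
    (content l i = 0 → D (word l) = 0) ∧ ∀ μ, content l = μ + Pi.single i 1 → D (word l) ∈ wt μ := by
  induction l with
  | nil =>
    refine ⟨fun _ => by simpa using h1, fun μ h => ?_⟩
    have := congrFun h i
    simp at this
  | cons a l ih =>
    obtain ⟨c, c', e⟩ := hD a l
    rw [content_cons, word_cons, e]
    constructor
    · intro h
      have h1 : content l i = 0 := by
        have := Nat.eq_zero_of_add_eq_zero_right h; exact this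
      have h2 : i ≠ a := by
        rintro rfl
        simp at h
      rw [ih.1 h1, if_neg h2]; simp
    · intro μ h
      by_cases hi : i = a
      · subst hi
        have h' := add_right_cancel h
        rw [if_pos rfl]
        refine add_mem (Submodule.smul_mem _ _ ?_)
          (Submodule.smul_mem _ _ (h' ▸ word_mem_wt l))
        by_cases h0 : content l i = 0
        · rw [ih.1 h0]; simp
        · have h1 : content l = (content l - Pi.single i 1) + Pi.single i 1 := by
            funext j
            by_cases hj : j = i
            · subst hj; simp; omega
            · simp [Pi.single_apply, hj]
          have := gen_mul_mem_wt i (ih.2 _ h1)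
          rwa [← h1, h'] at this
      · rw [if_neg hi, add_zero]
        have h1 : content l = (μ - Pi.single a 1) + Pi.single i 1 := by
          funext j
          have := congrFun h j
          simp only [Pi.add_apply, Pi.sub_apply, Pi.single_apply] at this ⊢
          split_ifs at this ⊢ <;> omega
        have h2 : μ = μ - Pi.single a 1 + Pi.single a 1 := by
          funext j
          have := congrFun h j
          have h3 : a ≠ i := fun e => hi e.symm
          simp only [Pi.add_apply, Pi.sub_apply, Pi.single_apply] at this ⊢
          split_ifs at this ⊢ <;> omega
        have := gen_mul_mem_wt a (ih.2 _ h1)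
        rw [← h2] at this
        exact Submodule.smul_mem _ _ this

theorem r_word (i : Fin k) (l : List (Fin k)) : (content l i = 0 → r i (word l : NilAlg s k) = 0) ∧
    ∀ μ, content l = μ + Pi.single i 1 → r i (word l : NilAlg s k) ∈ wt μ :=
  letter_removal i (r i) (r_one i) (fun a l => ⟨1, _, by
    rw [r_gen_mul, kap_of_mem_wt i (word_mem_wt l), one_smul]⟩) l

theorem l_word (i : Fin k) (w : List (Fin k)) : (content w i = 0 → l i (word w : NilAlg s k) = 0) ∧
    ∀ μ, content w = μ + Pi.single i 1 → l i (word w : NilAlg s k) ∈ wt μ :=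
  letter_removal i (l i) (l_one i) (fun a w => ⟨q ^ (-cartan i a), 1, by
    rw [l_gen_mul, one_smul, add_comm]⟩) w

theorem l_mem_wt {μ : Fin k → ℕ} {i : Fin k} {x : NilAlg s k} (h : x ∈ wt (μ + Pi.single i 1)) :
    l i x ∈ wt μ :=
  wt_le (S := (wt μ).comap (l i)) (fun w hw => (l_word i w).2 μ hw) h

theorem l_eq_zero {μ : Fin k → ℕ} {i : Fin k} {x : NilAlg s k} (h : x ∈ wt μ) (h0 : μ i = 0) :
    l i x = 0 :=
  wt_le (S := LinearMap.ker (l i)) (fun w hw => (l_word i w).1 (by rw [hw, h0])) h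

theorem r_mem_wt {μ : Fin k → ℕ} {i : Fin k} {x : NilAlg s k} (h : x ∈ wt (μ + Pi.single i 1)) :
    r i x ∈ wt μ :=
  wt_le (S := (wt μ).comap (r i)) (fun l hl => (r_word i l).2 μ hl) h

theorem r_eq_zero {μ : Fin k → ℕ} {i : Fin k} {x : NilAlg s k} (h : x ∈ wt μ) (h0 : μ i = 0) :
    r i x = 0 :=
  wt_le (S := LinearMap.ker (r i)) (fun l hl => (r_word i l).1 (by rw [hl, h0])) h

theorem exists_add_single {μ : Fin k → ℕ} {i : Fin k} (h : μ i ≠ 0) :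
    ∃ ν : Fin k → ℕ, μ = ν + Pi.single i 1 := by
  refine ⟨μ - Pi.single i 1, ?_⟩
  funext j
  by_cases hj : j = i
  · subst hj; simp; omega
  · simp [Pi.single_apply, hj]

theorem counit_eq_zero {μ : Fin k → ℕ} {x : NilAlg s k} (h : x ∈ wt μ) (h0 : μ ≠ 0) :
    counit x = 0 := by
  refine wt_le (S := LinearMap.ker counit.toLinearMap) ?_ h
  rintro (_ | ⟨a, l⟩) rfl
  · exact absurd rfl h0
  · simp

theorem mem_wt_zero {x : NilAlg s k} (h : x ∈ wt 0) : x = counit x • 1 := by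
  refine wt_le (S := LinearMap.eqLocus LinearMap.id
    ((LinearMap.toSpanSingleton Qq (NilAlg s k) 1).comp counit.toLinearMap)) ?_ h
  rintro (_ | ⟨a, l⟩) h
  · simp
  · have := congrFun h a
    simp at this

instance (μ : Fin k → ℕ) : FiniteDimensional Qq (wt μ : Submodule Qq (NilAlg s k)) := by
  apply FiniteDimensional.span_of_finite
  have h : {l : List (Fin k) | content l = μ}.Finite := by
    refine (List.finite_length_eq (Fin k) (∑ i, μ i)).subset ?_
    rintro l rfl
    change l.length = _
    simpa [content] using (Multiset.sum_count_eq_card (s := Finset.univ) (m :=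
      (l : Multiset (Fin k)))
      fun a _ => Finset.mem_univ a).symm
  refine (h.image word).subset ?_
  rintro _ ⟨l, hl, rfl⟩
  exact ⟨l, hl, rfl⟩

end NilAlg

/-! ### Lusztig's form and its canonical elements -/

namespace SA

open NilAlg

variable {k : ℕ}

/-- The Serre relation for the removal operators survives adding a letter by `m`. Here δ and δ'
record whether that letter is hit and c, c' are the powers of q picked up in passing it; `e1`–`e3`
say that the terms in which the letter is removed cancel. -/
theorem serre_skew {R X : Type*} [Field R] [AddCommGroup X] [Module R X] {ρ ρ' m : X →ₗ[R] X}
    {δ δ' c c' p : R} (h1 : ∀ x, ρ (m x) = δ • x + c • m (ρ x))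
    (h2 : ∀ x, ρ' (m x) = δ' • x + c' • m (ρ' x)) (e1 : δ' * (1 + c * c - p * c) = 0)
    (e2 : δ * (c' * (1 + c) - p) = 0) (e3 : δ * (1 + c - p * c * c') = 0) {x : X}
    (hx : ρ (ρ (ρ' x)) + ρ' (ρ (ρ x)) = p • ρ (ρ' (ρ x))) :
    ρ (ρ (ρ' (m x))) + ρ' (ρ (ρ (m x))) = p • ρ (ρ' (ρ (m x))) := by
  have hx' : m (ρ (ρ (ρ' x))) = p • m (ρ (ρ' (ρ x))) - m (ρ' (ρ (ρ x))) := by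
    rw [← map_smul, ← hx, map_add]; abel
  simp only [h1, h2, map_add, map_smul, hx', smul_add, smul_sub, smul_smul]
  match_scalars <;> first | ring1 | linear_combination e1 | linear_combination e2 |
    linear_combination e3

/-- Needed so that θ_i ↦ r_i defines an action of U_q(n⁻) on itself, which is what the form is built
from. -/
theorem r_serre {i j : Fin k} (h : Adjacent i j) (x : SA k) :
    r i (r i (r j x)) + r j (r i (r i x)) = (q + q⁻¹) • r i (r j (r i x)) := by
  have hq := q_ne_zero
  induction x using induction_right with
  | h1 => simp
  | hm a x hx =>
    have hm : ∀ (i : Fin k) (x : SA k), r i (LinearMap.mulRight Qq (gen a) x)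
        = (if i = a then (1 : Qq) else 0) • x
          + q ^ (-cartan i a) • LinearMap.mulRight Qq (gen a) (r i x) := fun i x => by
      rw [LinearMap.mulRight_apply, LinearMap.mulRight_apply, r_mul_gen]; split_ifs <;> simp
    refine serre_skew (m := LinearMap.mulRight Qq (gen a)) (hm i) (hm j) ?_ ?_ ?_ hx
    · split_ifs with h1
      · subst h1; rw [cartan_adjacent h, neg_neg, zpow_one]; field_simp; ring
      · simp
    · split_ifs with h1
      · subst h1; rw [cartan_adjacent h.symm, cartan_self, ← zpow_two_neg, neg_neg, zpow_one]
        field_simp; ring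
      · simp
    · split_ifs with h1
      · subst h1; rw [cartan_adjacent h.symm, cartan_self, ← zpow_two_neg, neg_neg, zpow_one]
        field_simp; ring
      · simp
  | ha x y hx hy => simp only [map_add, smul_add, ← hx, ← hy]; abel
  | hs c x hx => simp only [map_smul, smul_comm _ c, ← hx, smul_add]

theorem r_far {i j : Fin k} (h : Far i j) (x : SA k) : r i (r j x) = r j (r i x) := by
  induction x using induction_right with
  | h1 => simp
  | hm a x hx =>
    simp only [r_mul_gen, map_add, map_smul, hx]
    have h1 := cartan_far h
    have h2 := cartan_far h.symm
    have h3 := far_ne h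
    by_cases hi : i = a
    · subst hi
      simp [h1, h2, h3.symm, add_comm, smul_smul, mul_comm]
    · by_cases hj : j = a
      · subst hj
        simp [h1, h2, h3, add_comm, smul_smul, mul_comm]
      · simp [hi, hj, smul_smul, mul_comm]
  | ha x y hx hy => simp only [map_add, hx, hy]
  | hs c x hx => simp only [map_smul, hx]

/-- The action on itself in which `θ_i` acts by `r_i`. -/
def rAct : SA k →ₐ[Qq] Module.End Qq (SA k) :=
  lift r (fun _ i j h => LinearMap.ext fun x => by
      rw [pow_two]; exact r_serre h x)
    (fun _ i j h => LinearMap.ext fun x => r_far h x)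

/-- Lusztig's bilinear form. -/
def form : SA k →ₗ[Qq] SA k →ₗ[Qq] Qq :=
  (LinearMap.compRight Qq (counit (k := k) (s := True)).toLinearMap).comp rAct.toLinearMap

theorem form_apply (x y : SA k) : form x y = counit (rAct x y) := rfl

theorem form_one_left (y : SA k) : form 1 y = counit y := by rw [form_apply, map_one]; rfl

theorem form_mul_gen_left (x y : SA k) (i : Fin k) : form (x * gen i) y = form x (r i y) := by
  rw [form_apply, form_apply, map_mul, Module.End.mul_apply, rAct, lift_gen]

/-- The form is defined by the adjunction in its left argument. The adjunction in the right argument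
holds because both sides obey the same recursion in the last letter of x, by symmetry of the Cartan
matrix; symmetry of the form is a consequence. -/
theorem form_mul_gen_right (x y : SA k) (i : Fin k) : form x (y * gen i) = form (r i x) y := by
  induction x using induction_right generalizing y with
  | h1 => simp [form_one_left]
  | hm j x hx =>
    rw [form_mul_gen_left, r_mul_gen, r_mul_gen, map_add, map_smul, hx, map_add, map_smul,
      LinearMap.add_apply, LinearMap.smul_apply, form_mul_gen_left, cartan_symm]
    congr 1
    by_cases h : i = j
    · subst h; simp
    · have h' : ¬ j = i := fun e => h e.symm
      simp [h, h']
  | ha x x' hx hx' => simp only [map_add, LinearMap.add_apply, hx, hx']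
  | hs c x hx => simp only [map_smul, LinearMap.smul_apply, hx]

theorem form_symm (x y : SA k) : form x y = form y x := by
  induction x using induction_right generalizing y with
  | h1 =>
    rw [form_one_left]
    induction y using induction_right with
    | h1 => simp [form_one_left]
    | hm j y hy => rw [form_mul_gen_left]; simp
    | ha x x' hx hx' => simp only [map_add, LinearMap.add_apply, hx, hx']
    | hs c x hx => simp only [map_smul, LinearMap.smul_apply, hx]
  | hm j x hx => rw [form_mul_gen_left, hx, form_mul_gen_right]
  | ha x x' hx hx' => simp only [map_add, LinearMap.add_apply, hx, hx']
  | hs c x hx => simp only [map_smul, LinearMap.smul_apply, hx]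

/-- The left adjunction follows from the right one because l_i commutes with every r_j and ε ∘ l_i =
ε ∘ r_i. -/
theorem form_gen_mul_left (x y : SA k) (i : Fin k) : form (gen i * x) y = form x (l i y) := by
  induction x using induction_right generalizing y with
  | h1 =>
    rw [mul_one, form_one_left, counit_l]
    have := form_mul_gen_left 1 y i
    rw [one_mul, form_one_left] at this
    exact this
  | hm j x hx => rw [← mul_assoc, form_mul_gen_left, hx, l_r, form_mul_gen_left]
  | ha x x' hx hx' => simp only [mul_add, map_add, LinearMap.add_apply, hx, hx']
  | hs c x hx => simp only [mul_smul_comm, map_smul, LinearMap.smul_apply, hx]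

theorem form_gen_mul_right (x y : SA k) (i : Fin k) : form x (gen i * y) = form (l i x) y := by
  rw [form_symm, form_gen_mul_left, form_symm]

theorem form_eq_zero {μ ν : Fin k → ℕ} (h : μ ≠ ν) {x y : SA k} (hx : x ∈ wt μ) (hy : y ∈ wt ν) :
    form x y = 0 := by
  refine wt_le (S := LinearMap.ker (form.flip y)) ?_ hx
  rintro l rfl
  change form (word l) y = 0
  clear hx
  induction l using List.reverseRecOn generalizing y ν with
  | nil => rw [word_nil, form_one_left]; exact counit_eq_zero hy h.symm
  | append_singleton l i ih =>
    rw [word_concat, form_mul_gen_left]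
    rw [content_concat] at h
    by_cases h0 : ν i = 0
    · rw [r_eq_zero hy h0, map_zero]
    · obtain ⟨ν', rfl⟩ := exists_add_single h0
      exact ih (r_mem_wt hy) (fun e => h (by rw [e]))

/-- If y lies in the radical, so does each r_i y by adjunction. These have lower degree and vanish
by induction, so y is a scalar, and pairing with 1 shows that it is zero. -/
theorem eq_zero_of_form {y : SA k} (h : ∀ l, form (word l) y = 0) : y = 0 := by
  have key : ∀ (n : ℕ) (y : SA k), y ∈ W k k n → (∀ x, form x y = 0) → y = 0 := by
    intro n
    induction n with
    | zero =>
      intro y hy hf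
      obtain ⟨c, rfl⟩ := (mem_W_zero (p := k)).mp hy
      have := hf 1
      rw [form_one_left] at this
      simp at this
      simp [this]
    | succ n ih =>
      intro y hy hf
      obtain ⟨c, rfl⟩ := scalar_of_r_eq_zero (y := y) fun i =>
        ih _ (r_mem_W i y hy) fun x => by rw [← form_mul_gen_left, hf]
      have := hf 1
      rw [form_one_left] at this
      simp at this
      simp [this]
  obtain ⟨n, hn⟩ := exists_mem_W y
  exact key n y hn fun x => eq_top_of_word_mem (S := LinearMap.ker (form.flip y)) h x

theorem eq_zero_of_form_wt {μ : Fin k → ℕ} {y : SA k} (hy : y ∈ wt μ)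
    (h : ∀ x ∈ wt μ, form x y = 0) :
    y = 0 := by
  refine eq_zero_of_form fun l => ?_
  by_cases e : content l = μ
  · exact h _ (e ▸ word_mem_wt l)
  · exact form_eq_zero e (word_mem_wt l) hy

/-- Weight spaces are finite-dimensional and the form is nondegenerate on each of them, so it
represents every functional. -/
theorem exists_form_eq (μ : Fin k → ℕ) (φ : SA k →ₗ[Qq] Qq) :
    ∃ y ∈ wt μ, ∀ x ∈ wt μ, form x y = φ x := by
  let D : (wt μ : Submodule Qq (SA k)) →ₗ[Qq] Module.Dual Qq (wt μ : Submodule Qq (SA k)) :=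
    (LinearMap.lcomp Qq Qq (wt μ).subtype).comp (form.comp (wt μ).subtype)
  have hD : ∀ y x, D y x = form (y : SA k) (x : SA k) := fun y x => rfl
  have hinj : Function.Injective D := by
    rw [← LinearMap.ker_eq_bot, LinearMap.ker_eq_bot']
    intro y hy
    refine Subtype.ext (eq_zero_of_form_wt y.2 fun x hx => ?_)
    rw [form_symm, ← hD y ⟨x, hx⟩, hy]; rfl
  obtain ⟨y, hy⟩ := (LinearMap.injective_iff_surjective_of_finrank_eq_finrank
    (Subspace.dual_finrank_eq (K := Qq)).symm).mp hinj (φ.comp (wt μ).subtype)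
  refine ⟨y, y.2, fun x hx => ?_⟩
  rw [form_symm, ← hD y ⟨x, hx⟩, hy]; rfl

/-- `a ⊗ b ↦ (x, b) a`. -/
def slice (x : SA k) : SA k ⊗[Qq] SA k →ₗ[Qq] SA k :=
  (TensorProduct.rid Qq (SA k)).toLinearMap.comp (LinearMap.lTensor (SA k) (form x))

@[simp] theorem slice_tmul (x a b : SA k) : slice x (a ⊗ₜ b) = form x b • a := by
  simp [slice]

theorem map_zero_slice (Z : SA k ⊗[Qq] SA k) : slice (0 : SA k) Z = 0 := by
  simp [slice]

/-- With the left factor expanded in a basis, the coordinates of the slices are the pairings of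
words with the right-hand coefficients, and these determine the coefficients. -/
theorem eq_zero_of_slice {Z : SA k ⊗[Qq] SA k} (h : ∀ l, slice (word l) Z = 0) : Z = 0 := by
  let b := Module.Basis.ofVectorSpace Qq (SA k)
  obtain ⟨c, rfl⟩ := TensorProduct.eq_repr_basis_left b Z
  suffices hc : c = 0 by rw [hc]; simp
  ext i
  rw [Finsupp.zero_apply]
  refine eq_zero_of_form fun l => ?_
  have h1 := congrArg (fun z => b.repr z i) (h l)
  simp only [Finsupp.sum, map_sum, slice_tmul, map_smul, Module.Basis.repr_self, map_zero,
    Finsupp.coe_zero, Pi.zero_apply, Finsupp.finsetSum_apply, Finsupp.smul_apply,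
    smul_eq_mul] at h1
  by_cases h2 : i ∈ c.support
  · rw [Finset.sum_eq_single_of_mem i h2 fun j _ hj => by
      rw [Finsupp.single_eq_of_ne hj.symm, mul_zero], Finsupp.single_eq_same, mul_one] at h1
    exact h1
  · rw [Finsupp.notMem_support_iff.mp h2, map_zero]

/-- The sum of b_i ⊗ y_i over a basis b_i of the weight space and its dual basis y_i. Slicing
reproduces elements of that weight and kills all other weights; by `eq_zero_of_slice` this
characterises the element. -/
theorem exists_canon (ν : Fin k → ℕ) : ∃ Z : SA k ⊗[Qq] SA k,
    Z ∈ Submodule.map₂ (TensorProduct.mk Qq (SA k) (SA k)) (wt ν) (wt ν) ∧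
    ∀ μ, ∀ x ∈ wt μ, slice x Z = if μ = ν then x else 0 := by
  let b := Module.finBasis Qq (wt ν : Submodule Qq (SA k))
  have hφ : ∀ i, ∃ φ : SA k →ₗ[Qq] Qq, φ.comp (wt ν).subtype = b.coord i := fun i =>
    LinearMap.exists_extend _
  choose φ hφ using hφ
  choose y hy1 hy2 using fun i => exists_form_eq ν (φ i)
  refine ⟨∑ i, (b i : SA k) ⊗ₜ y i, ?_, ?_⟩
  · exact sum_mem fun i _ => Submodule.apply_mem_map₂ _ (b i).2 (hy1 i)
  · intro μ x hx
    rw [map_sum]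
    simp only [slice_tmul]
    split_ifs with h
    · subst h
      have : ∀ i, form x (y i) = b.repr ⟨x, hx⟩ i := fun i => by
        rw [hy2 i x hx]; exact LinearMap.congr_fun (hφ i) ⟨x, hx⟩
      simp only [this]
      have := congrArg Subtype.val (b.sum_repr ⟨x, hx⟩)
      rw [AddSubmonoidClass.coe_finsetSum] at this
      exact this
    · exact Finset.sum_eq_zero fun i _ => by rw [form_eq_zero h hx (hy1 i), zero_smul]

/-- The canonical element of the form on a weight space. -/
def canon (ν : Fin k → ℕ) : SA k ⊗[Qq] SA k := (exists_canon ν).choose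

theorem canon_mem (ν : Fin k → ℕ) :
    canon ν ∈ Submodule.map₂ (TensorProduct.mk Qq (SA k) (SA k)) (wt ν) (wt ν) :=
  (exists_canon ν).choose_spec.1

theorem slice_canon {μ : Fin k → ℕ} (ν : Fin k → ℕ) {x : SA k} (hx : x ∈ wt μ) :
    slice x (canon ν) = if μ = ν then x else 0 :=
  (exists_canon ν).choose_spec.2 μ x hx

theorem tensor_ext_of_slice {Z Z' : SA k ⊗[Qq] SA k}
    (h : ∀ μ, ∀ x ∈ wt μ, slice x Z = slice x Z') : Z = Z' := by
  rw [← sub_eq_zero]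
  refine eq_zero_of_slice fun l => ?_
  rw [map_sub, h _ _ (word_mem_wt l), sub_self]

theorem canon_zero : (canon 0 : SA k ⊗[Qq] SA k) = 1 := by
  refine tensor_ext_of_slice fun μ x hx => ?_
  rw [slice_canon _ hx, Algebra.TensorProduct.one_def, slice_tmul, form_symm, form_one_left]
  split_ifs with h
  · subst h; exact mem_wt_zero hx
  · rw [counit_eq_zero hx h, zero_smul]

theorem slice_linear {f g : SA k ⊗[Qq] SA k →ₗ[Qq] SA k} (h : ∀ a b, f (a ⊗ₜ b) = g (a ⊗ₜ b))
    (Z : SA k ⊗[Qq] SA k) : f Z = g Z :=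
  LinearMap.congr_fun (TensorProduct.ext' h) Z

theorem slice_mul_left (x a : SA k) (Z : SA k ⊗[Qq] SA k) :
    slice x ((a ⊗ₜ 1) * Z) = a * slice x Z :=
  slice_linear (f := (slice x).comp (LinearMap.mulLeft Qq (a ⊗ₜ 1)))
    (g := (LinearMap.mulLeft Qq a).comp (slice x)) (fun c d => by simp) Z
theorem slice_mul_right (x a : SA k) (Z : SA k ⊗[Qq] SA k) :
    slice x (Z * (a ⊗ₜ 1)) = slice x Z * a :=
  slice_linear (f := (slice x).comp (LinearMap.mulRight Qq (a ⊗ₜ 1)))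
    (g := (LinearMap.mulRight Qq a).comp (slice x)) (fun c d => by simp) Z
theorem slice_mul_gen (x : SA k) (i : Fin k) (Z : SA k ⊗[Qq] SA k) :
    slice x (Z * (1 ⊗ₜ gen i)) = slice (r i x) Z :=
  slice_linear (f := (slice x).comp (LinearMap.mulRight Qq (1 ⊗ₜ gen i)))
    (g := slice (r i x)) (fun c d => by simp [form_mul_gen_right]) Z
theorem slice_gen_mul (x : SA k) (i : Fin k) (Z : SA k ⊗[Qq] SA k) :
    slice x ((1 ⊗ₜ gen i) * Z) = slice (l i x) Z :=
  slice_linear (f := (slice x).comp (LinearMap.mulLeft Qq (1 ⊗ₜ gen i)))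
    (g := slice (l i x)) (fun c d => by simp [form_gen_mul_right]) Z
theorem slice_lTensor_r (x : SA k) (i : Fin k) (Z : SA k ⊗[Qq] SA k) :
    slice x ((r i).lTensor (SA k) Z) = slice (x * gen i) Z :=
  slice_linear (f := (slice x).comp ((r i).lTensor (SA k)))
    (g := slice (x * gen i)) (fun c d => by simp [form_mul_gen_left]) Z
theorem slice_lTensor_l (x : SA k) (i : Fin k) (Z : SA k ⊗[Qq] SA k) :
    slice x ((l i).lTensor (SA k) Z) = slice (gen i * x) Z :=
  slice_linear (f := (slice x).comp ((l i).lTensor (SA k)))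
    (g := slice (gen i * x)) (fun c d => by simp [form_gen_mul_left]) Z
theorem slice_rTensor (x : SA k) (f : SA k →ₗ[Qq] SA k) (Z : SA k ⊗[Qq] SA k) :
    slice x (f.rTensor (SA k) Z) = f (slice x Z) :=
  slice_linear (f := (slice x).comp (f.rTensor (SA k)))
    (g := f.comp (slice x)) (fun c d => by simp) Z

/-- Compare slices: r_i on the right leg turns into multiplication of the test vector by θ_i, which
the canonical element reproduces on the left leg. -/
theorem canon_r {ν : Fin k → ℕ} (i : Fin k) :
    (r i).lTensor (SA k) (canon (ν + Pi.single i 1)) = canon ν * (gen i ⊗ₜ 1) := by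
  refine tensor_ext_of_slice fun μ x hx => ?_
  rw [slice_lTensor_r, slice_mul_right, slice_canon _ (mul_gen_mem_wt i hx), slice_canon _ hx]
  simp only [add_left_inj, ite_mul, zero_mul]

theorem canon_l {ν : Fin k → ℕ} (i : Fin k) :
    (l i).lTensor (SA k) (canon (ν + Pi.single i 1)) = (gen i ⊗ₜ 1) * canon ν := by
  refine tensor_ext_of_slice fun μ x hx => ?_
  rw [slice_lTensor_l, slice_mul_left, slice_canon _ (gen_mul_mem_wt i hx), slice_canon _ hx]
  simp only [add_left_inj, mul_ite, mul_zero]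

/-- Here the derivation acts on the reproduced vector itself; test vectors without the letter θ_i
make both sides vanish, hence the case distinction. -/
theorem canon_r_left {ν : Fin k → ℕ} (i : Fin k) :
    (r i).rTensor (SA k) (canon (ν + Pi.single i 1)) = canon ν * (1 ⊗ₜ gen i) := by
  refine tensor_ext_of_slice fun μ x hx => ?_
  rw [slice_rTensor, slice_mul_gen, slice_canon _ hx]
  by_cases h0 : μ i = 0
  · rw [r_eq_zero hx h0, map_zero_slice]
    split_ifs
    · exact r_eq_zero hx h0
    · simp
  · obtain ⟨μ', rfl⟩ := exists_add_single h0
    rw [slice_canon _ (r_mem_wt hx)]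
    simp only [add_left_inj, apply_ite (r i), map_zero]

theorem canon_l_left {ν : Fin k → ℕ} (i : Fin k) :
    (l i).rTensor (SA k) (canon (ν + Pi.single i 1)) = (1 ⊗ₜ gen i) * canon ν := by
  refine tensor_ext_of_slice fun μ x hx => ?_
  rw [slice_rTensor, slice_gen_mul, slice_canon _ hx]
  by_cases h0 : μ i = 0
  · rw [l_eq_zero hx h0, map_zero_slice]
    split_ifs
    · exact l_eq_zero hx h0
    · simp
  · obtain ⟨μ', rfl⟩ := exists_add_single h0
    rw [slice_canon _ (l_mem_wt hx)]
    simp only [add_left_inj, apply_ite (l i), map_zero]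

end SA

end QSymPair

end

/-! ### The functional behind the intertwiner -/

noncomputable section

namespace QSymPair

namespace NilAlg

variable {k : ℕ}

section Degree

variable {s : Prop}

/-- The span of the words of length at most `d`. -/
def deg (d : ℕ) : Submodule Qq (NilAlg s k) :=
  Submodule.span Qq {x | ∃ l : List (Fin k), l.length ≤ d ∧ x = word l}

theorem word_mem_deg {l : List (Fin k)} {d : ℕ} (h : l.length ≤ d) :
    (word l : NilAlg s k) ∈ deg d := Submodule.subset_span ⟨l, h, rfl⟩

theorem deg_le {d : ℕ} {S : Submodule Qq (NilAlg s k)} (h : ∀ l, l.length ≤ d → word l ∈ S) :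
    deg d ≤ S := Submodule.span_le.mpr (by rintro _ ⟨l, hl, rfl⟩; exact h l hl)

theorem deg_mono {d e : ℕ} (h : d ≤ e) : (deg d : Submodule Qq (NilAlg s k)) ≤ deg e :=
  deg_le fun _ hl => word_mem_deg (hl.trans h)

/-- The step may use the statement for all of `deg d`, not only for x. This is needed because the
rules for L involve l_j x or r_j x in place of x. -/
theorem deg_induction_left {S : Submodule Qq (NilAlg s k)} (h1 : 1 ∈ S)
    (hs : ∀ d i x, x ∈ deg d → deg d ≤ S → gen i * x ∈ S) (x : NilAlg s k) : x ∈ S := by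
  have key : ∀ d, deg d ≤ S := fun d => by
    induction d with
    | zero => exact deg_le fun l hl => by rw [List.eq_nil_of_length_eq_zero (l := l) (by omega)]; exact h1
    | succ d ih =>
      refine deg_le fun l hl => ?_
      cases l with
      | nil => exact h1
      | cons i l => exact hs d i _ (word_mem_deg (by simpa using hl)) ih
  exact eq_top_of_word_mem (fun l => key l.length (word_mem_deg le_rfl)) x

theorem deg_induction_right {S : Submodule Qq (NilAlg s k)} (h1 : 1 ∈ S)
    (hs : ∀ d i x, x ∈ deg d → deg d ≤ S → x * gen i ∈ S) (x : NilAlg s k) : x ∈ S := by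
  have key : ∀ d, deg d ≤ S := fun d => by
    induction d with
    | zero => exact deg_le fun l hl => by rw [List.eq_nil_of_length_eq_zero (l := l) (by omega)]; exact h1
    | succ d ih =>
      refine deg_le fun l hl => ?_
      induction l using List.reverseRecOn with
      | nil => exact h1
      | append_singleton l i =>
        rw [word_concat]
        exact hs d i _ (word_mem_deg (by simpa using hl)) ih
  exact eq_top_of_word_mem (fun l => key l.length (word_mem_deg le_rfl)) x

theorem gen_mul_mem_deg {d : ℕ} (i : Fin k) {x : NilAlg s k} (h : x ∈ deg d) :
    gen i * x ∈ deg (d + 1) := by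
  refine deg_le (S := (deg (d + 1)).comap (LinearMap.mulLeft Qq (gen i))) (fun l hl => ?_) h
  have := word_mem_deg (s := s) (l := i :: l) (d := d + 1) (by simpa using hl)
  rwa [word_cons] at this

theorem exists_mem_deg (x : NilAlg s k) : ∃ d, x ∈ deg d := by
  induction x using induction_left with
  | h1 => exact ⟨0, word_mem_deg (l := []) le_rfl⟩
  | hm i x h => exact ⟨_, gen_mul_mem_deg i h.choose_spec⟩
  | ha x y hx hy =>
    exact ⟨_, add_mem (deg_mono (le_max_left _ _) hx.choose_spec)
      (deg_mono (le_max_right _ _) hy.choose_spec)⟩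
  | hs c x hx => exact ⟨_, Submodule.smul_mem _ _ hx.choose_spec⟩

theorem l_mem_deg {d : ℕ} (i : Fin k) {x : NilAlg s k} (h : x ∈ deg (d + 1)) : l i x ∈ deg d := by
  refine deg_le (S := (deg d).comap (l i)) (fun w hw => ?_) h
  clear h
  induction w generalizing d with
  | nil => rw [word_nil]; simp
  | cons a w ih =>
    change l i (word (a :: w)) ∈ deg d
    rw [word_cons, l_gen_mul]
    refine add_mem ?_ (Submodule.smul_mem _ _ ?_)
    · split_ifs
      · exact word_mem_deg (by simpa using hw)
      · exact zero_mem _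
    · cases d with
      | zero =>
        rw [List.eq_nil_of_length_eq_zero (l := w) (by simpa using hw)]; simp
      | succ d => exact gen_mul_mem_deg a (ih (by simpa using hw))

theorem r_mem_deg {d : ℕ} (i : Fin k) {x : NilAlg s k} (h : x ∈ deg (d + 1)) : r i x ∈ deg d := by
  refine deg_le (S := (deg d).comap (r i)) (fun w hw => ?_) h
  clear h
  induction w generalizing d with
  | nil => rw [word_nil]; simp
  | cons a w ih =>
    change r i (word (a :: w)) ∈ deg d
    rw [word_cons, r_gen_mul, kap_of_mem_wt i (word_mem_wt w)]
    refine add_mem ?_ ?_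
    · cases d with
      | zero =>
        rw [List.eq_nil_of_length_eq_zero (l := w) (by simpa using hw)]; simp
      | succ d => exact gen_mul_mem_deg a (ih (by simpa using hw))
    · split_ifs
      · exact Submodule.smul_mem _ _ (word_mem_deg (by simpa using hw))
      · exact zero_mem _

theorem l_mem_deg' {d : ℕ} (i : Fin k) {x : NilAlg s k} (h : x ∈ deg d) : l i x ∈ deg d :=
  l_mem_deg i (deg_mono (Nat.le_succ d) h)
theorem r_mem_deg' {d : ℕ} (i : Fin k) {x : NilAlg s k} (h : x ∈ deg d) : r i x ∈ deg d :=
  r_mem_deg i (deg_mono (Nat.le_succ d) h)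

end Degree

/-- The free algebra on `θ_i`, `i ∈ 𝕀`. -/
abbrev FA (k : ℕ) : Type := NilAlg False k

/-- `x ↦ [[ε x, ∂_i x], [0, x]]`. -/
def delHom (i : Fin k) : FA k →ₐ[Qq] Matrix (Fin 2) (Fin 2) (FA k) :=
  lift (fun j => !![0, if i = j then 1 else 0; 0, gen j]) (fun h => h.elim) (fun h => h.elim)

theorem delHom_gen (i j : Fin k) :
    delHom i (gen j) = !![0, if i = j then 1 else 0; 0, gen j] := lift_gen ..

theorem delHom_entry (i : Fin k) (x : FA k) : delHom i x 1 0 = 0 ∧ delHom i x 1 1 = x := by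
  induction x using induction_left with
  | h1 => simp
  | hm j x h => rw [map_mul]; simp [Matrix.mul_apply, Fin.sum_univ_two, h, delHom_gen]
  | ha x y hx hy => simp [hx, hy]
  | hs c x hx => simp [hx]

/-- The removal of a first letter `θ_i`. -/
def del (i : Fin k) : FA k →ₗ[Qq] FA k where
  toFun x := delHom i x 0 1
  map_add' x y := by simp
  map_smul' c x := by simp

theorem del_one (i : Fin k) : del i (1 : FA k) = 0 := by
  change delHom i 1 0 1 = 0; simp

theorem del_gen_mul (i j : Fin k) (x : FA k) : del i (gen j * x) = if i = j then x else 0 := by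
  change delHom i (gen j * x) 0 1 = _
  rw [map_mul, Matrix.mul_apply, Fin.sum_univ_two, (delHom_entry i x).2, delHom_gen]
  simp

section Functional

variable (c : Fin k → Qq)

/-- The sum over `i` of the operators `c_{-i} l_{-i} ∂_i`. -/
def contract : FA k →ₗ[Qq] FA k := ∑ i, c i.rev • (l i.rev).comp (del i)

theorem contract_one : contract c 1 = 0 := by
  simp [contract, del_one]

theorem contract_gen_mul (i : Fin k) (x : FA k) :
    contract c (gen i * x) = c i.rev • l i.rev x := by
  rw [contract, LinearMap.sum_apply, Finset.sum_eq_single i]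
  · simp [del_gen_mul]
  · intro j _ hj; simp [del_gen_mul, hj]
  · simp

theorem contract_mem_deg {d : ℕ} {x : FA k} (h : x ∈ deg (d + 1)) : contract c x ∈ deg d := by
  refine deg_le (S := (deg d).comap (contract c)) (fun w hw => ?_) h
  change contract c (word w) ∈ deg d
  cases w with
  | nil => rw [word_nil, contract_one]; exact zero_mem _
  | cons a w =>
    rw [word_cons, contract_gen_mul]
    exact Submodule.smul_mem _ _ (l_mem_deg' _ (word_mem_deg (by simpa using hw)))

/-- The operator removes at least the first letter, so it strictly lowers the degree. -/
theorem contract_nilpotent (x : FA k) : ∃ N, ∀ n, N ≤ n → (contract c ^ n) x = 0 := by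
  have key : ∀ d, ∀ x ∈ deg d, (contract c ^ (d + 1)) x = 0 := fun d => by
    induction d with
    | zero =>
      intro x hx
      refine deg_le (S := LinearMap.ker (contract c ^ (0 + 1))) (fun l hl => ?_) hx
      rw [List.eq_nil_of_length_eq_zero (l := l) (by omega)]
      change (contract c ^ (0 + 1)) 1 = 0
      rw [zero_add, pow_one, contract_one]
    | succ d ih =>
      intro x hx
      rw [pow_succ, Module.End.mul_apply]
      exact ih _ (contract_mem_deg c hx)
  obtain ⟨d, hd⟩ := exists_mem_deg x
  refine ⟨d + 1, fun n hn => ?_⟩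
  obtain ⟨m, rfl⟩ := Nat.exists_eq_add_of_le hn
  rw [add_comm, pow_add, Module.End.mul_apply, key d x hd, map_zero]

theorem contract_support (x : FA k) :
    (Function.support fun n => counit ((contract c ^ n) x)).Finite := by
  obtain ⟨N, hN⟩ := contract_nilpotent c x
  refine (Set.finite_lt_nat N).subset fun n hn => ?_
  by_contra h
  exact hn (by simp only; rw [hN n (by simpa using h), map_zero])

/-- L is ε applied to the geometric series of the contraction, a finite sum on each element. Hence L
= ε + L ∘ contraction, which is the stated rule for a leading letter. -/
theorem exists_free_functional : ∃ L : FA k →ₗ[Qq] Qq, L 1 = 1 ∧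
    ∀ i x, L (gen i * x) = c i.rev * L (l i.rev x) := by
  let L : FA k →ₗ[Qq] Qq :=
    { toFun := fun x => ∑ᶠ n, counit ((contract c ^ n) x)
      map_add' := fun x y => by
        rw [← finsum_add_distrib (contract_support c x) (contract_support c y)]
        simp only [map_add]
      map_smul' := fun a x => by
        simp only [map_smul, RingHom.id_apply, smul_finsum] }
  have hL : ∀ x, L x = ∑ᶠ n, counit ((contract c ^ n) x) := fun x => rfl
  have key : ∀ x, L x = counit x + L (contract c x) := fun x => by
    obtain ⟨N, hN⟩ := contract_nilpotent c x
    have h1 : ∀ y, (∀ n, N ≤ n → (contract c ^ n) y = 0) →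
        L y = ∑ n ∈ Finset.range N, counit ((contract c ^ n) y) := fun y hy => by
      rw [hL]
      refine finsum_eq_sum_of_support_subset _ fun n hn => ?_
      by_contra h
      exact hn (by simp only; rw [hy n (by simpa using h), map_zero])
    have h2 : ∀ n, (contract c ^ n) (contract c x) = (contract c ^ (n + 1)) x := fun n => by
      rw [pow_succ, Module.End.mul_apply]
    rw [h1 x hN, h1 (contract c x) fun n hn => by rw [h2, hN _ (by omega)]]
    simp only [h2]
    have h3 := Finset.sum_range_succ' (fun n => counit ((contract c ^ n) x)) N
    rw [Finset.sum_range_succ, hN N le_rfl, map_zero, add_zero] at h3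
    rw [h3, pow_zero, add_comm]; rfl
  refine ⟨L, ?_, fun i x => ?_⟩
  · rw [key, contract_one, map_zero, add_zero, map_one]
  · rw [key, contract_gen_mul, map_smul, map_mul, counit_gen, zero_mul, zero_add, smul_eq_mul]

variable {c} {L : FA k →ₗ[Qq] Qq}

/-- L removes letters in pairs θ_j, θ_{-j}, and α_j + α_{-j} has the same pairing with α_i as with
α_{-i}. -/
theorem functional_kap
    (hL : ∀ i x, L (gen i * x) = c i.rev * L (l i.rev x)) (i : Fin k) (x : FA k) :
    L (kap i x) = L (kap i.rev x) := by
  refine deg_induction_left (S := LinearMap.eqLocus (L.comp (kap i).toLinearMap)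
    (L.comp (kap i.rev).toLinearMap)) ?_ ?_ x
  · change L (kap i 1) = L (kap i.rev 1); simp
  · intro d j x hx ih
    change L (kap i (gen j * x)) = L (kap i.rev (gen j * x))
    have h1 := ih (l_mem_deg' j.rev hx)
    change L (kap i (l j.rev x)) = L (kap i.rev (l j.rev x)) at h1
    rw [map_mul (kap i), map_mul (kap i.rev), kap_gen, kap_gen, smul_mul_assoc, smul_mul_assoc,
      map_smul, map_smul, hL,
      hL, l_kap, l_kap, map_smul, map_smul, h1, cartan_rev i j, cartan_rev' i j]
    simp only [smul_eq_mul]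
    ring

/-- The rule for a last letter follows from that for a first letter because l and r commute. When
the removed pair consists of the first and the last letter, two different κ-twists appear, and
`functional_kap` identifies them. -/
theorem functional_mul_gen (h1 : L 1 = 1) (hL : ∀ i x, L (gen i * x) = c i.rev * L (l i.rev x))
    (i : Fin k) (x : FA k) : L (x * gen i) = c i * L (r i.rev x) := by
  refine deg_induction_left (S := LinearMap.eqLocus (L.comp (LinearMap.mulRight Qq (gen i)))
    (c i • L.comp (r i.rev))) ?_ ?_ x
  · change L (1 * gen i) = c i * L (r i.rev 1)
    rw [one_mul, ← mul_one (gen i), hL]; simp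
  · intro d j x hx ih
    change L (gen j * x * gen i) = c i * L (r i.rev (gen j * x))
    have h1 := ih (l_mem_deg' j.rev hx)
    change L (l j.rev x * gen i) = c i * L (r i.rev (l j.rev x)) at h1
    rw [mul_assoc, hL, l_mul_gen, map_add, h1, r_gen_mul, map_add, hL, l_r]
    by_cases h : j.rev = i
    · subst h
      rw [if_pos rfl, if_pos (Fin.rev_rev j), Fin.rev_rev, ← functional_kap hL]
    · rw [if_neg h, if_neg fun e => h (by rw [← e, Fin.rev_rev])]
      simp only [map_zero]
      ring

/-- The left-hand sides minus the right-hand sides of the Serre relations. -/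
def serreElements (k : ℕ) : Set (FA k) :=
  {z | ∃ i j, (Adjacent i j ∧ z = gen i ^ 2 * gen j + gen j * gen i ^ 2
    - (q + q⁻¹) • (gen i * gen j * gen i)) ∨ (Far i j ∧ z = gen i * gen j - gen j * gen i)}

/-- The Serre element is primitive for letter removal: `e1`–`e3` are the coefficients of the words
that remain once a letter has been removed. -/
theorem serre_removal_right {R A : Type*} [Field R] [Ring A] [Algebra R A] {ρ : A →ₗ[R] A}
    {x y : A} {δ δ' c c' p : R} (h1 : ∀ z, ρ (z * x) = δ • z + c • (ρ z * x))
    (h2 : ∀ z, ρ (z * y) = δ' • z + c' • (ρ z * y)) (h0 : ρ 1 = 0)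
    (e1 : δ' * (1 + c * c - p * c) = 0)
    (e2 : δ * (c' * (1 + c) - p) = 0) (e3 : δ * (1 + c - p * c * c') = 0) :
    ρ (x ^ 2 * y + y * x ^ 2 - p • (x * y * x)) = 0 := by
  have hx := h1 1
  have hy := h2 1
  rw [one_mul, h0] at hx hy
  rw [pow_two, ← mul_assoc y]
  simp only [map_add, map_sub, map_smul, h1, h2, hx, hy, zero_mul, smul_zero, add_zero, add_mul,
    smul_mul_assoc, one_mul, smul_add, smul_smul]
  match_scalars <;> first | ring1 | linear_combination e1 | linear_combination e2 |
    linear_combination e3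

theorem serre_removal_left {R A : Type*} [Field R] [Ring A] [Algebra R A] {ρ : A →ₗ[R] A}
    {x y : A} {δ δ' c c' p : R} (h1 : ∀ z, ρ (x * z) = δ • z + c • (x * ρ z))
    (h2 : ∀ z, ρ (y * z) = δ' • z + c' • (y * ρ z)) (h0 : ρ 1 = 0)
    (e1 : δ' * (1 + c * c - p * c) = 0)
    (e2 : δ * (c' * (1 + c) - p) = 0) (e3 : δ * (1 + c - p * c * c') = 0) :
    ρ (x ^ 2 * y + y * x ^ 2 - p • (x * y * x)) = 0 := by
  have hx := h1 1
  have hy := h2 1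
  rw [mul_one, h0] at hx hy
  rw [pow_two, mul_assoc x x, mul_assoc x y]
  simp only [map_add, map_sub, map_smul, h1, h2, hx, hy, mul_zero, smul_zero, add_zero, mul_add,
    mul_smul_comm, mul_one, smul_add, smul_smul]
  match_scalars <;> first | ring1 | linear_combination e1 | linear_combination e2 |
    linear_combination e3

theorem serre_coeff {i j : Fin k} (h : Adjacent i j) (a : Fin k) :
    (if a = j then (1 : Qq) else 0) * (1 + q ^ (-cartan a i) * q ^ (-cartan a i)
      - (q + q⁻¹) * q ^ (-cartan a i)) = 0 ∧
    (if a = i then (1 : Qq) else 0) * (q ^ (-cartan a j) * (1 + q ^ (-cartan a i))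
      - (q + q⁻¹)) = 0 ∧
    (if a = i then (1 : Qq) else 0) * (1 + q ^ (-cartan a i)
      - (q + q⁻¹) * q ^ (-cartan a i) * q ^ (-cartan a j)) = 0 := by
  have hq := q_ne_zero
  refine ⟨?_, ?_, ?_⟩
  · split_ifs with h1
    · subst h1; rw [cartan_adjacent h.symm, neg_neg, zpow_one]; field_simp; ring
    · simp
  · split_ifs with h1
    · subst h1; rw [cartan_adjacent h, cartan_self, ← zpow_two_neg, neg_neg, zpow_one]
      field_simp; ring
    · simp
  · split_ifs with h1
    · subst h1; rw [cartan_adjacent h, cartan_self, ← zpow_two_neg, neg_neg, zpow_one]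
      field_simp; ring
    · simp

theorem r_serreElements {z : FA k} (hz : z ∈ serreElements k) (a : Fin k) : r a z = 0 := by
  have h1 : ∀ i (x : FA k), r a (x * gen i) = (if a = i then (1 : Qq) else 0) • x
      + q ^ (-cartan a i) • (r a x * gen i) := fun i x => by
    rw [r_mul_gen]; split_ifs <;> simp
  obtain ⟨i, j, ⟨h, rfl⟩ | ⟨h, rfl⟩⟩ := hz
  · obtain ⟨e1, e2, e3⟩ := serre_coeff h a
    exact serre_removal_right (h1 i) (h1 j) (r_one a) e1 e2 e3
  · rw [map_sub, r_mul_gen, r_mul_gen, r_gen, r_gen]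
    have h3 := far_ne h
    by_cases hi : a = i
    · subst hi; simp [h3, cartan_far h]
    · by_cases hj : a = j
      · subst hj; simp [h3.symm, cartan_far h.symm]
      · simp [hi, hj]

theorem l_serreElements {z : FA k} (hz : z ∈ serreElements k) (a : Fin k) : l a z = 0 := by
  have h1 : ∀ i (x : FA k), l a (gen i * x) = (if a = i then (1 : Qq) else 0) • x
      + q ^ (-cartan a i) • (gen i * l a x) := fun i x => by
    rw [l_gen_mul]; split_ifs <;> simp
  obtain ⟨i, j, ⟨h, rfl⟩ | ⟨h, rfl⟩⟩ := hz
  · obtain ⟨e1, e2, e3⟩ := serre_coeff h a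
    exact serre_removal_left (h1 i) (h1 j) (l_one a) e1 e2 e3
  · rw [map_sub, l_gen_mul, l_gen_mul, l_gen, l_gen]
    have h3 := far_ne h
    by_cases hi : a = i
    · subst hi; simp [h3, cartan_far h]
    · by_cases hj : a = j
      · subst hj; simp [h3.symm, cartan_far h.symm]
      · simp [hi, hj]

theorem kap_serreElements {z : FA k} (hz : z ∈ serreElements k) (a : Fin k) :
    ∃ e : ℤ, kap a z = q ^ e • z := by
  obtain ⟨i, j, ⟨h, rfl⟩ | ⟨h, rfl⟩⟩ := hz
  · refine ⟨-cartan a i + -cartan a i + -cartan a j, ?_⟩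
    simp only [map_sub, map_add, map_mul, map_smul, pow_two, kap_gen, smul_mul_smul_comm,
      smul_sub, smul_add, ← zpow_add₀ q_ne_zero]
    rw [smul_comm (q + q⁻¹), add_right_comm _ _ (-cartan a j), add_comm (-cartan a j)]
    congr 3
    rw [add_assoc, add_comm (-cartan a i)]
  · refine ⟨-cartan a i + -cartan a j, ?_⟩
    simp only [map_sub, map_mul, kap_gen, smul_mul_smul_comm, smul_sub, ← zpow_add₀ q_ne_zero]
    rw [add_comm (-cartan a j)]

/-- The derivations r_a and l_a kill a Serre element z and κ scales it. The letters to the right of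
z are peeled off by the rule for last letters and those to its left by the rule for first letters,
which leaves L(z) = 0 to be checked. -/
theorem functional_serre (h1 : L 1 = 1) (hL : ∀ i x, L (gen i * x) = c i.rev * L (l i.rev x))
    (hc : ∀ i : Fin k, Far i i.rev → c i = c i.rev) {z : FA k} (hz : z ∈ serreElements k)
    (x y : FA k) : L (x * z * y) = 0 := by
  have hg : ∀ i, L (gen i) = 0 := fun i => by
    rw [← mul_one (gen i), hL, l_one, map_zero, mul_zero]
  have h0 : L z = 0 := by
    -- The cubic relations involve an odd number of letters, while L pairs letters off.
    have h3 : ∀ i j a : Fin k, L (gen i * (gen j * gen a)) = 0 := fun i j a => by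
      rw [hL, l_gen_mul, l_gen, map_add, map_smul]
      split_ifs <;> simp [hg]
    obtain ⟨i, j, ⟨h, rfl⟩ | ⟨h, rfl⟩⟩ := hz
    · simp only [pow_two, mul_assoc, map_sub, map_add, map_smul, h3]; simp
    · rw [map_sub, hL, hL, l_gen, l_gen]
      -- The only place where the symmetry of `c` enters: the commutation relation of θ_i with
      -- θ_{-i}. For adjacent i and -i there is no such relation, and c_i may differ from c_{-i}.
      by_cases e : i.rev = j
      · subst e
        rw [if_pos rfl, if_pos (Fin.rev_rev i), Fin.rev_rev, hc i h, sub_self]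
      · rw [if_neg e, if_neg fun e' => e (by rw [← e', Fin.rev_rev])]; simp
  -- A last letter of z y is traded for r on z y; this acts only on y because r kills z.
  have hzy : ∀ y, L (z * y) = 0 := fun y => by
    refine deg_induction_right (S := LinearMap.ker (L.comp (LinearMap.mulLeft Qq z))) ?_ ?_ y
    · change L (z * 1) = 0; rw [mul_one, h0]
    · intro d i y hy ih
      change L (z * (y * gen i)) = 0
      have h2 := ih (r_mem_deg' i.rev hy)
      change L (z * r i.rev y) = 0 at h2
      rw [← mul_assoc, functional_mul_gen h1 hL, r_mul, r_serreElements hz, zero_mul, add_zero, h2,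
        mul_zero]
  suffices h : ∀ x, ∀ y, L (x * z * y) = 0 from h x y
  have key : ∀ d, ∀ x ∈ deg d, ∀ y, L (x * z * y) = 0 := fun d => by
    induction d with
    | zero =>
      intro x hx y
      refine deg_le (S := LinearMap.ker (L.comp (LinearMap.mulRight Qq (z * y)))) (fun w hw => ?_)
        hx |> fun h => by rw [mul_assoc]; exact h
      rw [List.eq_nil_of_length_eq_zero (l := w) (by omega)]
      change L (1 * (z * y)) = 0
      rw [one_mul, hzy]
    | succ d ih =>
      intro x hx y
      refine deg_le (S := LinearMap.ker (L.comp (LinearMap.mulRight Qq (z * y)))) (fun w hw => ?_)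
        hx |> fun h => by rw [mul_assoc]; exact h
      change L (word w * (z * y)) = 0
      cases w with
      | nil => rw [word_nil, one_mul, hzy]
      | cons a w =>
        have hw' : (word w : FA k) ∈ deg d := word_mem_deg (by simpa using hw)
        obtain ⟨e, he⟩ := kap_serreElements hz a.rev
        rw [word_cons, mul_assoc, ← mul_assoc, ← mul_assoc, mul_assoc (gen a), mul_assoc (gen a),
          hL,
          l_mul, l_mul, l_serreElements hz, mul_zero, add_zero, map_mul, he, map_add,
          ih _ (l_mem_deg' _ hw'), kap_of_mem_wt _ (word_mem_wt w), smul_mul_smul_comm, smul_mul_assoc,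
          map_smul, ih _ hw']
        simp
  intro x y
  obtain ⟨d, hd⟩ := exists_mem_deg x
  exact key d x hd y

end Functional

/-- The projection of the free algebra. -/
def proj : FA k →ₐ[Qq] NilAlg True k := lift gen (fun h => h.elim) (fun h => h.elim)

theorem proj_gen (i : Fin k) : proj (gen i : FA k) = gen i := lift_gen ..

theorem proj_surjective : Function.Surjective (proj : FA k → NilAlg True k) := by
  intro x
  induction x using induction_left with
  | h1 => exact ⟨1, map_one _⟩
  | hm i x h => obtain ⟨y, rfl⟩ := h; exact ⟨gen i * y, by rw [map_mul, proj_gen]⟩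
  | ha x y hx hy =>
    obtain ⟨x, rfl⟩ := hx; obtain ⟨y, rfl⟩ := hy; exact ⟨x + y, map_add _ _ _⟩
  | hs c x hx => obtain ⟨x, rfl⟩ := hx; exact ⟨c • x, map_smul _ _ _⟩

theorem proj_kap (i : Fin k) (x : FA k) : proj (kap i x) = kap i (proj x) := by
  have : (proj.comp (kap i) : FA k →ₐ[Qq] _) = (kap i).comp proj := hom_ext fun a => by
    simp [proj_gen]
  exact DFunLike.congr_fun this x

theorem proj_l (i : Fin k) (x : FA k) : proj (l i x) = l i (proj x) := by
  have : (proj.toLinearMap.comp (l i) : FA k →ₗ[Qq] _) = (l i).comp proj.toLinearMap := by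
    refine linear_ext (by simp) fun a x hx => ?_
    simp only [LinearMap.comp_apply, AlgHom.toLinearMap_apply] at hx ⊢
    rw [l_gen_mul, map_mul, proj_gen, l_gen_mul, map_add, map_smul, map_mul, proj_gen, hx]
    split_ifs <;> simp
  exact LinearMap.congr_fun this x

theorem proj_r (i : Fin k) (x : FA k) : proj (r i x) = r i (proj x) := by
  have : (proj.toLinearMap.comp (r i) : FA k →ₗ[Qq] _) = (r i).comp proj.toLinearMap := by
    refine linear_ext (by simp) fun a x hx => ?_
    simp only [LinearMap.comp_apply, AlgHom.toLinearMap_apply] at hx ⊢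
    rw [r_gen_mul, map_mul, proj_gen, r_gen_mul, map_add, map_mul, proj_gen, hx]
    split_ifs <;> simp [proj_kap]
  exact LinearMap.congr_fun this x

/-- The functionals on the free algebra that vanish on the ideal of the Serre relations. -/
def serreDual (k : ℕ) : Submodule Qq (Module.Dual Qq (FA k)) where
  carrier := {φ | ∀ z ∈ serreElements k, ∀ x y, φ (x * z * y) = 0}
  zero_mem' := by simp
  add_mem' h h' z hz x y := by simp [h z hz x y, h' z hz x y]
  smul_mem' c φ h z hz x y := by simp [h z hz x y]

/-- `φ ↦ φ(- θ_i)`. -/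
def dualShift (i : Fin k) : Module.End Qq (serreDual k) :=
  LinearMap.restrict (LinearMap.lcomp Qq Qq (LinearMap.mulRight Qq (gen i)))
    (fun φ h z hz x y => by
      change φ (x * z * y * gen i) = 0
      rw [mul_assoc]; exact h z hz x _)

theorem dualShift_apply (i : Fin k) (φ : serreDual k) (x : FA k) :
    (dualShift i φ).1 x = φ.1 (x * gen i) := rfl

/-- The left action of `U_q(n⁻)` on the functionals. -/
def dualAct : NilAlg True k →ₐ[Qq] Module.End Qq (serreDual k) :=
  lift dualShift (fun _ i j h => by
      refine LinearMap.ext fun φ => Subtype.ext (LinearMap.ext fun x => ?_)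
      have := φ.2 _ ⟨i, j, Or.inl ⟨h, rfl⟩⟩ x 1
      rw [mul_one, mul_sub, mul_add, map_sub, map_add, mul_smul_comm, map_smul, sub_eq_zero] at this
      rw [pow_two] at this ⊢
      change φ.1 (x * gen i * gen i * gen j) + φ.1 (x * gen j * gen i * gen i)
        = (q + q⁻¹) * φ.1 (x * gen i * gen j * gen i)
      simp only [← mul_assoc] at this
      exact this)
    (fun _ i j h => by
      refine LinearMap.ext fun φ => Subtype.ext (LinearMap.ext fun x => ?_)
      have := φ.2 _ ⟨i, j, Or.inr ⟨h, rfl⟩⟩ x 1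
      rw [mul_one, mul_sub, map_sub, sub_eq_zero] at this
      change φ.1 (x * gen i * gen j) = φ.1 (x * gen j * gen i)
      simp only [← mul_assoc] at this
      exact this)

theorem dualAct_proj (a x : FA k) (φ : serreDual k) : (dualAct (proj a) φ).1 x = φ.1 (x * a) := by
  induction a using induction_left generalizing x with
  | h1 => simp
  | hm i a h =>
    rw [map_mul, proj_gen, map_mul, Module.End.mul_apply, dualAct, lift_gen, dualShift_apply]
    rw [dualAct] at h
    rw [h, mul_assoc]
  | ha a b h h' => rw [map_add, map_add, LinearMap.add_apply, mul_add, map_add, ← h, ← h']; rfl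
  | hs c a h => rw [map_smul, map_smul, LinearMap.smul_apply, mul_smul_comm, map_smul, ← h]; rfl

/-- L descends from the free algebra to U_q(n⁻) without a description of the kernel of the
projection: U_q(n⁻) acts on the functionals that vanish on the Serre ideal, and the value at x is
that of x · L at 1. -/
theorem exists_functional (c : Fin k → Qq) (hc : ∀ i : Fin k, Far i i.rev → c i = c i.rev) :
    ∃ L : NilAlg True k →ₗ[Qq] Qq, L 1 = 1 ∧ (∀ i x, L (gen i * x) = c i.rev * L (l i.rev x)) ∧
      ∀ i x, L (x * gen i) = c i * L (r i.rev x) := by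
  obtain ⟨L, h1, h2⟩ := exists_free_functional c
  let φ : serreDual k := ⟨L, fun z hz x y => functional_serre h1 h2 hc hz x y⟩
  let L' : NilAlg True k →ₗ[Qq] Qq :=
    { toFun := fun x => (dualAct x φ).1 1
      map_add' := fun x y => by rw [map_add]; rfl
      map_smul' := fun c x => by rw [map_smul]; rfl }
  have key : ∀ a : FA k, L' (proj a) = L a := fun a => by
    change (dualAct (proj a) φ).1 1 = L a
    rw [dualAct_proj, one_mul]
  refine ⟨L', ?_, fun i x => ?_, fun i x => ?_⟩
  · rw [← map_one proj, key, h1]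
  · obtain ⟨a, rfl⟩ := proj_surjective x
    rw [← proj_gen, ← map_mul, key, h2, ← proj_l, key]
  · obtain ⟨a, rfl⟩ := proj_surjective x
    rw [← proj_gen, ← map_mul, key, functional_mul_gen h1 h2, ← proj_r, key]

end NilAlg

/-! ### The elements representing the functional -/

namespace SA

open NilAlg

variable {k : ℕ}

/-- The element y_μ represents L on the weight space. By adjunction (x, r_i y) = L(x θ_i) = c_i
L(r_{-i} x) = c_i (x, y' θ_{-i}), where y' has weight lower by α_i + α_{-i}; likewise on the left.
Nondegeneracy turns these into identities of elements. -/
theorem exists_intertwining_elements (c : Fin k → Qq)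
    (hc : ∀ i : Fin k, Far i i.rev → c i = c i.rev) :
    ∃ y : (Fin k → ℕ) → SA k, (∀ μ, y μ ∈ wt μ) ∧ y 0 = 1 ∧
      (∀ μ i, r i (y (μ + Pi.single i.rev 1 + Pi.single i 1)) = c i • (y μ * gen i.rev)) ∧
      (∀ μ i, l i (y (μ + Pi.single i.rev 1 + Pi.single i 1)) = c i.rev • (gen i.rev * y μ)) ∧
      ∀ μ i, (¬ ∃ ν : Fin k → ℕ, μ = ν + Pi.single i.rev 1 + Pi.single i 1) → r i (y μ) = 0 ∧ l i (y μ) = 0 := by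
  obtain ⟨L, h1, h2, h3⟩ := exists_functional c hc
  choose y hy1 hy2 using fun μ => exists_form_eq μ L
  have ext : ∀ μ (a b : SA k), a ∈ wt μ → b ∈ wt μ → (∀ x ∈ wt μ, form x a = form x b) → a = b :=
    fun μ a b ha hb h => sub_eq_zero.mp (eq_zero_of_form_wt (sub_mem ha hb) fun x hx => by
      rw [map_sub, h x hx, sub_self])
  refine ⟨y, hy1, ?_, fun μ i => ?_, fun μ i => ?_, fun μ i h => ?_⟩
  · refine ext 0 _ _ (hy1 0) one_mem_wt fun x hx => ?_
    rw [hy2 0 x hx, form_symm, form_one_left]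
    conv_lhs => rw [mem_wt_zero hx]
    rw [map_smul, h1, smul_eq_mul, mul_one]
  · refine ext _ _ _ (r_mem_wt (hy1 _)) (Submodule.smul_mem _ _ (mul_gen_mem_wt _ (hy1 _)))
      fun x hx => ?_
    rw [← form_mul_gen_left, hy2 _ _ (mul_gen_mem_wt i hx), h3, map_smul, form_mul_gen_right,
      hy2 _ _ (r_mem_wt hx), smul_eq_mul]
  · refine ext _ _ _ (l_mem_wt (hy1 _)) (Submodule.smul_mem _ _ (gen_mul_mem_wt _ (hy1 _)))
      fun x hx => ?_
    rw [← form_gen_mul_left, hy2 _ _ (gen_mul_mem_wt i hx), h2, map_smul, form_gen_mul_right,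
      hy2 _ _ (l_mem_wt hx), smul_eq_mul]
  · by_cases h0 : μ i = 0
    · exact ⟨r_eq_zero (hy1 μ) h0, l_eq_zero (hy1 μ) h0⟩
    · obtain ⟨ν, rfl⟩ := exists_add_single h0
      -- One letter θ_i has already been split off, so for i = -i this also covers weights with a
      -- single θ_i.
      have hν : ν i.rev = 0 := by
        by_contra h4
        obtain ⟨ν', rfl⟩ := exists_add_single h4
        exact h ⟨ν', rfl⟩
      constructor
      · refine ext _ _ _ (r_mem_wt (hy1 _)) (zero_mem _) fun x hx => ?_
        rw [← form_mul_gen_left, hy2 _ _ (mul_gen_mem_wt i hx), h3, r_eq_zero hx hν]; simp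
      · refine ext _ _ _ (l_mem_wt (hy1 _)) (zero_mem _) fun x hx => ?_
        rw [← form_gen_mul_left, hy2 _ _ (gen_mul_mem_wt i hx), h2, l_eq_zero hx hν]; simp

end SA

end QSymPair

end

/-! ### U_q(n⁻) inside U and commutators with the Chevalley generators -/

noncomputable section

namespace QSymPair

namespace U

variable {k : ℕ}

open NilAlg

theorem mkAlgHom_surjective (u : U k) :
    ∃ a : FreeAlgebra Qq (UGen k), RingQuot.mkAlgHom Qq (URel k) a = u :=
  RingQuot.mkAlgHom_surjective Qq (URel k) u

theorem induction {P : U k → Prop} (hc : ∀ c : Qq, P (algebraMap Qq (U k) c)) (hg : ∀ x, P (gen x))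
    (hm : ∀ x y, P x → P y → P (x * y)) (ha : ∀ x y, P x → P y → P (x + y)) (u : U k) : P u := by
  obtain ⟨a, rfl⟩ := mkAlgHom_surjective u
  induction a using FreeAlgebra.induction with
  | grade0 c => rw [AlgHom.commutes]; exact hc c
  | grade1 x => exact hg x
  | mul a b h h' => rw [map_mul]; exact hm _ _ h h'
  | add a b h h' => rw [map_add]; exact ha _ _ h h'

theorem hom_ext {A : Type*} [Ring A] [Algebra Qq A] {φ ψ : U k →ₐ[Qq] A}
    (h : ∀ x, φ (gen x) = ψ (gen x)) : φ = ψ := by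
  ext u
  induction u using induction with
  | hc c => rw [AlgHom.commutes, AlgHom.commutes]
  | hg x => exact h x
  | hm x y hx hy => rw [map_mul, map_mul, hx, hy]
  | ha x y hx hy => rw [map_add, map_add, hx, hy]

/-- The automorphism of `U` that exchanges `E_i` and `F_i`. -/
def swapEF : U k →ₐ[Qq] U k :=
  lift (fun x => match x with
    | .E i => F i
    | .F i => E i
    | .K i => Kinv i
    | .Kinv i => K i) (by
    intro x y h
    cases h with
    | K_Kinv i => simp only [map_mul, map_one, FreeAlgebra.lift_ι_apply]; exact Kinv_K i
    | Kinv_K i => simp only [map_mul, map_one, FreeAlgebra.lift_ι_apply]; exact K_Kinv i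
    | K_K i j => simp only [map_mul, FreeAlgebra.lift_ι_apply]; exact Kinv_Kinv i j
    | K_E i j =>
      simp only [map_mul, map_smul, FreeAlgebra.lift_ι_apply]
      exact conj_of_skew (Kinv_K i) (Kinv_F i j)
    | K_F i j =>
      simp only [map_mul, map_smul, FreeAlgebra.lift_ι_apply]
      exact conj_of_skew (Kinv_K i) (Kinv_E i j)
    | E_F i =>
      simp only [map_mul, map_sub, map_smul, FreeAlgebra.lift_ι_apply]
      rw [← neg_sub (E i * F i), E_F, ← smul_neg, neg_sub]
    | E_F_ne i j h =>
      simp only [map_mul, map_sub, map_zero, FreeAlgebra.lift_ι_apply]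
      rw [← neg_sub (E j * F i), E_F_ne j i h.symm, neg_zero]
    | E_serre i j h =>
      simp only [map_mul, map_add, map_pow, map_smul, FreeAlgebra.lift_ι_apply]; exact F_serre i j h
    | E_far i j h => simp only [map_mul, FreeAlgebra.lift_ι_apply]; exact F_far i j h
    | F_serre i j h =>
      simp only [map_mul, map_add, map_pow, map_smul, FreeAlgebra.lift_ι_apply]; exact E_serre i j h
    | F_far i j h => simp only [map_mul, FreeAlgebra.lift_ι_apply]; exact E_far i j h)

@[simp] theorem swapEF_E (i : Fin k) : swapEF (E i) = F i := lift_gen ..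
@[simp] theorem swapEF_F (i : Fin k) : swapEF (F i) = E i := lift_gen ..
@[simp] theorem swapEF_K (i : Fin k) : swapEF (K i) = Kinv i := lift_gen ..
@[simp] theorem swapEF_Kinv (i : Fin k) : swapEF (Kinv i) = K i := lift_gen ..

@[simp] theorem swapEF_swapEF (u : U k) : swapEF (swapEF u) = u := by
  have : (swapEF.comp swapEF : U k →ₐ[Qq] U k) = AlgHom.id Qq (U k) := hom_ext fun x => by
    cases x
    · exact (congrArg swapEF (swapEF_E _)).trans (swapEF_F _)
    · exact (congrArg swapEF (swapEF_F _)).trans (swapEF_E _)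
    · exact (congrArg swapEF (swapEF_K _)).trans (swapEF_Kinv _)
    · exact (congrArg swapEF (swapEF_Kinv _)).trans (swapEF_K _)
  exact DFunLike.congr_fun this u

/-- The homomorphism `U_q(n⁻) → U` with `θ_i ↦ F_i`. -/
def neg : SA k →ₐ[Qq] U k :=
  NilAlg.lift F (fun _ i j h => F_serre i j h) (fun _ i j h => F_far i j h)

/-- The homomorphism `U_q(n⁻) → U` with `θ_i ↦ E_i`. -/
def pos : SA k →ₐ[Qq] U k :=
  NilAlg.lift E (fun _ i j h => E_serre i j h) (fun _ i j h => E_far i j h)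

@[simp] theorem neg_gen (i : Fin k) : neg (NilAlg.gen i : SA k) = F i := NilAlg.lift_gen ..
@[simp] theorem pos_gen (i : Fin k) : pos (NilAlg.gen i : SA k) = E i := NilAlg.lift_gen ..

@[simp] theorem swapEF_neg (x : SA k) : swapEF (neg x) = pos x := by
  have : (swapEF.comp neg : SA k →ₐ[Qq] U k) = pos := NilAlg.hom_ext fun i => by
    rw [AlgHom.comp_apply, neg_gen, swapEF_F, pos_gen]
  exact DFunLike.congr_fun this x

theorem K_neg (i : Fin k) (x : SA k) : K i * neg x = neg (kap i x) * K i := by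
  induction x using induction_left with
  | h1 => simp
  | hm j x h =>
    rw [map_mul, map_mul, map_mul, neg_gen, kap_gen, map_smul, neg_gen, ← mul_assoc, K_F,
      smul_mul_assoc, smul_mul_assoc, mul_assoc, h, smul_mul_assoc, mul_assoc]
  | ha x y hx hy => simp only [map_add, mul_add, add_mul, hx, hy]
  | hs c x hx => simp only [map_smul, mul_smul_comm, smul_mul_assoc, hx]

theorem Kinv_neg_kap (i : Fin k) (x : SA k) : Kinv i * neg (kap i x) = neg x * Kinv i := by
  have h := congrArg (fun z => Kinv i * z * Kinv i) (K_neg i x)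
  simp only [mul_assoc, K_Kinv, mul_one] at h
  rw [← mul_assoc, Kinv_K, one_mul] at h
  exact h.symm

/-- Lusztig's commutator formula: E_i commutes with every F_j except F_i, so its commutator is a sum
of letter removals. The K_i from each is moved to the right and the K_i⁻¹ to the left, which gives
the twists of r_i and l_i. -/
theorem E_neg (i : Fin k) (y : SA k) : (q - q⁻¹) • (E i * neg y - neg y * E i)
    = neg (r i y) * K i - Kinv i * neg (l i y) := by
  induction y using induction_right with
  | h1 => simp
  | hm j y h =>
    have h1 : (q - q⁻¹) • (E i * F j - F j * E i) = if i = j then K i - Kinv i else 0 := by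
      split_ifs with e
      · subst e; rw [E_F, smul_smul, mul_inv_cancel₀ q_sub_inv_ne_zero, one_smul]
      · rw [E_F_ne i j e, smul_zero]
    rw [map_mul, neg_gen]
    have h2 : E i * (neg y * F j) - neg y * F j * E i
        = (E i * neg y - neg y * E i) * F j + neg y * (E i * F j - F j * E i) := by noncomm_ring
    rw [h2, smul_add, ← smul_mul_assoc, h, ← mul_smul_comm, h1, sub_mul, mul_assoc _ (K i), K_F,
      r_mul_gen, l_mul_gen, map_add, map_add, map_smul, map_mul, map_mul, neg_gen, add_mul, mul_add]
    split_ifs with e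
    · rw [Kinv_neg_kap]
      simp only [mul_sub, mul_smul_comm, smul_mul_assoc, mul_assoc]
      abel
    · simp only [mul_smul_comm, smul_mul_assoc, mul_assoc, map_zero, mul_zero, zero_mul, add_zero,
        zero_add]
  | ha x y hx hy =>
    simp only [map_add, mul_add, add_mul]
    rw [add_sub_add_comm, smul_add, hx, hy]; abel
  | hs c x hx =>
    simp only [map_smul, mul_smul_comm, smul_mul_assoc]
    rw [← smul_sub, smul_comm, hx, smul_sub]

theorem E_neg' (i : Fin k) (y : SA k) : E i * neg y - neg y * E i
    = (q - q⁻¹)⁻¹ • (neg (r i y) * K i - Kinv i * neg (l i y)) := by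
  rw [← E_neg, smul_smul, inv_mul_cancel₀ q_sub_inv_ne_zero, one_smul]

/-- The mirror image under the automorphism exchanging E_i with F_i and inverting K_i. -/
theorem F_pos' (i : Fin k) (y : SA k) : F i * pos y - pos y * F i
    = (q - q⁻¹)⁻¹ • (pos (r i y) * Kinv i - K i * pos (l i y)) := by
  have := congrArg swapEF (E_neg' i y)
  simpa only [map_sub, map_mul, map_smul, swapEF_E, swapEF_K, swapEF_Kinv, swapEF_neg] using this

end U

/-! ### Filtrations that define the completions -/

open U NilAlg

variable {k : ℕ}

theorem neg_word (w : List (Fin k)) : neg (word w : SA k) = (w.map F).prod := by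
  induction w with
  | nil => simp
  | cons a w ih => rw [word_cons, map_mul, neg_gen, ih, List.map_cons, List.prod_cons]

theorem pos_word (w : List (Fin k)) : pos (word w : SA k) = (w.map E).prod := by
  induction w with
  | nil => simp
  | cons a w ih => rw [word_cons, map_mul, pos_gen, ih, List.map_cons, List.prod_cons]

theorem UnegW_eq (μ : RootCone k) : UnegW μ = (wt μ).map (neg (k := k)).toLinearMap := by
  rw [UnegW, wt, Submodule.map_span]
  congr 1
  ext x
  constructor
  · rintro ⟨w, hw, rfl⟩
    exact ⟨word w, ⟨w, funext hw, rfl⟩, neg_word w⟩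
  · rintro ⟨_, ⟨w, hw, rfl⟩, rfl⟩
    exact ⟨w, congrFun hw, neg_word w⟩

theorem UposW_eq (μ : RootCone k) : UposW μ = (wt μ).map (pos (k := k)).toLinearMap := by
  rw [UposW, wt, Submodule.map_span]
  congr 1
  ext x
  constructor
  · rintro ⟨w, hw, rfl⟩
    exact ⟨word w, ⟨w, funext hw, rfl⟩, pos_word w⟩
  · rintro ⟨_, ⟨w, hw, rfl⟩, rfl⟩
    exact ⟨w, congrFun hw, pos_word w⟩

theorem neg_mem {μ : RootCone k} {x : SA k} (h : x ∈ wt μ) : neg x ∈ UnegW μ := by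
  rw [UnegW_eq]; exact ⟨x, h, rfl⟩
theorem pos_mem {μ : RootCone k} {x : SA k} (h : x ∈ wt μ) : pos x ∈ UposW μ := by
  rw [UposW_eq]; exact ⟨x, h, rfl⟩

theorem map_swapEF_Upos : (Upos k).map (swapEF (k := k)).toLinearMap = Uneg k := by
  rw [Upos, Uneg]
  rw [show Submodule.map (swapEF (k := k)).toLinearMap (Subalgebra.toSubmodule
      (Algebra.adjoin Qq (Set.range (E (k := k))))) = Subalgebra.toSubmodule
      ((Algebra.adjoin Qq (Set.range (E (k := k)))).map swapEF) from rfl, AlgHom.map_adjoin,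
    ← Set.range_comp]
  congr 3
  funext i; exact swapEF_E i

theorem map_swapEF_Uzero : (Uzero k).map (swapEF (k := k)).toLinearMap = Uzero k := by
  rw [Uzero]
  rw [show Submodule.map (swapEF (k := k)).toLinearMap (Subalgebra.toSubmodule
      (Algebra.adjoin Qq (Set.range (K (k := k)) ∪ Set.range (Kinv (k := k))))) =
      Subalgebra.toSubmodule ((Algebra.adjoin Qq (Set.range (K (k := k)) ∪
        Set.range (Kinv (k := k)))).map swapEF) from rfl, AlgHom.map_adjoin,
    Set.image_union, ← Set.range_comp, ← Set.range_comp, Set.union_comm]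
  congr 4
  · funext i; exact swapEF_Kinv i
  · funext i; exact swapEF_K i

theorem map_swapEF_UnegW (μ : RootCone k) :
    (UnegW μ).map (swapEF (k := k)).toLinearMap = UposW μ := by
  rw [UnegW_eq, UposW_eq, ← Submodule.map_comp]
  congr 1
  ext x; exact swapEF_neg x

theorem map_swapEF_filNeg (N : ℕ) : (filNeg k N).map (swapEF (k := k)).toLinearMap = filPos k N := by
  rw [filNeg, filPos, Submodule.map_mul, Submodule.map_mul, map_swapEF_Upos, map_swapEF_Uzero]
  simp only [Submodule.map_iSup, map_swapEF_UnegW]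

theorem mem_filPos_iff {N : ℕ} {x : U k} : x ∈ filPos k N ↔ swapEF x ∈ filNeg k N := by
  rw [← map_swapEF_filNeg]
  constructor
  · rintro ⟨y, hy, rfl⟩
    change swapEF (swapEF y) ∈ _
    rwa [swapEF_swapEF]
  · intro h
    exact ⟨_, h, swapEF_swapEF x⟩

theorem pos_mem_Upos (x : SA k) : pos x ∈ Upos k := by
  induction x using NilAlg.induction_left with
  | h1 => rw [map_one]; exact one_mem (S := Subalgebra Qq (U k)) _
  | hm i x h =>
    rw [map_mul, pos_gen]
    exact mul_mem (S := Subalgebra Qq (U k)) (Algebra.subset_adjoin ⟨i, rfl⟩) h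
  | ha x y hx hy => rw [map_add]; exact add_mem hx hy
  | hs c x hx => rw [map_smul]; exact Submodule.smul_mem _ _ hx

theorem exists_pos {x : U k} (h : x ∈ Upos k) : ∃ y : SA k, pos y = x := by
  have : Algebra.adjoin Qq (Set.range (E (k := k))) ≤ (pos (k := k)).range := by
    refine Algebra.adjoin_le ?_
    rintro _ ⟨i, rfl⟩
    exact ⟨gen i, pos_gen i⟩
  exact this h

theorem K_mem_Uzero (i : Fin k) : K i ∈ Uzero k := Algebra.subset_adjoin (Or.inl ⟨i, rfl⟩)
theorem Kinv_mem_Uzero (i : Fin k) : Kinv i ∈ Uzero k := Algebra.subset_adjoin (Or.inr ⟨i, rfl⟩)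
theorem mul_mem_Uzero {x y : U k} (hx : x ∈ Uzero k) (hy : y ∈ Uzero k) : x * y ∈ Uzero k :=
  mul_mem (S := Subalgebra Qq (U k)) hx hy

theorem Uzero_skew {h x : U k} (hh : h ∈ Uzero k) (hK : ∀ i, ∃ c : Qq, x * K i = c • (K i * x))
    (hK' : ∀ i, ∃ c : Qq, x * Kinv i = c • (Kinv i * x)) : ∃ h' ∈ Uzero k, x * h = h' * x := by
  refine Algebra.adjoin_induction (p := fun h _ => ∃ h' ∈ Uzero k, x * h = h' * x) ?_ ?_ ?_ ?_ hh
  · rintro _ (⟨i, rfl⟩ | ⟨i, rfl⟩)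
    · obtain ⟨c, hc⟩ := hK i
      exact ⟨c • K i, Submodule.smul_mem _ _ (K_mem_Uzero i), by rw [hc, smul_mul_assoc]⟩
    · obtain ⟨c, hc⟩ := hK' i
      exact ⟨c • Kinv i, Submodule.smul_mem _ _ (Kinv_mem_Uzero i), by rw [hc, smul_mul_assoc]⟩
  · intro c
    exact ⟨algebraMap Qq (U k) c, algebraMap_mem (S :=
      Subalgebra Qq (U k)) _ c, (Algebra.commutes c x).symm⟩
  · rintro a b _ _ ⟨a', ha, e⟩ ⟨b', hb, e'⟩
    exact ⟨a' + b', add_mem ha hb, by rw [mul_add, e, e', add_mul]⟩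
  · rintro a b _ _ ⟨a', ha, e⟩ ⟨b', hb, e'⟩
    exact ⟨a' * b', mul_mem_Uzero ha hb, by rw [← mul_assoc, e, mul_assoc, e', mul_assoc]⟩

theorem skew_symm {A : Type*} [Ring A] [Algebra Qq A] {x y : A} {e : ℤ}
    (h : x * y = q ^ e • (y * x)) : y * x = q ^ (-e) • (x * y) := by
  rw [h, smul_smul, zpow_neg, inv_mul_cancel₀ (zpow_ne_zero _ q_ne_zero), one_smul]

theorem F_Uzero (i : Fin k) {h : U k} (hh : h ∈ Uzero k) : ∃ h' ∈ Uzero k, F i * h = h' * F i :=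
  Uzero_skew hh (fun j => ⟨_, skew_symm (K_F j i)⟩) (fun j => ⟨_, skew_symm (Kinv_F j i)⟩)

theorem Uzero_E (i : Fin k) {h : U k} (hh : h ∈ Uzero k) : ∃ h' ∈ Uzero k, h * E i = E i * h' := by
  refine Algebra.adjoin_induction (p :=
    fun h _ => ∃ h' ∈ Uzero k, h * E i = E i * h') ?_ ?_ ?_ ?_ hh
  · rintro _ (⟨j, rfl⟩ | ⟨j, rfl⟩)
    · exact ⟨_ • K j, Submodule.smul_mem _ _ (K_mem_Uzero j), by rw [K_E, mul_smul_comm]⟩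
    · exact ⟨_ • Kinv j, Submodule.smul_mem _ _ (Kinv_mem_Uzero j), by rw [Kinv_E, mul_smul_comm]⟩
  · intro c
    exact ⟨algebraMap Qq (U k) c, algebraMap_mem (S :=
      Subalgebra Qq (U k)) _ c, Algebra.commutes c _⟩
  · rintro a b _ _ ⟨a', ha, e⟩ ⟨b', hb, e'⟩
    exact ⟨a' + b', add_mem ha hb, by rw [add_mul, e, e', mul_add]⟩
  · rintro a b _ _ ⟨a', ha, e⟩ ⟨b', hb, e'⟩
    exact ⟨a' * b', mul_mem_Uzero ha hb, by rw [mul_assoc, e', ← mul_assoc, e, mul_assoc]⟩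

theorem mem_filNeg {N : ℕ} {x h y : U k} (hx : x ∈ Upos k) (hh : h ∈ Uzero k) {μ : RootCone k}
    (hy : y ∈ UnegW μ) (hN : N ≤ ht μ) : x * h * y ∈ filNeg k N :=
  Submodule.mul_mem_mul (Submodule.mul_mem_mul hx hh)
    (Submodule.mem_iSup_of_mem μ (Submodule.mem_iSup_of_mem hN hy))

theorem filNeg_le {N : ℕ} {S : Submodule Qq (U k)} (h : ∀ x, ∀ h ∈ Uzero k, ∀ μ, N ≤ ht μ →
    ∀ y ∈ wt μ, pos x * h * neg y ∈ S) : filNeg k N ≤ S := by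
  rw [filNeg, mul_assoc, Submodule.mul_le]
  intro x hx z hz
  obtain ⟨x, rfl⟩ := exists_pos hx
  suffices h' : Uzero k * (⨆ (μ : RootCone k) (_ : N ≤ ht μ), UnegW μ)
      ≤ S.comap (LinearMap.mulLeft Qq (pos x)) from h' hz
  rw [Submodule.mul_le]
  intro a ha y hy
  suffices h' : (⨆ (μ : RootCone k) (_ : N ≤ ht μ), UnegW μ)
      ≤ S.comap (LinearMap.mulLeft Qq (pos x * a)) by
    have := h' hy
    change pos x * a * y ∈ S at this
    change pos x * (a * y) ∈ S
    rwa [← mul_assoc]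
  refine iSup₂_le fun μ hμ => ?_
  rw [UnegW_eq]
  rintro _ ⟨y, hy, rfl⟩
  exact h x a ha μ hμ y hy

theorem ht_add (μ ν : RootCone k) : ht (μ + ν) = ht μ + ht ν := Finset.sum_add_distrib
theorem ht_single (i : Fin k) : ht (Pi.single i 1 : RootCone k) = 1 := by
  simp [ht]
theorem ht_add_single (μ : RootCone k) (i : Fin k) : ht (μ + Pi.single i 1) = ht μ + 1 := by
  rw [ht_add, ht_single]

/-- Only F_i needs an argument: it is moved past the positive part by `F_pos'`, past U⁰ up to a
change of the torus element, and then joins the negative part, which increases the height. -/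
theorem filNeg_gen_mul (g : UGen k) {N : ℕ} {z : U k} (hz : z ∈ filNeg k N) :
    U.gen g * z ∈ filNeg k N := by
  refine filNeg_le (S := (filNeg k N).comap (LinearMap.mulLeft Qq (U.gen g))) ?_ hz
  intro x h hh μ hμ y hy
  change U.gen g * (pos x * h * neg y) ∈ filNeg k N
  have hK : ∀ i x, K i * (pos x * h * neg y) ∈ filNeg k N ∧ Kinv i * (pos x * h * neg y) ∈ filNeg k N := by
    intro i x
    have key : ∀ l : List (Fin k), K i * (pos (word l) * h * neg y) ∈ filNeg k N ∧
        Kinv i * (pos (word l) * h * neg y) ∈ filNeg k N := fun l => by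
      have h2 := congrArg swapEF (K_neg i (word l))
      rw [kap_of_mem_wt i (word_mem_wt l)] at h2
      simp only [map_mul, map_smul, swapEF_K, swapEF_neg, smul_mul_assoc] at h2
      have h1 := skew_inv (zpow_ne_zero _ q_ne_zero) (Kinv_K i) (K_Kinv i) h2
      constructor
      · rw [← mul_assoc, ← mul_assoc, h1, smul_mul_assoc, smul_mul_assoc, mul_assoc _ (K i)]
        exact Submodule.smul_mem _ _ (mem_filNeg (pos_mem_Upos _)
          (mul_mem_Uzero (K_mem_Uzero i) hh) (neg_mem hy) hμ)
      · rw [← mul_assoc, ← mul_assoc, h2, smul_mul_assoc, smul_mul_assoc, mul_assoc _ (Kinv i)]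
        exact Submodule.smul_mem _ _ (mem_filNeg (pos_mem_Upos _)
          (mul_mem_Uzero (Kinv_mem_Uzero i) hh) (neg_mem hy) hμ)
    constructor
    · refine eq_top_of_word_mem (S := (filNeg k N).comap ((LinearMap.mulLeft Qq (K i)).comp
        ((LinearMap.mulRight Qq (neg y)).comp ((LinearMap.mulRight Qq h).comp pos.toLinearMap))))
        (fun l => (key l).1) x
    · refine eq_top_of_word_mem (S := (filNeg k N).comap ((LinearMap.mulLeft Qq (Kinv i)).comp
        ((LinearMap.mulRight Qq (neg y)).comp ((LinearMap.mulRight Qq h).comp pos.toLinearMap))))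
        (fun l => (key l).2) x
  cases g with
  | E i =>
    change E i * _ ∈ _
    rw [← mul_assoc, ← mul_assoc, ← pos_gen, ← map_mul]
    exact mem_filNeg (pos_mem_Upos _) hh (neg_mem hy) hμ
  | K i => exact (hK i x).1
  | Kinv i => exact (hK i x).2
  | F i =>
    change F i * _ ∈ _
    have e := sub_eq_iff_eq_add.mp (F_pos' i x)
    obtain ⟨h', hh', e'⟩ := F_Uzero i hh
    rw [← mul_assoc, ← mul_assoc, e, add_mul, add_mul, smul_mul_assoc, smul_mul_assoc, sub_mul,
      sub_mul, mul_assoc (pos x), e', ← mul_assoc (pos x), mul_assoc _ (F i), ← neg_gen i,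
      ← map_mul neg]
    refine add_mem (Submodule.smul_mem _ _ (sub_mem ?_ ?_)) ?_
    · rw [mul_assoc _ (Kinv i)]
      exact mem_filNeg (pos_mem_Upos _) (mul_mem_Uzero (Kinv_mem_Uzero i) hh) (neg_mem hy) hμ
    · have := (hK i (l i x)).1
      rwa [← mul_assoc, ← mul_assoc] at this
    · exact mem_filNeg (pos_mem_Upos _) hh' (neg_mem (gen_mul_mem_wt i hy))
        (by rw [ht_add_single]; omega)

theorem filNeg_mono {N N' : ℕ} (h : N ≤ N') : filNeg k N' ≤ filNeg k N :=
  filNeg_le fun x _ hh _ hμ _ hy => mem_filNeg (pos_mem_Upos x) hh (neg_mem hy) (h.trans hμ)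

theorem filNeg_mul_K (i : Fin k) {N : ℕ} {z : U k} (hz : z ∈ filNeg k N) :
    z * K i ∈ filNeg k N ∧ z * Kinv i ∈ filNeg k N := by
  constructor
  · refine filNeg_le (S := (filNeg k N).comap (LinearMap.mulRight Qq (K i))) ?_ hz
    intro x h hh μ hμ y hy
    change pos x * h * neg y * K i ∈ filNeg k N
    have h2 := K_neg i y
    rw [kap_of_mem_wt i hy, map_smul, smul_mul_assoc] at h2
    rw [mul_assoc, skew_symm h2, mul_smul_comm, ← mul_assoc, mul_assoc _ h]
    exact Submodule.smul_mem _ _ (mem_filNeg (pos_mem_Upos _)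
      (mul_mem_Uzero hh (K_mem_Uzero i)) (neg_mem hy) hμ)
  · refine filNeg_le (S := (filNeg k N).comap (LinearMap.mulRight Qq (Kinv i))) ?_ hz
    intro x h hh μ hμ y hy
    change pos x * h * neg y * Kinv i ∈ filNeg k N
    have h2 := Kinv_neg_kap i y
    rw [kap_of_mem_wt i hy, map_smul, mul_smul_comm] at h2
    rw [mul_assoc, ← h2, mul_smul_comm, ← mul_assoc, mul_assoc _ h]
    exact Submodule.smul_mem _ _ (mem_filNeg (pos_mem_Upos _)
      (mul_mem_Uzero hh (Kinv_mem_Uzero i)) (neg_mem hy) hμ)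

/-- Moving E_i to the left through U⁻ removes at most one letter, so right multiplication loses at
most one step of the filtration. -/
theorem filNeg_mul_gen (g : UGen k) {N : ℕ} {z : U k} (hz : z ∈ filNeg k (N + 1)) :
    z * U.gen g ∈ filNeg k N := by
  cases g with
  | K i => exact (filNeg_mul_K i (filNeg_mono (Nat.le_succ N) hz)).1
  | Kinv i => exact (filNeg_mul_K i (filNeg_mono (Nat.le_succ N) hz)).2
  | F i =>
    refine filNeg_le (S := (filNeg k N).comap (LinearMap.mulRight Qq (F i))) ?_ hz
    intro x h hh μ hμ y hy
    change pos x * h * neg y * F i ∈ filNeg k N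
    rw [mul_assoc, ← neg_gen i, ← map_mul neg]
    exact mem_filNeg (pos_mem_Upos _) hh (neg_mem (mul_gen_mem_wt i hy))
      (by rw [ht_add_single]; omega)
  | E i =>
    refine filNeg_le (S := (filNeg k N).comap (LinearMap.mulRight Qq (E i))) ?_ hz
    intro x h hh μ hμ y hy
    change pos x * h * neg y * E i ∈ filNeg k N
    obtain ⟨h', hh', e⟩ := Uzero_E i hh
    have e' : neg y * E i
        = E i * neg y - (q - q⁻¹)⁻¹ • (neg (r i y) * K i - Kinv i * neg (l i y)) := by
      rw [← E_neg']; abel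
    rw [mul_assoc, e', mul_sub, mul_smul_comm, mul_sub, ← mul_assoc, ← mul_assoc, ← mul_assoc,
      mul_assoc (pos x) h, e, ← mul_assoc, ← pos_gen i, ← map_mul pos, mul_assoc _ h (Kinv i)]
    refine sub_mem (mem_filNeg (pos_mem_Upos _) hh' (neg_mem hy) (by omega))
      (Submodule.smul_mem _ _ ?_)
    by_cases h0 : μ i = 0
    · rw [r_eq_zero hy h0, l_eq_zero hy h0]; simp
    · obtain ⟨ν, rfl⟩ := exists_add_single h0
      rw [ht_add_single] at hμ
      refine sub_mem (filNeg_mul_K i ?_).1 ?_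
      · exact mem_filNeg (pos_mem_Upos _) hh (neg_mem (r_mem_wt hy)) (by omega)
      · exact mem_filNeg (pos_mem_Upos _) (mul_mem_Uzero hh (Kinv_mem_Uzero i))
          (neg_mem (l_mem_wt hy)) (by omega)

theorem filNeg_mul_left (u : U k) {N : ℕ} {z : U k} (hz : z ∈ filNeg k N) : u * z ∈ filNeg k N := by
  induction u using U.induction generalizing z with
  | hc c => rw [← Algebra.smul_def]; exact Submodule.smul_mem _ _ hz
  | hg g => exact filNeg_gen_mul g hz
  | hm x y hx hy => rw [mul_assoc]; exact hx (hy hz)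
  | ha x y hx hy => rw [add_mul]; exact add_mem (hx hz) (hy hz)

/-- Continuity of right multiplication. The shift of the filtration depends on u, which is why `N'`
is existential, unlike for left multiplication. -/
theorem filNeg_mul_right (u : U k) (N : ℕ) : ∃ N', ∀ z ∈ filNeg k N', z * u ∈ filNeg k N := by
  induction u using U.induction generalizing N with
  | hc c =>
    exact ⟨N, fun z hz => by
      rw [← Algebra.commutes, ← Algebra.smul_def]; exact Submodule.smul_mem _ _ hz⟩
  | hg g => exact ⟨N + 1, fun z hz => filNeg_mul_gen g hz⟩
  | hm x y hx hy =>
    obtain ⟨N₁, h1⟩ := hy N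
    obtain ⟨N₂, h2⟩ := hx N₁
    exact ⟨N₂, fun z hz => by rw [← mul_assoc]; exact h1 _ (h2 _ hz)⟩
  | ha x y hx hy =>
    obtain ⟨N₁, h1⟩ := hx N
    obtain ⟨N₂, h2⟩ := hy N
    exact ⟨max N₁ N₂, fun z hz => by
      rw [mul_add]
      exact add_mem (h1 _ (filNeg_mono (le_max_left ..) hz)) (h2 _ (filNeg_mono (le_max_right ..) hz))⟩

theorem filPos_mono {N N' : ℕ} (h : N ≤ N') : filPos k N' ≤ filPos k N := fun _ hx =>
  mem_filPos_iff.mpr (filNeg_mono h (mem_filPos_iff.mp hx))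

theorem filPos_mul_left (u : U k) {N : ℕ} {z : U k} (hz : z ∈ filPos k N) : u * z ∈ filPos k N := by
  rw [mem_filPos_iff, map_mul]
  exact filNeg_mul_left _ (mem_filPos_iff.mp hz)

theorem filPos_mul_right (u : U k) (N : ℕ) : ∃ N', ∀ z ∈ filPos k N', z * u ∈ filPos k N := by
  obtain ⟨N', h⟩ := filNeg_mul_right (swapEF u) N
  exact ⟨N', fun z hz => by rw [mem_filPos_iff, map_mul]; exact h _ (mem_filPos_iff.mp hz)⟩

theorem tensorSub_mono {A A' B B' : Submodule Qq (U k)} (hA : A ≤ A') (hB : B ≤ B') :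
    tensorSub A B ≤ tensorSub A' B' := Submodule.map₂_le_map₂ hA hB

theorem tmul_mem_tensorSub {A B : Submodule Qq (U k)} {a b : U k} (ha : a ∈ A) (hb : b ∈ B) :
    a ⊗ₜ b ∈ tensorSub A B := Submodule.apply_mem_map₂ _ ha hb

theorem filTensor_mono {N N' : ℕ} (h : N ≤ N') : filTensor k N' ≤ filTensor k N :=
  sup_le_sup (tensorSub_mono (filPos_mono h) le_rfl) (tensorSub_mono le_rfl (filNeg_mono h))

theorem filTensor_le {N : ℕ} {S : Submodule Qq (U k ⊗[Qq] U k)}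
    (h1 : ∀ a ∈ filPos k N, ∀ b, a ⊗ₜ b ∈ S) (h2 : ∀ a, ∀ b ∈ filNeg k N, a ⊗ₜ b ∈ S) :
    filTensor k N ≤ S :=
  sup_le (Submodule.map₂_le.mpr fun a ha b _ => h1 a ha b)
    (Submodule.map₂_le.mpr fun a _ b hb => h2 a b hb)

theorem tmul_mem_filTensor_left {N : ℕ} {a : U k} (ha : a ∈ filPos k N) (b : U k) :
    a ⊗ₜ b ∈ filTensor k N :=
  Submodule.mem_sup_left (tmul_mem_tensorSub ha Submodule.mem_top)
theorem tmul_mem_filTensor_right {N : ℕ} {b : U k} (a : U k) (hb : b ∈ filNeg k N) :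
    a ⊗ₜ b ∈ filTensor k N :=
  Submodule.mem_sup_right (tmul_mem_tensorSub Submodule.mem_top hb)

theorem filTensor_mul_left (w : U k ⊗[Qq] U k) {N : ℕ} {z : U k ⊗[Qq] U k}
    (hz : z ∈ filTensor k N) : w * z ∈ filTensor k N := by
  induction w using TensorProduct.induction_on with
  | zero => rw [zero_mul]; exact zero_mem _
  | tmul c d =>
    refine filTensor_le (S := (filTensor k N).comap (LinearMap.mulLeft Qq (c ⊗ₜ d))) ?_ ?_ hz
    · intro a ha b
      rw [Submodule.mem_comap, LinearMap.mulLeft_apply, Algebra.TensorProduct.tmul_mul_tmul]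
      exact tmul_mem_filTensor_left (filPos_mul_left c ha) (d * b)
    · intro a b hb
      rw [Submodule.mem_comap, LinearMap.mulLeft_apply, Algebra.TensorProduct.tmul_mul_tmul]
      exact tmul_mem_filTensor_right (c * a) (filNeg_mul_left d hb)
  | add x y hx hy => rw [add_mul]; exact add_mem hx hy

theorem filTensor_mul_right (w : U k ⊗[Qq] U k) (N : ℕ) :
    ∃ N', ∀ z ∈ filTensor k N', z * w ∈ filTensor k N := by
  induction w using TensorProduct.induction_on with
  | zero => exact ⟨0, fun z _ => by rw [mul_zero]; exact zero_mem _⟩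
  | tmul c d =>
    obtain ⟨N₁, h1⟩ := filPos_mul_right c N
    obtain ⟨N₂, h2⟩ := filNeg_mul_right d N
    refine ⟨max N₁ N₂, fun z hz => ?_⟩
    refine filTensor_le (S := (filTensor k N).comap (LinearMap.mulRight Qq (c ⊗ₜ d))) ?_ ?_ hz
    · intro a ha b
      rw [Submodule.mem_comap, LinearMap.mulRight_apply, Algebra.TensorProduct.tmul_mul_tmul]
      exact tmul_mem_filTensor_left (h1 a (filPos_mono (le_max_left ..) ha)) (b * d)
    · intro a b hb
      rw [Submodule.mem_comap, LinearMap.mulRight_apply, Algebra.TensorProduct.tmul_mul_tmul]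
      exact tmul_mem_filTensor_right (a * c) (h2 b (filNeg_mono (le_max_right ..) hb))
  | add x y hx hy =>
    obtain ⟨N₁, h1⟩ := hx
    obtain ⟨N₂, h2⟩ := hy
    exact ⟨max N₁ N₂, fun z hz => by
      rw [mul_add]
      exact add_mem (h1 _ (filTensor_mono (le_max_left ..) hz))
        (h2 _ (filTensor_mono (le_max_right ..) hz))⟩

section SumsToZero

variable {Y : Type} [AddCommGroup Y] [Module Qq Y] {J : ℕ → Submodule Qq Y}

theorem SumsToZero.zero : SumsToZero J fun _ : RootCone k => 0 :=
  fun N => ⟨∅, fun S _ => by rw [Finset.sum_const_zero]; exact zero_mem _⟩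

theorem SumsToZero.add {x y : RootCone k → Y} (hx : SumsToZero J x) (hy : SumsToZero J y) :
    SumsToZero J fun μ => x μ + y μ := by
  classical
  intro N
  obtain ⟨A, hA⟩ := hx N
  obtain ⟨B, hB⟩ := hy N
  refine ⟨A ∪ B, fun S hS => ?_⟩
  rw [Finset.sum_add_distrib]
  exact add_mem (hA S (Finset.union_subset_left hS)) (hB S (Finset.union_subset_right hS))

theorem SumsToZero.map {x : RootCone k → Y} (hx : SumsToZero J x) (f : Y →+ Y)
    (hf : ∀ N, ∃ N', ∀ z ∈ J N', f z ∈ J N) : SumsToZero J fun μ => f (x μ) := by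
  intro N
  obtain ⟨N', h⟩ := hf N
  obtain ⟨A, hA⟩ := hx N'
  refine ⟨A, fun S hS => ?_⟩
  rw [← map_sum]
  exact h _ (hA S hS)

/-- How a recursion between components becomes an identity in the completion: a_{ν+β} cancels g_ν,
so a large partial sum leaves only terms of large height. -/
theorem SumsToZero.telescope (β : RootCone k) {a g : RootCone k → Y} (h1 : ∀ ν, a (ν + β) = g ν)
    (h2 : ∀ ν, (¬ ∃ ν', ν = ν' + β) → a ν = 0) (hJ : ∀ N, ∃ M, ∀ ν, M ≤ ht ν → g ν ∈ J N) :
    SumsToZero J fun ν => a ν - g ν := by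
  classical
  intro N
  obtain ⟨M, hM⟩ := hJ N
  -- This box contains every ν of height at most M + ht β. Hence S and its translate by -β both
  -- contain all ν of height at most M, and the uncancelled terms lie above that height.
  refine ⟨Finset.Iic fun _ => M + ht β, fun S hS => ?_⟩
  have hS' : ∀ ν, ht ν ≤ M + ht β → ν ∈ S := fun ν hν => by
    refine hS (Finset.mem_Iic.mpr fun i => le_trans ?_ hν)
    exact Finset.single_le_sum (f := ν) (fun _ _ => Nat.zero_le _) (Finset.mem_univ i)
  let S' := S.preimage (fun ν => ν + β) (add_left_injective β).injOn
  have h3 : ∑ ν ∈ S, a ν = ∑ ν ∈ S', g ν := by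
    rw [← Finset.sum_preimage (fun ν => ν + β) S (add_left_injective β).injOn a]
    · exact Finset.sum_congr rfl fun ν _ => h1 ν
    · intro ν _ hν
      exact h2 ν fun ⟨ν', e⟩ => hν ⟨ν', e.symm⟩
  rw [Finset.sum_sub_distrib, h3, ← Finset.sum_sdiff_sub_sum_sdiff]
  refine sub_mem (sum_mem fun ν hν => hM ν ?_) (sum_mem fun ν hν => hM ν ?_)
  · by_contra h
    exact (Finset.mem_sdiff.mp hν).2 (hS' ν (by omega))
  · by_contra h
    refine (Finset.mem_sdiff.mp hν).2 (Finset.mem_preimage.mpr (hS' _ ?_))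
    rw [ht_add]; omega

end SumsToZero

end QSymPair

end

/-! ### Existence of the quasi-R-matrix -/

noncomputable section

namespace QSymPair

open U NilAlg SA

variable {k : ℕ}

/-- An intertwining relation between two families of operators is a consequence of the relations for
two factors. -/
theorem SumsToZero.intertwine_mul {Y : Type} [Ring Y] [Algebra Qq Y] {J : ℕ → Submodule Qq Y}
    (hl : ∀ u N, ∃ N', ∀ z ∈ J N', u * z ∈ J N) (hr : ∀ u N, ∃ N', ∀ z ∈ J N', z * u ∈ J N)
    {Z : RootCone k → Y} {a a' b b' : Y} (h : SumsToZero J fun ν => a * Z ν - Z ν * a')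
    (h' : SumsToZero J fun ν => b * Z ν - Z ν * b') :
    SumsToZero J fun ν => a * b * Z ν - Z ν * (a' * b') := by
  -- The identity abZ - Za'b' = a(bZ - Zb') + (aZ - Za')b'.
  have := (h'.map (AddMonoidHom.mulLeft a) (hl a)).add (h.map (AddMonoidHom.mulRight b') (hr b'))
  convert this using 2 with ν
  simp only [AddMonoidHom.coe_mulLeft, AddMonoidHom.coe_mulRight]
  noncomm_ring

theorem SumsToZero.intertwine_add {Y : Type} [Ring Y] [Algebra Qq Y] {J : ℕ → Submodule Qq Y}
    {Z : RootCone k → Y} {a a' b b' : Y} (h : SumsToZero J fun ν => a * Z ν - Z ν * a')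
    (h' : SumsToZero J fun ν => b * Z ν - Z ν * b') :
    SumsToZero J fun ν => (a + b) * Z ν - Z ν * (a' + b') := by
  convert h.add h' using 2 with ν
  noncomm_ring

theorem SumsToZero.of_eq {Y : Type} [Ring Y] [Algebra Qq Y] {J : ℕ → Submodule Qq Y}
    {Z : RootCone k → Y} {a a' : Y} (h : ∀ ν, a * Z ν = Z ν * a') :
    SumsToZero J fun ν => a * Z ν - Z ν * a' := by
  simp only [h, sub_self]
  exact SumsToZero.zero

namespace U

theorem barU_mul (x y : U k) : barU (x * y) = barU x * barU y := map_mul barHom x y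
theorem barU_one : barU (1 : U k) = 1 := map_one barHom
theorem barU_gen (x : UGen k) : barU (gen x) = match x with
    | .E i => E i
    | .F i => F i
    | .K i => Kinv i
    | .Kinv i => K i := (lift_gen (A := Twist (U k)) _ _ x).trans (by cases x <;> rfl)
@[simp] theorem barU_E (i : Fin k) : barU (E i) = E i := barU_gen _
@[simp] theorem barU_F (i : Fin k) : barU (F i) = F i := barU_gen _
@[simp] theorem barU_K (i : Fin k) : barU (K i) = Kinv i := barU_gen _
@[simp] theorem barU_Kinv (i : Fin k) : barU (Kinv i) = K i := barU_gen _
theorem barU_algebraMap (c : Qq) : barU (algebraMap Qq (U k) c) = algebraMap Qq (U k) (bar c) := by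
  have h := map_smulₛₗ barU c (1 : U k)
  rwa [barU_one, ← Algebra.algebraMap_eq_smul_one, ← Algebra.algebraMap_eq_smul_one] at h

theorem bar_bar (c : Qq) : bar (bar c) = c := by
  have key : ∀ P : Polynomial ℚ, bar (bar (algebraMap (Polynomial ℚ) Qq P))
      = algebraMap (Polynomial ℚ) Qq P := by
    intro P
    induction P using Polynomial.induction_on with
    | C a =>
      have : (algebraMap (Polynomial ℚ) Qq) (Polynomial.C a) = ((a : ℚ) : Qq) := by
        exact map_ratCast ((algebraMap (Polynomial ℚ) Qq).comp Polynomial.C) a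
      rw [this, map_ratCast, map_ratCast]
    | add p q hp hq => simp only [map_add, hp, hq]
    | monomial n a h =>
      rw [pow_succ, ← mul_assoc, map_mul, map_mul, map_mul, h]
      congr 1
      rw [RatFunc.algebraMap_X]
      change bar (bar q) = q
      simp
  obtain ⟨a, b, hb, rfl⟩ := IsFractionRing.div_surjective (A := Polynomial ℚ) c
  rw [map_div₀, map_div₀, key, key]

theorem coprod_E (i : Fin k) : coprod (E i) = 1 ⊗ₜ E i + E i ⊗ₜ Kinv i := lift_gen ..
theorem coprod_F (i : Fin k) : coprod (F i) = F i ⊗ₜ 1 + K i ⊗ₜ F i := lift_gen ..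
theorem coprod_K (i : Fin k) : coprod (K i) = K i ⊗ₜ K i := lift_gen ..
theorem coprod_Kinv (i : Fin k) : coprod (Kinv i) = Kinv i ⊗ₜ Kinv i := lift_gen ..

theorem map_barU_mul (x y : U k ⊗[Qq] U k) :
    TensorProduct.map barU barU (x * y)
      = TensorProduct.map barU barU x * (TensorProduct.map barU barU y : U k ⊗[Qq] U k) := by
  induction x using TensorProduct.induction_on with
  | zero => simp
  | add a b ha hb => rw [add_mul, map_add, map_add, ha, hb, add_mul]
  | tmul a b =>
    induction y using TensorProduct.induction_on with
    | zero => simp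
    | add c d hc hd => rw [mul_add, map_add, map_add, hc, hd, mul_add]
    | tmul c d =>
      simp only [Algebra.TensorProduct.tmul_mul_tmul, TensorProduct.map_tmul, barU_mul]

end U

theorem barCoprod_mul (x y : U k) : barCoprod (x * y) = barCoprod x * barCoprod y := by
  rw [barCoprod, barU_mul, map_mul, map_barU_mul]; rfl
theorem barCoprod_add (x y : U k) : barCoprod (x + y) = barCoprod x + barCoprod y := by
  rw [barCoprod, map_add, map_add, map_add]; rfl
theorem barCoprod_algebraMap (c : Qq) :
    barCoprod (algebraMap Qq (U k) c) = algebraMap Qq (U k ⊗[Qq] U k) c := by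
  rw [barCoprod, barU_algebraMap, AlgHom.commutes, Algebra.algebraMap_eq_smul_one, map_smulₛₗ,
    Algebra.TensorProduct.one_def, TensorProduct.map_tmul, barU_one, bar_bar,
    Algebra.algebraMap_eq_smul_one, Algebra.TensorProduct.one_def]
theorem barCoprod_E (i : Fin k) : barCoprod (E i) = 1 ⊗ₜ E i + E i ⊗ₜ K i := by
  rw [barCoprod, barU_E, coprod_E, map_add]; simp [barU_one]
theorem barCoprod_F (i : Fin k) : barCoprod (F i) = F i ⊗ₜ 1 + Kinv i ⊗ₜ F i := by
  rw [barCoprod, barU_F, coprod_F, map_add]; simp [barU_one]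
theorem barCoprod_K (i : Fin k) : barCoprod (K i) = K i ⊗ₜ K i := by
  rw [barCoprod, barU_K, coprod_Kinv]; simp
theorem barCoprod_Kinv (i : Fin k) : barCoprod (Kinv i) = Kinv i ⊗ₜ Kinv i := by
  rw [barCoprod, barU_Kinv, coprod_K]; simp

/-- `θ_i ⊗ θ_j ↦ E_i ⊗ F_j`. -/
def posNeg : SA k ⊗[Qq] SA k →ₐ[Qq] U k ⊗[Qq] U k := Algebra.TensorProduct.map pos neg

theorem posNeg_tmul (x y : SA k) : posNeg (x ⊗ₜ y) = pos x ⊗ₜ neg y :=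
    Algebra.TensorProduct.map_tmul ..

theorem posNeg_E (i : Fin k) (Z : SA k ⊗[Qq] SA k) :
    (1 ⊗ₜ E i) * posNeg Z - posNeg Z * (1 ⊗ₜ E i) = (q - q⁻¹)⁻¹ •
      (posNeg ((r i).lTensor (SA k) Z) * (1 ⊗ₜ K i)
        - (1 ⊗ₜ Kinv i) * posNeg ((l i).lTensor (SA k) Z)) := by
  induction Z using TensorProduct.induction_on with
  | zero => simp
  | tmul x y =>
    simp only [LinearMap.lTensor_tmul, posNeg_tmul, Algebra.TensorProduct.tmul_mul_tmul, one_mul,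
      mul_one, ← TensorProduct.tmul_sub, E_neg', TensorProduct.tmul_smul]
  | add a b ha hb =>
    simp only [map_add, mul_add, add_mul]
    rw [add_sub_add_comm, add_sub_add_comm, smul_add, ha, hb]

theorem posNeg_F (i : Fin k) (Z : SA k ⊗[Qq] SA k) :
    (F i ⊗ₜ 1) * posNeg Z - posNeg Z * (F i ⊗ₜ 1) = (q - q⁻¹)⁻¹ •
      (posNeg ((r i).rTensor (SA k) Z) * (Kinv i ⊗ₜ 1)
        - (K i ⊗ₜ 1) * posNeg ((l i).rTensor (SA k) Z)) := by
  induction Z using TensorProduct.induction_on with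
  | zero => simp
  | tmul x y =>
    simp only [LinearMap.rTensor_tmul, posNeg_tmul, Algebra.TensorProduct.tmul_mul_tmul, one_mul,
      mul_one, ← TensorProduct.sub_tmul, F_pos', ← TensorProduct.smul_tmul']
  | add a b ha hb =>
    simp only [map_add, mul_add, add_mul]
    rw [add_sub_add_comm, add_sub_add_comm, smul_add, ha, hb]

/-- The components of the quasi-`R`-matrix. -/
def theta (ν : RootCone k) : U k ⊗[Qq] U k := (q - q⁻¹) ^ ht ν • posNeg (canon ν)

theorem mem_span_induction_canon {S : Submodule Qq (SA k ⊗[Qq] SA k)} {ν : RootCone k}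
    (h : ∀ a ∈ wt ν, ∀ b ∈ wt ν, a ⊗ₜ b ∈ S) : canon ν ∈ S :=
  (Submodule.map₂_le (f := TensorProduct.mk Qq (SA k) (SA k)).mpr h) (canon_mem ν)

theorem theta_mem (ν : RootCone k) : theta ν ∈ tensorSub (UposW ν) (UnegW ν) := by
  refine Submodule.smul_mem (tensorSub (UposW ν) (UnegW ν)) _ ?_
  refine mem_span_induction_canon (S := (tensorSub (UposW ν) (UnegW ν)).comap posNeg.toLinearMap)
    fun a ha b hb => ?_
  change posNeg (a ⊗ₜ b) ∈ tensorSub (UposW ν) (UnegW ν)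
  rw [posNeg_tmul]
  exact tmul_mem_tensorSub (pos_mem ha) (neg_mem hb)

theorem theta_zero : theta (0 : RootCone k) = 1 := by
  rw [theta, canon_zero, map_one]; simp [ht]

theorem lTensor_canon_eq_zero {ν : RootCone k} (D : SA k →ₗ[Qq] SA k) (h : ∀ x ∈ wt ν, D x = 0) :
    D.lTensor (SA k) (canon ν) = 0 ∧ D.rTensor (SA k) (canon ν) = 0 := by
  constructor
  · exact mem_span_induction_canon (S := LinearMap.ker (D.lTensor (SA k))) fun a _ b hb => by
      rw [LinearMap.mem_ker, LinearMap.lTensor_tmul, h b hb, TensorProduct.tmul_zero]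
  · exact mem_span_induction_canon (S := LinearMap.ker (D.rTensor (SA k))) fun a ha b _ => by
      rw [LinearMap.mem_ker, LinearMap.rTensor_tmul, h a ha, TensorProduct.zero_tmul]

theorem canon_eq_zero {ν : RootCone k} {i : Fin k}
    (h : ¬ ∃ ν' : RootCone k, ν = ν' + Pi.single i 1) :
    (r i).lTensor (SA k) (canon ν) = 0 ∧ (l i).lTensor (SA k) (canon ν) = 0 ∧
    (r i).rTensor (SA k) (canon ν) = 0 ∧ (l i).rTensor (SA k) (canon ν) = 0 := by
  have h0 : ν i = 0 := by
    by_contra h'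
    exact h (exists_add_single h')
  have h1 := lTensor_canon_eq_zero (r i) (ν := ν) fun x hx => r_eq_zero hx h0
  have h2 := lTensor_canon_eq_zero (l i) (ν := ν) fun x hx => l_eq_zero hx h0
  exact ⟨h1.1, h2.1, h1.2, h2.2⟩

/-- The commutator with E_i on the right leg is given by r_i and l_i, which the canonical element
converts into multiplication by E_i on the left leg. The power of q - q⁻¹ in `theta` absorbs the
denominator of the commutator formula, the form being normalised by (θ_i, θ_i) = 1. -/
theorem theta_E (i : Fin k) (ν : RootCone k) :
    (1 ⊗ₜ E i) * theta (ν + Pi.single i 1) - theta (ν + Pi.single i 1) * (1 ⊗ₜ E i)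
      = theta ν * (E i ⊗ₜ K i) - (E i ⊗ₜ Kinv i) * theta ν := by
  simp only [theta, mul_smul_comm, smul_mul_assoc]
  rw [← smul_sub, posNeg_E, canon_r, canon_l, ht_add_single, pow_succ, mul_smul,
    smul_smul (q - q⁻¹), mul_inv_cancel₀ q_sub_inv_ne_zero, one_smul, map_mul, map_mul, posNeg_tmul,
    pos_gen, map_one, mul_assoc, ← mul_assoc (1 ⊗ₜ[Qq] Kinv i), smul_sub]
  simp only [Algebra.TensorProduct.tmul_mul_tmul, one_mul, mul_one]

theorem theta_F (i : Fin k) (ν : RootCone k) :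
    (F i ⊗ₜ 1) * theta (ν + Pi.single i 1) - theta (ν + Pi.single i 1) * (F i ⊗ₜ 1)
      = theta ν * (Kinv i ⊗ₜ F i) - (K i ⊗ₜ F i) * theta ν := by
  simp only [theta, mul_smul_comm, smul_mul_assoc]
  rw [← smul_sub, posNeg_F, canon_r_left, canon_l_left, ht_add_single, pow_succ, mul_smul,
    smul_smul (q - q⁻¹), mul_inv_cancel₀ q_sub_inv_ne_zero, one_smul, map_mul, map_mul, posNeg_tmul,
    neg_gen, map_one, mul_assoc, ← mul_assoc (K i ⊗ₜ[Qq] 1), smul_sub]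
  simp only [Algebra.TensorProduct.tmul_mul_tmul, one_mul, mul_one]

theorem theta_skew {w w' : U k ⊗[Qq] U k} {ν : RootCone k}
    (h : ∀ a ∈ wt ν, ∀ b ∈ wt ν, w * (pos a ⊗ₜ neg b) = (pos a ⊗ₜ neg b) * w') :
    w * theta ν = theta ν * w' := by
  rw [theta, mul_smul_comm, smul_mul_assoc]
  congr 1
  exact mem_span_induction_canon (S := LinearMap.eqLocus
    ((LinearMap.mulLeft Qq w).comp posNeg.toLinearMap)
    ((LinearMap.mulRight Qq w').comp posNeg.toLinearMap)) fun a ha b hb => by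
      change w * posNeg (a ⊗ₜ b) = posNeg (a ⊗ₜ b) * w'
      rw [posNeg_tmul, h a ha b hb]

theorem K_neg_wt {μ : RootCone k} (i : Fin k) {y : SA k} (hy : y ∈ wt μ) :
    K i * neg y = q ^ (-∑ j, cartan i j * μ j) • (neg y * K i) := by
  rw [K_neg, kap_of_mem_wt i hy, map_smul, smul_mul_assoc]
theorem Kinv_neg_wt {μ : RootCone k} (i : Fin k) {y : SA k} (hy : y ∈ wt μ) :
    Kinv i * neg y = q ^ (∑ j, cartan i j * μ j) • (neg y * Kinv i) := by
  have := skew_inv (zpow_ne_zero _ q_ne_zero) (K_Kinv i) (Kinv_K i) (K_neg_wt i hy)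
  rwa [zpow_neg, inv_inv] at this
theorem K_pos_wt {μ : RootCone k} (i : Fin k) {y : SA k} (hy : y ∈ wt μ) :
    K i * pos y = q ^ (∑ j, cartan i j * μ j) • (pos y * K i) := by
  simpa using congrArg swapEF (Kinv_neg_wt i hy)
theorem Kinv_pos_wt {μ : RootCone k} (i : Fin k) {y : SA k} (hy : y ∈ wt μ) :
    Kinv i * pos y = q ^ (-∑ j, cartan i j * μ j) • (pos y * Kinv i) := by
  have := congrArg swapEF (K_neg_wt i hy)
  simpa only [map_mul, map_smul, swapEF_K, swapEF_neg] using this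

theorem theta_K (i : Fin k) (ν : RootCone k) :
    (K i ⊗ₜ K i) * theta ν = theta ν * (K i ⊗ₜ K i) ∧
    (Kinv i ⊗ₜ Kinv i) * theta ν = theta ν * (Kinv i ⊗ₜ Kinv i) := by
  constructor
  · refine theta_skew fun a ha b hb => ?_
    rw [Algebra.TensorProduct.tmul_mul_tmul, Algebra.TensorProduct.tmul_mul_tmul, K_pos_wt i ha,
      K_neg_wt i hb, TensorProduct.smul_tmul_smul, ← zpow_add₀ q_ne_zero]
    simp
  · refine theta_skew fun a ha b hb => ?_
    rw [Algebra.TensorProduct.tmul_mul_tmul, Algebra.TensorProduct.tmul_mul_tmul, Kinv_pos_wt i ha,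
      Kinv_neg_wt i hb, TensorProduct.smul_tmul_smul, ← zpow_add₀ q_ne_zero]
    simp

theorem UposW_le_filPos {N : ℕ} {μ : RootCone k} (h : N ≤ ht μ) : UposW μ ≤ filPos k N := by
  intro x hx
  rw [← one_mul x, ← one_mul (1 : U k)]
  exact Submodule.mul_mem_mul (Submodule.mul_mem_mul (one_mem (S := Subalgebra Qq (U k)) _)
    (one_mem (S := Subalgebra Qq (U k)) _))
    (Submodule.mem_iSup_of_mem μ (Submodule.mem_iSup_of_mem h hx))

theorem UnegW_le_filNeg {N : ℕ} {μ : RootCone k} (h : N ≤ ht μ) : UnegW μ ≤ filNeg k N := by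
  intro x hx
  have := mem_filNeg (N := N) (one_mem (S := Subalgebra Qq (U k)) _)
    (one_mem (S := Subalgebra Qq (U k)) _) hx h
  rwa [one_mul, one_mul] at this

theorem theta_mem_filTensor {N : ℕ} {ν : RootCone k} (h : N ≤ ht ν) : theta ν ∈ filTensor k N :=
  Submodule.mem_sup_left (tensorSub_mono (UposW_le_filPos h) le_top (theta_mem ν))

/-- The set of u that satisfy the intertwining relation is a subalgebra, so generators suffice. For
E_i and F_i the recursions telescope; for K_i the relation holds in each weight, because the two
legs have opposite weights. -/
theorem isQuasiR_theta : IsQuasiR (theta (k := k)) where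
  mem := theta_mem
  zero := theta_zero
  intertwines u := by
    have hl : ∀ (w : U k ⊗[Qq] U k) N, ∃ N', ∀ z ∈ filTensor k N', w * z ∈ filTensor k N :=
      fun w N => ⟨N, fun z hz => filTensor_mul_left w hz⟩
    have hg : ∀ (w w' : U k ⊗[Qq] U k) N, ∃ M, ∀ ν, M ≤ ht ν →
        theta ν * w - w' * theta ν ∈ filTensor k N := fun w w' N => by
      obtain ⟨N', h⟩ := filTensor_mul_right w N
      exact ⟨max N N', fun ν hν => sub_mem (h _ (theta_mem_filTensor ((le_max_right ..).trans hν)))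
        (filTensor_mul_left w' (theta_mem_filTensor ((le_max_left ..).trans hν)))⟩
    induction u using U.induction with
    | hc c =>
      refine SumsToZero.of_eq fun ν => ?_
      rw [barCoprod_algebraMap, AlgHom.commutes, Algebra.commutes]
    | hg g =>
      cases g with
      | E i =>
        change SumsToZero _ fun ν => coprod (E i) * theta ν - theta ν * barCoprod (E i)
        rw [coprod_E, barCoprod_E]
        have := SumsToZero.telescope (J := filTensor k) (Pi.single i 1)
          (a := fun ν => (1 ⊗ₜ E i) * theta ν - theta ν * (1 ⊗ₜ E i))
          (g := fun ν => theta ν * (E i ⊗ₜ K i) - (E i ⊗ₜ Kinv i) * theta ν) (theta_E i)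
          (fun ν h => by
            obtain ⟨h1, h2, -, -⟩ := canon_eq_zero h
            simp only [theta, mul_smul_comm, smul_mul_assoc]
            rw [← smul_sub, posNeg_E, h1, h2]; simp) (hg _ _)
        convert this using 2 with ν
        noncomm_ring
      | F i =>
        change SumsToZero _ fun ν => coprod (F i) * theta ν - theta ν * barCoprod (F i)
        rw [coprod_F, barCoprod_F]
        have := SumsToZero.telescope (J := filTensor k) (Pi.single i 1)
          (a := fun ν => (F i ⊗ₜ 1) * theta ν - theta ν * (F i ⊗ₜ 1))
          (g := fun ν => theta ν * (Kinv i ⊗ₜ F i) - (K i ⊗ₜ F i) * theta ν) (theta_F i)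
          (fun ν h => by
            obtain ⟨-, -, h1, h2⟩ := canon_eq_zero h
            simp only [theta, mul_smul_comm, smul_mul_assoc]
            rw [← smul_sub, posNeg_F, h1, h2]; simp) (hg _ _)
        convert this using 2 with ν
        noncomm_ring
      | K i =>
        refine SumsToZero.of_eq fun ν => ?_
        change coprod (K i) * _ = _ * barCoprod (K i)
        rw [coprod_K, barCoprod_K, (theta_K i ν).1]
      | Kinv i =>
        refine SumsToZero.of_eq fun ν => ?_
        change coprod (Kinv i) * _ = _ * barCoprod (Kinv i)
        rw [coprod_Kinv, barCoprod_Kinv, (theta_K i ν).2]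
    | hm x y hx hy =>
      rw [map_mul, barCoprod_mul]
      exact SumsToZero.intertwine_mul hl filTensor_mul_right hx hy
    | ha x y hx hy =>
      rw [map_add, barCoprod_add]
      exact SumsToZero.intertwine_add hx hy

/-- Existence is all that is needed to use the chosen family; the sequel relies on its defining
properties only. -/
theorem isQuasiR_quasiR : IsQuasiR (quasiR k) := Classical.epsilon_spec ⟨_, isQuasiR_theta⟩

end QSymPair

end

/-! ### Existence of the intertwiner Υ -/

noncomputable section

namespace QSymPair

open U NilAlg SA

variable {k : ℕ}

namespace UI

@[simp] theorem lift_gen {A : Type} [Ring A] [Algebra Qq A] (g : IGen k → A)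
    (h : ∀ x y, IRel k x y → FreeAlgebra.lift Qq g x = FreeAlgebra.lift Qq g y) (x : IGen k) :
    lift g h (gen x) = g x := by
  unfold lift gen
  erw [RingQuot.liftAlgHom_mkAlgHom_apply]
  exact FreeAlgebra.lift_ι_apply g x

theorem induction {P : UI k → Prop} (hc : ∀ c, P (algebraMap Qq (UI k) c)) (hg : ∀ g, P (gen g))
    (hm : ∀ x y, P x → P y → P (x * y)) (ha : ∀ x y, P x → P y → P (x + y)) (u : UI k) : P u := by
  obtain ⟨x, rfl⟩ := RingQuot.mkAlgHom_surjective Qq (IRel k) u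
  induction x using FreeAlgebra.induction with
  | grade0 c => rw [AlgHom.commutes]; exact hc c
  | grade1 g => exact hg g
  | mul a b h1 h2 => rw [map_mul]; exact hm _ _ h1 h2
  | add a b h1 h2 => rw [map_add]; exact ha _ _ h1 h2

theorem barUI_mul (x y : UI k) : barUI (x * y) = barUI x * barUI y := map_mul barHom x y
theorem barUI_one : barUI (1 : UI k) = 1 := map_one barHom
theorem barUI_gen (x : IGen k) : barUI (gen x) = barGen x := lift_gen (A := Twist (UI k)) _ _ x
theorem barUI_algebraMap (c : Qq) :
    barUI (algebraMap Qq (UI k) c) = algebraMap Qq (UI k) (bar c) := by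
  have h := map_smulₛₗ barUI c (1 : UI k)
  rwa [barUI_one, ← Algebra.algebraMap_eq_smul_one, ← Algebra.algebraMap_eq_smul_one] at h
theorem emb_gen (x : IGen k) : emb (gen x) = embGen x := lift_gen ..

/-- The coefficient of `F_{-i} K_i⁻¹` in the generator of `U^ı` with leading term `E_i`. -/
def coeff (i : Fin k) : Qq := if i.rev < i then 1 else if i < i.rev then q ^ cartan i i.rev else q

/-- The element of `U^ı` with leading term `E_i`. -/
def B (i : Fin k) : UI k :=
  if h : i.rev < i then gen (.e ⟨i, h⟩) else
    if h : i < i.rev then gen (.f ⟨i.rev, by rwa [Fin.rev_rev]⟩) else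
      gen (.t i (le_antisymm (not_lt.mp h) (not_lt.mp ‹_›)))

theorem B_e (i : Pos k) : gen (.e i) = B i.1 := by rw [B, dif_pos i.2]
theorem B_f (i : Pos k) : gen (.f i) = B i.1.rev := by
  have h : i.1.rev < i.1.rev.rev := by rw [Fin.rev_rev]; exact i.2
  rw [B, dif_neg h.not_gt, dif_pos h]
  congr 3
  exact Subtype.ext (Fin.rev_rev _).symm
theorem B_t (z : Fin k) (hz : z.rev = z) : gen (.t z hz) = B z := by
  rw [B, dif_neg (by rw [hz]; exact lt_irrefl z), dif_neg (by rw [hz]; exact lt_irrefl z)]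

theorem bar_coeff (i : Fin k) : bar (coeff i) = (coeff i)⁻¹ := by
  unfold coeff
  split_ifs <;> simp

/-- The compatibility between the coefficients at i and -i that makes the l-term of the commutator
with E_i match the coefficient of F_{-i} K_i⁻¹ in the embedding. -/
theorem coeff_rev (i : Fin k) : (coeff i.rev)⁻¹ * q ^ cartan i i.rev = coeff i := by
  have hq := q_ne_zero
  unfold coeff
  rw [Fin.rev_rev]
  rcases lt_trichotomy i i.rev with h | h | h
  · rw [if_pos h, if_neg h.not_gt, if_pos h, inv_one, one_mul]
  · rw [← h, cartan_self]
    simp only [lt_self_iff_false, if_false]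
    rw [zpow_ofNat]; field_simp
  · rw [if_neg h.not_gt, if_pos h, if_pos h, cartan_symm, inv_mul_cancel₀ (zpow_ne_zero _ hq)]

/-- The symmetry required by `exists_functional`; it concerns only pairs i, -i that are neither
equal nor adjacent. -/
theorem coeff_far {i : Fin k} (h : Far i i.rev) : coeff i = coeff i.rev := by
  unfold coeff
  rw [Fin.rev_rev, cartan_symm i.rev, cartan_far h, zpow_zero]
  rcases lt_trichotomy i i.rev with h | h | h
  · rw [if_neg h.not_gt, if_pos h, if_pos h]
  · rw [← h]
  · rw [if_pos h, if_neg h.not_gt, if_pos h]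

theorem emb_B (i : Fin k) : emb (B i) = E i + coeff i • (F i.rev * Kinv i) := by
  rcases lt_trichotomy i i.rev with h | h | h
  · rw [B, dif_neg h.not_gt, dif_pos h, emb_gen, coeff, if_neg h.not_gt, if_pos h]
    change Kinv i.rev.rev * F i.rev + E i.rev.rev = _
    rw [Fin.rev_rev, Kinv_F, add_comm]
  · have h1 := h.symm
    rw [← B_t i h.symm, emb_gen, coeff, if_neg (by rw [h1]; exact lt_irrefl i),
      if_neg (by rw [h1]; exact lt_irrefl i)]
    simp only [embGen, h1]
  · rw [B, dif_pos h, emb_gen, coeff, if_pos h, one_smul]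
    rfl

theorem barUI_B (i : Fin k) : barUI (B i) = B i := by
  unfold B
  split_ifs <;> exact barUI_gen _

theorem barU_emb_B (i : Fin k) : barU (emb (B i)) = E i + (coeff i)⁻¹ • (F i.rev * K i) := by
  rw [emb_B, map_add, map_smulₛₗ, barU_mul, bar_coeff, barU_E, barU_F, barU_Kinv]

/-- The image of `U^ı` is generated by the `B_i` and the group-like elements. -/
theorem induction_B {P : UI k → Prop} (hc : ∀ c, P (algebraMap Qq (UI k) c)) (hB : ∀ i, P (B i))
    (hκ : ∀ i, P (gen (.κ i))) (hκ' : ∀ i, P (gen (.κinv i)))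
    (hm : ∀ x y, P x → P y → P (x * y)) (ha : ∀ x y, P x → P y → P (x + y)) (u : UI k) : P u := by
  refine induction hc (fun g => ?_) hm ha u
  cases g with
  | e i => rw [B_e]; exact hB _
  | f i => rw [B_f]; exact hB _
  | κ i => exact hκ i
  | κinv i => exact hκ' i
  | t z hz => rw [B_t]; exact hB _

end UI

theorem sum_cartan_rev (i : Fin k) {μ : RootCone k} (h : ∀ j, μ j.rev = μ j) :
    ∑ j, cartan i.rev j * (μ j : ℤ) = ∑ j, cartan i j * (μ j : ℤ) := by
  rw [← Equiv.sum_comp Fin.revPerm]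
  simp only [Fin.revPerm_apply, cartan_rev, h]

/-- With c_i = (q - q⁻¹)/coeff_i the commutator of E_i with the component of weight μ + α_i + α_{-i}
consists of the two terms by which F_{-i} K_i^{±1} acts on the component of weight μ, so the
relation for B_i telescopes. -/
theorem exists_isIntertwiner : ∃ Y : RootCone k → U k, IsIntertwiner Y := by
  obtain ⟨y, hy, h0, hr, hl, hn⟩ := exists_intertwining_elements
    (fun i : Fin k => (q - q⁻¹) * (UI.coeff i)⁻¹) (fun i h => by
      rw [UI.coeff_far h])
  -- Nonzero components occur only in weights invariant under i ↦ -i. This is what makes the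
  -- elements K_i K_{-i}⁻¹ commute with every component.
  have sym : ∀ n, ∀ μ : RootCone k, ht μ = n → y μ ≠ 0 → ∀ j, μ j.rev = μ j := by
    intro n
    induction n using Nat.strong_induction_on with
    | _ n ih =>
      intro μ hμ hne
      by_cases hμ0 : μ = 0
      · simp [hμ0]
      -- An element of nonzero weight killed by all r_i would be a scalar, hence zero.
      have : ∃ i, r i (y μ) ≠ 0 := by
        by_contra! h
        obtain ⟨c, hc⟩ := scalar_of_r_eq_zero h
        have := counit_eq_zero (hy μ) hμ0
        rw [hc, map_smul, map_one, smul_eq_mul, mul_one] at this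
        rw [hc, this, zero_smul] at hne
        exact hne rfl
      obtain ⟨i, hi⟩ := this
      have hex : ∃ ν : RootCone k, μ = ν + Pi.single i.rev 1 + Pi.single i 1 := by
        by_contra h
        exact hi (hn μ i h).1
      obtain ⟨ν, rfl⟩ := hex
      rw [hr] at hi
      have := ih (ht ν) (by rw [ht_add_single, ht_add_single] at hμ; omega) ν rfl
        (fun h => hi (by rw [h, zero_mul, smul_zero]))
      intro j
      simp only [Pi.add_apply, this j, Pi.single_apply, Fin.rev_inj, Fin.rev_eq_iff, Fin.rev_rev]
      omega
  have hκ : ∀ (i : Fin k) (μ : RootCone k),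
      K i * Kinv i.rev * neg (y μ) = neg (y μ) * (K i * Kinv i.rev) := by
    intro i μ
    by_cases hμ : y μ = 0
    · rw [hμ, map_zero, mul_zero, zero_mul]
    · rw [mul_assoc, Kinv_neg_wt i.rev (hy μ), mul_smul_comm, ← mul_assoc, K_neg_wt i (hy μ),
        smul_mul_assoc, smul_smul, sum_cartan_rev i (sym _ μ rfl hμ), ← zpow_add₀ q_ne_zero,
        add_neg_cancel, zpow_zero, one_smul, mul_assoc]
  have hmem : ∀ {N : ℕ} {μ}, N ≤ ht μ → neg (y μ) ∈ filNeg k N := fun h =>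
    UnegW_le_filNeg h (neg_mem (hy _))
  have hg : ∀ (w w' : U k) N, ∃ M, ∀ μ, M ≤ ht μ →
      neg (y μ) * w - w' * neg (y μ) ∈ filNeg k N := fun w w' N => by
    obtain ⟨N', h⟩ := filNeg_mul_right w N
    exact ⟨max N N', fun ν hν => sub_mem (h _ (hmem ((le_max_right ..).trans hν)))
      (filNeg_mul_left w' (hmem ((le_max_left ..).trans hν)))⟩
  refine ⟨fun μ => neg (y μ), fun μ => neg_mem (hy μ), by simp [h0], fun u => ?_⟩
  induction u using UI.induction_B with
  | hc c =>
    refine SumsToZero.of_eq fun ν => ?_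
    rw [UI.barUI_algebraMap, AlgHom.commutes, AlgHom.commutes, barU_algebraMap, Algebra.commutes]
  | hB i =>
    rw [UI.barUI_B, UI.barU_emb_B, UI.emb_B]
    have := SumsToZero.telescope (J := filNeg k) (Pi.single i.rev 1 + Pi.single i 1)
      (a := fun μ => E i * neg (y μ) - neg (y μ) * E i)
      (g := fun μ => neg (y μ) * ((UI.coeff i)⁻¹ • (F i.rev * K i))
        - UI.coeff i • (F i.rev * Kinv i) * neg (y μ)) (fun μ => by
          change E i * neg (y (μ + _)) - neg (y (μ + _)) * E i = _
          rw [E_neg', ← add_assoc, hr, hl, map_smul, map_smul, map_mul, map_mul, neg_gen,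
            smul_mul_assoc, mul_smul_comm, smul_sub, smul_smul, smul_smul, ← mul_assoc,
            inv_mul_cancel₀ q_sub_inv_ne_zero, ← mul_assoc, inv_mul_cancel₀ q_sub_inv_ne_zero,
            one_mul, one_mul, ← mul_assoc (Kinv i), Kinv_F, smul_mul_assoc, smul_smul,
            UI.coeff_rev, mul_smul_comm, smul_mul_assoc, mul_assoc (neg (y μ))])
        (fun μ h => by
          obtain ⟨h1, h2⟩ := hn μ i (fun ⟨ν, h'⟩ => h ⟨ν, by rw [h', add_assoc]⟩)
          rw [E_neg', h1, h2]; simp) (hg _ _)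
    convert this using 2 with ν
    noncomm_ring
  | hκ i =>
    refine SumsToZero.of_eq fun ν => ?_
    rw [UI.barUI_gen, UI.emb_gen]
    change UI.emb (UI.gen (.κinv i)) * _ = _ * barU (K i.1 * Kinv i.1.rev)
    rw [UI.emb_gen, barU_mul, barU_K, barU_Kinv, Kinv_K']
    have := hκ i.1.rev ν
    rwa [Fin.rev_rev] at this
  | hκ' i =>
    refine SumsToZero.of_eq fun ν => ?_
    rw [UI.barUI_gen, UI.emb_gen]
    change UI.emb (UI.gen (.κ i)) * _ = _ * barU (K i.1.rev * Kinv i.1)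
    rw [UI.emb_gen, barU_mul, barU_K, barU_Kinv, Kinv_K']
    exact hκ i.1 ν
  | hm x y hx hy =>
    rw [UI.barUI_mul, map_mul, map_mul, barU_mul]
    exact SumsToZero.intertwine_mul (fun w N => ⟨N, fun z hz => filNeg_mul_left w hz⟩)
      filNeg_mul_right hx hy
  | ha x y hx hy =>
    rw [map_add, map_add, map_add, map_add]
    exact SumsToZero.intertwine_add hx hy

theorem isIntertwiner_upsilon : IsIntertwiner (upsilon k) :=
  Classical.epsilon_spec exists_isIntertwiner

end QSymPair

end

/-! ### Finite-dimensional modules kill deep filtration steps -/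

noncomputable section

namespace QSymPair

open U

variable {k : ℕ}

/-- The number (j+1)(k-j), with j counted from 0, is the coefficient of α_j in 2ρ; the identity says
(2ρ, α_i) = 2. -/
theorem sum_rho_cartan (i : Fin k) : ∑ j : Fin k, ((j + 1) * (k - j) : ℕ) * cartan j i = 2 := by
  obtain ⟨f, hf⟩ : ∃ f : ℕ → ℤ, f = fun n : ℕ => ((n : ℤ) + 1) * (k - n) * ((if n = i then 2 else 0)
      - (if n + 1 = i then 1 else 0) - (if n = i + 1 then 1 else 0)) := ⟨_, rfl⟩
  have h : ∀ j : Fin k, ((j + 1) * (k - j) : ℕ) * cartan j i = f j := fun j => by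
    have hj := j.2
    rw [hf]
    push_cast [hj.le]
    congr 1
    simp only [cartan, Fin.ext_iff]
    split_ifs <;> first | rfl | omega
  rw [Finset.sum_congr rfl fun j _ => h j, Fin.sum_univ_eq_sum_range, hf]
  have hi := i.2
  simp only [mul_sub, Finset.sum_sub_distrib, mul_ite, mul_zero, mul_one, Finset.sum_ite_eq',
    Finset.mem_range, hi, if_true]
  have h1 : ∑ n ∈ Finset.range k, (if n + 1 = (i : ℕ) then ((n : ℤ) + 1) * k - (n + 1) * n else 0)
      = i * (k - (i - 1)) := by
    rcases Nat.eq_zero_or_pos (i : ℕ) with h0 | h0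
    · rw [Finset.sum_eq_zero fun n _ => if_neg (by omega), h0]; simp
    · rw [Finset.sum_eq_single_of_mem ((i : ℕ) - 1) (Finset.mem_range.mpr (by omega))
        fun n _ hn => if_neg (by omega), if_pos (by omega)]
      push_cast [h0]
      ring
  have h2 : (if (i : ℕ) + 1 < k then ((i : ℤ) + 1 + 1) * k - (i + 1 + 1) * (i + 1) else 0)
      = (i + 2) * (k - (i + 1)) := by
    split_ifs with h
    · ring
    · have : (k : ℤ) = i + 1 := by omega
      rw [this]; ring
  push_cast
  rw [h1, h2]
  ring

/-- The group-like element `K_{2ρ}`. -/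
theorem exists_twoRho : ∃ κ κ' : U k, κ * κ' = 1 ∧ κ' * κ = 1 ∧
    ∀ i, κ * E i = q ^ (2 : ℤ) • (E i * κ) := by
  suffices h : ∀ s : Finset (Fin k), ∃ κ κ' : U k, κ * κ' = 1 ∧ κ' * κ = 1 ∧
      ∀ i, κ * E i = q ^ (∑ j ∈ s, ((j + 1) * (k - j) : ℕ) * cartan j i) • (E i * κ) by
    obtain ⟨κ, κ', h1, h2, h3⟩ := h Finset.univ
    exact ⟨κ, κ', h1, h2, fun i => by rw [h3, sum_rho_cartan]⟩
  intro s
  induction s using Finset.induction with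
  | empty => exact ⟨1, 1, one_mul 1, one_mul 1, fun i => by simp⟩
  | insert j s hj ih =>
    obtain ⟨κ, κ', h1, h2, h3⟩ := ih
    have hp : ∀ n : ℕ, K j ^ n * Kinv j ^ n = 1 ∧ Kinv j ^ n * K j ^ n = 1 ∧
        ∀ i, K j ^ n * E i = q ^ (n * cartan j i) • (E i * K j ^ n) := fun n => by
      induction n with
      | zero => simp
      | succ n ih =>
        obtain ⟨g1, g2, g3⟩ := ih
        refine ⟨?_, ?_, fun i => ?_⟩
        · rw [pow_succ, pow_succ', mul_assoc, ← mul_assoc (K j), K_Kinv, one_mul, g1]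
        · rw [pow_succ, pow_succ', mul_assoc, ← mul_assoc (Kinv j), Kinv_K, one_mul, g2]
        · rw [pow_succ, skew_mul (g3 i) (K_E j i), ← zpow_add₀ q_ne_zero]
          push_cast
          rw [add_mul, one_mul]
    obtain ⟨g1, g2, g3⟩ := hp ((j + 1) * (k - j))
    refine ⟨K j ^ ((j + 1) * (k - j) : ℕ) * κ, κ' * Kinv j ^ ((j + 1) * (k - j) : ℕ), ?_, ?_,
      fun i => ?_⟩
    · rw [mul_assoc, ← mul_assoc κ, h1, one_mul, g1]
    · rw [mul_assoc, ← mul_assoc (Kinv j ^ _), g2, one_mul, h2]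
    · rw [skew_mul (g3 i) (h3 i), ← zpow_add₀ q_ne_zero, Finset.sum_insert hj]

theorem q_pow_injective : Function.Injective fun n : ℕ => (q ^ (2 : ℤ)) ^ n := by
  intro a b h
  have h2 : (q : Qq) ^ (2 * a) = q ^ (2 * b) := by
    simpa [pow_mul, zpow_ofNat] using h
  have h3 : (algebraMap (Polynomial ℚ) (RatFunc ℚ)) (Polynomial.X ^ (2 * a))
      = algebraMap (Polynomial ℚ) (RatFunc ℚ) (Polynomial.X ^ (2 * b)) := by
    rw [map_pow, map_pow, RatFunc.algebraMap_X]
    exact h2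
  have h4 := congrArg Polynomial.natDegree (RatFunc.algebraMap_injective ℚ h3)
  rw [Polynomial.natDegree_X_pow, Polynomial.natDegree_X_pow] at h4
  omega

section Finite

variable {N N' : Type} [AddCommGroup N] [Module Qq N] [AddCommGroup N'] [Module Qq N']

/-- If the word acted nontrivially, so would all its suffixes. They are eigenvectors for conjugation
by K_{2ρ} with the distinct eigenvalues q^{2t}, t the length, hence independent, and there are more
of them than the dimension allows. -/
theorem rep_E_word_eq_zero [Module.Finite Qq N] (ρ : U k →ₐ[Qq] Module.End Qq N) (l : List (Fin k))
    (hl : Module.finrank Qq (Module.End Qq N) ≤ l.length) : ρ (l.map E).prod = 0 := by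
  by_contra hne
  obtain ⟨κ, κ', h1, h2, h3⟩ := exists_twoRho (k := k)
  have hw : ∀ l : List (Fin k), κ * (l.map E).prod = (q ^ (2 : ℤ)) ^ l.length • ((l.map E).prod * κ) := by
    intro l
    induction l with
    | nil => simp
    | cons i l ih =>
      rw [List.map_cons, List.prod_cons, List.length_cons, ← mul_assoc, h3, smul_mul_assoc,
        mul_assoc,
        ih, mul_smul_comm, smul_smul, pow_succ', mul_assoc]
  let Ad : Module.End Qq (Module.End Qq N) :=
    (LinearMap.mulLeft Qq (ρ κ)).comp (LinearMap.mulRight Qq (ρ κ'))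
  have hli := Module.End.eigenvectors_linearIndependent' Ad
    (fun t : Fin (l.length + 1) => (q ^ (2 : ℤ)) ^ (t : ℕ))
    (fun a b h => Fin.ext (q_pow_injective h))
    -- The suffix of length t, for t from 0 to the full length; counting the empty suffix gives one
    -- vector too many.
    (fun t => ρ ((l.drop (l.length - t)).map E).prod) (fun t => by
      have ht := t.2
      refine Module.End.hasEigenvector_iff.mpr ⟨Module.End.mem_eigenspace_iff.mpr ?_, fun h0 => hne ?_⟩
      · change ρ κ * (ρ _ * ρ κ') = _
        rw [← map_mul, ← map_mul, ← mul_assoc, hw, smul_mul_assoc, mul_assoc, h1, mul_one, map_smul,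
          List.length_drop]
        congr 2
        omega
      · rw [← List.take_append_drop (l.length - t) l, List.map_append, List.prod_append, map_mul, h0,
          mul_zero])
  have := hli.fintype_card_le_finrank
  rw [Fintype.card_fin] at this
  omega

/-- The rightmost factor of an element of the filtration already acts by zero. The negative case is
the positive one for the module twisted by the automorphism exchanging E and F. -/
theorem exists_fil_le_ker [Module.Finite Qq N] (ρ : U k →ₐ[Qq] Module.End Qq N) :
    ∃ n, (∀ x ∈ filPos k n, ρ x = 0) ∧ ∀ x ∈ filNeg k n, ρ x = 0 := by
  have key : ∀ ρ : U k →ₐ[Qq] Module.End Qq N,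
      ∀ x ∈ filPos k (Module.finrank Qq (Module.End Qq N)), ρ x = 0 := by
    intro ρ x hx
    have : filPos k (Module.finrank Qq (Module.End Qq N)) ≤ LinearMap.ker ρ.toLinearMap := by
      refine Submodule.mul_le.mpr fun a _ b hb => ?_
      have hb' : b ∈ LinearMap.ker ρ.toLinearMap := by
        refine (iSup₂_le fun μ hμ => Submodule.span_le.mpr ?_ : _ ≤ LinearMap.ker ρ.toLinearMap) hb
        rintro _ ⟨l, hl, rfl⟩
        refine rep_E_word_eq_zero ρ l (hμ.trans (le_of_eq ?_))
        rw [← List.sum_toFinset_count_eq_length, ht, ← Finset.sum_congr rfl fun i _ => hl i]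
        refine (Finset.sum_subset (Finset.subset_univ _) fun i _ hi => ?_).symm
        exact List.count_eq_zero_of_not_mem fun h => hi (List.mem_toFinset.mpr h)
      change ρ (a * b) = 0
      rw [map_mul, show ρ b = 0 from hb', mul_zero]
    exact this hx
  refine ⟨_, key ρ, fun x hx => ?_⟩
  have := key (ρ.comp swapEF) (swapEF x) (mem_filPos_iff.mpr (by rwa [U.swapEF_swapEF]))
  change ρ (swapEF (swapEF x)) = 0 at this
  rwa [U.swapEF_swapEF] at this

end Finite

end QSymPair

end

/-! ### Θ and Υ as operators; compatibility with the bar involutions -/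

noncomputable section

namespace QSymPair

open U

variable {k : ℕ}

theorem finite_ht_lt (n : ℕ) : {μ : RootCone k | ht μ < n}.Finite :=
  (Set.finite_Iic fun _ => n).subset fun μ hμ i =>
    (Finset.single_le_sum (f := μ) (fun _ _ => Nat.zero_le _) (Finset.mem_univ i)).trans
      (le_of_lt hμ)

section Finsum

variable {X : Type} {n : ℕ}

theorem finsum_eq_sum_of_ht [AddCommMonoid X] {z : RootCone k → X} (hz : ∀ μ, n ≤ ht μ → z μ = 0)
    (S : Finset (RootCone k)) (hS : (finite_ht_lt n).toFinset ⊆ S) : ∑ᶠ μ, z μ = ∑ μ ∈ S, z μ :=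
  finsum_eq_sum_of_support_subset _ fun μ hμ => hS (by
    rw [Set.Finite.mem_toFinset]
    exact not_le.mp fun h => hμ (hz μ h))

variable [AddCommGroup X] [Module Qq X] {Y : Type} [Ring Y] [Algebra Qq Y] {J : ℕ → Submodule Qq Y} {Z : RootCone k → Y} {a b : Y}

/-- A module on which all but finitely many components of `∑ Z_μ` vanish inherits an intertwining
relation that holds in the completion. -/
theorem finsum_intertwines {φ : Y →ₐ[Qq] Module.End Qq X} (hJ : ∀ x ∈ J n, φ x = 0)
    (hZ : ∀ μ, n ≤ ht μ → Z μ ∈ J n) (h : SumsToZero J fun ν => a * Z ν - Z ν * b) :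
    φ a * ∑ᶠ μ, φ (Z μ) = (∑ᶠ μ, φ (Z μ)) * φ b := by
  classical
  obtain ⟨S, hS⟩ := h n
  have h1 := hJ _ (hS (S ∪ (finite_ht_lt n).toFinset) Finset.subset_union_left)
  rw [finsum_eq_sum_of_ht (fun μ hμ => hJ _ (hZ μ hμ)) (S ∪ (finite_ht_lt n).toFinset)
    Finset.subset_union_right, Finset.mul_sum, Finset.sum_mul, ← sub_eq_zero,
    ← Finset.sum_sub_distrib, ← h1, map_sum]
  simp only [map_sub, map_mul]

end Finsum

section Pair

variable {N N' N₁ N₁' : Type} [AddCommGroup N] [Module Qq N] [AddCommGroup N'] [Module Qq N']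
  [AddCommGroup N₁] [Module Qq N₁] [AddCommGroup N₁'] [Module Qq N₁']
  {ρ : U k →ₐ[Qq] Module.End Qq N} {σ : U k →ₐ[Qq] Module.End Qq N'}
  {ρ₁ : U k →ₐ[Qq] Module.End Qq N₁} {σ₁ : U k →ₐ[Qq] Module.End Qq N₁'}

theorem pairRep_tmul (a b : U k) : pairRep ρ σ (a ⊗ₜ b) = TensorProduct.map (ρ a) (σ b) := rfl

theorem pairRep_tmul_apply (a b : U k) (x : N) (y : N') :
    pairRep ρ σ (a ⊗ₜ b) (x ⊗ₜ y) = ρ a x ⊗ₜ σ b y := rfl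

theorem exists_filTensor_ker [Module.Finite Qq N] [Module.Finite Qq N']
    (ρ : U k →ₐ[Qq] Module.End Qq N) (σ : U k →ₐ[Qq] Module.End Qq N') :
    ∃ n, ∀ x ∈ filTensor k n, pairRep ρ σ x = 0 := by
  obtain ⟨n₁, h1, -⟩ := exists_fil_le_ker ρ
  obtain ⟨n₂, -, h2⟩ := exists_fil_le_ker σ
  refine ⟨max n₁ n₂, fun x hx => ?_⟩
  have : filTensor k (max n₁ n₂) ≤ LinearMap.ker (pairRep ρ σ).toLinearMap := by
    refine sup_le (Submodule.map₂_le.mpr fun a ha b _ => ?_) (Submodule.map₂_le.mpr fun a _ b hb => ?_)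
    · change pairRep ρ σ (a ⊗ₜ b) = 0
      rw [pairRep_tmul, h1 a (filPos_mono (le_max_left ..) ha), TensorProduct.map_zero_left]
    · change pairRep ρ σ (a ⊗ₜ b) = 0
      rw [pairRep_tmul, h2 b (filNeg_mono (le_max_right ..) hb), TensorProduct.map_zero_right]
  exact this hx

theorem quasiR_mem_filTensor {n : ℕ} {ν : RootCone k} (h : n ≤ ht ν) : quasiR k ν ∈ filTensor k n :=
  Submodule.mem_sup_left (tensorSub_mono (UposW_le_filPos h) le_top (isQuasiR_quasiR.mem ν))

/-- The operator by which the quasi-`R`-matrix acts on a tensor product. -/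
def thetaOp (ρ : U k →ₐ[Qq] Module.End Qq N) (σ : U k →ₐ[Qq] Module.End Qq N') :
    Module.End Qq (N ⊗[Qq] N') := ∑ᶠ ν, pairRep ρ σ (quasiR k ν)

theorem exists_thetaOp_eq_sum [Module.Finite Qq N] [Module.Finite Qq N']
    (ρ : U k →ₐ[Qq] Module.End Qq N) (σ : U k →ₐ[Qq] Module.End Qq N') :
    ∃ n, ∀ S, (finite_ht_lt n).toFinset ⊆ S → thetaOp ρ σ = ∑ ν ∈ S, pairRep ρ σ (quasiR k ν) := by
  obtain ⟨n, hn⟩ := exists_filTensor_ker ρ σ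
  exact ⟨n, fun S hS => finsum_eq_sum_of_ht (fun μ hμ => hn _ (quasiR_mem_filTensor hμ)) S hS⟩

theorem thetaOp_intertwines [Module.Finite Qq N] [Module.Finite Qq N']
    (ρ : U k →ₐ[Qq] Module.End Qq N) (σ : U k →ₐ[Qq] Module.End Qq N') (u : U k) :
    pairRep ρ σ (coprod u) * thetaOp ρ σ = thetaOp ρ σ * pairRep ρ σ (barCoprod u) := by
  obtain ⟨n, hn⟩ := exists_filTensor_ker ρ σ
  exact finsum_intertwines hn (fun μ hμ => quasiR_mem_filTensor hμ)
    (isQuasiR_quasiR.intertwines u)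

theorem pairRep_natural {f : N →ₗ[Qq] N₁} {g : N' →ₗ[Qq] N₁'} (hf : ∀ u x, f (ρ u x) = ρ₁ u (f x))
    (hg : ∀ u x, g (σ u x) = σ₁ u (g x)) (w : U k ⊗[Qq] U k) (z : N ⊗[Qq] N') :
    TensorProduct.map f g (pairRep ρ σ w z) = pairRep ρ₁ σ₁ w (TensorProduct.map f g z) := by
  induction w using TensorProduct.induction_on with
  | zero => simp
  | add a b ha hb => simp only [map_add, LinearMap.add_apply, ha, hb]
  | tmul a b =>
    induction z using TensorProduct.induction_on with
    | zero => simp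
    | add x y hx hy => simp only [map_add, hx, hy]
    | tmul x y => simp only [pairRep_tmul_apply, TensorProduct.map_tmul, hf, hg]

/-- Each component acts through U ⊗ U, so it commutes with tensor products of module maps. The two
truncations of Θ are first replaced by one common finite sum. -/
theorem thetaOp_natural [Module.Finite Qq N] [Module.Finite Qq N'] [Module.Finite Qq N₁]
    [Module.Finite Qq N₁'] {f : N →ₗ[Qq] N₁} {g : N' →ₗ[Qq] N₁'}
    (hf : ∀ u x, f (ρ u x) = ρ₁ u (f x)) (hg : ∀ u x, g (σ u x) = σ₁ u (g x)) (z : N ⊗[Qq] N') :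
    TensorProduct.map f g (thetaOp ρ σ z) = thetaOp ρ₁ σ₁ (TensorProduct.map f g z) := by
  classical
  obtain ⟨n, h⟩ := exists_thetaOp_eq_sum ρ σ
  obtain ⟨n₁, h₁⟩ := exists_thetaOp_eq_sum ρ₁ σ₁
  rw [h _ (Finset.subset_union_left (s₂ := (finite_ht_lt n₁).toFinset)),
    h₁ _ (Finset.subset_union_right (s₁ := (finite_ht_lt n).toFinset)), LinearMap.sum_apply,
    LinearMap.sum_apply, map_sum]
  exact Finset.sum_congr rfl fun ν _ => pairRep_natural hf hg _ _

/-- An anti-linear map that is compatible with the bar involution of `U`. -/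
def BarCompat (ρ : U k →ₐ[Qq] Module.End Qq N) (φ : N →ₛₗ[bar] N) : Prop :=
  ∀ u x, φ (ρ u x) = ρ (barU u) (φ x)

theorem BarCompat.of_gen {φ : N →ₛₗ[bar] N} (h : ∀ g x, φ (ρ (gen g) x) = ρ (barU (gen g)) (φ x)) :
    BarCompat ρ φ := fun u => by
  induction u using U.induction with
  | hc c =>
    intro x
    rw [barU_algebraMap, AlgHom.commutes, AlgHom.commutes, Module.algebraMap_end_apply,
      Module.algebraMap_end_apply, map_smulₛₗ]
  | hg g => exact h g
  | hm a b ha hb =>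
    intro x
    rw [barU_mul, map_mul, map_mul, Module.End.mul_apply, Module.End.mul_apply, ha, hb]
  | ha a b ha hb =>
    intro x
    rw [map_add, map_add, map_add, LinearMap.add_apply, LinearMap.add_apply, map_add, ha, hb]

theorem barU_barU (u : U k) : barU (barU u) = u := by
  induction u using U.induction with
  | hc c => rw [barU_algebraMap, barU_algebraMap, bar_bar]
  | hg g => cases g <;> simp
  | hm a b ha hb => rw [barU_mul, barU_mul, ha, hb]
  | ha a b ha hb => rw [map_add, map_add, ha, hb]

theorem BarCompat.map {φ : N →ₛₗ[bar] N} {χ : N' →ₛₗ[bar] N'} (hφ : BarCompat ρ φ)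
    (hχ : BarCompat σ χ) (w : U k ⊗[Qq] U k) (z : N ⊗[Qq] N') :
    TensorProduct.map φ χ (pairRep ρ σ w z)
      = pairRep ρ σ (TensorProduct.map barU barU w) (TensorProduct.map φ χ z) := by
  induction w using TensorProduct.induction_on with
  | zero => simp
  | add a b ha hb => simp only [map_add, LinearMap.add_apply, ha, hb]
  | tmul a b =>
    induction z using TensorProduct.induction_on with
    | zero => simp
    | add x y hx hy => simp only [map_add, hx, hy]
    | tmul x y => simp only [pairRep_tmul_apply, TensorProduct.map_tmul, hφ a, hχ b]

/-- The tensor product of two representations. -/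
def tensorRep (ρ : U k →ₐ[Qq] Module.End Qq N) (σ : U k →ₐ[Qq] Module.End Qq N') :
    U k →ₐ[Qq] Module.End Qq (N ⊗[Qq] N') := (pairRep ρ σ).comp coprod

theorem tensorRep_apply (u : U k) (z : N ⊗[Qq] N') :
    tensorRep ρ σ u z = pairRep ρ σ (coprod u) z := rfl

/-- The anti-linear map `Θ ∘ (φ ⊗ χ)`. -/
def thetaBar (ρ : U k →ₐ[Qq] Module.End Qq N) (σ : U k →ₐ[Qq] Module.End Qq N')
    (φ : N →ₛₗ[bar] N) (χ : N' →ₛₗ[bar] N') : N ⊗[Qq] N' →ₛₗ[bar] N ⊗[Qq] N' :=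
  (thetaOp ρ σ).comp (TensorProduct.map φ χ)

theorem thetaBar_apply (φ : N →ₛₗ[bar] N) (χ : N' →ₛₗ[bar] N') (z : N ⊗[Qq] N') :
    thetaBar ρ σ φ χ z = thetaOp ρ σ (TensorProduct.map φ χ z) := rfl

/-- The intertwining property of Θ, applied to the bar conjugate of u. -/
theorem BarCompat.thetaBar [Module.Finite Qq N] [Module.Finite Qq N'] {φ : N →ₛₗ[bar] N}
    {χ : N' →ₛₗ[bar] N'} (hφ : BarCompat ρ φ) (hχ : BarCompat σ χ) :
    BarCompat (tensorRep ρ σ) (thetaBar ρ σ φ χ) := fun u z => by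
  rw [thetaBar_apply, thetaBar_apply, tensorRep_apply, tensorRep_apply, hφ.map hχ]
  have h := LinearMap.congr_fun (thetaOp_intertwines ρ σ (barU u)) (TensorProduct.map φ χ z)
  rw [barCoprod, barU_barU] at h
  exact h.symm

end Pair

instance (k m : ℕ) : Module.Finite Qq (T k m) := Module.Finite.of_basis (M k m)

theorem rep_zero_apply (u : U k) (x : T k 0) : rep k 0 u x = counit u • x := by
  change (algebraMap Qq (Module.End Qq (T k 0)) (counit u)) x = _
  rw [Module.algebraMap_end_apply]

theorem rep_succ_apply {m : ℕ} (u : U k) (z : T k m ⊗[Qq] V k) :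
    rep k (m + 1) u (tensorSnoc k m z) = tensorSnoc k m (tensorRep (rep k m) V.rep u z) := by
  change tensorSnoc k m (tensorRep (rep k m) V.rep u
    ((tensorSnoc k m).symm (tensorSnoc k m z))) = _
  rw [LinearEquiv.symm_apply_apply]

theorem psiT_succ_apply {m : ℕ} (z : T k m ⊗[Qq] V k) : psiT k (m + 1) (tensorSnoc k m z)
    = tensorSnoc k m (thetaBar (rep k m) V.rep (psiT k m) V.psi z) := by
  change tensorSnoc k m (thetaBar (rep k m) V.rep (psiT k m) V.psi
    ((tensorSnoc k m).symm (tensorSnoc k m z))) = _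
  rw [LinearEquiv.symm_apply_apply]

theorem counit_barU (u : U k) : counit (barU u) = bar (counit u) := by
  induction u using U.induction with
  | hc c => rw [barU_algebraMap, AlgHom.commutes, AlgHom.commutes]; rfl
  | hg g =>
    cases g
    all_goals
      simp only [barU_E, barU_F, barU_K, barU_Kinv]
      simp [counit, E, F, K, Kinv]
  | hm a b ha hb => rw [barU_mul, map_mul, map_mul, map_mul, ha, hb]
  | ha a b ha hb => rw [map_add, map_add, map_add, map_add, ha, hb]

theorem V.rep_gen (g : UGen k) : V.rep (gen g) = V.genAct g := lift_gen ..

theorem V.psi_v (a : Fin (k + 1)) : V.psi (V.v a) = V.v a := by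
  funext b
  simp only [V.psi, V.v, Pi.basisFun_apply, LinearMap.coe_mk, AddHom.coe_mk, Pi.single_apply]
  split_ifs <;> simp

theorem barCompat_V : BarCompat V.rep (V.psi (k := k)) := .of_gen fun g => by
  have h : V.psi.comp (V.rep (gen g)) = (V.rep (barU (gen g))).comp (V.psi (k := k)) := by
    refine (V.basis k).ext fun a => ?_
    rw [LinearMap.comp_apply, LinearMap.comp_apply, V.psi_v]
    cases g
    · rw [barU_E, V.rep_gen, V.E_v]
      split_ifs
      exacts [V.psi_v _, map_zero _]
    · rw [barU_F, V.rep_gen, V.F_v]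
      split_ifs
      exacts [V.psi_v _, map_zero _]
    · rw [barU_K, V.rep_gen, V.rep_gen, V.K_v, V.Kinv_v, map_smulₛₗ, V.psi_v]
      split_ifs <;> simp
    · rw [barU_Kinv, V.rep_gen, V.rep_gen, V.K_v, V.Kinv_v, map_smulₛₗ, V.psi_v]
      split_ifs <;> simp
  exact fun x => LinearMap.congr_fun h x

theorem barCompat_psiT (m : ℕ) : BarCompat (rep k m) (psiT k m) := by
  induction m with
  | zero =>
    intro u x
    rw [rep_zero_apply, rep_zero_apply, map_smulₛₗ, counit_barU]
  | succ m ih =>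
    intro u x
    obtain ⟨z, rfl⟩ := (tensorSnoc k m).surjective x
    rw [rep_succ_apply, psiT_succ_apply, psiT_succ_apply, rep_succ_apply, ih.thetaBar barCompat_V]

/-- The operator by which the intertwiner `Υ` acts. -/
def upsilonOp (k m : ℕ) : Module.End Qq (T k m) := ∑ᶠ μ, rep k m (upsilon k μ)

theorem psiIota_apply {m : ℕ} (x : T k m) : psiIota k m x = upsilonOp k m (psiT k m x) := rfl

theorem upsilon_mem_filNeg {n : ℕ} {μ : RootCone k} (h : n ≤ ht μ) : upsilon k μ ∈ filNeg k n :=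
  UnegW_le_filNeg h (isIntertwiner_upsilon.mem μ)

theorem exists_upsilonOp_eq_sum (k m : ℕ) : ∃ n, ∀ S, (finite_ht_lt n).toFinset ⊆ S →
    upsilonOp k m = ∑ μ ∈ S, rep k m (upsilon k μ) := by
  obtain ⟨n, -, hn⟩ := exists_fil_le_ker (rep k m)
  exact ⟨n, fun S hS => finsum_eq_sum_of_ht
    (z := fun μ => rep k m (upsilon k μ)) (fun μ hμ => hn _ (upsilon_mem_filNeg hμ)) S hS⟩

/-- Compatibility of ψ with U, followed by the intertwining property of Υ. -/
theorem psiIota_actI {m : ℕ} (u : UI k) (x : T k m) :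
    psiIota k m (actI u x) = actI (UI.barUI u) (psiIota k m x) := by
  obtain ⟨n, -, hn⟩ := exists_fil_le_ker (rep k m)
  have h := finsum_intertwines hn (fun μ hμ => upsilon_mem_filNeg hμ)
    (isIntertwiner_upsilon.intertwines u)
  rw [psiIota_apply, psiIota_apply, actI, actI, barCompat_psiT]
  exact (LinearMap.congr_fun h (psiT k m x)).symm

end QSymPair

end

/-! ### The filtration by the last tensor factor and rigidity -/

noncomputable section

namespace QSymPair

open U

variable {k : ℕ}

section Last

variable {W : Type} [AddCommGroup W] [Module Qq W]

/-- The coefficient of `v_a` in the last tensor factor. -/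
def lastCoeff (a : Fin (k + 1)) : W ⊗[Qq] V k →ₗ[Qq] W :=
  (TensorProduct.rid Qq W).toLinearMap ∘ₗ
    LinearMap.lTensor W (LinearMap.proj a : V k →ₗ[Qq] Qq)

theorem lastCoeff_tmul (a : Fin (k + 1)) (x : W) (v : V k) : lastCoeff a (x ⊗ₜ v) = v a • x := by
  simp [lastCoeff]

theorem V.v_apply (a b : Fin (k + 1)) : V.v a b = if b = a then 1 else 0 := by
  rw [V.v, Pi.basisFun_apply, Pi.single_apply]

theorem eq_sum_lastCoeff (w : W ⊗[Qq] V k) : w = ∑ a, lastCoeff a w ⊗ₜ V.v a := by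
  induction w using TensorProduct.induction_on with
  | zero => simp
  | add x y hx hy =>
    conv_lhs => rw [hx, hy]
    simp only [map_add, TensorProduct.add_tmul, Finset.sum_add_distrib]
  | tmul x v =>
    have hv : v = ∑ a, v a • V.v a := by
      funext b
      simp [Pi.single_apply]
    conv_lhs => rw [hv, TensorProduct.tmul_sum]
    simp only [lastCoeff_tmul, TensorProduct.smul_tmul]

theorem eq_zero_of_lastCoeff {w : W ⊗[Qq] V k} (h : ∀ a, lastCoeff a w = 0) : w = 0 := by
  rw [eq_sum_lastCoeff w]
  simp [h]

/-- The tensors with last factor in the span of the `v_a` with `a ≥ b`. -/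
def lastGE (W : Type) [AddCommGroup W] [Module Qq W] (k b : ℕ) : Submodule Qq (W ⊗[Qq] V k) where
  carrier := {w | ∀ a : Fin (k + 1), (a : ℕ) < b → lastCoeff a w = 0}
  zero_mem' _ _ := map_zero _
  add_mem' hx hy a ha := by rw [map_add, hx a ha, hy a ha, add_zero]
  smul_mem' c x hx a ha := by rw [map_smul, hx a ha, smul_zero]

theorem tmul_mem_lastGE {x : W} {v : V k} {b : ℕ} (h : ∀ a : Fin (k + 1), (a : ℕ) < b → v a = 0) :
    x ⊗ₜ v ∈ lastGE W k b := fun a ha => by rw [lastCoeff_tmul, h a ha, zero_smul]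

theorem tmul_v_mem_lastGE (x : W) {a : Fin (k + 1)} {b : ℕ} (h : b ≤ a) :
    x ⊗ₜ V.v a ∈ lastGE W k b := tmul_mem_lastGE fun c hc => by
  rw [V.v_apply, if_neg (by rintro rfl; omega)]

theorem lastGE_mono {b c : ℕ} (h : b ≤ c) : lastGE W k c ≤ lastGE W k b :=
  fun _ hw a ha => hw a (ha.trans_le h)

theorem mem_lastGE_zero (w : W ⊗[Qq] V k) : w ∈ lastGE W k 0 :=
    fun _ h => absurd h (Nat.not_lt_zero _)

theorem eq_zero_of_mem_lastGE {w : W ⊗[Qq] V k} {b : ℕ} (hb : k + 1 ≤ b) (h : w ∈ lastGE W k b) :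
    w = 0 := eq_zero_of_lastCoeff fun a => h a (a.2.trans_le hb)

theorem lastGE_induction {b : ℕ} {P : W ⊗[Qq] V k → Prop} (h0 : P 0)
    (ha : ∀ x y, P x → P y → P (x + y)) (h : ∀ x (a : Fin (k + 1)), b ≤ a → P (x ⊗ₜ V.v a))
    {w : W ⊗[Qq] V k} (hw : w ∈ lastGE W k b) : P w := by
  rw [eq_sum_lastCoeff w]
  refine Finset.sum_induction _ P ha h0 fun a _ => ?_
  by_cases hb : b ≤ a
  · exact h _ a hb
  · rw [hw a (not_le.mp hb), TensorProduct.zero_tmul]; exact h0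

theorem V.rep_E_apply (j : Fin k) (v : V k) (a : Fin (k + 1)) :
    V.rep (E j) v a = if a = j.castSucc then v j.succ else 0 := by
  have h : (LinearMap.proj a : V k →ₗ[Qq] Qq) ∘ₗ V.rep (E j)
      = if a = j.castSucc then LinearMap.proj j.succ else 0 := by
    refine (V.basis k).ext fun b => ?_
    rw [LinearMap.comp_apply, V.rep_gen, V.E_v]
    split_ifs with h1 h2 h2 <;> simp [V.v_apply, h1, h2, Ne.symm]
  have := LinearMap.congr_fun h v
  rw [LinearMap.comp_apply, LinearMap.proj_apply] at this
  rw [this]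
  split_ifs <;> rfl

theorem V.rep_F_apply (j : Fin k) (v : V k) (a : Fin (k + 1)) :
    V.rep (F j) v a = if a = j.succ then v j.castSucc else 0 := by
  have h : (LinearMap.proj a : V k →ₗ[Qq] Qq) ∘ₗ V.rep (F j)
      = if a = j.succ then LinearMap.proj j.castSucc else 0 := by
    refine (V.basis k).ext fun b => ?_
    rw [LinearMap.comp_apply, V.rep_gen, V.F_v]
    split_ifs with h1 h2 h2 <;> simp [V.v_apply, h1, h2, Ne.symm]
  have := LinearMap.congr_fun h v
  rw [LinearMap.comp_apply, LinearMap.proj_apply] at this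
  rw [this]
  split_ifs <;> rfl

theorem lastCoeff_lTensor_E (j : Fin k) (w : W ⊗[Qq] V k) (a : Fin (k + 1)) :
    lastCoeff a (LinearMap.lTensor W (V.rep (E j)) w) = if a = j.castSucc then lastCoeff j.succ w else 0 := by
  induction w using TensorProduct.induction_on with
  | zero => simp
  | add x y hx hy => simp only [map_add, hx, hy]; split_ifs <;> simp
  | tmul x v =>
    rw [LinearMap.lTensor_tmul, lastCoeff_tmul, lastCoeff_tmul, V.rep_E_apply]
    split_ifs <;> simp

/-- `β` acts on the last tensor factor as `E_j`, up to an operator that does not lower it. -/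
def IsLowering (j : Fin k) (β : W ⊗[Qq] V k → W ⊗[Qq] V k) : Prop :=
  ∀ b w, w ∈ lastGE W k b → β w - LinearMap.lTensor W (V.rep (E j)) w ∈ lastGE W k b

/-- To leading order β moves v_{j+1} to v_j, and nothing else in w can contribute to v_j. If v_j
does not occur in β w, then v_{j+1} does not occur in w. -/
theorem IsLowering.mem {j : Fin k} {β : W ⊗[Qq] V k → W ⊗[Qq] V k} (h : IsLowering j β)
    {w : W ⊗[Qq] V k} (hw : w ∈ lastGE W k (j + 1)) (hβ : β w ∈ lastGE W k (j + 1)) :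
    w ∈ lastGE W k (j + 2) := by
  intro a ha
  by_cases haj : (a : ℕ) < j + 1
  · exact hw a haj
  · have e : a = j.succ := Fin.ext (by rw [Fin.val_succ]; omega)
    have h1 := h _ w hw j.castSucc (by simp)
    rwa [map_sub, hβ j.castSucc (by simp), lastCoeff_lTensor_E, if_pos rfl, zero_sub, neg_eq_zero,
      ← e] at h1

/-- The operators β_b, β_{b+1}, … successively remove the lowest possible index of the last factor
until none is left. -/
theorem eq_zero_of_isLowering {β : Fin k → W ⊗[Qq] V k → W ⊗[Qq] V k}
    (hβ : ∀ j, IsLowering j (β j)) {b : ℕ} {w : W ⊗[Qq] V k} (hw : w ∈ lastGE W k (b + 1))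
    (h : ∀ j : Fin k, b ≤ j → β j w = 0) : w = 0 := by
  have key : ∀ n, w ∈ lastGE W k (b + 1 + n) := by
    intro n
    induction n with
    | zero => exact hw
    | succ n ih =>
      by_cases hk : b + n < k
      · have := (hβ ⟨b + n, hk⟩).mem (w := w) (by convert ih using 2; simp; omega)
          (by rw [h _ (Nat.le_add_right b n)]; exact zero_mem _)
        convert this using 2; simp; omega
      · rw [eq_zero_of_mem_lastGE (by omega) ih]; exact zero_mem _
  exact eq_zero_of_mem_lastGE (by omega) (key (k + 1))

/-- An additive map that raises the last tensor factor and commutes with lowering operators is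
zero. -/
theorem eq_zero_of_commutes {β : Fin k → W ⊗[Qq] V k → W ⊗[Qq] V k}
    (hβ : ∀ j, IsLowering j (β j)) (δ : W ⊗[Qq] V k →+ W ⊗[Qq] V k)
    (h1 : ∀ x (b : Fin (k + 1)), δ (x ⊗ₜ V.v b) ∈ lastGE W k (b + 1))
    (h2 : ∀ j w, δ (β j w) = β j (δ w)) (w : W ⊗[Qq] V k) : δ w = 0 := by
  -- If δ raises by d + 1, it raises by one more. On x ⊗ v_a use j = a + d: since E_j v_a = 0, β_j
  -- does not lower x ⊗ v_a, so δ β_j = β_j δ stays at index at least a + d + 1, and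
  -- `IsLowering.mem` gains a step.
  have key : ∀ d b w, w ∈ lastGE W k b → δ w ∈ lastGE W k (b + (d + 1)) := by
    intro d
    induction d with
    | zero =>
      intro b w hw
      refine lastGE_induction (P := fun w => δ w ∈ lastGE W k (b + (0 + 1))) ?_ ?_ ?_ hw
      · rw [map_zero]; exact zero_mem _
      · intro x y hx hy; rw [map_add]; exact add_mem hx hy
      · intro x a ha; exact lastGE_mono (by omega) (h1 x a)
    | succ d ih =>
      intro b w hw
      refine lastGE_induction (P := fun w => δ w ∈ lastGE W k (b + (d + 1 + 1))) ?_ ?_ ?_ hw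
      · rw [map_zero]; exact zero_mem _
      · intro x y hx hy; rw [map_add]; exact add_mem hx hy
      · intro x a ha
        refine lastGE_mono (c := a + d + 2) (by omega) ?_
        have hx := ih a _ (tmul_v_mem_lastGE x le_rfl)
        by_cases hk : (a : ℕ) + d < k
        · refine (hβ ⟨a + d, hk⟩).mem hx ?_
          rw [← h2]
          refine ih a _ ?_
          have h3 := hβ ⟨a + d, hk⟩ a _ (tmul_v_mem_lastGE x le_rfl)
          rwa [LinearMap.lTensor_tmul, V.rep_gen, V.E_v, if_neg (by simp [Fin.ext_iff]; omega),
            TensorProduct.tmul_zero, sub_zero] at h3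
        · rw [eq_zero_of_mem_lastGE (by omega) hx]; exact zero_mem _
  exact eq_zero_of_mem_lastGE (by omega) (key k 0 w (mem_lastGE_zero w))

theorem map_mem_lastGE {W' : Type} [AddCommGroup W'] [Module Qq W'] (f : W →ₗ[Qq] W')
    {g : Module.End Qq (V k)} {b c : ℕ}
    (hg : ∀ a : Fin (k + 1), b ≤ a → ∀ d : Fin (k + 1), (d : ℕ) < c → g (V.v a) d = 0)
    {w : W ⊗[Qq] V k} (hw : w ∈ lastGE W k b) : TensorProduct.map f g w ∈ lastGE W' k c := by
  refine lastGE_induction (P := fun w => TensorProduct.map f g w ∈ lastGE W' k c) ?_ ?_ ?_ hw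
  · rw [map_zero]; exact zero_mem _
  · intro x y hx hy; rw [map_add]; exact add_mem hx hy
  · intro x a ha
    rw [TensorProduct.map_tmul]
    exact tmul_mem_lastGE (hg a ha)

theorem rTensor_mem_lastGE {W' : Type} [AddCommGroup W'] [Module Qq W'] (f : W →ₗ[Qq] W') {b : ℕ}
    {w : W ⊗[Qq] V k} (hw : w ∈ lastGE W k b) : LinearMap.rTensor (V k) f w ∈ lastGE W' k b :=
  map_mem_lastGE f (fun a ha d hd => by
    rw [LinearMap.id_apply, V.v_apply, if_neg (by rintro rfl; omega)]) hw

theorem V.rep_F_v (i : Fin k) {a d : Fin (k + 1)} (h : (d : ℕ) < a + 1) :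
    V.rep (F i) (V.v a) d = 0 := by
  rw [V.rep_F_apply, V.v_apply]
  split_ifs with h1 h2
  · subst h1 h2; simp at h
  all_goals rfl

theorem V.rep_Kinv_v (i : Fin k) {a d : Fin (k + 1)} (h : (d : ℕ) < a) :
    V.rep (Kinv i) (V.v a) d = 0 := by
  rw [V.rep_gen, V.Kinv_v, Pi.smul_apply, V.v_apply,
    if_neg (show ¬ d = a by rintro rfl; omega), smul_zero]

variable {N : Type} [AddCommGroup N] [Module Qq N]
  {ρ : U k →ₐ[Qq] Module.End Qq N} {σ : U k →ₐ[Qq] Module.End Qq W}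

/-- `u` acts on `W ⊗ 𝕍` as `u ⊗ 1`, up to terms that raise the last factor. -/
def ActsOnFirst (σ : U k →ₐ[Qq] Module.End Qq W) (u : U k) : Prop :=
  ∀ b w, w ∈ lastGE W k b →
    tensorRep σ V.rep u w - LinearMap.rTensor (V k) (σ u) w ∈ lastGE W k (b + 1)

theorem ActsOnFirst.mem {u : U k} (h : ActsOnFirst σ u) {b : ℕ} {w : W ⊗[Qq] V k}
    (hw : w ∈ lastGE W k b) : tensorRep σ V.rep u w ∈ lastGE W k b := by
  have := add_mem (lastGE_mono (Nat.le_succ b) (h b w hw)) (rTensor_mem_lastGE (σ u) hw)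
  rwa [sub_add_cancel] at this

theorem ActsOnFirst.mul {u u' : U k} (h : ActsOnFirst σ u) (h' : ActsOnFirst σ u') :
    ActsOnFirst σ (u * u') := fun b w hw => by
  have h1 := h.mem (h' b w hw)
  have h2 := h b _ (rTensor_mem_lastGE (σ u') hw)
  have := add_mem h1 h2
  rw [map_sub, sub_add_sub_cancel] at this
  rwa [map_mul, map_mul, Module.End.mul_apply, Module.End.mul_eq_comp, LinearMap.rTensor_comp,
    LinearMap.comp_apply]

/-- In Δ(F_i) = F_i ⊗ 1 + K_i ⊗ F_i the second term raises the last index. -/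
theorem actsOnFirst_F (i : Fin k) : ActsOnFirst σ (F i) := fun b w hw => by
  rw [tensorRep_apply, coprod_F, map_add, LinearMap.add_apply, pairRep_tmul, pairRep_tmul, map_one]
  change LinearMap.rTensor (V k) (σ (F i)) w + _ - _ ∈ _
  rw [add_sub_cancel_left]
  exact map_mem_lastGE _ (fun a ha d hd => V.rep_F_v i (by omega)) hw

theorem actsOnFirst_UnegW {μ : RootCone k} {y : U k} (hy : y ∈ UnegW μ) : ActsOnFirst σ y := by
  induction hy using Submodule.span_induction with
  | mem y hy =>
    obtain ⟨l, -, rfl⟩ := hy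
    induction l with
    | nil =>
      intro b w _
      rw [List.map_nil, List.prod_nil, map_one, map_one]
      change w - LinearMap.rTensor (V k) LinearMap.id w ∈ _
      rw [LinearMap.rTensor_id, LinearMap.id_apply, sub_self]
      exact zero_mem _
    | cons i l ih =>
      rw [List.map_cons, List.prod_cons]
      exact (actsOnFirst_F i).mul ih
  | zero =>
    intro b w _
    rw [map_zero, map_zero, LinearMap.rTensor_zero, sub_self]
    exact zero_mem _
  | add x y _ _ hx hy =>
    intro b w hw
    rw [map_add, map_add, LinearMap.rTensor_add, LinearMap.add_apply, LinearMap.add_apply,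
      add_sub_add_comm]
    exact add_mem (hx b w hw) (hy b w hw)
  | smul c x _ hx =>
    intro b w hw
    rw [map_smul, map_smul, LinearMap.rTensor_smul, LinearMap.smul_apply, LinearMap.smul_apply,
      ← smul_sub]
    exact Submodule.smul_mem _ _ (hx b w hw)

theorem V.rep_UnegW_v {μ : RootCone k} (hμ : μ ≠ 0) {y : U k} (hy : y ∈ UnegW μ) {a d : Fin (k + 1)}
    (h : (d : ℕ) < a + 1) : V.rep y (V.v a) d = 0 := by
  induction hy using Submodule.span_induction with
  | mem y hy =>
    obtain ⟨l, hl, rfl⟩ := hy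
    have key : ∀ l : List (Fin k), ∀ d : Fin (k + 1), (d : ℕ) < a + l.length →
        V.rep (l.map F).prod (V.v a) d = 0 := by
      intro l
      induction l with
      | nil =>
        intro d hd
        rw [List.map_nil, List.prod_nil, map_one, Module.End.one_apply, V.v_apply,
          if_neg (by rintro rfl; simp at hd)]
      | cons i l ih =>
        intro d hd
        rw [List.map_cons, List.prod_cons, map_mul, Module.End.mul_apply, V.rep_F_apply]
        split_ifs with h
        · subst h
          exact ih _ (by simp at hd ⊢; omega)
        · rfl
    refine key l d (h.trans_le ?_)
    have : l ≠ [] := by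
      rintro rfl
      exact hμ (funext fun i => (hl i).symm)
    have := List.length_pos_of_ne_nil this
    omega
  | zero => rw [map_zero]; rfl
  | add x y _ _ hx hy => rw [map_add, LinearMap.add_apply, Pi.add_apply, hx, hy, add_zero]
  | smul c x _ hx => rw [map_smul, LinearMap.smul_apply, Pi.smul_apply, hx, smul_zero]

theorem quasiR_mem_lastGE {ν : RootCone k} (hν : ν ≠ 0) {b : ℕ} {w : W ⊗[Qq] V k}
    (hw : w ∈ lastGE W k b) : pairRep σ V.rep (quasiR k ν) w ∈ lastGE W k (b + 1) := by
  have : tensorSub (UposW ν) (UnegW ν) ≤ (lastGE W k (b + 1)).comap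
      ((LinearMap.applyₗ w).comp (pairRep σ (V.rep (k := k))).toLinearMap) := by
    refine Submodule.map₂_le.mpr fun x _ y hy => ?_
    exact map_mem_lastGE _ (fun a ha d hd => V.rep_UnegW_v hν hy (by omega)) hw
  exact this (isQuasiR_quasiR.mem ν)

/-- The component at 0 is the identity, and every other component has a nontrivial element of U⁻ on
the last factor. -/
theorem thetaOp_sub_mem [Module.Finite Qq W] {b : ℕ} {w : W ⊗[Qq] V k} (hw : w ∈ lastGE W k b) :
    thetaOp σ V.rep w - w ∈ lastGE W k (b + 1) := by
  classical
  obtain ⟨n, h⟩ := exists_thetaOp_eq_sum σ (V.rep (k := k))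
  rw [h (insert 0 _) (Finset.subset_insert _ _),
    ← Finset.add_sum_erase _ _ (Finset.mem_insert_self _ _),
    isQuasiR_quasiR.zero, map_one, LinearMap.add_apply, Module.End.one_apply, add_sub_cancel_left,
    LinearMap.sum_apply]
  exact sum_mem fun ν hν => quasiR_mem_lastGE (Finset.ne_of_mem_erase hν) hw

theorem thetaBar_sub_mem [Module.Finite Qq W] (φ : W →ₛₗ[bar] W) (x : W) (b : Fin (k + 1)) :
    thetaBar σ V.rep φ V.psi (x ⊗ₜ V.v b) - φ x ⊗ₜ V.v b ∈ lastGE W k (b + 1) := by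
  rw [thetaBar_apply, TensorProduct.map_tmul, V.psi_v]
  exact thetaOp_sub_mem (tmul_v_mem_lastGE _ le_rfl)

theorem isLowering_E (j : Fin k) : IsLowering j (tensorRep σ V.rep (E j)) := fun b w hw => by
  rw [tensorRep_apply, coprod_E, map_add, LinearMap.add_apply, pairRep_tmul, pairRep_tmul, map_one]
  change LinearMap.lTensor W (V.rep (E j)) w + _ - _ ∈ _
  rw [add_sub_cancel_left]
  exact map_mem_lastGE _ (fun a ha d hd => V.rep_Kinv_v j (by omega)) hw

theorem coprod_FKinv (i j : Fin k) : coprod (F i * Kinv j)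
    = (F i * Kinv j) ⊗ₜ Kinv j + (K i * Kinv j) ⊗ₜ (F i * Kinv j) := by
  rw [map_mul, coprod_F, coprod_Kinv, add_mul, Algebra.TensorProduct.tmul_mul_tmul,
    Algebra.TensorProduct.tmul_mul_tmul, one_mul]

theorem coprod_emb_B (j : Fin k) : coprod (UI.emb (UI.B j)) = UI.emb (UI.B j) ⊗ₜ Kinv j + 1 ⊗ₜ E j
    + UI.coeff j • ((K j.rev * Kinv j) ⊗ₜ (F j.rev * Kinv j)) := by
  rw [UI.emb_B, map_add, map_smul, coprod_E, coprod_FKinv, TensorProduct.add_tmul, smul_add,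
    TensorProduct.smul_tmul']
  abel

/-- Besides 1 ⊗ E_j, the coproduct of B_j has one term diagonal on the last factor and one that
raises it. -/
theorem isLowering_B (j : Fin k) : IsLowering j (tensorRep σ V.rep (UI.emb (UI.B j))) :=
  fun b w hw => by
  rw [tensorRep_apply, coprod_emb_B, map_add, map_add, map_smul, LinearMap.add_apply,
    LinearMap.add_apply, LinearMap.smul_apply, pairRep_tmul, pairRep_tmul, pairRep_tmul, map_one]
  change _ + LinearMap.lTensor W (V.rep (E j)) w + _ - LinearMap.lTensor W (V.rep (E j)) w ∈ _
  rw [add_right_comm, add_sub_cancel_right]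
  refine add_mem (map_mem_lastGE _ (fun a ha d hd => V.rep_Kinv_v j (by omega)) hw)
    (Submodule.smul_mem _ _ (map_mem_lastGE _ (fun a ha d hd => ?_) hw))
  rw [map_mul, Module.End.mul_apply, V.rep_gen (.Kinv j), V.Kinv_v, map_smul, Pi.smul_apply,
    V.rep_F_v _ (by omega), smul_zero]

end Last

/-- `ψ_ı` acts on `𝕍^{⊗ m} ⊗ 𝕍` as on the first factor, up to terms that raise the last one. -/
theorem psiIota_sub_mem {m : ℕ} (x : T k m) (b : Fin (k + 1)) :
    (tensorSnoc k m).symm (psiIota k (m + 1) (tensorSnoc k m (x ⊗ₜ V.v b)))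
      - psiIota k m x ⊗ₜ V.v b ∈ lastGE (T k m) k (b + 1) := by
  classical
  obtain ⟨n, h⟩ := exists_upsilonOp_eq_sum k m
  obtain ⟨n', h'⟩ := exists_upsilonOp_eq_sum k (m + 1)
  have e := h _ (Finset.subset_union_left (s₂ := (finite_ht_lt n').toFinset))
  have e' := h' _ (Finset.subset_union_right (s₁ := (finite_ht_lt n).toFinset))
  set S := (finite_ht_lt n).toFinset ∪ (finite_ht_lt n').toFinset
  -- There are two sources of error: Θ differs from the identity by raising terms (`h1`), and the
  -- components of Υ act on the whole tensor product rather than on the first factor (`h2`). The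
  -- operator of Υ on the first factor preserves the filtration, so the errors add up.
  have h1 := thetaBar_sub_mem (σ := rep k m) (psiT k m) x b
  set z := thetaBar (rep k m) V.rep (psiT k m) V.psi (x ⊗ₜ V.v b)
  have hz : z ∈ lastGE (T k m) k b := by
    have := add_mem (lastGE_mono (Nat.le_succ _) h1) (tmul_v_mem_lastGE (psiT k m x) (le_refl (b : ℕ)))
    rwa [sub_add_cancel] at this
  have h2 := sum_mem (t := S) fun μ _ => actsOnFirst_UnegW (σ := rep k m)
    (isIntertwiner_upsilon.mem μ) b z hz
  replace h2 := (congrArg (· ∈ lastGE (T k m) k (b + 1)) (Finset.sum_sub_distrib _ _)).mp h2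
  have h3 := rTensor_mem_lastGE (upsilonOp k m) h1
  rw [map_sub, LinearMap.rTensor_tmul, ← psiIota_apply] at h3
  have h4 : LinearMap.rTensor (V k) (upsilonOp k m) z
      = ∑ μ ∈ S, LinearMap.rTensor (V k) (rep k m (upsilon k μ)) z := by
    rw [e]
    change LinearMap.rTensorHom (V k) _ z = _
    rw [map_sum, LinearMap.sum_apply]
    rfl
  have h5 : (tensorSnoc k m).symm (psiIota k (m + 1) (tensorSnoc k m (x ⊗ₜ V.v b)))
      = ∑ μ ∈ S, tensorRep (rep k m) V.rep (upsilon k μ) z := by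
    rw [psiIota_apply, psiT_succ_apply, e', LinearMap.sum_apply, map_sum]
    simp only [rep_succ_apply, LinearEquiv.symm_apply_apply]
    rfl
  rw [h5, ← sub_add_sub_cancel _ (LinearMap.rTensor (V k) (upsilonOp k m) z)]
  refine add_mem ?_ h3
  rwa [h4]

end QSymPair

end

/-! ### The operator s_0 commutes with U^ı -/

noncomputable section

namespace QSymPair

open U

variable {k : ℕ}

theorem tensorSnoc_M {m : ℕ} (f : Fin m → Fin (k + 1)) (a : Fin (k + 1)) :
    tensorSnoc k m (M k m f ⊗ₜ V.v a) = M k (m + 1) (Fin.snoc (α := fun _ => Fin (k + 1)) f a) := by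
  rw [M, M, Basis.piTensorProduct_apply, Basis.piTensorProduct_apply, tensorSnoc,
    LinearEquiv.trans_apply, TensorProduct.congr_tmul, LinearEquiv.refl_apply,
    PiTensorProduct.subsingletonEquiv_symm_apply']
  rw [← TensorPower.gMul_def, TensorPower.tprod_mul_tprod, Fin.append_right_eq_snoc]
  congr 1
  funext i
  refine Fin.lastCases ?_ (fun j => ?_) i
  · simp
  · simp

/-- Linear maps on `𝕍^{⊗ m} ⊗ 𝕍` agree if they agree on the standard basis. -/
theorem snoc_hom_ext {m : ℕ} {X : Type} [AddCommGroup X] [Module Qq X] {σ : Qq →+* Qq}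
    {φ χ : T k m ⊗[Qq] V k →ₛₗ[σ] X} (h : ∀ f a, φ (M k m f ⊗ₜ V.v a) = χ (M k m f ⊗ₜ V.v a)) :
    φ = χ :=
  ((M k m).tensorProduct (V.basis k)).ext fun ⟨f, a⟩ => by
    rw [Module.Basis.tensorProduct_apply]
    exact h f a

/-- The involution `v_a ↦ v_{-a}` of `𝕍`. -/
def V.flip (k : ℕ) : Module.End Qq (V k) := V.op fun a => V.v a.rev

theorem V.flip_v (a : Fin (k + 1)) : V.flip k (V.v a) = V.v a.rev := Module.Basis.constr_basis ..

theorem opS0_one (z : T k 0 ⊗[Qq] V k) :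
    opS0 k 0 (tensorSnoc k 0 z) = tensorSnoc k 0 (LinearMap.lTensor (T k 0) (V.flip k) z) := by
  have : (opS0 k 0).comp (tensorSnoc k 0).toLinearMap
      = (tensorSnoc k 0).toLinearMap.comp (LinearMap.lTensor (T k 0) (V.flip k)) :=
    snoc_hom_ext fun f a => by
      rw [LinearMap.comp_apply, LinearMap.comp_apply, LinearEquiv.coe_coe, tensorSnoc_M, opS0_M,
        LinearMap.lTensor_tmul, V.flip_v, tensorSnoc_M]
      congr 1
      funext i
      rw [Subsingleton.elim (α := Fin 1) i (Fin.last 0)]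
      have h : actS0 (Fin.snoc (α := fun _ => Fin (k + 1)) f a) (Fin.last 0)
        = (Fin.snoc (α := fun _ => Fin (k + 1)) f a (Fin.last 0)).rev := Function.update_self ..
      rw [h, Fin.snoc_last, Fin.snoc_last]
  exact LinearMap.congr_fun this z

theorem actS0_snoc {n : ℕ} (f : Fin (n + 1) → Fin (k + 1)) (a : Fin (k + 1)) :
    actS0 (Fin.snoc (α := fun _ => Fin (k + 1)) f a)
      = Fin.snoc (α := fun _ => Fin (k + 1)) (actS0 f) a := by
  rw [actS0, actS0, Fin.snoc_update]
  have : (Fin.snoc (α := fun _ => Fin (k + 1)) f a) 0 = f 0 :=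
    Fin.snoc_castSucc (α := fun _ => Fin (k + 1)) a f 0
  rw [this]
  rfl

theorem opS0_succ {n : ℕ} (z : T k (n + 1) ⊗[Qq] V k) : opS0 k (n + 1) (tensorSnoc k (n + 1) z)
    = tensorSnoc k (n + 1) (LinearMap.rTensor (V k) (opS0 k n) z) := by
  have : (opS0 k (n + 1)).comp (tensorSnoc k (n + 1)).toLinearMap
      = (tensorSnoc k (n + 1)).toLinearMap.comp (LinearMap.rTensor (V k) (opS0 k n)) :=
    snoc_hom_ext fun f a => by
      rw [LinearMap.comp_apply, LinearMap.comp_apply, LinearEquiv.coe_coe, tensorSnoc_M, opS0_M,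
        LinearMap.rTensor_tmul, opS0_M, tensorSnoc_M, actS0_snoc]
  exact LinearMap.congr_fun this z

theorem V.ext_rep {φ χ : Module.End Qq (V k)} (h : ∀ a, φ (V.v a) = χ (V.v a)) : φ = χ :=
  (V.basis k).ext h

/-- The matrix entries of B_j are 0 and 1 and are symmetric under a ↦ -a. This accounts both for the
flip of 𝕍 commuting with U^ı and for ψ commuting with B_j on 𝕍. -/
theorem V.rep_B_v (j : Fin k) (a : Fin (k + 1)) : V.rep (UI.emb (UI.B j)) (V.v a)
    = (if a = j.succ then V.v j.castSucc else 0)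
      + (if a = j.succ.rev then V.v j.castSucc.rev else 0) := by
  have hq := q_ne_zero
  rw [UI.emb_B, map_add, map_smul, map_mul, LinearMap.add_apply, LinearMap.smul_apply,
    Module.End.mul_apply, V.rep_gen, V.rep_gen, V.rep_gen, V.E_v, V.Kinv_v, map_smul, V.F_v,
    smul_smul, ← Fin.rev_succ, ← Fin.rev_castSucc]
  congr 1
  by_cases h : a = j.succ.rev
  · rw [if_pos h]
    -- The coefficient of F_{-j} K_j⁻¹ cancels the eigenvalue of K_j⁻¹ on v_{-(j+1/2)}, in each of
    -- the cases j < 0 (adjacent to -j or not), j = 0 and j > 0.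
    convert one_smul Qq _
    rcases lt_trichotomy j j.rev with h1 | h1 | h1
    · rw [UI.coeff, if_neg h1.not_gt, if_pos h1]
      by_cases h2 : (j : ℕ) + 1 = j.rev
      · rw [cartan_adjacent (Or.inl h2), if_neg, if_pos, zpow_neg_one, inv_mul_cancel₀ hq]
        · rw [h]; simp only [Fin.ext_iff, Fin.val_rev, Fin.val_succ] at *; omega
        · rw [h]; simp only [Fin.ext_iff, Fin.val_rev, Fin.val_succ, Fin.val_castSucc] at *; omega
      · rw [cartan_far (Or.inl (lt_of_le_of_ne h1 h2)), if_neg, if_neg, zpow_zero, one_mul]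
        · rw [h]; simp only [Fin.ext_iff, Fin.val_rev, Fin.val_succ] at *; omega
        · rw [h]; simp only [Fin.ext_iff, Fin.val_rev, Fin.val_succ, Fin.val_castSucc, Fin.lt_def] at *
          omega
    · rw [UI.coeff, if_neg (by rw [← h1]; exact lt_irrefl j), if_neg (by rw [← h1]; exact lt_irrefl j),
        if_pos, mul_inv_cancel₀ hq]
      rw [h]; simp only [Fin.ext_iff, Fin.val_rev, Fin.val_succ, Fin.val_castSucc] at *; omega
    · rw [UI.coeff, if_pos h1, if_neg, if_neg, one_mul]
      · rw [h]; simp only [Fin.ext_iff, Fin.val_rev, Fin.val_succ, Fin.lt_def] at *; omega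
      · rw [h]; simp only [Fin.ext_iff, Fin.val_rev, Fin.val_succ, Fin.val_castSucc, Fin.lt_def] at *
        omega
  · rw [if_neg h, smul_zero]

theorem V.rep_kappa_v (i : Fin k) (a : Fin (k + 1)) : ∃ c : Qq,
    V.rep (K i * Kinv i.rev) (V.v a) = c • V.v a ∧
    V.rep (K i * Kinv i.rev) (V.v a.rev) = c • V.v a.rev := by
  have hq := q_ne_zero
  simp only [map_mul, Module.End.mul_apply, V.rep_gen, V.Kinv_v, V.K_v, map_smul, smul_smul]
  refine ⟨_, rfl, ?_⟩
  congr 1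
  have h1 : a.rev = i.castSucc ↔ a = i.rev.succ := by rw [Fin.rev_eq_iff, Fin.rev_castSucc]
  have h2 : a.rev = i.succ ↔ a = i.rev.castSucc := by rw [Fin.rev_eq_iff, Fin.rev_succ]
  have h3 : a.rev = i.rev.castSucc ↔ a = i.succ := by
    rw [Fin.rev_eq_iff, Fin.rev_castSucc, Fin.rev_rev]
  have h4 : a.rev = i.rev.succ ↔ a = i.castSucc := by rw [Fin.rev_eq_iff, Fin.rev_succ, Fin.rev_rev]
  have n1 : i.castSucc ≠ i.succ := by simp [Fin.ext_iff]
  have n2 : i.rev.castSucc ≠ i.rev.succ := by simp [Fin.ext_iff]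
  simp only [h1, h2, h3, h4]
  split_ifs <;> first | ring1 | (exfalso; simp only [Fin.ext_iff] at *; omega)

theorem V.flip_rep (u : UI k) (x : V k) :
    V.flip k (V.rep (UI.emb u) x) = V.rep (UI.emb u) (V.flip k x) := by
  have key : ∀ i : Fin k, V.flip k * V.rep (K i * Kinv i.rev) = V.rep (K i * Kinv i.rev) * V.flip k := by
    intro i
    refine V.ext_rep fun a => ?_
    obtain ⟨c, h1, h2⟩ := V.rep_kappa_v i a
    rw [Module.End.mul_apply, Module.End.mul_apply, h1, map_smul, V.flip_v, h2]
  have : V.flip k * V.rep (UI.emb u) = V.rep (UI.emb u) * V.flip k := by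
    induction u using UI.induction_B with
    | hc c => rw [AlgHom.commutes, AlgHom.commutes, Algebra.commutes]
    | hB j =>
      refine V.ext_rep fun a => ?_
      rw [Module.End.mul_apply, Module.End.mul_apply, V.rep_B_v, V.flip_v, V.rep_B_v, map_add,
        add_comm]
      simp only [Fin.rev_eq_iff, Fin.rev_rev]
      congr 1
      · split_ifs
        exacts [(V.flip_v _).trans (by rw [Fin.rev_rev]), map_zero (V.flip k)]
      · split_ifs
        exacts [V.flip_v _, map_zero (V.flip k)]
    | hκ i => rw [UI.emb_gen]; exact key i.1
    | hκ' i =>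
      rw [UI.emb_gen]
      have := key i.1.rev
      rw [Fin.rev_rev] at this
      exact this
    | hm x y hx hy => rw [map_mul, map_mul, ← mul_assoc, hx, mul_assoc, hy, mul_assoc]
    | ha x y hx hy => rw [map_add, map_add, mul_add, add_mul, hx, hy]
  exact LinearMap.congr_fun this x

theorem tensorRep_zero (u : U k) :
    tensorRep (rep k 0) V.rep u = LinearMap.lTensor (T k 0) (V.rep (k := k) u) := by
  have h0 : ∀ u : U k, rep k 0 u = algebraMap Qq _ (counit u) := fun u => by
    refine LinearMap.ext fun x => ?_
    rw [rep_zero_apply, Module.algebraMap_end_apply]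
  induction u using U.induction with
  | hc c =>
    rw [AlgHom.commutes, AlgHom.commutes]
    refine TensorProduct.ext' fun x v => ?_
    simp [Module.algebraMap_end_apply]
  | hg g =>
    have e : ∀ g : UGen k, counit (gen g) = match g with
      | .E _ => 0
      | .F _ => 0
      | .K _ => 1
      | .Kinv _ => 1 := fun g => (lift_gen _ _ g).trans (by cases g <;> rfl)
    refine TensorProduct.ext' fun x v => ?_
    rw [tensorRep_apply, LinearMap.lTensor_tmul]
    cases g
    · erw [coprod_E]
      rw [map_add, LinearMap.add_apply, pairRep_tmul_apply, pairRep_tmul_apply, h0 (E _), e]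
      simp
    · erw [coprod_F]
      rw [map_add, LinearMap.add_apply, pairRep_tmul_apply, pairRep_tmul_apply, h0 (F _), h0 (K _),
        e, e]
      simp
    · erw [coprod_K]
      rw [pairRep_tmul_apply, h0 (K _), e]
      simp
    · erw [coprod_Kinv]
      rw [pairRep_tmul_apply, h0 (Kinv _), e]
      simp
  | hm a b ha hb =>
    rw [map_mul, map_mul, ha, hb, Module.End.mul_eq_comp, Module.End.mul_eq_comp,
      LinearMap.lTensor_comp]
  | ha a b ha hb => rw [map_add, map_add, ha, hb, LinearMap.lTensor_add]

/-- `U^ı` is a right coideal. -/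
theorem exists_coprod_emb (u : UI k) : ∃ w : UI k ⊗[Qq] U k,
    coprod (UI.emb u) = Algebra.TensorProduct.map UI.emb (AlgHom.id Qq (U k)) w := by
  have hk : ∀ i : Fin k, ∃ x : UI k, UI.emb x = K i * Kinv i.rev := by
    intro i
    -- The index i is arbitrary, while U^ı has generators for positive indices only: for negative i
    -- an inverse is taken, and for i = 0 the element is 1.
    rcases lt_trichotomy i i.rev with h | h | h
    · refine ⟨UI.gen (.κinv ⟨i.rev, by rwa [Fin.rev_rev]⟩), ?_⟩
      rw [UI.emb_gen]
      simp only [UI.embGen, Fin.rev_rev]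
    · exact ⟨1, by rw [map_one, ← h, K_Kinv]⟩
    · exact ⟨UI.gen (.κ ⟨i, h⟩), UI.emb_gen _⟩
  have hkk : ∀ i : Fin k, ∃ w : UI k ⊗[Qq] U k, coprod (K i * Kinv i.rev)
      = Algebra.TensorProduct.map UI.emb (AlgHom.id Qq (U k)) w := by
    intro i
    obtain ⟨x, hx⟩ := hk i
    refine ⟨x ⊗ₜ (K i * Kinv i.rev), ?_⟩
    rw [map_mul, coprod_K, coprod_Kinv, Algebra.TensorProduct.map_tmul, hx, AlgHom.id_apply,
      Algebra.TensorProduct.tmul_mul_tmul]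
  induction u using UI.induction_B with
  | hc c => exact ⟨algebraMap Qq _ c, by rw [AlgHom.commutes, AlgHom.commutes, AlgHom.commutes]⟩
  | hB j =>
    obtain ⟨x, hx⟩ := hk j.rev
    rw [Fin.rev_rev] at hx
    refine ⟨UI.B j ⊗ₜ Kinv j + 1 ⊗ₜ E j + UI.coeff j • (x ⊗ₜ (F j.rev * Kinv j)), ?_⟩
    rw [coprod_emb_B, map_add, map_add, map_smul]
    simp only [Algebra.TensorProduct.map_tmul, hx, map_one, AlgHom.id_apply]
  | hκ i => rw [UI.emb_gen]; exact hkk i.1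
  | hκ' i =>
    rw [UI.emb_gen]
    have := hkk i.1.rev
    rw [Fin.rev_rev] at this
    exact this
  | hm x y hx hy =>
    obtain ⟨w, hw⟩ := hx
    obtain ⟨w', hw'⟩ := hy
    exact ⟨w * w', by rw [map_mul, map_mul, map_mul, hw, hw']⟩
  | ha x y hx hy =>
    obtain ⟨w, hw⟩ := hx
    obtain ⟨w', hw'⟩ := hy
    exact ⟨w + w', by rw [map_add, map_add, map_add, hw, hw']⟩

/-- The operator s_0 touches the first factor only, and the coproduct of U^ı keeps U^ı on all
factors but the last, so the claim reduces inductively to 𝕍 itself. -/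
theorem opS0_actI {n : ℕ} (u : UI k) (x : T k (n + 1)) :
    opS0 k n (actI u x) = actI u (opS0 k n x) := by
  induction n generalizing u with
  | zero =>
    obtain ⟨z, rfl⟩ := (tensorSnoc k 0).surjective x
    rw [actI, actI, rep_succ_apply, opS0_one, opS0_one, rep_succ_apply, tensorRep_zero,
      ← LinearMap.comp_apply, ← LinearMap.comp_apply, ← LinearMap.lTensor_comp,
      ← LinearMap.lTensor_comp]
    congr 3
    refine LinearMap.ext fun y => ?_
    exact V.flip_rep u y
  | succ n ih =>
    obtain ⟨z, rfl⟩ := (tensorSnoc k (n + 1)).surjective x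
    obtain ⟨w, hw⟩ := exists_coprod_emb u
    rw [actI, actI, rep_succ_apply, opS0_succ, opS0_succ, rep_succ_apply, tensorRep_apply,
      tensorRep_apply, hw]
    congr 1
    clear hw
    induction w using TensorProduct.induction_on with
    | zero => simp
    | add a b ha hb => simp only [map_add, LinearMap.add_apply, ha, hb]
    | tmul a b =>
      rw [Algebra.TensorProduct.map_tmul, pairRep_tmul, AlgHom.id_apply]
      induction z using TensorProduct.induction_on with
      | zero => simp
      | add x y hx hy => simp only [map_add, hx, hy]
      | tmul x y =>
        rw [TensorProduct.map_tmul, LinearMap.rTensor_tmul, LinearMap.rTensor_tmul,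
          TensorProduct.map_tmul]
        congr 1
        exact ih a x

end QSymPair

end

/-! ### ψ_ı commutes with s_0 and fixes anti-dominant vectors -/

noncomputable section

namespace QSymPair

open U

variable {k : ℕ}

/-- Rigidity for anti-linear maps: the difference is additive, raises the last index and commutes
with lowering operators. -/
theorem eq_of_commutes {W : Type} [AddCommGroup W] [Module Qq W]
    {β : Fin k → Module.End Qq (W ⊗[Qq] V k)} (hβ : ∀ j, IsLowering j (β j))
    {φ χ : W ⊗[Qq] V k →ₛₗ[bar] W ⊗[Qq] V k}
    (h : ∀ x (b : Fin (k + 1)), φ (x ⊗ₜ V.v b) - χ (x ⊗ₜ V.v b) ∈ lastGE W k (b + 1))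
    (hφ : ∀ j w, φ (β j w) = β j (φ w)) (hχ : ∀ j w, χ (β j w) = β j (χ w)) : φ = χ := by
  refine LinearMap.ext fun w => sub_eq_zero.mp ?_
  refine eq_zero_of_commutes hβ (φ.toAddMonoidHom - χ.toAddMonoidHom) h (fun j w => ?_) w
  change φ (β j w) - χ (β j w) = β j (φ w - χ w)
  rw [hφ, hχ, map_sub]

theorem sub_mem_lastGE_of_sub_mem {W : Type} [AddCommGroup W] [Module Qq W] {b : ℕ}
    {x y z : W ⊗[Qq] V k} (h : x - z ∈ lastGE W k b) (h' : y - z ∈ lastGE W k b) :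
    x - y ∈ lastGE W k b := by
  have := sub_mem h h'
  rwa [sub_sub_sub_cancel_right] at this

theorem counit_UnegW {μ : RootCone k} (hμ : μ ≠ 0) {y : U k} (hy : y ∈ UnegW μ) : counit y = 0 := by
  induction hy using Submodule.span_induction with
  | mem y hy =>
    obtain ⟨l, hl, rfl⟩ := hy
    cases l with
    | nil => exact absurd (funext fun i => (hl i).symm) hμ
    | cons i l =>
      rw [List.map_cons, List.prod_cons, map_mul, show counit (F i) = 0 from lift_gen .., zero_mul]
  | zero => exact map_zero _
  | add x y _ _ hx hy => rw [map_add, hx, hy, add_zero]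
  | smul c x _ hx => rw [map_smul, hx, smul_zero]

theorem psiIota_zero (x : T k 0) : psiIota k 0 x = psiT k 0 x := by
  classical
  obtain ⟨n, h⟩ := exists_upsilonOp_eq_sum k 0
  rw [psiIota_apply, h (insert 0 _) (Finset.subset_insert _ _),
    ← Finset.add_sum_erase _ _ (Finset.mem_insert_self _ _), isIntertwiner_upsilon.zero, map_one,
    Finset.sum_eq_zero, add_zero, Module.End.one_apply]
  intro μ hμ
  refine LinearMap.ext fun x => ?_
  rw [rep_zero_apply, counit_UnegW (Finset.ne_of_mem_erase hμ) (isIntertwiner_upsilon.mem μ),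
    zero_smul]
  rfl

theorem psiIota_tensorSnoc_B {m : ℕ} (j : Fin k) (z : T k m ⊗[Qq] V k) :
    (tensorSnoc k m).symm (psiIota k (m + 1) (tensorSnoc k m
      (tensorRep (rep k m) V.rep (UI.emb (UI.B j)) z)))
      = tensorRep (rep k m) V.rep (UI.emb (UI.B j))
        ((tensorSnoc k m).symm (psiIota k (m + 1) (tensorSnoc k m z))) := by
  have h := psiIota_actI (UI.B j) (tensorSnoc k m z)
  rw [actI, rep_succ_apply] at h
  rw [h, UI.barUI_B, LinearEquiv.symm_apply_eq, ← rep_succ_apply, LinearEquiv.apply_symm_apply]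
  rfl

theorem V.psi_rep_B (j : Fin k) (v : V k) :
    V.psi (V.rep (UI.emb (UI.B j)) v) = V.rep (UI.emb (UI.B j)) (V.psi v) := by
  have : V.psi.comp (V.rep (UI.emb (UI.B j))) = (V.rep (UI.emb (UI.B j))).comp (V.psi (k := k)) := by
    refine (V.basis k).ext fun a => ?_
    rw [LinearMap.comp_apply, LinearMap.comp_apply, V.psi_v, V.rep_B_v, map_add]
    congr 1
    · split_ifs
      exacts [V.psi_v _, map_zero V.psi]
    · split_ifs
      exacts [V.psi_v _, map_zero V.psi]
  exact LinearMap.congr_fun this v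

/-- On a single factor Υ has no effect: the map fixing every v_a already commutes with all B_j and
has the same leading term as ψ_ı. -/
theorem psiIota_one (z : T k 0 ⊗[Qq] V k) : psiIota k 1 (tensorSnoc k 0 z)
    = tensorSnoc k 0 (TensorProduct.map (psiT k 0) V.psi z) := by
  rw [← LinearEquiv.symm_apply_eq]
  refine LinearMap.congr_fun (eq_of_commutes
    (β := fun j => tensorRep (rep k 0) V.rep (UI.emb (UI.B j))) (fun j => isLowering_B j)
    (φ := (tensorSnoc k 0).symm.toLinearMap.comp ((psiIota k 1).comp (tensorSnoc k 0).toLinearMap))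
    (χ := TensorProduct.map (psiT k 0) V.psi) (fun x b => ?_)
    (fun j w => psiIota_tensorSnoc_B j w) (fun j w => ?_)) z
  · rw [TensorProduct.map_tmul, V.psi_v, ← psiIota_zero]
    exact psiIota_sub_mem x b
  · rw [tensorRep_zero]
    induction w using TensorProduct.induction_on with
    | zero => simp
    | add x y hx hy => simp only [map_add, hx, hy]
    | tmul x y =>
      simp only [LinearMap.lTensor_tmul, TensorProduct.map_tmul, V.psi_rep_B]

/-- For one factor by the explicit form of ψ_ı. In general ψ_ı s_0 and s_0 ψ_ı both commute with the
B_j, and their leading terms agree by the claim for one factor fewer; rigidity gives equality. -/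
theorem psiIota_opS0 {n : ℕ} (x : T k (n + 1)) :
    psiIota k (n + 1) (opS0 k n x) = opS0 k n (psiIota k (n + 1) x) := by
  induction n with
  | zero =>
    obtain ⟨z, rfl⟩ := (tensorSnoc k 0).surjective x
    have h : V.psi.comp (V.flip k) = (V.flip k).comp (V.psi (k := k)) :=
      (V.basis k).ext fun a => by
        rw [LinearMap.comp_apply, LinearMap.comp_apply, V.flip_v, V.psi_v, V.psi_v, V.flip_v]
    rw [opS0_one, psiIota_one, psiIota_one, opS0_one]
    congr 1
    induction z using TensorProduct.induction_on with
    | zero => simp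
    | add x y hx hy => simp only [map_add, hx, hy]
    | tmul x y =>
      simp only [LinearMap.lTensor_tmul, TensorProduct.map_tmul]
      congr 1
      exact LinearMap.congr_fun h y
  | succ n ih =>
    obtain ⟨z, rfl⟩ := (tensorSnoc k (n + 1)).surjective x
    let P : T k (n + 1) ⊗[Qq] V k →ₛₗ[bar] T k (n + 1) ⊗[Qq] V k :=
      (tensorSnoc k (n + 1)).symm.toLinearMap.comp
        ((psiIota k (n + 2)).comp (tensorSnoc k (n + 1)).toLinearMap)
    let s : Module.End Qq (T k (n + 1) ⊗[Qq] V k) := LinearMap.rTensor (V k) (opS0 k n)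
    have hP : ∀ w, psiIota k (n + 2) (tensorSnoc k (n + 1) w) = tensorSnoc k (n + 1) (P w) :=
      fun w =>
      ((tensorSnoc k (n + 1)).apply_symm_apply _).symm
    have hs : ∀ (j : Fin k) w, s (tensorRep (rep k (n + 1)) V.rep (UI.emb (UI.B j)) w)
        = tensorRep (rep k (n + 1)) V.rep (UI.emb (UI.B j)) (s w) := fun j w => by
      have := opS0_actI (UI.B j) (tensorSnoc k (n + 1) w)
      rw [actI, actI, rep_succ_apply, opS0_succ, opS0_succ, rep_succ_apply] at this
      exact (tensorSnoc k (n + 1)).injective this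
    rw [opS0_succ, hP, hP, opS0_succ]
    congr 1
    have hB : ∀ (j : Fin k) w, P (tensorRep (rep k (n + 1)) V.rep (UI.emb (UI.B j)) w)
      = tensorRep (rep k (n + 1)) V.rep (UI.emb (UI.B j)) (P w) := psiIota_tensorSnoc_B
    refine LinearMap.congr_fun (eq_of_commutes
      (β := fun j => tensorRep (rep k (n + 1)) V.rep (UI.emb (UI.B j))) (fun j => isLowering_B j)
      (φ := P.comp s) (χ := s.comp P) (fun x b => ?_)
      (fun j w => ?_) (fun j w => ?_)) z
    · change P (s (x ⊗ₜ V.v b)) - s (P (x ⊗ₜ V.v b)) ∈ _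
      have h1 := psiIota_sub_mem (opS0 k n x) b
      have h2 := rTensor_mem_lastGE (opS0 k n) (psiIota_sub_mem x b)
      rw [map_sub, LinearMap.rTensor_tmul, ← ih] at h2
      exact sub_mem_lastGE_of_sub_mem h1 h2
    · change P (s (tensorRep _ _ _ w)) = tensorRep _ _ _ (P (s w))
      rw [hs, hB]
    · change s (P (tensorRep _ _ _ w)) = tensorRep _ _ _ (s (P w))
      rw [hB, hs]

theorem exists_rep_Kinv_M (j : Fin k) {m : ℕ} (f : Fin m → Fin (k + 1)) :
    ∃ c : Qq, rep k m (Kinv j) (M k m f) = c • M k m f := by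
  induction m with
  | zero => exact ⟨counit (Kinv j), rep_zero_apply _ _⟩
  | succ m ih =>
    obtain ⟨c, hc⟩ := ih (Fin.init f)
    refine ⟨c * (if f (Fin.last m) = j.castSucc then q⁻¹ else if f (Fin.last m) = j.succ then q else 1), ?_⟩
    rw [← Fin.snoc_init_self f, ← tensorSnoc_M, rep_succ_apply, tensorRep_apply, coprod_Kinv,
      pairRep_tmul_apply, hc, V.rep_gen, V.Kinv_v, TensorProduct.smul_tmul_smul, map_smul,
      Fin.snoc_init_self]

theorem rep_E_M_eq_zero {j : Fin k} {m : ℕ} {f : Fin m → Fin (k + 1)} (h : ∀ i, f i ≠ j.succ) :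
    rep k m (E j) (M k m f) = 0 := by
  induction m with
  | zero => rw [rep_zero_apply, show counit (E j) = 0 from lift_gen .., zero_smul]
  | succ m ih =>
    rw [← Fin.snoc_init_self f, ← tensorSnoc_M, rep_succ_apply, tensorRep_apply, coprod_E,
      map_add, LinearMap.add_apply, pairRep_tmul_apply, pairRep_tmul_apply,
      ih (f := Fin.init f) (fun i => h i.castSucc), V.rep_gen, V.E_v, if_neg (h _)]
    simp

theorem rep_F_M_eq_zero {j : Fin k} {m : ℕ} {f : Fin m → Fin (k + 1)} (h : ∀ i, f i ≠ j.castSucc) :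
    rep k m (F j) (M k m f) = 0 := by
  induction m with
  | zero => rw [rep_zero_apply, show counit (F j) = 0 from lift_gen .., zero_smul]
  | succ m ih =>
    rw [← Fin.snoc_init_self f, ← tensorSnoc_M, rep_succ_apply, tensorRep_apply, coprod_F,
      map_add, LinearMap.add_apply, pairRep_tmul_apply, pairRep_tmul_apply,
      ih (f := Fin.init f) (fun i => h i.castSucc), V.rep_gen (.F j), V.F_v, if_neg (h _)]
    simp

/-- E_j needs the index j + 1/2 somewhere among the factors and F_{-j} needs -(j + 1/2). -/
theorem actI_B_M_eq_zero {j : Fin k} {m : ℕ} {f : Fin m → Fin (k + 1)} (h : ∀ i, f i ≠ j.succ)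
    (h' : ∀ i, f i ≠ j.succ.rev) : actI (UI.B j) (M k m f) = 0 := by
  obtain ⟨c, hc⟩ := exists_rep_Kinv_M j f
  rw [actI, UI.emb_B, map_add, map_smul, map_mul, LinearMap.add_apply, LinearMap.smul_apply,
    Module.End.mul_apply, hc, map_smul, rep_E_M_eq_zero h,
    rep_F_M_eq_zero (fun i => by rw [← Fin.rev_succ]; exact h' i)]
  simp

theorem twice_le_twice {a b : Fin (k + 1)} : twice a ≤ twice b ↔ a ≤ b := by
  rw [twice, twice, Fin.le_def]; omega

theorem DAntidominant.init {n : ℕ} {f : Fin (n + 2) → Fin (k + 1)} (h : DAntidominant f) :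
    DAntidominant (Fin.init f) := fun i => h i.castSucc

theorem DAntidominant.abs_le {n : ℕ} {f : Fin (n + 2) → Fin (k + 1)} (h : DAntidominant f)
    (i : Fin (n + 2)) : |twice (f i)| ≤ twice (f (Fin.last (n + 1))) := by
  induction n with
  | zero =>
    have h0 := h 0
    rw [if_pos (by rfl)] at h0
    refine Fin.lastCases ?_ (fun j => ?_) i
    · exact le_of_eq (abs_of_nonneg ((abs_nonneg _).trans h0))
    · rw [Subsingleton.elim (α := Fin 1) j 0]; exact h0
  | succ n ih =>
    have h1 := h (Fin.last (n + 1))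
    rw [if_neg (by simp)] at h1
    have h2 : ∀ j : Fin (n + 2), |twice (f j.castSucc)| ≤ twice (f (Fin.last (n + 2))) := fun j =>
      (ih h.init j).trans h1
    refine Fin.lastCases ?_ h2 i
    exact le_of_eq (abs_of_nonneg ((abs_nonneg _).trans (h2 0)))

theorem psiT_zero_M (f : Fin 0 → Fin (k + 1)) : psiT k 0 (M k 0 f) = M k 0 f := by
  have : tensorZero k (M k 0 f) = 1 := by
    rw [M, Basis.piTensorProduct_apply, tensorZero, PiTensorProduct.isEmptyEquiv_apply_tprod]
  change (tensorZero k).symm (bar (tensorZero k (M k 0 f))) = _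
  rw [LinearEquiv.symm_apply_eq, this, map_one]

/-- By induction ψ_ı(M_f) - M_f has last index above f(m). It is killed by every B_j with j > f(m),
because M_f is; this forces it to vanish. -/
theorem psiIota_M {n : ℕ} {f : Fin (n + 1) → Fin (k + 1)} (h : DAntidominant f) :
    psiIota k (n + 1) (M k (n + 1) f) = M k (n + 1) f := by
  induction n with
  | zero =>
    rw [← Fin.snoc_init_self f, ← tensorSnoc_M, psiIota_one, TensorProduct.map_tmul, V.psi_v,
      psiT_zero_M]
  | succ n ih =>
    have h1 := psiIota_sub_mem (M k (n + 1) (Fin.init f)) (f (Fin.last _))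
    rw [ih h.init, tensorSnoc_M, Fin.snoc_init_self] at h1
    have h2 := eq_zero_of_isLowering
      (β := fun j => tensorRep (rep k (n + 1)) V.rep (UI.emb (UI.B j))) (fun j => isLowering_B j) h1
      (fun j hj => by
        have h0 : actI (UI.B j) (M k (n + 2) f) = 0 := by
          -- Every |f(i)| is at most f(m), while the index that B_j looks for has absolute value
          -- above f(m).
          refine actI_B_M_eq_zero (fun i e => ?_) (fun i e => ?_)
          · have := (le_abs_self _).trans (h.abs_le i)
            rw [twice_le_twice, e, Fin.le_def, Fin.val_succ] at this
            omega
          · have := (neg_abs_le _).trans' (neg_le_neg (h.abs_le i))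
            rw [e, twice, twice, Fin.val_rev, Fin.val_succ] at this
            have hj2 := j.2
            omega
        have h3 := psiIota_actI (UI.B j) (M k (n + 2) f)
        rw [h0, map_zero, UI.barUI_B] at h3
        have e2 : ∀ y : T k (n + 2), tensorRep (rep k (n + 1)) V.rep (UI.emb (UI.B j))
            ((tensorSnoc k (n + 1)).symm y) = (tensorSnoc k (n + 1)).symm (actI (UI.B j) y) :=
              fun y => by
          rw [LinearEquiv.eq_symm_apply, ← rep_succ_apply, LinearEquiv.apply_symm_apply]
          rfl
        have e3 : M k (n + 1) (Fin.init f) ⊗ₜ V.v (f (Fin.last _))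
            = (tensorSnoc k (n + 1)).symm (M k (n + 2) f) := by
          rw [LinearEquiv.eq_symm_apply, tensorSnoc_M, Fin.snoc_init_self]
        change tensorRep _ _ _ (_ - _) = 0
        rw [e3, map_sub, e2, e2, ← h3, h0, sub_self])
    rw [sub_eq_zero, LinearEquiv.symm_apply_eq, tensorSnoc_M, Fin.snoc_init_self] at h2
    exact h2

end QSymPair

end

/-! ### The Hecke operator and ψ on 𝕍 ⊗ 𝕍 -/

noncomputable section

namespace QSymPair

open U

variable {k : ℕ}

section Scalars

variable {R X : Type*} [Field R] [AddCommGroup X] [Module R X] {p : R}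

theorem hecke_scalar_quadratic (hp : p ≠ 0) (x : X) :
    p⁻¹ • p⁻¹ • x = x + (p⁻¹ - p) • p⁻¹ • x := by
  match_scalars; field_simp; ring

theorem hecke_scalar_comm (hp : p ≠ 0) (x y : X) :
    y + (p⁻¹ - p) • x + p • x = p⁻¹ • (x + p • y) := by
  match_scalars <;> field_simp <;> ring

theorem hecke_scalar_bar_eq (x : X) : p⁻¹⁻¹ • x = p⁻¹ • x + (p - p⁻¹) • x := by
  match_scalars; rw [inv_inv]; ring

theorem hecke_scalar_bar_gt (x y : X) : x + (p - p⁻¹) • (y + (p - p⁻¹) • x)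
    = x + (p⁻¹ - p) • y + (p - p⁻¹) • y + (p - p⁻¹) • (y + (p - p⁻¹) • x) := by
  match_scalars <;> ring

theorem hecke_scalar_bar_E (x y : X) : x + (p - p⁻¹) • y + p⁻¹ • y = x + p • y := by
  match_scalars <;> ring

end Scalars

namespace V

/-- The representation of `U` on `𝕍 ⊗ 𝕍`. -/
abbrev rep₂ (k : ℕ) : U k →ₐ[Qq] Module.End Qq (V k ⊗[Qq] V k) := tensorRep rep rep

theorem ext₂ {X : Type} [AddCommGroup X] [Module Qq X] {σ : Qq →+* Qq}
    {φ χ : V k ⊗[Qq] V k →ₛₗ[σ] X} (h : ∀ a b, φ (v a ⊗ₜ v b) = χ (v a ⊗ₜ v b)) : φ = χ :=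
  ((basis k).tensorProduct (basis k)).ext fun ⟨a, b⟩ => by
    rw [Module.Basis.tensorProduct_apply]
    exact h a b

/-- The Hecke operator on `𝕍 ⊗ 𝕍`. -/
def H₂ (k : ℕ) : Module.End Qq (V k ⊗[Qq] V k) :=
  ((basis k).tensorProduct (basis k)).constr Qq fun p : Fin (k + 1) × Fin (k + 1) =>
    heckeCase q p.1 p.2 (v p.1 ⊗ₜ v p.2) (v p.2 ⊗ₜ v p.1)

theorem H₂_v (a b : Fin (k + 1)) :
    H₂ k (v a ⊗ₜ v b) = heckeCase q a b (v a ⊗ₜ v b) (v b ⊗ₜ v a) := by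
  have := Module.Basis.constr_basis ((basis k).tensorProduct (basis k)) Qq
    (fun p : Fin (k + 1) × Fin (k + 1) =>
      heckeCase q p.1 p.2 (v p.1 ⊗ₜ[Qq] v p.2) (v p.2 ⊗ₜ[Qq] v p.1)) (a, b)
  rwa [Module.Basis.tensorProduct_apply] at this

theorem H₂_eq (a : Fin (k + 1)) : H₂ k (v a ⊗ₜ v a) = q⁻¹ • (v a ⊗ₜ v a) := by
  rw [H₂_v, heckeCase_eq]
theorem H₂_lt {a b : Fin (k + 1)} (h : a < b) : H₂ k (v a ⊗ₜ v b) = v b ⊗ₜ v a := by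
  rw [H₂_v, heckeCase_lt q h]
theorem H₂_gt {a b : Fin (k + 1)} (h : b < a) :
    H₂ k (v a ⊗ₜ v b) = v b ⊗ₜ v a + (q⁻¹ - q) • (v a ⊗ₜ v b) := by
  rw [H₂_v, heckeCase_gt q h]

theorem H₂_H₂ (w : V k ⊗[Qq] V k) : H₂ k (H₂ k w) = w + (q⁻¹ - q) • H₂ k w := by
  have hq := q_ne_zero
  have : (H₂ k).comp (H₂ k) = LinearMap.id + (q⁻¹ - q) • H₂ k := by
    refine ext₂ fun a b => ?_
    simp only [LinearMap.comp_apply, LinearMap.add_apply, LinearMap.smul_apply, LinearMap.id_apply]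
    rcases lt_trichotomy a b with h | rfl | h
    · rw [H₂_lt h, H₂_gt h]
    · rw [H₂_eq, map_smul, H₂_eq]
      exact hecke_scalar_quadratic (X := V k ⊗[Qq] V k) hq _
    · rw [H₂_gt h, map_add, map_smul, H₂_lt h, H₂_gt h]
  exact LinearMap.congr_fun this w

theorem rep₂_E (j : Fin k) (x y : V k) :
    rep₂ k (E j) (x ⊗ₜ y) = x ⊗ₜ rep (E j) y + rep (E j) x ⊗ₜ rep (Kinv j) y := by
  rw [tensorRep_apply, coprod_E, map_add, LinearMap.add_apply, pairRep_tmul_apply,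
    pairRep_tmul_apply,
    map_one, Module.End.one_apply]
theorem rep₂_F (j : Fin k) (x y : V k) :
    rep₂ k (F j) (x ⊗ₜ y) = rep (F j) x ⊗ₜ y + rep (K j) x ⊗ₜ rep (F j) y := by
  rw [tensorRep_apply, coprod_F, map_add, LinearMap.add_apply, pairRep_tmul_apply,
    pairRep_tmul_apply,
    map_one, Module.End.one_apply]

theorem cs_lt (j : Fin k) : j.castSucc < j.succ := Fin.castSucc_lt_succ

theorem rep₂_E_lt (j : Fin k) {a b : Fin (k + 1)} (h : a < b) : rep₂ k (E j) (v a ⊗ₜ v b)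
    = (if b = j.succ then v a ⊗ₜ v j.castSucc else 0)
      + (if a = j.succ then v j.castSucc ⊗ₜ v b else 0) := by
  rw [rep₂_E, rep_gen, rep_gen, E_v, E_v, Kinv_v]
  congr 1
  · split_ifs <;> simp
  · by_cases ha : a = j.succ
    · have h' : b ≠ j.castSucc := by
        subst ha
        exact ((cs_lt j).trans h).ne'
      rw [if_pos ha, if_pos ha, if_neg h', if_neg (by rw [ha] at h; exact h.ne'), one_smul]
    · rw [if_neg ha, if_neg ha, TensorProduct.zero_tmul]

theorem rep₂_E_gt (j : Fin k) {a b : Fin (k + 1)} (h : b < a) : rep₂ k (E j) (v a ⊗ₜ v b)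
    = (if b = j.succ then v a ⊗ₜ v j.castSucc else 0)
      + (if a = j.succ then (if b = j.castSucc then q⁻¹ else 1) • v j.castSucc ⊗ₜ v b else 0) := by
  rw [rep₂_E, rep_gen, rep_gen, E_v, E_v, Kinv_v]
  congr 1
  · split_ifs <;> simp
  · by_cases ha : a = j.succ
    · rw [if_pos ha, if_pos ha, if_neg (show ¬ b = j.succ by rw [ha] at h; exact h.ne),
        TensorProduct.tmul_smul, TensorProduct.smul_tmul']
    · rw [if_neg ha, if_neg ha, TensorProduct.zero_tmul]

theorem rep₂_E_eq (j : Fin k) : rep₂ k (E j) (v j.succ ⊗ₜ v j.succ)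
    = v j.succ ⊗ₜ v j.castSucc + q • (v j.castSucc ⊗ₜ v j.succ) := by
  rw [rep₂_E, rep_gen, rep_gen, E_v, Kinv_v, if_pos rfl, if_neg (by simp [Fin.ext_iff]), if_pos rfl,
    TensorProduct.tmul_smul]

theorem rep₂_E_self (j : Fin k) {a : Fin (k + 1)} (h : a ≠ j.succ) :
    rep₂ k (E j) (v a ⊗ₜ v a) = 0 := by
  rw [rep₂_E, rep_gen, E_v, if_neg h]; simp

theorem rep₂_F_lt (j : Fin k) {a b : Fin (k + 1)} (h : a < b) : rep₂ k (F j) (v a ⊗ₜ v b)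
    = (if a = j.castSucc then v j.succ ⊗ₜ v b else 0)
      + (if b = j.castSucc then v a ⊗ₜ v j.succ else 0) := by
  rw [rep₂_F, rep_gen, rep_gen, F_v, F_v, K_v]
  congr 1
  · split_ifs <;> simp
  · by_cases hb : b = j.castSucc
    · have h' : a ≠ j.succ := by
        subst hb
        exact (h.trans (cs_lt j)).ne
      rw [if_pos hb, if_pos hb, if_neg (by rw [hb] at h; exact h.ne), if_neg h', one_smul]
    · rw [if_neg hb, if_neg hb, TensorProduct.tmul_zero]

theorem rep₂_F_gt (j : Fin k) {a b : Fin (k + 1)} (h : b < a) : rep₂ k (F j) (v a ⊗ₜ v b)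
    = (if a = j.castSucc then v j.succ ⊗ₜ v b else 0)
      + (if b = j.castSucc then (if a = j.succ then q⁻¹ else 1) • v a ⊗ₜ v j.succ else 0) := by
  rw [rep₂_F, rep_gen, rep_gen, F_v, F_v, K_v]
  congr 1
  · split_ifs <;> simp
  · by_cases hb : b = j.castSucc
    · rw [if_pos hb, if_pos hb, if_neg (show ¬ a = j.castSucc by rw [hb] at h; exact h.ne'),
        ← TensorProduct.smul_tmul']
    · rw [if_neg hb, if_neg hb, TensorProduct.tmul_zero]

theorem rep₂_F_eq (j : Fin k) : rep₂ k (F j) (v j.castSucc ⊗ₜ v j.castSucc)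
    = v j.succ ⊗ₜ v j.castSucc + q • (v j.castSucc ⊗ₜ v j.succ) := by
  rw [rep₂_F, rep_gen, rep_gen, F_v, K_v, if_pos rfl, if_pos rfl, TensorProduct.smul_tmul']

theorem rep₂_F_self (j : Fin k) {a : Fin (k + 1)} (h : a ≠ j.castSucc) :
    rep₂ k (F j) (v a ⊗ₜ v a) = 0 := by
  rw [rep₂_F, rep_gen, F_v, if_neg h]; simp

/-- For b < a the vector v_a ⊗ v_b is the image of v_b ⊗ v_a under H, and the quadratic relation
transports commutation from the latter to the former. -/
theorem H₂_comm_of_le {D : Module.End Qq (V k ⊗[Qq] V k)}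
    (h : ∀ a b, a ≤ b → H₂ k (D (v a ⊗ₜ v b)) = D (H₂ k (v a ⊗ₜ v b))) (w : V k ⊗[Qq] V k) :
    H₂ k (D w) = D (H₂ k w) := by
  have : (H₂ k).comp D = D.comp (H₂ k) := by
    refine ext₂ fun a b => ?_
    rw [LinearMap.comp_apply, LinearMap.comp_apply]
    rcases le_or_gt a b with hab | hab
    · exact h a b hab
    · rw [← H₂_lt hab, ← h b a hab.le, H₂_H₂, H₂_H₂, map_add, map_smul, h b a hab.le]
  exact LinearMap.congr_fun this w

theorem H₂_E (j : Fin k) (w : V k ⊗[Qq] V k) : H₂ k (rep₂ k (E j) w) = rep₂ k (E j) (H₂ k w) := by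
  have hq := q_ne_zero
  refine H₂_comm_of_le (fun a b hab => ?_) w
  have hj := cs_lt j
  rcases hab.lt_or_eq with h | rfl
  · rw [H₂_lt h, rep₂_E_lt j h, rep₂_E_gt j h]
    by_cases hb : b = j.succ
    · subst hb
      rw [if_pos rfl, if_neg h.ne, if_pos rfl, if_neg h.ne, add_zero, zero_add]
      by_cases ha : a = j.castSucc
      · rw [if_pos ha, ha, H₂_eq, TensorProduct.smul_tmul']
      · have h' : a < j.castSucc := by
          simp only [Fin.ext_iff, Fin.lt_def, Fin.val_succ, Fin.val_castSucc] at *; omega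
        rw [if_neg ha, one_smul, H₂_lt h']
    · rw [if_neg hb, if_neg hb, zero_add, add_zero]
      by_cases ha : a = j.succ
      · subst ha
        rw [if_pos rfl, if_pos rfl, H₂_lt (hj.trans h)]
      · rw [if_neg ha, if_neg ha, map_zero]
  · rw [H₂_eq, map_smul]
    by_cases ha : a = j.succ
    · rw [ha, rep₂_E_eq, map_add, map_smul, H₂_gt hj, H₂_lt hj]
      exact hecke_scalar_comm (X := V k ⊗[Qq] V k) hq _ _
    · rw [rep₂_E_self j ha, map_zero, smul_zero]

theorem H₂_F (j : Fin k) (w : V k ⊗[Qq] V k) : H₂ k (rep₂ k (F j) w) = rep₂ k (F j) (H₂ k w) := by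
  have hq := q_ne_zero
  refine H₂_comm_of_le (fun a b hab => ?_) w
  have hj := cs_lt j
  rcases hab.lt_or_eq with h | rfl
  · rw [H₂_lt h, rep₂_F_lt j h, rep₂_F_gt j h]
    by_cases ha : a = j.castSucc
    · subst ha
      rw [if_pos rfl, if_neg h.ne', if_neg h.ne', if_pos rfl, add_zero, zero_add]
      by_cases hb : b = j.succ
      · rw [if_pos hb, hb, H₂_eq, TensorProduct.smul_tmul']
      · have h' : j.succ < b := by
          simp only [Fin.ext_iff, Fin.lt_def, Fin.val_succ, Fin.val_castSucc] at *; omega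
        rw [if_neg hb, one_smul, H₂_lt h']
    · rw [if_neg ha, if_neg ha, zero_add, add_zero]
      by_cases hb : b = j.castSucc
      · subst hb
        rw [if_pos rfl, if_pos rfl, H₂_lt (h.trans hj)]
      · rw [if_neg hb, if_neg hb, map_zero]
  · rw [H₂_eq, map_smul]
    by_cases ha : a = j.castSucc
    · rw [ha, rep₂_F_eq, map_add, map_smul, H₂_gt hj, H₂_lt hj]
      exact hecke_scalar_comm (X := V k ⊗[Qq] V k) hq _ _
    · rw [rep₂_F_self j ha, map_zero, smul_zero]

theorem H₂_diag {D : Module.End Qq (V k ⊗[Qq] V k)} {c : Fin (k + 1) → Qq}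
    (h : ∀ a b, D (v a ⊗ₜ v b) = (c a * c b) • (v a ⊗ₜ v b)) (w : V k ⊗[Qq] V k) :
    H₂ k (D w) = D (H₂ k w) := by
  refine H₂_comm_of_le (fun a b hab => ?_) w
  rcases hab.lt_or_eq with h' | rfl
  · rw [h, map_smul, H₂_lt h', h, mul_comm]
  · rw [h, map_smul, H₂_eq, map_smul, h, smul_comm]

/-- The Hecke operator commutes with `U`. -/
theorem H₂_rep₂ (u : U k) (w : V k ⊗[Qq] V k) : H₂ k (rep₂ k u w) = rep₂ k u (H₂ k w) := by
  induction u using U.induction generalizing w with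
  | hc c => rw [AlgHom.commutes, Module.algebraMap_end_apply, Module.algebraMap_end_apply, map_smul]
  | hg g =>
    cases g with
    | E j => exact H₂_E j w
    | F j => exact H₂_F j w
    | K j =>
      refine H₂_diag (D := rep₂ k (K j))
        (c := fun a => if a = j.castSucc then q else if a = j.succ then q⁻¹ else 1)
        (fun a b => ?_) w
      rw [tensorRep_apply, coprod_K, pairRep_tmul_apply, rep_gen, K_v, K_v,
        TensorProduct.smul_tmul_smul]
    | Kinv j =>
      refine H₂_diag (D := rep₂ k (Kinv j))
        (c := fun a => if a = j.castSucc then q⁻¹ else if a = j.succ then q else 1)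
        (fun a b => ?_) w
      rw [tensorRep_apply, coprod_Kinv, pairRep_tmul_apply, rep_gen, Kinv_v, Kinv_v,
        TensorProduct.smul_tmul_smul]
  | hm a b ha hb => rw [map_mul, Module.End.mul_apply, Module.End.mul_apply, ha, hb]
  | ha a b ha hb => rw [map_add, LinearMap.add_apply, LinearMap.add_apply, map_add, ha, hb]

/-- The bar involution of `𝕍 ⊗ 𝕍`. -/
def psi₂ (k : ℕ) : V k ⊗[Qq] V k →ₛₗ[bar] V k ⊗[Qq] V k :=
  (((basis k).tensorProduct (basis k)).constr Qq fun p : Fin (k + 1) × Fin (k + 1) =>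
    if p.2 < p.1 then v p.1 ⊗ₜ[Qq] v p.2 + (q - q⁻¹) • (v p.2 ⊗ₜ[Qq] v p.1)
      else v p.1 ⊗ₜ[Qq] v p.2).comp (TensorProduct.map psi psi)

theorem psi₂_v (a b : Fin (k + 1)) : psi₂ k (v a ⊗ₜ v b)
    = if b < a then v a ⊗ₜ v b + (q - q⁻¹) • (v b ⊗ₜ v a) else v a ⊗ₜ v b := by
  have := Module.Basis.constr_basis ((basis k).tensorProduct (basis k)) Qq
    (fun p : Fin (k + 1) × Fin (k + 1) =>
      if p.2 < p.1 then v p.1 ⊗ₜ[Qq] v p.2 + (q - q⁻¹) • (v p.2 ⊗ₜ[Qq] v p.1)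
        else v p.1 ⊗ₜ[Qq] v p.2) (a, b)
  rw [Module.Basis.tensorProduct_apply] at this
  rw [psi₂, LinearMap.comp_apply, TensorProduct.map_tmul, psi_v, psi_v]
  exact this

theorem psi₂_le {a b : Fin (k + 1)} (h : a ≤ b) : psi₂ k (v a ⊗ₜ v b) = v a ⊗ₜ v b := by
  rw [psi₂_v, if_neg h.not_gt]
theorem psi₂_gt {a b : Fin (k + 1)} (h : b < a) :
    psi₂ k (v a ⊗ₜ v b) = v a ⊗ₜ v b + (q - q⁻¹) • (v b ⊗ₜ v a) := by
  rw [psi₂_v, if_pos h]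

/-- The right-hand side is H⁻¹ applied to ψ(w), since H⁻¹ = H + (q - q⁻¹). -/
theorem psi₂_H₂ (w : V k ⊗[Qq] V k) :
    psi₂ k (H₂ k w) = H₂ k (psi₂ k w) + (q - q⁻¹) • psi₂ k w := by
  have hq := q_ne_zero
  have : (psi₂ k).comp (H₂ k) = (H₂ k + (q - q⁻¹) • LinearMap.id).comp (psi₂ k) := by
    refine ext₂ fun a b => ?_
    rw [LinearMap.comp_apply, LinearMap.comp_apply, LinearMap.add_apply, LinearMap.smul_apply,
      LinearMap.id_apply]
    rcases lt_trichotomy a b with h | rfl | h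
    · rw [H₂_lt h, psi₂_gt h, psi₂_le h.le, H₂_lt h]
    · rw [H₂_eq, map_smulₛₗ, psi₂_le le_rfl, H₂_eq, map_inv₀, bar_q]
      exact hecke_scalar_bar_eq (p := q) (X := V k ⊗[Qq] V k) _
    · rw [H₂_gt h, map_add, map_smulₛₗ, psi₂_gt h, psi₂_le h.le, map_add, map_smul, H₂_gt h, H₂_lt h]
      simp only [map_sub, map_inv₀, bar_q, inv_inv]
      exact hecke_scalar_bar_gt (p := q) (X := V k ⊗[Qq] V k) _ _
  exact LinearMap.congr_fun this w

/-- Checked on v_a ⊗ v_b with a ≤ b, where ψ is the identity on basis vectors, and extended to b < a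
through H, which commutes with U and satisfies the bar rule with ψ. -/
theorem psi₂_E (j : Fin k) (w : V k ⊗[Qq] V k) :
    psi₂ k (rep₂ k (E j) w) = rep₂ k (E j) (psi₂ k w) := by
  have hq := q_ne_zero
  have hj := cs_lt j
  have key : ∀ a b, a ≤ b →
      psi₂ k (rep₂ k (E j) (v a ⊗ₜ v b)) = rep₂ k (E j) (psi₂ k (v a ⊗ₜ v b)) := by
    intro a b hab
    rw [psi₂_le hab]
    rcases hab.lt_or_eq with h | rfl
    · rw [rep₂_E_lt j h, map_add]
      congr 1
      · split_ifs with hb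
        · refine psi₂_le ?_
          subst hb
          simp only [Fin.le_def, Fin.lt_def, Fin.val_succ, Fin.val_castSucc] at *; omega
        · exact map_zero (psi₂ k)
      · split_ifs with ha
        · exact psi₂_le ((hj.le.trans ha.ge).trans hab)
        · exact map_zero (psi₂ k)
    · by_cases ha : a = j.succ
      · rw [ha, rep₂_E_eq, map_add, map_smulₛₗ, psi₂_gt hj, psi₂_le hj.le, bar_q]
        exact hecke_scalar_bar_E (p := q) (X := V k ⊗[Qq] V k) _ _
      · rw [rep₂_E_self j ha, map_zero]
  have : (psi₂ k).comp (rep₂ k (E j)) = (rep₂ k (E j)).comp (psi₂ k) := by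
    refine ext₂ fun a b => ?_
    rw [LinearMap.comp_apply, LinearMap.comp_apply]
    rcases le_or_gt a b with hab | hab
    · exact key a b hab
    · rw [← H₂_lt hab, ← H₂_rep₂, psi₂_H₂, psi₂_H₂, key b a hab.le, H₂_rep₂, map_add, map_smul]
  exact LinearMap.congr_fun this w

theorem psi₂_sub_mem (x : V k) (b : Fin (k + 1)) :
    psi₂ k (x ⊗ₜ v b) - psi x ⊗ₜ v b ∈ lastGE (V k) k (b + 1) := by
  have hx : x = ∑ a, x a • v a := by
    funext b
    simp [Pi.single_apply]
  rw [hx, TensorProduct.sum_tmul, map_sum, map_sum, TensorProduct.sum_tmul,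
    ← Finset.sum_sub_distrib]
  refine sum_mem fun a _ => ?_
  rw [← TensorProduct.smul_tmul', map_smulₛₗ, map_smulₛₗ, psi_v, ← TensorProduct.smul_tmul',
    ← smul_sub]
  refine Submodule.smul_mem _ _ ?_
  rcases le_or_gt a b with hab | hab
  · rw [psi₂_le hab, sub_self]; exact zero_mem _
  · rw [psi₂_gt hab, add_sub_cancel_left]
    exact Submodule.smul_mem _ _ (tmul_v_mem_lastGE _ hab)

/-- No computation of Θ on 𝕍 ⊗ 𝕍 is needed: both maps commute with every E_j and have the same
leading term. -/
theorem thetaBar_psi : thetaBar rep rep psi psi = psi₂ k := by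
  refine eq_of_commutes (β := fun j => rep₂ k (E j)) (fun j => isLowering_E j) (fun x b =>
    sub_mem_lastGE_of_sub_mem (thetaBar_sub_mem psi x b) (psi₂_sub_mem x b)) (fun j w => ?_) psi₂_E
  have := barCompat_V.thetaBar barCompat_V (E j) w
  rwa [barU_E] at this

theorem barCompat_psi₂ : BarCompat (rep₂ k) (psi₂ k) := by
  rw [← thetaBar_psi]; exact barCompat_V.thetaBar barCompat_V

end V

end QSymPair

end

/-! ### Associativity of the bar construction -/

noncomputable section

namespace QSymPair

open U

variable {k : ℕ}

section Assoc

variable {N : Type} [AddCommGroup N] [Module Qq N] {ρ : U k →ₐ[Qq] Module.End Qq N}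

/-- The reassociation `N ⊗ (𝕍 ⊗ 𝕍) ≃ (N ⊗ 𝕍) ⊗ 𝕍`. -/
abbrev reassoc (k : ℕ) (N : Type) [AddCommGroup N] [Module Qq N] :
    N ⊗[Qq] (V k ⊗[Qq] V k) ≃ₗ[Qq] (N ⊗[Qq] V k) ⊗[Qq] V k :=
  (TensorProduct.assoc Qq N (V k) (V k)).symm

theorem reassoc_tmul (n : N) (r : V k ⊗[Qq] V k) :
    reassoc k N (n ⊗ₜ r) = LinearMap.rTensor (V k) (TensorProduct.mk Qq N (V k) n) r := by
  induction r using TensorProduct.induction_on with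
  | zero => simp
  | add x y hx hy => simp only [TensorProduct.tmul_add, map_add, hx, hy]
  | tmul x y => rfl

/-- Coassociativity. -/
theorem reassoc_tensorRep (u : U k) (z : N ⊗[Qq] (V k ⊗[Qq] V k)) :
    reassoc k N (tensorRep ρ (V.rep₂ k) u z)
      = tensorRep (tensorRep ρ V.rep) V.rep u (reassoc k N z) := by
  induction u using U.induction generalizing z with
  | hc c =>
    rw [AlgHom.commutes, AlgHom.commutes, Module.algebraMap_end_apply,
      Module.algebraMap_end_apply, map_smul]
  | hg g =>
    induction z using TensorProduct.induction_on with
    | zero => simp only [map_zero]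
    | add x y hx hy => simp only [map_add, hx, hy]
    | tmul n r =>
      induction r using TensorProduct.induction_on with
      | zero => simp only [TensorProduct.tmul_zero, map_zero]
      | add x y hx hy => simp only [TensorProduct.tmul_add, map_add, hx, hy]
      | tmul x y =>
        change _ = tensorRep (tensorRep ρ V.rep) V.rep (gen g) ((n ⊗ₜ x) ⊗ₜ y)
        cases g
        all_goals
          simp only [tensorRep_apply, coprod_E, coprod_F, coprod_K, coprod_Kinv, map_one,
            Module.End.one_apply, map_add, LinearMap.add_apply, pairRep_tmul_apply,
            TensorProduct.tmul_add, TensorProduct.add_tmul, TensorProduct.assoc_symm_tmul]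
        all_goals abel
  | hm a b ha hb =>
    rw [map_mul, map_mul, Module.End.mul_apply, Module.End.mul_apply, ha, hb]
  | ha a b ha hb => rw [map_add, map_add, LinearMap.add_apply, LinearMap.add_apply, map_add, ha, hb]

/-- The right leg of Θ_ν lies in U⁻, so on 𝕍 ⊗ 𝕍 it acts on the first factor up to terms raising the
last one. -/
theorem reassoc_quasiR_sub_mem (ν : RootCone k) (n : N) {b : ℕ} {r : V k ⊗[Qq] V k}
    (hr : r ∈ lastGE (V k) k b) :
    reassoc k N (pairRep ρ (V.rep₂ k) (quasiR k ν) (n ⊗ₜ r))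
      - LinearMap.rTensor (V k) (pairRep ρ V.rep (quasiR k ν)) (reassoc k N (n ⊗ₜ r))
        ∈ lastGE (N ⊗[Qq] V k) k (b + 1) := by
  have : tensorSub (UposW ν) (UnegW ν) ≤ (lastGE (N ⊗[Qq] V k) k (b + 1)).comap
      (((reassoc k N).toLinearMap ∘ₗ
        (LinearMap.applyₗ (n ⊗ₜ r)).comp (pairRep ρ (V.rep₂ k)).toLinearMap)
      - (LinearMap.applyₗ (reassoc k N (n ⊗ₜ r))).comp
        ((LinearMap.rTensorHom (V k)).comp (pairRep ρ (V.rep (k := k))).toLinearMap)) := by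
    refine Submodule.map₂_le.mpr fun x _ y hy => ?_
    change reassoc k N (ρ x n ⊗ₜ V.rep₂ k y r) - LinearMap.rTensor (V k)
      (TensorProduct.map (ρ x) (V.rep y)) (reassoc k N (n ⊗ₜ r)) ∈
        lastGE (N ⊗[Qq] V k) k (b + 1)
    have e : LinearMap.rTensor (V k) (TensorProduct.map (ρ x) (V.rep y)) (reassoc k N (n ⊗ₜ r))
        = LinearMap.rTensor (V k) (TensorProduct.mk Qq N (V k) (ρ x n))
          (LinearMap.rTensor (V k) (V.rep y) r) := by
      rw [reassoc_tmul, ← LinearMap.comp_apply, ← LinearMap.comp_apply, ← LinearMap.rTensor_comp,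
        ← LinearMap.rTensor_comp]
      rfl
    rw [e, reassoc_tmul, ← map_sub]
    exact rTensor_mem_lastGE _ (actsOnFirst_UnegW hy b r hr)
  exact this (isQuasiR_quasiR.mem ν)

theorem reassoc_thetaOp_sub_mem [Module.Finite Qq N] (n : N) {b : ℕ} {r : V k ⊗[Qq] V k}
    (hr : r ∈ lastGE (V k) k b) :
    reassoc k N (thetaOp ρ (V.rep₂ k) (n ⊗ₜ r))
      - LinearMap.rTensor (V k) (thetaOp ρ V.rep) (reassoc k N (n ⊗ₜ r))
        ∈ lastGE (N ⊗[Qq] V k) k (b + 1) := by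
  classical
  obtain ⟨c, h⟩ := exists_thetaOp_eq_sum ρ (V.rep₂ k)
  obtain ⟨c', h'⟩ := exists_thetaOp_eq_sum ρ (V.rep (k := k))
  have e := h _ (Finset.subset_union_left (s₂ := (finite_ht_lt c').toFinset))
  have e' := h' _ (Finset.subset_union_right (s₁ := (finite_ht_lt c).toFinset))
  set S := (finite_ht_lt c).toFinset ∪ (finite_ht_lt c').toFinset
  have h2 := sum_mem (t := S) fun ν _ => reassoc_quasiR_sub_mem (ρ := ρ) ν n hr
  replace h2 := (congrArg (· ∈ lastGE (N ⊗[Qq] V k) k (b + 1)) (Finset.sum_sub_distrib _ _)).mp h2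
  have h4 : LinearMap.rTensor (V k) (thetaOp ρ V.rep) (reassoc k N (n ⊗ₜ r))
      = ∑ ν ∈ S, LinearMap.rTensor (V k) (pairRep ρ V.rep (quasiR k ν)) (reassoc k N (n ⊗ₜ r)) := by
    rw [e']
    change LinearMap.rTensorHom (V k) _ _ = _
    rw [map_sum, LinearMap.sum_apply]
    rfl
  rwa [h4, e, LinearMap.sum_apply, map_sum]

/-- Rigidity replaces the cocycle identity of Θ: both bracketings are compatible with U, in
particular commute with E_j, and agree up to terms that raise the last factor. -/
theorem reassoc_thetaBar [Module.Finite Qq N] {φ : N →ₛₗ[bar] N} (hφ : BarCompat ρ φ)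
    (z : N ⊗[Qq] (V k ⊗[Qq] V k)) :
    reassoc k N (thetaBar ρ (V.rep₂ k) φ (V.psi₂ k) z)
      = thetaBar (tensorRep ρ V.rep) V.rep (thetaBar ρ V.rep φ V.psi) V.psi (reassoc k N z) := by
  have key := eq_of_commutes (W := N ⊗[Qq] V k)
    (β := fun j => tensorRep (tensorRep ρ V.rep) V.rep (E j)) (fun j => isLowering_E j)
    (φ := (reassoc k N).toLinearMap.comp ((thetaBar ρ (V.rep₂ k) φ (V.psi₂ k)).comp
      (reassoc k N).symm.toLinearMap))
    (χ := thetaBar (tensorRep ρ V.rep) V.rep (thetaBar ρ V.rep φ V.psi) V.psi)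
    (fun x b => ?_) (fun j w => ?_) (fun j w => ?_)
  · have := LinearMap.congr_fun key (reassoc k N z)
    rw [← this]
    change _ = reassoc k N (thetaBar ρ (V.rep₂ k) φ (V.psi₂ k) ((reassoc k N).symm (reassoc k N z)))
    rw [LinearEquiv.symm_apply_apply]
  · refine sub_mem_lastGE_of_sub_mem ?_ (thetaBar_sub_mem (thetaBar ρ V.rep φ V.psi) x b)
    induction x using TensorProduct.induction_on with
    | zero =>
      rw [TensorProduct.zero_tmul, map_zero, map_zero, TensorProduct.zero_tmul, sub_zero]
      exact zero_mem _
    | add x y hx hy =>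
      rw [TensorProduct.add_tmul, map_add, map_add, TensorProduct.add_tmul, add_sub_add_comm]
      exact add_mem hx hy
    | tmul n x =>
      change reassoc k N (thetaOp ρ (V.rep₂ k) (φ n ⊗ₜ V.psi₂ k (x ⊗ₜ V.v b))) - _ ∈ _
      have h1 := V.psi₂_sub_mem x b
      have h2 : V.psi₂ k (x ⊗ₜ V.v b) ∈ lastGE (V k) k b := by
        have := add_mem (lastGE_mono (Nat.le_succ _) h1)
          (tmul_v_mem_lastGE (V.psi x) (le_refl (b : ℕ)))
        rwa [sub_add_cancel] at this
      have h3 := reassoc_thetaOp_sub_mem (ρ := ρ) (φ n) h2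
      -- The error from replacing ψ(x ⊗ v_b) by ψ(x) ⊗ v_b, transported through Θ on N and the
      -- middle factor.
      have h4 := rTensor_mem_lastGE (thetaOp ρ V.rep)
        (rTensor_mem_lastGE (TensorProduct.mk Qq N (V k) (φ n)) h1)
      rw [map_sub, map_sub, ← reassoc_tmul] at h4
      have := add_mem h3 h4
      rwa [sub_add_sub_cancel] at this
  · change reassoc k N (thetaBar ρ (V.rep₂ k) φ (V.psi₂ k) ((reassoc k N).symm _))
      = _
    have e : (reassoc k N).symm (tensorRep (tensorRep ρ V.rep) V.rep (E j) w)
        = tensorRep ρ (V.rep₂ k) (E j) ((reassoc k N).symm w) := by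
      rw [LinearEquiv.symm_apply_eq, reassoc_tensorRep, LinearEquiv.apply_symm_apply]
    rw [e, hφ.thetaBar V.barCompat_psi₂, barU_E, reassoc_tensorRep]
    rfl
  · rw [(hφ.thetaBar barCompat_V).thetaBar barCompat_V, barU_E]

end Assoc

end QSymPair

end

/-! ### ψ_ı and the Hecke operators H_1, …, H_{m-1} -/

noncomputable section

namespace QSymPair

open U

variable {k : ℕ}

theorem map_heckeCase {R X Y I : Type} [Field R] [AddCommGroup X] [Module R X] [AddCommGroup Y]
    [Module R Y] [LinearOrder I] (f : X →ₗ[R] Y) (p : R) (x y : I) (u v : X) :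
    f (heckeCase p x y u v) = heckeCase p x y (f u) (f v) := by
  unfold heckeCase
  split_ifs
  · rw [map_smul]
  · rfl
  · rw [map_add, map_smul]

theorem actS_snoc {n : ℕ} (i : Fin n) (f : Fin (n + 1) → Fin (k + 1)) (a : Fin (k + 1)) :
    actS i.castSucc (Fin.snoc (α := fun _ => Fin (k + 1)) f a)
      = Fin.snoc (α := fun _ => Fin (k + 1)) (actS i f) a := by
  funext j
  refine Fin.lastCases ?_ (fun j => ?_) j
  · rw [Fin.snoc_last, actS, Equiv.swap_apply_of_ne_of_ne, Fin.snoc_last]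
    · exact (Fin.castSucc_ne_last _).symm
    · rw [Fin.succ_castSucc]
      exact (Fin.castSucc_ne_last _).symm
  · rw [Fin.snoc_castSucc, actS, actS, Fin.succ_castSucc,
      ← (Fin.castSucc_injective _).map_swap, Fin.snoc_castSucc]

theorem opH_castSucc {n : ℕ} (i : Fin n) (z : T k (n + 1) ⊗[Qq] V k) :
    opH k i.castSucc (tensorSnoc k (n + 1) z)
      = tensorSnoc k (n + 1) (LinearMap.rTensor (V k) (opH k i) z) := by
  have : (opH k i.castSucc).comp (tensorSnoc k (n + 1)).toLinearMap
      = (tensorSnoc k (n + 1)).toLinearMap.comp (LinearMap.rTensor (V k) (opH k i)) :=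
    snoc_hom_ext fun f a => by
      rw [LinearMap.comp_apply, LinearMap.comp_apply, LinearEquiv.coe_coe, tensorSnoc_M, opH_M,
        LinearMap.rTensor_tmul, opH_M, actS_snoc, Fin.succ_castSucc, Fin.snoc_castSucc,
        Fin.snoc_castSucc, ← tensorSnoc_M, ← tensorSnoc_M]
      exact (map_heckeCase ((tensorSnoc k (n + 1)).toLinearMap ∘ₗ
        (TensorProduct.mk Qq (T k (n + 1)) (V k)).flip (V.v a)) _ _ _ _ _).symm
  exact LinearMap.congr_fun this z

/-- The identification `𝕍^{⊗ n} ⊗ (𝕍 ⊗ 𝕍) ≃ 𝕍^{⊗ (n+2)}`. -/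
def tensorSnoc₂ (k n : ℕ) : T k n ⊗[Qq] (V k ⊗[Qq] V k) ≃ₗ[Qq] T k (n + 2) :=
  reassoc k (T k n) ≪≫ₗ (tensorSnoc k n).rTensor (V k) ≪≫ₗ tensorSnoc k (n + 1)

theorem tensorSnoc₂_apply {n : ℕ} (z : T k n ⊗[Qq] (V k ⊗[Qq] V k)) : tensorSnoc₂ k n z
    = tensorSnoc k (n + 1) (LinearMap.rTensor (V k) (tensorSnoc k n).toLinearMap
      (reassoc k (T k n) z)) := rfl

theorem tensorSnoc₂_M {n : ℕ} (f : Fin n → Fin (k + 1)) (a b : Fin (k + 1)) :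
    tensorSnoc₂ k n (M k n f ⊗ₜ (V.v a ⊗ₜ V.v b)) = M k (n + 2)
      (Fin.snoc (α := fun _ => Fin (k + 1)) (Fin.snoc (α := fun _ => Fin (k + 1)) f a) b) := by
  rw [tensorSnoc₂_apply, TensorProduct.assoc_symm_tmul, LinearMap.rTensor_tmul,
    LinearEquiv.coe_coe, tensorSnoc_M, tensorSnoc_M]

theorem actS_snoc_snoc {n : ℕ} (f : Fin n → Fin (k + 1)) (a b : Fin (k + 1)) :
    actS (Fin.last n) (Fin.snoc (α := fun _ => Fin (k + 1))
      (Fin.snoc (α := fun _ => Fin (k + 1)) f a) b)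
      = Fin.snoc (α := fun _ => Fin (k + 1)) (Fin.snoc (α := fun _ => Fin (k + 1)) f b) a := by
  funext j
  rw [actS]
  refine Fin.lastCases ?_ (fun j => Fin.lastCases ?_ (fun j => ?_) j) j
  · rw [← Fin.succ_last, Equiv.swap_apply_right, Fin.snoc_castSucc, Fin.snoc_last, Fin.succ_last,
      Fin.snoc_last]
  · rw [Equiv.swap_apply_left, Fin.succ_last, Fin.snoc_last, Fin.snoc_castSucc, Fin.snoc_last]
  · rw [Equiv.swap_apply_of_ne_of_ne, Fin.snoc_castSucc, Fin.snoc_castSucc, Fin.snoc_castSucc,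
      Fin.snoc_castSucc]
    · exact fun h => Fin.castSucc_ne_last j (Fin.castSucc_injective _ h)
    · rw [Fin.succ_last]
      exact Fin.castSucc_ne_last _

theorem opH_last {n : ℕ} (z : T k n ⊗[Qq] (V k ⊗[Qq] V k)) :
    opH k (Fin.last n) (tensorSnoc₂ k n z)
      = tensorSnoc₂ k n (LinearMap.lTensor (T k n) (V.H₂ k) z) := by
  have : (opH k (Fin.last n)).comp (tensorSnoc₂ k n).toLinearMap
      = (tensorSnoc₂ k n).toLinearMap.comp (LinearMap.lTensor (T k n) (V.H₂ k)) :=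
    ((M k n).tensorProduct ((V.basis k).tensorProduct (V.basis k))).ext fun ⟨f, a, b⟩ => by
      rw [Module.Basis.tensorProduct_apply, Module.Basis.tensorProduct_apply]
      change opH k (Fin.last n) (tensorSnoc₂ k n (M k n f ⊗ₜ (V.v a ⊗ₜ V.v b)))
        = tensorSnoc₂ k n (M k n f ⊗ₜ V.H₂ k (V.v a ⊗ₜ V.v b))
      rw [V.H₂_v, tensorSnoc₂_M, opH_M, actS_snoc_snoc, Fin.succ_last, Fin.snoc_last,
        Fin.snoc_castSucc, Fin.snoc_last, ← tensorSnoc₂_M, ← tensorSnoc₂_M]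
      exact (map_heckeCase ((tensorSnoc₂ k n).toLinearMap ∘ₗ
        (TensorProduct.mk Qq (T k n) (V k ⊗[Qq] V k)) (M k n f)) _ _ _ _ _).symm
  exact LinearMap.congr_fun this z

theorem rep_tensorSnoc₂ {n : ℕ} (u : U k) (z : T k n ⊗[Qq] (V k ⊗[Qq] V k)) :
    rep k (n + 2) u (tensorSnoc₂ k n z)
      = tensorSnoc₂ k n (tensorRep (rep k n) (V.rep₂ k) u z) := by
  rw [tensorSnoc₂_apply, tensorSnoc₂_apply, rep_succ_apply, reassoc_tensorRep]
  congr 1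
  exact (pairRep_natural (f := (tensorSnoc k n).toLinearMap) (g := LinearMap.id)
    (ρ := tensorRep (rep k n) V.rep) (fun u x => (rep_succ_apply u x).symm) (fun _ _ => rfl) _ _).symm

/-- By associativity ψ may be computed with the last two factors grouped, which isolates the pair on
which the last Hecke operator acts. -/
theorem psiT_tensorSnoc₂ {n : ℕ} (z : T k n ⊗[Qq] (V k ⊗[Qq] V k)) :
    psiT k (n + 2) (tensorSnoc₂ k n z)
      = tensorSnoc₂ k n (thetaBar (rep k n) (V.rep₂ k) (psiT k n) (V.psi₂ k) z) := by
  rw [tensorSnoc₂_apply, tensorSnoc₂_apply, psiT_succ_apply, reassoc_thetaBar (barCompat_psiT n)]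
  congr 1
  generalize reassoc k (T k n) z = w
  have e : TensorProduct.map (psiT k (n + 1)) V.psi
      (LinearMap.rTensor (V k) (tensorSnoc k n).toLinearMap w)
      = TensorProduct.map (tensorSnoc k n).toLinearMap LinearMap.id
        (TensorProduct.map (thetaBar (rep k n) V.rep (psiT k n) V.psi) V.psi w) := by
    induction w using TensorProduct.induction_on with
    | zero => simp only [map_zero]
    | add x y hx hy => simp only [map_add, hx, hy]
    | tmul x y =>
      rw [LinearMap.rTensor_tmul, TensorProduct.map_tmul, TensorProduct.map_tmul,
        TensorProduct.map_tmul, LinearEquiv.coe_coe, psiT_succ_apply, LinearMap.id_apply]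
  rw [thetaBar_apply, thetaBar_apply, e]
  exact (thetaOp_natural (ρ := tensorRep (rep k n) V.rep) (fun u x => (rep_succ_apply u x).symm)
    (fun _ _ => rfl) _).symm

/-- The action of `U` commutes with the Hecke operators. -/
theorem opH_rep {n : ℕ} (i : Fin n) (u : U k) (x : T k (n + 1)) :
    opH k i (rep k (n + 1) u x) = rep k (n + 1) u (opH k i x) := by
  induction n generalizing u with
  | zero => exact i.elim0
  | succ n ih =>
    refine Fin.lastCases ?_ (fun i => ?_) i
    · obtain ⟨z, rfl⟩ := (tensorSnoc₂ k n).surjective x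
      rw [rep_tensorSnoc₂, opH_last, opH_last, rep_tensorSnoc₂]
      congr 1
      exact pairRep_natural (f := LinearMap.id) (fun _ _ => rfl) (fun u y => V.H₂_rep₂ u y) _ _
    · obtain ⟨z, rfl⟩ := (tensorSnoc k (n + 1)).surjective x
      rw [rep_succ_apply, opH_castSucc, opH_castSucc, rep_succ_apply]
      congr 1
      exact pairRep_natural (g := LinearMap.id) (fun u y => ih i u y) (fun _ _ => rfl) _ _

/-- Θ commutes with f ⊗ g because f and g are module maps, so a bar rule for ψ ⊗ ψ passes to Θ ∘ (ψ
⊗ ψ). -/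
theorem thetaBar_quadratic {N N' : Type} [AddCommGroup N] [Module Qq N] [AddCommGroup N']
    [Module Qq N'] [Module.Finite Qq N] [Module.Finite Qq N'] {ρ : U k →ₐ[Qq] Module.End Qq N}
    {σ : U k →ₐ[Qq] Module.End Qq N'} {f : Module.End Qq N} {g : Module.End Qq N'}
    (hf : ∀ u x, f (ρ u x) = ρ u (f x)) (hg : ∀ u x, g (σ u x) = σ u (g x))
    {φ : N →ₛₗ[bar] N} {χ : N' →ₛₗ[bar] N'} {c : Qq}
    (h : ∀ x y, φ (f x) ⊗ₜ[Qq] χ (g y) = f (φ x) ⊗ₜ g (χ y) + c • (φ x ⊗ₜ χ y)) (z : N ⊗[Qq] N') :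
    thetaBar ρ σ φ χ (TensorProduct.map f g z)
      = TensorProduct.map f g (thetaBar ρ σ φ χ z) + c • thetaBar ρ σ φ χ z := by
  have e : TensorProduct.map φ χ (TensorProduct.map f g z)
      = TensorProduct.map f g (TensorProduct.map φ χ z) + c • TensorProduct.map φ χ z := by
    induction z using TensorProduct.induction_on with
    | zero => simp
    | add x y hx hy => simp only [map_add, hx, hy, smul_add]; abel
    | tmul x y => simp only [TensorProduct.map_tmul, h]
  rw [thetaBar_apply, thetaBar_apply, e, map_add, map_smul, thetaOp_natural hf hg]

/-- The last H_i acts on the final pair of factors, where the rule is known from 𝕍 ⊗ 𝕍; every other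
one acts on the first tensor factor and is covered by induction. -/
theorem psiT_opH {n : ℕ} (i : Fin n) (x : T k (n + 1)) :
    psiT k (n + 1) (opH k i x)
      = opH k i (psiT k (n + 1) x) + (q - q⁻¹) • psiT k (n + 1) x := by
  induction n with
  | zero => exact i.elim0
  | succ n ih =>
    refine Fin.lastCases ?_ (fun i => ?_) i
    · obtain ⟨z, rfl⟩ := (tensorSnoc₂ k n).surjective x
      rw [opH_last, psiT_tensorSnoc₂, psiT_tensorSnoc₂, opH_last, ← map_smul, ← map_add]
      congr 1
      exact thetaBar_quadratic (f := LinearMap.id) (fun _ _ => rfl) (fun u y => V.H₂_rep₂ u y)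
        (fun x y => by
          rw [V.psi₂_H₂, TensorProduct.tmul_add, TensorProduct.tmul_smul, LinearMap.id_apply,
            LinearMap.id_apply]) z
    · obtain ⟨z, rfl⟩ := (tensorSnoc k (n + 1)).surjective x
      rw [opH_castSucc, psiT_succ_apply, psiT_succ_apply, opH_castSucc, ← map_smul, ← map_add]
      congr 1
      exact thetaBar_quadratic (g := LinearMap.id) (fun u y => opH_rep i u y) (fun _ _ => rfl)
        (fun x y => by
          rw [ih, TensorProduct.add_tmul, TensorProduct.smul_tmul', LinearMap.id_apply,
            LinearMap.id_apply]) z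

/-- Υ acts through elements of U, which commute with H_i, so the rule for ψ carries over. -/
theorem psiIota_opH {n : ℕ} (i : Fin n) (x : T k (n + 1)) :
    psiIota k (n + 1) (opH k i x)
      = opH k i (psiIota k (n + 1) x) + (q - q⁻¹) • psiIota k (n + 1) x := by
  obtain ⟨c, h⟩ := exists_upsilonOp_eq_sum k (n + 1)
  have e : ∀ y, upsilonOp k (n + 1) (opH k i y) = opH k i (upsilonOp k (n + 1) y) := by
    intro y
    rw [h _ (Finset.Subset.refl _), LinearMap.sum_apply, LinearMap.sum_apply, map_sum]
    exact Finset.sum_congr rfl fun μ _ => (opH_rep i _ y).symm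
  rw [psiIota_apply, psiIota_apply, psiT_opH, map_add, map_smul, e]

end QSymPair

end

/-! ### H_{D_m}: generation by anti-dominant vectors, involutivity and uniqueness -/

noncomputable section

namespace QSymPair

variable {k n : ℕ}

namespace HD

theorem lift_gen {A : Type} [Ring A] [Algebra Qq A] (g : DGen n → A)
    (h : ∀ x y, DRel n x y → FreeAlgebra.lift Qq g x = FreeAlgebra.lift Qq g y) (x : DGen n) :
    lift g h (gen x) = g x := by
  unfold lift gen
  erw [RingQuot.liftAlgHom_mkAlgHom_apply]
  exact FreeAlgebra.lift_ι_apply g x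

theorem induction {P : HD n → Prop} (hc : ∀ c, P (algebraMap Qq (HD n) c)) (hg : ∀ g, P (gen g))
    (hm : ∀ x y, P x → P y → P (x * y)) (ha : ∀ x y, P x → P y → P (x + y)) (h : HD n) : P h := by
  obtain ⟨x, rfl⟩ := RingQuot.mkAlgHom_surjective Qq (DRel n) h
  induction x using FreeAlgebra.induction with
  | grade0 c => rw [AlgHom.commutes]; exact hc c
  | grade1 g => exact hg g
  | mul a b h1 h2 => rw [map_mul]; exact hm _ _ h1 h2
  | add a b h1 h2 => rw [map_add]; exact ha _ _ h1 h2

theorem barHD_mul (x y : HD n) : barHD (x * y) = barHD x * barHD y := map_mul barHom x y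
theorem barHD_one : barHD (1 : HD n) = 1 := map_one barHom
theorem barHD_gen (x : DGen n) : barHD (gen x) = inv x := lift_gen (A := Twist (HD n)) _ _ x
theorem barHD_algebraMap (c : Qq) :
    barHD (algebraMap Qq (HD n) c) = algebraMap Qq (HD n) (bar c) := by
  have h := map_smulₛₗ barHD c (1 : HD n)
  rwa [barHD_one, ← Algebra.algebraMap_eq_smul_one, ← Algebra.algebraMap_eq_smul_one] at h

end HD

theorem HB.lift_gen {A : Type} [Ring A] [Algebra Qq A] (g : BGen n → A)
    (h : ∀ x y, BRel n x y → FreeAlgebra.lift Qq g x = FreeAlgebra.lift Qq g y) (x : BGen n) :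
    lift g h (gen x) = g x := by
  unfold lift gen
  erw [RingQuot.liftAlgHom_mkAlgHom_apply]
  exact FreeAlgebra.lift_ι_apply g x

/-- The operators by which the generators of `H_{D_m}` act. -/
def opD (k : ℕ) {n : ℕ} : DGen n → Module.End Qq (T k (n + 1))
  | .H0 h => opS0 k n * opH k ⟨0, h⟩ * opS0 k n
  | .H i => opH k i

theorem actD_gen (v : T k (n + 1)) (g : DGen n) : actD v (HD.gen g) = opD k g v := by
  have h : HD.rho (HD.gen g) = HD.rhoGen g := HD.lift_gen ..
  rw [actD, h]
  cases g with
  | H0 hn =>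
    rw [HD.rhoGen, map_mul, map_mul, actB, HB.lift_gen, HB.lift_gen]
    rfl
  | H i =>
    rw [HD.rhoGen, actB, HB.lift_gen]
    rfl

theorem actD_mul (v : T k (n + 1)) (h h' : HD n) : actD v (h * h') = actD (actD v h) h' := by
  rw [actD, map_mul, map_mul]
  rfl

theorem actD_add (v : T k (n + 1)) (h h' : HD n) : actD v (h + h') = actD v h + actD v h' := by
  rw [actD, map_add, map_add]
  rfl

theorem actD_algebraMap (v : T k (n + 1)) (c : Qq) :
    actD v (algebraMap Qq (HD n) c) = c • v := by
  rw [actD, AlgHom.commutes, AlgHom.commutes]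
  rfl

theorem actD_inv (v : T k (n + 1)) (g : DGen n) :
    actD v (HD.inv g) = opD k g v + (q - q⁻¹) • v := by
  rw [HD.inv, actD_add, actD_gen, ← Algebra.algebraMap_eq_smul_one, actD_algebraMap]

theorem psiIota_opD (g : DGen n) (v : T k (n + 1)) : psiIota k (n + 1) (opD k g v)
    = opD k g (psiIota k (n + 1) v) + (q - q⁻¹) • psiIota k (n + 1) v := by
  cases g with
  | H0 hn =>
    have h : ∀ x, opS0 k n (opS0 k n x) = x := LinearMap.congr_fun opS0_sq
    change psiIota k (n + 1) (opS0 k n (opH k ⟨0, hn⟩ (opS0 k n v)))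
      = opS0 k n (opH k ⟨0, hn⟩ (opS0 k n _)) + _
    rw [psiIota_opS0, psiIota_opH, psiIota_opS0, map_add, map_smul, h]
  | H i => exact psiIota_opH i v

theorem psiIota_actD (v : T k (n + 1)) (h : HD n) :
    psiIota k (n + 1) (actD v h) = actD (psiIota k (n + 1) v) (HD.barHD h) := by
  induction h using HD.induction generalizing v with
  | hc c => rw [actD_algebraMap, HD.barHD_algebraMap, actD_algebraMap, map_smulₛₗ]
  | hg g => rw [actD_gen, HD.barHD_gen, actD_inv, psiIota_opD]
  | hm x y hx hy => rw [actD_mul, HD.barHD_mul, actD_mul, hy, hx]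
  | ha x y hx hy => rw [actD_add, map_add, map_add, actD_add, hx, hy]

/-- The compatibility with u = 1 and a single generator of the Hecke algebra. -/
theorem IsCompatibleBar.map_opD {φ : T k (n + 1) →ₛₗ[bar] T k (n + 1)} (h : IsCompatibleBar φ)
    (g : DGen n) (v : T k (n + 1)) : φ (opD k g v) = opD k g (φ v) + (q - q⁻¹) • φ v := by
  have h1 : ∀ x : T k (n + 1), actI (1 : UI k) x = x := fun x => by
    rw [actI, map_one, map_one, Module.End.one_apply]
  have := h.compatible 1 v (HD.gen g)
  rwa [UI.barUI_one, h1, h1, actD_gen, HD.barHD_gen, actD_inv] at this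

theorem actS_actS (i : Fin n) (f : Fin (n + 1) → Fin (k + 1)) : actS i (actS i f) = f := by
  funext j
  rw [actS, actS, Equiv.swap_apply_self]

theorem actS_castSucc (i : Fin n) (f : Fin (n + 1) → Fin (k + 1)) :
    actS i f i.castSucc = f i.succ := by rw [actS, Equiv.swap_apply_left]

theorem actS_succ (i : Fin n) (f : Fin (n + 1) → Fin (k + 1)) :
    actS i f i.succ = f i.castSucc := by rw [actS, Equiv.swap_apply_right]

theorem opH_M_actS {i : Fin n} {f : Fin (n + 1) → Fin (k + 1)} (h : f i.succ < f i.castSucc) :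
    opH k i (M k (n + 1) (actS i f)) = M k (n + 1) f := by
  rw [opH_M, actS_castSucc, actS_succ, heckeCase_lt q h, actS_actS]

/-- The weighted sum `∑ j f(j)`, which grows when a descent is removed. -/
def weightedSum (f : Fin (n + 1) → Fin (k + 1)) : ℤ := ∑ j :
    Fin (n + 1), ((j : ℕ) : ℤ) * twice (f j)

theorem weightedSum_actS (i : Fin n) (f : Fin (n + 1) → Fin (k + 1)) :
    weightedSum (actS i f) = weightedSum f + (twice (f i.castSucc) - twice (f i.succ)) := by
  have hne : i.castSucc ≠ i.succ := Fin.castSucc_lt_succ.ne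
  have e : weightedSum (actS i f)
      = ∑ j, ((Equiv.swap i.castSucc i.succ j : Fin (n + 1)) : ℕ) * twice (f j) := by
    rw [weightedSum, ← Equiv.sum_comp (Equiv.swap i.castSucc i.succ)]
    simp only [actS, Equiv.swap_apply_self]
  rw [e, weightedSum, ← sub_eq_iff_eq_add', ← Finset.sum_sub_distrib,
    Fintype.sum_eq_add _ _ hne fun x hx => by
      rw [Equiv.swap_apply_of_ne_of_ne hx.1 hx.2, sub_self],
    Equiv.swap_apply_left, Equiv.swap_apply_right]
  simp only [Fin.val_succ, Fin.val_castSucc]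
  push_cast
  ring

/-- Positions are counted from 0, so the first entry has weight zero and its sign is irrelevant. -/
theorem weightedSum_actS0 (f : Fin (n + 1) → Fin (k + 1)) :
    weightedSum (actS0 f) = weightedSum f := by
  refine Finset.sum_congr rfl fun j _ => ?_
  by_cases hj : j = 0
  · subst hj; simp
  · rw [actS0, Function.update_of_ne hj]

theorem twice_rev (a : Fin (k + 1)) : twice a.rev = -twice a := by
  unfold twice
  rw [Fin.val_rev]
  omega

/-- The tensor space is generated by the `M_f` with `D`-anti-dominant `f`, under the action of
`H_{D_m}`. -/
theorem opD_induction {P : T k (n + 1) → Prop} (h0 : P 0) (ha : ∀ x y, P x → P y → P (x + y))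
    (hs : ∀ (c : Qq) x, P x → P (c • x)) (hD : ∀ g x, P x → P (opD k g x))
    (hM : ∀ f, DAntidominant f → P (M k (n + 1) f)) (v : T k (n + 1)) : P v := by
  have key : ∀ f, P (M k (n + 1) f) := by
    -- Take a counterexample f with the largest weighted sum; there are finitely many f.
    by_contra! hne
    obtain ⟨f, hf, hmax⟩ := Set.exists_max_image {f | ¬ P (M k (n + 1) f)} weightedSum
      (Set.toFinite _) hne
    have hlt : ∀ f', weightedSum f < weightedSum f' → P (M k (n + 1) f') := fun f' h => by
      by_contra hf'
      exact absurd (hmax f' hf') (not_le.mpr h)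
    -- At a descent, f · s_i has a larger weighted sum, and H_i sends its vector to M_f.
    have hsort : ∀ i : Fin n, twice (f i.castSucc) ≤ twice (f i.succ) := fun i => by
      by_contra! h
      refine hf ?_
      rw [← opH_M_actS (f := f) (i := i) (not_le.mp fun h' => not_le.mpr h (twice_le_twice.mpr h'))]
      exact hD (.H i) _ (hlt _ (by rw [weightedSum_actS]; omega))
    have hanti : ¬ DAntidominant f := fun h => hf (hM f h)
    unfold DAntidominant at hanti
    push Not at hanti
    obtain ⟨i, hi⟩ := hanti
    split_ifs at hi with hi0
    swap
    · exact absurd (hsort i) (not_le.mpr hi)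
    have hn : 0 < n := i.pos
    obtain rfl : i = ⟨0, hn⟩ := Fin.ext hi0
    have hc : (⟨0, hn⟩ : Fin n).castSucc = 0 := rfl
    have h1 := hsort ⟨0, hn⟩
    rw [hc] at hi h1
    -- Since f is weakly increasing, anti-dominance can fail only through -f(1) > f(2).
    have h2 : twice (f (⟨0, hn⟩ : Fin n).succ) < - twice (f 0) := by
      rcases lt_abs.mp hi with h | h
      · exact absurd h1 (not_le.mpr h)
      · exact h
    have e1 : actS0 f 0 = (f 0).rev := Function.update_self ..
    have e2 : actS0 f (⟨0, hn⟩ : Fin n).succ = f (⟨0, hn⟩ : Fin n).succ :=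
      Function.update_of_ne (Fin.succ_ne_zero _) ..
    have h3 : actS0 f (⟨0, hn⟩ : Fin n).succ < actS0 f (⟨0, hn⟩ : Fin n).castSucc := by
      rw [hc, e1, e2, ← not_le, ← twice_le_twice, twice_rev, not_le]
      exact h2
    -- Conjugating the descent argument by s_0: the vector (-f(2), -f(1), f(3), …) has a larger
    -- weighted sum, and H_0 = s_0 H_1 s_0 sends it to M_f.
    have h4 := hD (.H0 hn) _ (hlt (actS0 (actS ⟨0, hn⟩ (actS0 f))) (by
      rw [weightedSum_actS0, weightedSum_actS, weightedSum_actS0, hc, e1, e2, twice_rev]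
      omega))
    change P (opS0 k n (opH k ⟨0, hn⟩ (opS0 k n _))) at h4
    rw [opS0_M, actS0_actS0, opH_M_actS h3, opS0_M, actS0_actS0] at h4
    exact hf h4
  have hv : v ∈ Submodule.span Qq (Set.range (M k (n + 1))) := by
    rw [(M k (n + 1)).span_eq]; trivial
  induction hv using Submodule.span_induction with
  | mem x hx => obtain ⟨f, rfl⟩ := hx; exact key f
  | zero => exact h0
  | add x y _ _ hx hy => exact ha x y hx hy
  | smul c x _ hx => exact hs c x hx

/-- Involutivity is not proved from properties of Θ and Υ; it follows from generation by the fixed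
vectors. -/
theorem psiIota_psiIota (v : T k (n + 1)) : psiIota k (n + 1) (psiIota k (n + 1) v) = v := by
  induction v using opD_induction with
  | h0 => rw [map_zero, map_zero]
  | ha x y hx hy => rw [map_add, map_add, hx, hy]
  | hs c x hx => rw [map_smulₛₗ, map_smulₛₗ, hx, U.bar_bar]
  | hD g x hx =>
    -- The bar conjugate of q - q⁻¹ is its negative, so the two correction terms cancel.
    rw [psiIota_opD, map_add, psiIota_opD, map_smulₛₗ, hx, map_sub, map_inv₀, bar_q, inv_inv,
      add_assoc, ← add_smul, sub_add_sub_cancel, sub_self, zero_smul, add_zero]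
  | hM f hf => rw [psiIota_M hf, psiIota_M hf]

theorem isCompatibleBar_psiIota : IsCompatibleBar (psiIota k (n + 1)) where
  involutive := psiIota_psiIota
  compatible u v h := by rw [psiIota_actD, psiIota_actI]
  fixes _ h := psiIota_M h

theorem IsCompatibleBar.eq {φ χ : T k (n + 1) →ₛₗ[bar] T k (n + 1)} (hφ : IsCompatibleBar φ)
    (hχ : IsCompatibleBar χ) : φ = χ := by
  refine LinearMap.ext fun v => ?_
  induction v using opD_induction with
  | h0 => rw [map_zero, map_zero]
  | ha x y hx hy => rw [map_add, map_add, hx, hy]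
  | hs c x hx => rw [map_smulₛₗ, map_smulₛₗ, hx]
  | hD g x hx => rw [hφ.map_opD, hχ.map_opD, hx]
  | hM f hf => rw [hφ.fixes f hf, hχ.fixes f hf]

end QSymPair

end

theorem mainTheorem2 (k n : ℕ) :
    QSymPair.IsCompatibleBar (QSymPair.psiIota k (n + 1)) ∧
      ∀ φ : QSymPair.T k (n + 1) →ₛₗ[QSymPair.bar] QSymPair.T k (n + 1),
        QSymPair.IsCompatibleBar φ → φ = QSymPair.psiIota k (n + 1) :=
  ⟨QSymPair.isCompatibleBar_psiIota, fun _ h => h.eq QSymPair.isCompatibleBar_psiIota⟩
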